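/- Conventions. $\hat\varphi(\xi)=\frac1{\sqrt{2\pi}}\int_{\mathbb R}e^{-ix\xi}\varphi(x)\,dx$; $\|\varphi\|_{H^{k,0}}=\sum_{i=0}^k\|\partial_x^i\varphi\|_{L^2(\mathbb R)}$; $\|\varphi\|_{H^{0,k}}=\sum_{i=0}^k\|x^i\varphi\|_{L^2(\mathbb R)}$; $\mathbb N\ni 0$; $(2it)^{1/2}$ is the principal square root. Fix $n\in\mathbb N$ and $0<\nu<\frac14$. There are $\varepsilon>0$ and $C>0$, depending only on $n$ and $\nu$, such that for all $u_1,v_1$ with $$\|u_1\|_{H^{2n+1,0}}+\|u_1\|_{H^{0,1}}+\|v_1\|_{H^{2n+1,0}}+\|v_1\|_{H^{0,1}}\le\varepsilon$$ the following holds. (i) The system $i\partial_tu+\partial_{xx}u=|v|^2u$, $i\partial_tv+\partial_{xx}v=|u|^2v$ on $[1,\infty)\times\mathbb R$ (in the sense of distributions in $x$ at every time) with $u(1)=u_1$, $v(1)=v_1$ has a unique pair of solutions $(u,v)$ with $u,v\in\mathcal C\big([1,\infty);H^{2n+1,0}(\mathbb R)\cap H^{0,1}(\mathbb R)\big)$,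 and for all $t\ge1$ $$\|u(t)\|_{L^\infty}\le Ct^{-1/2},\qquad \|v(t)\|_{L^\infty}\le Ct^{-1/2}.$$ (ii) Let $f(t)=e^{-it\partial_{xx}}u(t)$, $g(t)=e^{-it\partial_{xx}}v(t)$ and $$\hat w_f(t,\xi)=\hat f(t,\xi)\exp\Big(\tfrac i2\int_1^t\tfrac1s|\hat v(s,\xi)|^2ds\Big),\qquad \hat w_g(t,\xi)=\hat g(t,\xi)\exp\Big(\tfrac i2\int_1^t\tfrac1s|\hat u(s,\xi)|^2ds\Big).$$ There are $W_f,W_g\in L^\infty\cap H^{0,n}$ such that for all $t\ge1$ $$\|\hat w_f(t)-W_f\|_{L^\infty}+\|\hat w_g(t)-W_g\|_{L^\infty}\le 2C\,t^{-\frac14+\nu},\qquad \|\hat w_f(t)-W_f\|_{H^{0,n}}+\|\hat w_g(t)-W_g\|_{H^{0,n}}\le 2C\,t^{-\frac18+\frac\nu2},$$ each of the four terms being at most $C$ times the power of $t$; and $(W_f,W_g)$ is the unique pair in $(L^\infty\cap H^{0,n})^2$ satisfying such bounds with some constant. (iii) There is a unique pair of real-valued $\Gamma_f,\Gamma_g\in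 L^\infty$ such that, in $L^\infty_\xi$ and for $t\ge 1$, $$\int_1^t\tfrac1s|\hat u(s)|^2ds=|W_f|^2\ln t+\Gamma_f+O(t^{-\frac14+\nu}),\qquad \int_1^t\tfrac1s|\hat v(s)|^2ds=|W_g|^2\ln t+\Gamma_g+O(t^{-\frac14+\nu}),$$ and with it, uniformly in $x\in\mathbb R$ and for $t\ge1$, $$u(t,x)=\frac1{(2it)^{1/2}}W_f\big(\tfrac x{2t}\big)\exp\Big(i\tfrac{x^2}{4t}-\tfrac i2\big(|W_g|^2(\tfrac x{2t})\ln t+\Gamma_g(\tfrac x{2t})\big)\Big)+O(t^{-\frac34+\nu}),$$ $$v(t,x)=\frac1{(2it)^{1/2}}W_g\big(\tfrac x{2t}\big)\exp\Big(i\tfrac{x^2}{4t}-\tfrac i2\big(|W_f|^2(\tfrac x{2t})\ln t+\Gamma_f(\tfrac x{2t})\big)\Big)+O(t^{-\frac34+\nu}),$$ the constants in the $O$'s being at most $C$. Moreover, any real-valued $\Gamma_f',\Gamma_g'\in L^\infty$ for which the last two formulas hold for large $t$ (with any constant) satisfy $\Gamma_g'-\Gamma_g\in4\pi\mathbb Z$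 a.e. on $\{W_f\ne0\}$ and $\Gamma_f'-\Gamma_f\in4\pi\mathbb Z$ a.e. on $\{W_g\neq0\}$. -/

import Mathlib

open MeasureTheory Set Filter Topology
open scoped ENNReal ContDiff

noncomputable section

namespace CoupledNLS

/-- The unitary Fourier transform
`φ̂(ξ) = (2π)^{-1/2} ∫ e^{-ixξ} φ(x) dx` of an integrable function. -/
def hat (φ : ℝ → ℂ) (ξ : ℝ) : ℂ :=
  ((Real.sqrt (2 * Real.pi))⁻¹ : ℝ) * ∫ x : ℝ, Complex.exp (-Complex.I * x * ξ) * φ x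

/-- The free Schrodinger group `e^{it∂ₓₓ}`, the Fourier multiplier with symbol `e^{-itξ²}`,
written with the Fourier inversion integral.  It is only applied to functions in
`H^{1,0} ∩ H^{0,1}`, for which `φ` and `φ̂` are both integrable. -/
def freeGroup (t : ℝ) (φ : ℝ → ℂ) (x : ℝ) : ℂ :=
  ((Real.sqrt (2 * Real.pi))⁻¹ : ℝ) *
    ∫ ξ : ℝ, Complex.exp (Complex.I * x * ξ) * Complex.exp (-Complex.I * t * (ξ : ℂ) ^ 2) * hat φ ξ

/-- Test functions: smooth and compactly supported. -/
def IsTest (η : ℝ → ℂ) : Prop := ContDiff ℝ ∞ η ∧ HasCompactSupport η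

/-- `ψ` is the weak derivative of order `k` of `φ` on the line. -/
def HasWeakDeriv (k : ℕ) (φ ψ : ℝ → ℂ) : Prop :=
  LocallyIntegrable φ ∧ LocallyIntegrable ψ ∧
    ∀ η : ℝ → ℂ, IsTest η →
      ∫ x : ℝ, φ x * iteratedDeriv k η x = (-1) ^ k * ∫ x : ℝ, ψ x * η x

/-- `‖∂ₓᵏ φ‖_{L²}`, with the value `∞` if `φ` has no weak derivative of order `k`.  Weak
derivatives are unique almost everywhere, so the infimum is over at most one value. -/
def weakDerivNorm (k : ℕ) (φ : ℝ → ℂ) : ℝ≥0∞ :=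
  ⨅ (ψ : ℝ → ℂ) (_ : HasWeakDeriv k φ ψ), eLpNorm ψ 2 volume

/-- `‖φ‖_{H^{k,0}} = ∑_{i ≤ k} ‖∂ₓⁱ φ‖_{L²}` (equal to `∞` outside `H^{k,0}`). -/
def sobolevNorm (k : ℕ) (φ : ℝ → ℂ) : ℝ≥0∞ :=
  ∑ i ∈ Finset.range (k + 1), weakDerivNorm i φ

/-- `‖φ‖_{H^{0,k}} = ∑_{i ≤ k} ‖xⁱ φ‖_{L²}`. -/
def weightNorm (k : ℕ) (φ : ℝ → ℂ) : ℝ≥0∞ :=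
  ∑ i ∈ Finset.range (k + 1), eLpNorm (fun x : ℝ => (x : ℂ) ^ i * φ x) 2 volume

/-- The norm of `H^{k,0} ∩ H^{0,1}`. -/
def dataNorm (k : ℕ) (φ : ℝ → ℂ) : ℝ≥0∞ := sobolevNorm k φ + weightNorm 1 φ

/-- `u ∈ C([1,∞); H^{k,0} ∩ H^{0,1})`; the values `u t` for `t < 1` play no role. -/
def ContinuousInSpace (k : ℕ) (u : ℝ → ℝ → ℂ) : Prop :=
  (∀ t : ℝ, 1 ≤ t → dataNorm k (u t) < ⊤) ∧
    ∀ t₀ : ℝ, 1 ≤ t₀ →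
      Tendsto (fun t : ℝ => dataNorm k (fun x => u t x - u t₀ x)) (𝓝[Ici 1] t₀) (𝓝 0)

/-- `i ∂ₜu + ∂ₓₓu = |v|² u` on `[1,∞) × ℝ`, in the sense of distributions in `x` at every time
(the time derivative at `t = 1` is one-sided). -/
def SolvesEquation (u v : ℝ → ℝ → ℂ) : Prop :=
  ∀ η : ℝ → ℂ, IsTest η → ∀ t : ℝ, 1 ≤ t →
    ∃ d : ℂ, HasDerivWithinAt (fun s : ℝ => ∫ x : ℝ, u s x * η x) d (Ici 1) t ∧
      Complex.I * d + ∫ x : ℝ, u t x * iteratedDeriv 2 η x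
        = ∫ x : ℝ, ((‖v t x‖ ^ 2 : ℝ) : ℂ) * u t x * η x

/-- `(u, v)` is a solution in `C([1,∞); H^{k,0} ∩ H^{0,1})²` of the coupled system with
`u(1) = u₁`, `v(1) = v₁`. -/
structure IsSolution (k : ℕ) (u₁ v₁ : ℝ → ℂ) (u v : ℝ → ℝ → ℂ) : Prop where
  cont_u : ContinuousInSpace k u
  cont_v : ContinuousInSpace k v
  eq_u : SolvesEquation u v
  eq_v : SolvesEquation v u
  init_u : u 1 =ᵐ[volume] u₁
  init_v : v 1 =ᵐ[volume] v₁

/-- The profile `f(t) = e^{-it∂ₓₓ} u(t)`. -/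
def profile (u : ℝ → ℝ → ℂ) (t : ℝ) : ℝ → ℂ := freeGroup (-t) (u t)

/-- `∫₁ᵗ s⁻¹ |v̂(s,ξ)|² ds`. -/
def phase (v : ℝ → ℝ → ℂ) (t ξ : ℝ) : ℝ :=
  ∫ s in (1 : ℝ)..t, 1 / s * ‖hat (v s) ξ‖ ^ 2

/-- The phase-corrected profile `f̂(t,ξ) exp((i/2) ∫₁ᵗ s⁻¹ |v̂(s,ξ)|² ds)`, where `f` is the
profile of `u`. -/
def correctedProfile (u v : ℝ → ℝ → ℂ) (t ξ : ℝ) : ℂ :=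
  hat (profile u t) ξ * Complex.exp (Complex.I / 2 * (phase v t ξ : ℂ))

/-- `W ∈ L^∞ ∩ H^{0,n}`. -/
def MemLimitSpace (n : ℕ) (W : ℝ → ℂ) : Prop :=
  MemLp W ⊤ volume ∧ weightNorm n W < ⊤

/-- `‖φ(t)‖_{L^∞} ≤ C t^r` for all `t ≥ T`. -/
def SupBound (C T r : ℝ) (φ : ℝ → ℝ → ℂ) : Prop :=
  ∀ t : ℝ, T ≤ t → eLpNorm (φ t) ⊤ volume ≤ ENNReal.ofReal (C * t ^ r)

/-- `W` is the limit of the corrected profile of `u` (the phase being given by `v`), at the rate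
`t^{-1/4+ν}` in `L^∞` and `t^{-1/8+ν/2}` in `H^{0,n}`, with constant `C`. -/
def ScattersTo (n : ℕ) (ν C : ℝ) (u v : ℝ → ℝ → ℂ) (W : ℝ → ℂ) : Prop :=
  SupBound C 1 (-1 / 4 + ν) (fun t ξ => correctedProfile u v t ξ - W ξ) ∧
    ∀ t : ℝ, 1 ≤ t →
      weightNorm n (fun ξ => correctedProfile u v t ξ - W ξ)
        ≤ ENNReal.ofReal (C * t ^ (-1 / 8 + ν / 2))

/-- `∫₁ᵗ s⁻¹ |v̂(s)|² ds = |W|² ln t + Γ + O(t^{-1/4+ν})` in `L^∞`, with constant `C`. -/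
def PhaseExpansion (ν C : ℝ) (v : ℝ → ℝ → ℂ) (W : ℝ → ℂ) (Γ : ℝ → ℝ) : Prop :=
  SupBound C 1 (-1 / 4 + ν)
    (fun t ξ => ((phase v t ξ - (‖W ξ‖ ^ 2 * Real.log t + Γ ξ) : ℝ) : ℂ))

/-- The asymptotic profile `(2it)^{-1/2} W(x/2t) exp(i x²/4t - (i/2)(|W'(x/2t)|² ln t + Γ(x/2t)))`
(principal branch of the square root). -/
def asymptoticProfile (W W' : ℝ → ℂ) (Γ : ℝ → ℝ) (t x : ℝ) : ℂ :=
  1 / (2 * Complex.I * (t : ℂ)) ^ (1 / 2 : ℂ) * W (x / (2 * t)) *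
    Complex.exp (Complex.I * ((x ^ 2 / (4 * t) : ℝ) : ℂ) -
      Complex.I / 2 *
        ((‖W' (x / (2 * t))‖ ^ 2 * Real.log t + Γ (x / (2 * t)) : ℝ) : ℂ))

/-- `u = asymptoticProfile + O(t^{-3/4+ν})` in `L^∞`, for `t ≥ T`, with constant `C`. -/
def AsymptoticFormula (ν C T : ℝ) (u : ℝ → ℝ → ℂ) (W W' : ℝ → ℂ) (Γ : ℝ → ℝ) : Prop :=
  SupBound C T (-3 / 4 + ν) (fun t x => u t x - asymptoticProfile W W' Γ t x)

end CoupledNLS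

end

open CoupledNLS

/-!
The solution is described through its profiles `f = e^{-it∂ₓₓ}u`, `g = e^{-it∂ₓₓ}v`, which solve
`i∂ₜf = e^{-it∂ₓₓ}(|e^{it∂ₓₓ}g|² e^{it∂ₓₓ}f)` and the equation with `f` and `g` exchanged.  In the
Banach space `Prof (2n)` of continuous representatives of `H^{2n+1,0} ∩ H^{0,1}` this is an ordinary
differential equation whose right-hand side is continuous and locally Lipschitz (`Prof.tri`,
`field`), because the free group acts boundedly and the space is an algebra.

The pseudo-conformal factorisation `e^{it∂ₓₓ}φ(x) = (2it)^{-1/2} e^{ix²/4t} U(x/2t)`, where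
`U = e^{i∂ₓₓ/4t}φ̂`, does two things.  Since `|U - φ̂| ≤ 2t^{-1/4}‖φ‖`, it gives the decay of the
free evolution and the leading term of the asymptotic formula.  It also turns the nonlinearity into
`(2t)⁻¹` times a pointwise product (`trip_eq`), so that on the Fourier side
`i∂ₜf̂ = (2t)⁻¹|ĝ|² f̂ + O(t^{-5/4}‖g‖²‖f‖)` (`Prof.exists_norm_hat_tri_sub_le`).  The phase in the
corrected profile removes exactly the main term, which is not integrable in time
(`exists_hasDerivAt_corrOf`).

For small data a continuous induction closes on the bounds `‖f‖, ‖g‖ ≤ M t^δ` and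
`|f̂|, |ĝ| ≤ M`: the sup norms are controlled through the corrected profiles, and the norms grow
slowly because the nonlinearity satisfies the tame estimate `Prof.exists_norm_tri_le`, linear in the
norm and quadratic in the sup norms of the evolutions, which decay like `t^{-1/2}`.  The tame
estimate rests on a Gagliardo–Nirenberg inequality, proved for finite differences so that no
regularity is needed in the summations by parts, and transferred to Sobolev norms by Plancherel and
Fatou.  Conversely, a distributional solution tested with truncated plane waves satisfies the
equation of the profiles at each frequency, hence in the space, and uniqueness for the system is
uniqueness for the differential equation (`IsSolution.eq_evol`).

With `δ = ν/4` the time derivative of the corrected profile is `O(t^{-5/4+3δ})`, so it converges in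
the sup norm at the rate `t^{-1/4+3δ}`.  The rate in `H^{0,n}` follows by interpolation: the square
of the `L²` norm of `ξⁱ` times a dyadic increment is at most the sup norm of the increment times the
integral of `ξ^{2i}(|f̂(2t)| + |f̂(t)|)`, which is `O(t^δ)`; the increments are then summed.  The
accumulated phase minus `|W|² ln t` has the time derivative `t⁻¹(|ŵ|² - |W|²)`, which is integrable,
and its limit is `Γ`.  Uniqueness of the limits, and of `Γ` modulo `4π` where the amplitude does not
vanish, is read off along integer times.
-/


noncomputable section

namespace CoupledNLS

section

open scoped FourierTransform SchwartzMap

/-! ### The unitary Fourier transform -/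

/-- The normalising constant `(2π)^{-1/2}`. -/
abbrev hatConst : ℝ := (Real.sqrt (2 * Real.pi))⁻¹

theorem hatConst_pos : 0 < hatConst := by
  unfold hatConst; positivity

theorem hatConst_sq : hatConst ^ 2 = (2 * Real.pi)⁻¹ := by
  rw [hatConst, inv_pow, Real.sq_sqrt (by positivity)]

/-- The bilinear form `(x, ξ) ↦ xξ / (2π)`, which turns Mathlib's Fourier integrals into `hat`. -/
def hatForm : ℝ →ₗ[ℝ] ℝ →ₗ[ℝ] ℝ := (2 * Real.pi)⁻¹ • LinearMap.mul ℝ ℝ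

theorem hatForm_apply (x ξ : ℝ) : hatForm x ξ = (2 * Real.pi)⁻¹ * (x * ξ) := rfl

theorem continuous_hatForm : Continuous fun p : ℝ × ℝ => hatForm p.1 p.2 := by
  simp only [hatForm_apply]; fun_prop

theorem hatForm_flip : hatForm.flip = hatForm := by
  ext; simp [hatForm]

theorem fourierChar_hatForm (x ξ : ℝ) :
    ((𝐞 (-hatForm x ξ) : Circle) : ℂ) = Complex.exp (-Complex.I * x * ξ) := by
  rw [Real.fourierChar_apply, hatForm_apply]
  congr 1
  push_cast
  have : (Real.pi : ℂ) ≠ 0 := by exact_mod_cast Real.pi_ne_zero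
  field_simp

theorem norm_exp_I_mul (x ξ : ℝ) : ‖Complex.exp (-Complex.I * x * ξ)‖ = 1 := by
  simp [Complex.norm_exp]

theorem hat_eq_fourierIntegral (φ : ℝ → ℂ) (ξ : ℝ) :
    hat φ ξ = (hatConst : ℂ) * VectorFourier.fourierIntegral 𝐞 volume hatForm φ ξ := by
  unfold hat VectorFourier.fourierIntegral
  simp only [Circle.smul_def, fourierChar_hatForm, smul_eq_mul]

theorem hat_eq_fourier (φ : ℝ → ℂ) (ξ : ℝ) :
    hat φ ξ = (hatConst : ℂ) * 𝓕 φ (ξ / (2 * Real.pi)) := by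
  unfold hat
  rw [Real.fourier_real_eq_integral_exp_smul]
  congr 2
  ext x
  rw [smul_eq_mul]
  congr 2
  push_cast
  have : (Real.pi : ℂ) ≠ 0 := by exact_mod_cast Real.pi_ne_zero
  field_simp

theorem integrable_exp_mul {φ : ℝ → ℂ} (hφ : Integrable φ) (ξ : ℝ) :
    Integrable fun x : ℝ => Complex.exp (-Complex.I * x * ξ) * φ x := by
  refine hφ.bdd_mul (c := 1) (by fun_prop) (Eventually.of_forall fun x => ?_)
  rw [norm_exp_I_mul]

theorem continuous_hat {φ : ℝ → ℂ} (hφ : Integrable φ) : Continuous (hat φ) := by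
  have := VectorFourier.fourierIntegral_continuous (μ := volume) Real.continuous_fourierChar
    continuous_hatForm hφ
  have h2 : hat φ = fun ξ => (hatConst : ℂ) * VectorFourier.fourierIntegral 𝐞 volume hatForm φ ξ :=
    funext fun ξ => hat_eq_fourierIntegral φ ξ
  rw [h2]
  exact continuous_const.mul this

theorem hat_congr_ae {φ ψ : ℝ → ℂ} (h : φ =ᵐ[volume] ψ) : hat φ = hat ψ := by
  ext ξ
  unfold hat
  congr 1
  apply integral_congr_ae
  filter_upwards [h] with x hx
  rw [hx]

theorem hat_add {φ ψ : ℝ → ℂ} (hφ : Integrable φ) (hψ : Integrable ψ) (ξ : ℝ) :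
    hat (fun x => φ x + ψ x) ξ = hat φ ξ + hat ψ ξ := by
  unfold hat
  rw [← mul_add, ← integral_add (integrable_exp_mul hφ ξ) (integrable_exp_mul hψ ξ)]
  simp only [mul_add]

theorem hat_sub {φ ψ : ℝ → ℂ} (hφ : Integrable φ) (hψ : Integrable ψ) (ξ : ℝ) :
    hat (fun x => φ x - ψ x) ξ = hat φ ξ - hat ψ ξ := by
  unfold hat
  rw [← mul_sub, ← integral_sub (integrable_exp_mul hφ ξ) (integrable_exp_mul hψ ξ)]
  simp only [mul_sub]

theorem hat_const_mul (c : ℂ) (φ : ℝ → ℂ) (ξ : ℝ) :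
    hat (fun x => c * φ x) ξ = c * hat φ ξ := by
  simp only [hat, ← integral_const_mul]
  refine integral_congr_ae (Eventually.of_forall fun x => ?_)
  simp only
  ring

theorem norm_hat_le (φ : ℝ → ℂ) (ξ : ℝ) : ‖hat φ ξ‖ ≤ hatConst * ∫ x, ‖φ x‖ := by
  rw [hat_eq_fourierIntegral, norm_mul, Complex.norm_real, Real.norm_of_nonneg hatConst_pos.le]
  gcongr
  exact VectorFourier.norm_fourierIntegral_le_integral_norm _ _ _ _ _

/-- Self-adjointness of the Fourier transform. -/
theorem integral_hat_mul {φ θ : ℝ → ℂ} (hφ : Integrable φ) (hθ : Integrable θ) :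
    ∫ ξ, hat φ ξ * θ ξ = ∫ x, φ x * hat θ x := by
  have := VectorFourier.integral_fourierIntegral_smul_eq_flip (μ := volume) (ν := volume)
    Real.continuous_fourierChar continuous_hatForm hφ hθ
  rw [hatForm_flip] at this
  simp only [smul_eq_mul] at this
  simp only [hat_eq_fourierIntegral, mul_assoc, mul_left_comm (_ : ℂ) (hatConst : ℂ)]
  rw [integral_const_mul, integral_const_mul, this]

theorem hat_hat_eq_fourier (φ : ℝ → ℂ) (x : ℝ) : hat (hat φ) x = 𝓕 (𝓕 φ) x := by
  rw [Real.fourier_real_eq_integral_exp_smul]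
  unfold hat
  rw [show (fun ξ : ℝ => Complex.exp (-Complex.I * ξ * x) * (((Real.sqrt (2 * Real.pi))⁻¹ : ℝ) *
      ∫ y : ℝ, Complex.exp (-Complex.I * y * ξ) * φ y)) = fun ξ : ℝ => (fun w : ℝ =>
        Complex.exp (-Complex.I * (2 * Real.pi * w : ℝ) * x) * ((hatConst : ℂ) * 𝓕 φ w))
          (ξ / (2 * Real.pi)) from ?_]
  · rw [Measure.integral_comp_div (g := fun w : ℝ =>
        Complex.exp (-Complex.I * (2 * Real.pi * w : ℝ) * x) * ((hatConst : ℂ) * 𝓕 φ w))]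
    simp only [mul_left_comm _ (hatConst : ℂ)]
    rw [integral_const_mul, abs_of_pos (by positivity), Complex.real_smul]
    have h : (((Real.sqrt (2 * Real.pi))⁻¹ : ℝ) : ℂ) * (((2 * Real.pi : ℝ) : ℂ) * (hatConst : ℂ)) = 1 := by
      have := hatConst_sq
      rw [← Complex.ofReal_mul, ← Complex.ofReal_mul]
      rw [show (Real.sqrt (2 * Real.pi))⁻¹ * (2 * Real.pi * hatConst) = 2 * Real.pi * hatConst ^ 2 by
        unfold hatConst; ring, this, mul_inv_cancel₀ (by positivity)]
      simp
    rw [← mul_assoc, ← mul_assoc, mul_assoc _ _ (hatConst : ℂ), h, one_mul]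
    congr 1
    ext w
    rw [smul_eq_mul]
    congr 2
    push_cast
    ring
  · ext ξ
    have := hat_eq_fourier φ ξ
    unfold hat at this
    simp only [this]
    congr 3
    field_simp

/-- Fourier inversion. -/
theorem hat_hat {φ : ℝ → ℂ} (hc : Continuous φ) (hφ : Integrable φ) (hh : Integrable (hat φ))
    (x : ℝ) : hat (hat φ) x = φ (-x) := by
  have hF : Integrable (𝓕 φ) := by
    have h1 : 𝓕 φ = fun w => (hatConst : ℂ)⁻¹ * hat φ (w * (2 * Real.pi)) := by
      ext w
      rw [hat_eq_fourier, mul_div_cancel_right₀ _ (by positivity), inv_mul_cancel_left₀]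
      exact_mod_cast hatConst_pos.ne'
    rw [h1]
    exact (hh.comp_mul_right' (by positivity)).const_mul _
  rw [hat_hat_eq_fourier]
  have h2 := congrFun (hc.fourierInv_fourier_eq hφ hF) (-x)
  rw [Real.fourierInv_eq_fourier_neg, neg_neg] at h2
  exact h2

theorem hat_comp_neg (φ : ℝ → ℂ) (ξ : ℝ) : hat (fun x => φ (-x)) ξ = hat φ (-ξ) := by
  unfold hat
  rw [← integral_neg_eq_self]
  congr 2
  ext x
  simp

theorem hat_comp_add (φ : ℝ → ℂ) (h ξ : ℝ) :
    hat (fun x => φ (x + h)) ξ = Complex.exp (Complex.I * h * ξ) * hat φ ξ := by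
  have h1 := integral_add_right_eq_self (μ := volume) (fun x : ℝ =>
    Complex.exp (Complex.I * h * ξ) * (Complex.exp (-Complex.I * x * ξ) * φ x)) h
  rw [integral_const_mul (μ := volume) (Complex.exp (Complex.I * h * ξ))
    (fun x : ℝ => Complex.exp (-Complex.I * x * ξ) * φ x)] at h1
  unfold hat
  rw [mul_left_comm, ← h1]
  congr 1
  refine integral_congr_ae (Eventually.of_forall fun x => ?_)
  simp only
  rw [← mul_assoc, ← Complex.exp_add]
  congr 2
  push_cast
  ring

theorem hasDerivAt_hat {φ : ℝ → ℂ} (hφ : Integrable φ) (hφ' : Integrable fun x : ℝ => (x : ℂ) * φ x)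
    (ξ : ℝ) : HasDerivAt (hat φ) (hat (fun x : ℝ => -Complex.I * x * φ x) ξ) ξ := by
  have h0 : hat φ = fun ξ => (hatConst : ℂ) * 𝓕 φ (ξ / (2 * Real.pi)) :=
    funext fun ξ => hat_eq_fourier φ ξ
  have h1 := Real.hasDerivAt_fourier hφ (by simpa [Complex.real_smul] using hφ') (ξ / (2 * Real.pi))
  have h2 := (h1.scomp ξ ((hasDerivAt_id ξ).div_const (2 * Real.pi))).const_mul (hatConst : ℂ)
  rw [h0]
  refine h2.congr_deriv ?_
  have h3 := hat_const_mul ((1 / (2 * Real.pi) : ℝ) : ℂ)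
    (fun x : ℝ => (-2 * Real.pi * Complex.I * x) • φ x) ξ
  rw [hat_eq_fourier (fun x : ℝ => (-2 * Real.pi * Complex.I * x) • φ x)] at h3
  rw [Complex.real_smul, mul_left_comm, ← h3]
  congr 1
  ext x
  rw [smul_eq_mul]
  push_cast
  have : (Real.pi : ℂ) ≠ 0 := by exact_mod_cast Real.pi_ne_zero
  field_simp


theorem iteratedDeriv_hat {φ : ℝ → ℂ} (hφ : ∀ n : ℕ, Integrable fun x : ℝ => (x : ℂ) ^ n * φ x)
    (j : ℕ) : iteratedDeriv j (hat φ) = hat (fun x : ℝ => (-Complex.I * x) ^ j * φ x) := by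
  have key : ∀ j n : ℕ, Integrable fun x : ℝ => (x : ℂ) ^ n * ((-Complex.I * x) ^ j * φ x) := by
    intro j n
    refine ((hφ (n + j)).const_mul ((-Complex.I) ^ j)).congr (Eventually.of_forall fun x => ?_)
    simp only [mul_pow, pow_add]
    ring
  induction j with
  | zero => simp
  | succ j ih =>
    rw [iteratedDeriv_succ, ih]
    ext ξ
    rw [(hasDerivAt_hat (by simpa using key j 0) (by simpa using key j 1) ξ).deriv]
    congr 1
    ext x
    ring

/-! ### Schwartz functions and the Fourier transform on `L²` -/

/-- The dilation `ξ ↦ ξ / (2π)` relating `hat` to Mathlib's Fourier transform. -/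
def dilation : ℝ ≃L[ℝ] ℝ :=
  ContinuousLinearEquiv.unitsEquivAut ℝ (Units.mk0 (2 * Real.pi)⁻¹ (by positivity))

theorem dilation_apply (ξ : ℝ) : dilation ξ = ξ / (2 * Real.pi) := by
  simp [dilation, ContinuousLinearEquiv.unitsEquivAut_apply, div_eq_mul_inv, mul_comm]

/-- The transform `hat` on Schwartz functions. -/
def hatSchwartz (θ : 𝓢(ℝ, ℂ)) : 𝓢(ℝ, ℂ) :=
  (hatConst : ℂ) • SchwartzMap.compCLMOfContinuousLinearEquiv ℂ dilation (𝓕 θ)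

theorem hatSchwartz_apply (θ : 𝓢(ℝ, ℂ)) (ξ : ℝ) : hatSchwartz θ ξ = hat θ ξ := by
  rw [hat_eq_fourier]
  simp [hatSchwartz, dilation_apply, SchwartzMap.fourier_coe]

theorem integrable_pow_mul_schwartz (θ : 𝓢(ℝ, ℂ)) (n : ℕ) :
    Integrable fun x : ℝ => (x : ℂ) ^ n * θ x := by
  rw [← integrable_norm_iff (by fun_prop)]
  simpa using SchwartzMap.integrable_pow_mul volume θ n

theorem integrable_schwartz (θ : 𝓢(ℝ, ℂ)) : Integrable (θ : ℝ → ℂ) := θ.integrable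

/-- The reflected Fourier transform of a Schwartz function, which is its inverse transform. -/
def ihatSchwartz (θ : 𝓢(ℝ, ℂ)) : 𝓢(ℝ, ℂ) :=
  SchwartzMap.compCLMOfContinuousLinearEquiv ℂ (ContinuousLinearEquiv.neg ℝ) (hatSchwartz θ)

theorem ihatSchwartz_apply (θ : 𝓢(ℝ, ℂ)) (ξ : ℝ) : ihatSchwartz θ ξ = hat θ (-ξ) := by
  simp [ihatSchwartz, hatSchwartz_apply]

theorem integrable_hat_schwartz (θ : 𝓢(ℝ, ℂ)) : Integrable (hat θ) :=
  (integrable_schwartz (hatSchwartz θ)).congr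
    (Eventually.of_forall fun x => hatSchwartz_apply θ x)

theorem hat_ihatSchwartz (θ : 𝓢(ℝ, ℂ)) (x : ℝ) : hat (ihatSchwartz θ) x = θ x := by
  have h : (ihatSchwartz θ : ℝ → ℂ) = fun ξ => hat θ (-ξ) := funext (ihatSchwartz_apply θ)
  rw [h, hat_comp_neg, hat_hat θ.continuous (integrable_schwartz θ) (integrable_hat_schwartz θ),
    neg_neg]

theorem IsTest.exists_schwartz {η : ℝ → ℂ} (h : IsTest η) : ∃ θ : 𝓢(ℝ, ℂ), (θ : ℝ → ℂ) = η :=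
  ⟨h.2.toSchwartzMap h.1, rfl⟩

/-- Locally integrable functions with the same pairings against test functions coincide. -/
theorem ae_eq_of_forall_schwartz {φ ψ : ℝ → ℂ} (hφ : LocallyIntegrable φ)
    (hψ : LocallyIntegrable ψ)
    (h : ∀ θ : 𝓢(ℝ, ℂ), ∫ x, φ x * θ x = ∫ x, ψ x * θ x) : φ =ᵐ[volume] ψ := by
  refine ae_eq_of_integral_contDiff_smul_eq hφ hψ fun g hg hs => ?_
  have hs' : HasCompactSupport fun x => (g x : ℂ) := hs.comp_left (g := Complex.ofReal) rfl
  have := h (hs'.toSchwartzMap (Complex.ofRealCLM.contDiff.comp hg))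
  have e : ∀ x, (hs'.toSchwartzMap (Complex.ofRealCLM.contDiff.comp hg)) x = (g x : ℂ) :=
    fun _ => rfl
  simp only [e] at this
  simpa [mul_comm] using this

theorem eLpNorm_comp_mul {a : ℝ} (ha : a ≠ 0) {g : ℝ → ℂ} (hg : AEStronglyMeasurable g volume) :
    eLpNorm (fun x => g (a * x)) 2 volume
      = ENNReal.ofReal |a|⁻¹ ^ (1 / 2 : ℝ) * eLpNorm g 2 volume := by
  have hm : Measure.map (a * ·) (volume : Measure ℝ) = ENNReal.ofReal |a⁻¹| • volume :=
    Real.map_volume_mul_left ha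
  have h1 := eLpNorm_map_measure (p := 2) (μ := (volume : Measure ℝ)) (f := fun x => a * x)
    (g := g) (by rw [hm]; exact hg.smul_measure _) (by fun_prop)
  rw [hm, eLpNorm_smul_measure_of_ne_top (by simp)] at h1
  rw [abs_inv] at h1
  simp only [Function.comp_def] at h1
  rw [← h1]
  simp

theorem memLp_comp_mul {a : ℝ} (ha : a ≠ 0) {g : ℝ → ℂ} (hg : MemLp g 2 volume) :
    MemLp (fun x => g (a * x)) 2 volume := by
  refine ⟨?_, ?_⟩
  · refine hg.1.comp_quasiMeasurePreserving ⟨by fun_prop, ?_⟩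
    rw [Real.map_volume_mul_left ha]
    exact Measure.smul_absolutelyContinuous
  · rw [eLpNorm_comp_mul ha hg.1]
    exact ENNReal.mul_lt_top (ENNReal.rpow_lt_top_of_nonneg (by norm_num) (by simp)) hg.2

/-- The Fourier transform on `L²`, described by its pairings with Schwartz functions. -/
theorem exists_hat_of_memLp {ψ : ℝ → ℂ} (hψ : MemLp ψ 2 volume) :
    ∃ χ : ℝ → ℂ, MemLp χ 2 volume ∧ eLpNorm χ 2 volume = eLpNorm ψ 2 volume ∧
      ∀ θ : 𝓢(ℝ, ℂ), ∫ ξ, χ ξ * θ ξ = ∫ x, ψ x * hat θ x := by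
  set Ψ : Lp ℂ 2 (volume : Measure ℝ) := hψ.toLp ψ with hΨ
  set Φ : Lp ℂ 2 (volume : Measure ℝ) := 𝓕 Ψ with hΦ
  have hp : (0 : ℝ) < 2 * Real.pi := by positivity
  have hΦm : MemLp (fun ξ => Φ ((2 * Real.pi)⁻¹ * ξ)) 2 volume :=
    memLp_comp_mul (by positivity) (Lp.memLp Φ)
  refine ⟨fun ξ => (hatConst : ℂ) * Φ ((2 * Real.pi)⁻¹ * ξ), hΦm.const_mul _, ?_, ?_⟩
  · have h1 := eLpNorm_const_smul (p := 2) (μ := (volume : Measure ℝ)) (hatConst : ℂ)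
      (fun ξ => Φ ((2 * Real.pi)⁻¹ * ξ))
    have h2 : eLpNorm Φ 2 volume = eLpNorm ψ 2 volume := by
      have : ‖Φ‖ = ‖Ψ‖ := Lp.norm_fourier_eq Ψ
      rw [Lp.norm_def, Lp.norm_def, ENNReal.toReal_eq_toReal_iff' (Lp.eLpNorm_ne_top _)
        (Lp.eLpNorm_ne_top _)] at this
      rw [this, eLpNorm_congr_ae hψ.coeFn_toLp]
    rw [show (fun ξ => (hatConst : ℂ) * Φ ((2 * Real.pi)⁻¹ * ξ)) =
      (hatConst : ℂ) • (fun ξ => Φ ((2 * Real.pi)⁻¹ * ξ)) from rfl, h1,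
      eLpNorm_comp_mul (by positivity) (Lp.aestronglyMeasurable Φ), h2, ← mul_assoc]
    have h3 : ‖(hatConst : ℂ)‖ₑ * ENNReal.ofReal |(2 * Real.pi)⁻¹|⁻¹ ^ (1 / 2 : ℝ) = 1 := by
      rw [abs_of_pos (by positivity), inv_inv,
        ENNReal.ofReal_rpow_of_nonneg (by positivity) (by norm_num), ← Real.sqrt_eq_rpow,
        ← ofReal_norm, Complex.norm_real, Real.norm_of_nonneg hatConst_pos.le,
        ← ENNReal.ofReal_mul hatConst_pos.le, hatConst, inv_mul_cancel₀ (by positivity)]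
      simp
    rw [h3, one_mul]
  · intro θ
    let θ' : 𝓢(ℝ, ℂ) := SchwartzMap.compCLMOfContinuousLinearEquiv ℂ dilation.symm θ
    have hθ' : ∀ w, θ' w = θ (2 * Real.pi * w) := by
      intro w
      have : dilation.symm w = 2 * Real.pi * w := by
        rw [ContinuousLinearEquiv.symm_apply_eq, dilation_apply]; field_simp
      simp [θ', this]
    have hF : ∀ x, 𝓕 θ' x = (hatConst : ℂ) * hat θ x := by
      intro x
      rw [SchwartzMap.fourier_coe, Real.fourier_real_eq_integral_exp_smul]
      have h1 := Measure.integral_comp_mul_left (fun ξ : ℝ =>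
        Complex.exp (-Complex.I * ξ * x) * θ ξ) (2 * Real.pi)
      rw [abs_of_pos (by positivity)] at h1
      have h2 : ∫ v : ℝ, Complex.exp (↑(-2 * Real.pi * v * x) * Complex.I) • θ' v =
          ∫ v : ℝ, Complex.exp (-Complex.I * ((2 * Real.pi * v : ℝ) : ℂ) * x) *
            θ (2 * Real.pi * v) := by
        congr 1
        ext v
        rw [hθ', smul_eq_mul]
        congr 2
        push_cast
        ring
      rw [h2, h1, hat, Complex.real_smul, ← mul_assoc, ← hatConst_sq, pow_two]
      push_cast
      rfl
    have h4 := congrArg (fun T : 𝓢'(ℝ, ℂ) => T θ') (Lp.fourier_toTemperedDistribution_eq Ψ)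
    simp only [TemperedDistribution.fourier_apply, Lp.toTemperedDistribution_apply] at h4
    have h5 : ∫ x, ψ x * hat θ x = (hatConst : ℂ)⁻¹ * ∫ x, 𝓕 θ' x • Ψ x := by
      rw [← integral_const_mul]
      apply integral_congr_ae
      filter_upwards [hψ.coeFn_toLp] with x hx
      rw [hΨ, hx, hF, smul_eq_mul, mul_comm (ψ x), ← mul_assoc, inv_mul_cancel_left₀]
      exact_mod_cast hatConst_pos.ne'
    rw [h5, h4, ← hΦ]
    have h6 := Measure.integral_comp_mul_left (fun w : ℝ => θ' w • Φ w) (2 * Real.pi)⁻¹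
    have h7 : ∀ ξ, θ' ((2 * Real.pi)⁻¹ * ξ) = θ ξ := by
      intro ξ; rw [hθ', mul_inv_cancel_left₀ hp.ne']
    simp only [h7, inv_inv] at h6
    rw [abs_of_pos hp] at h6
    simp only [mul_assoc]
    rw [integral_const_mul]
    simp only [smul_eq_mul, mul_comm (θ _)] at h6 ⊢
    rw [h6, Complex.real_smul]
    have h8 := hatConst_sq
    have h9 : hatConst * (2 * Real.pi) = hatConst⁻¹ := by
      have := hatConst_pos
      apply eq_inv_of_mul_eq_one_left
      rw [show hatConst * (2 * Real.pi) * hatConst = 2 * Real.pi * hatConst ^ 2 by ring, h8,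
        mul_inv_cancel₀ hp.ne']
    rw [← mul_assoc, ← Complex.ofReal_mul, h9, Complex.ofReal_inv]

end

section

open scoped FourierTransform SchwartzMap

theorem locallyIntegrable_of_memLp {φ : ℝ → ℂ} (h : MemLp φ 2 volume) : LocallyIntegrable φ :=
  h.locallyIntegrable (by norm_num)

/-- The inverse Fourier transform on `L²`. -/
theorem exists_hat_eq_of_memLp {χ : ℝ → ℂ} (hχ : MemLp χ 2 volume) :
    ∃ ψ : ℝ → ℂ, MemLp ψ 2 volume ∧ eLpNorm ψ 2 volume = eLpNorm χ 2 volume ∧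
      ∀ θ : 𝓢(ℝ, ℂ), ∫ ξ, χ ξ * θ ξ = ∫ x, ψ x * hat θ x := by
  obtain ⟨κ, hκ, hn, hp⟩ := exists_hat_of_memLp hχ
  have hneg : MeasurePreserving (fun x : ℝ => -x) volume volume := Measure.measurePreserving_neg _
  refine ⟨fun x => κ (-x), hκ.comp_measurePreserving hneg, ?_, fun θ => ?_⟩
  · rw [← hn]
    exact eLpNorm_comp_measurePreserving hκ.1 hneg
  · have h1 := hp (ihatSchwartz θ)
    simp only [hat_ihatSchwartz, ihatSchwartz_apply] at h1
    rw [← h1, ← integral_neg_eq_self]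
    simp

theorem ae_eq_hat_of_pairing {φ χ : ℝ → ℂ} (hφ : Integrable φ) (hχ : LocallyIntegrable χ)
    (h : ∀ θ : 𝓢(ℝ, ℂ), ∫ ξ, χ ξ * θ ξ = ∫ x, φ x * hat θ x) : χ =ᵐ[volume] hat φ := by
  refine ae_eq_of_forall_schwartz hχ (continuous_hat hφ).locallyIntegrable fun θ => ?_
  rw [h θ, integral_hat_mul hφ (integrable_schwartz θ)]

/-- Plancherel's theorem on `L¹ ∩ L²`. -/
theorem eLpNorm_hat {φ : ℝ → ℂ} (hφ : Integrable φ) (hφ2 : MemLp φ 2 volume) :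
    eLpNorm (hat φ) 2 volume = eLpNorm φ 2 volume := by
  obtain ⟨χ, hχ, hn, hp⟩ := exists_hat_of_memLp hφ2
  rw [← hn]
  exact eLpNorm_congr_ae (ae_eq_hat_of_pairing hφ (locallyIntegrable_of_memLp hχ) hp).symm

theorem memLp_hat {φ : ℝ → ℂ} (hφ : Integrable φ) (hφ2 : MemLp φ 2 volume) :
    MemLp (hat φ) 2 volume :=
  ⟨(continuous_hat hφ).aestronglyMeasurable, by rw [eLpNorm_hat hφ hφ2]; exact hφ2.2⟩

/-- Fourier inversion for integrable functions that need not be continuous. -/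
theorem ae_eq_hat_hat {φ : ℝ → ℂ} (hφ : Integrable φ) (hh : Integrable (hat φ)) :
    φ =ᵐ[volume] fun x => hat (hat φ) (-x) := by
  have hc : Continuous fun x => hat (hat φ) (-x) := (continuous_hat hh).comp continuous_neg
  refine ae_eq_of_forall_schwartz hφ.locallyIntegrable hc.locallyIntegrable fun θ => ?_
  have h1 : ∫ x, φ x * θ x = ∫ x, hat φ x * ihatSchwartz θ x := by
    rw [integral_hat_mul hφ (integrable_schwartz _)]
    simp only [hat_ihatSchwartz]
  rw [h1, ← integral_neg_eq_self]
  simp only [← hat_comp_neg (hat φ)]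
  have h2 : Integrable fun x => hat φ (-x) := hh.comp_neg
  rw [integral_hat_mul h2 (integrable_schwartz θ)]
  simp [ihatSchwartz_apply]

/-! ### Weak derivatives and the Fourier transform -/

/-- A smooth cutoff, equal to one on `[-(n+1), n+1]`. -/
def cutoff (n : ℕ) (x : ℝ) : ℂ :=
  (((⟨1, 2, one_pos, one_lt_two⟩ : ContDiffBump (0 : ℝ)) (((n : ℝ) + 1)⁻¹ • x) : ℝ) : ℂ)

theorem contDiff_cutoff (n : ℕ) : ContDiff ℝ ∞ (cutoff n) := by
  unfold cutoff
  exact Complex.ofRealCLM.contDiff.comp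
    ((ContDiffBump.contDiff _).comp (contDiff_const_smul (((n : ℝ) + 1)⁻¹)))

theorem hasCompactSupport_cutoff (n : ℕ) : HasCompactSupport (cutoff n) := by
  have h1 : HasCompactSupport fun x : ℝ =>
      (⟨1, 2, one_pos, one_lt_two⟩ : ContDiffBump (0 : ℝ)) (((n : ℝ) + 1)⁻¹ • x) :=
    (ContDiffBump.hasCompactSupport _).comp_smul (by positivity)
  exact h1.comp_left (g := Complex.ofReal) rfl

theorem cutoff_eq_one {n : ℕ} {x : ℝ} (h : |x| ≤ (n : ℝ) + 1) : cutoff n x = 1 := by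
  unfold cutoff
  rw [ContDiffBump.one_of_mem_closedBall]
  · simp
  · simp only [Metric.mem_closedBall, dist_zero_right, norm_smul, norm_inv, Real.norm_eq_abs]
    rw [abs_of_pos (by positivity : (0 : ℝ) < (n : ℝ) + 1), inv_mul_le_iff₀ (by positivity)]
    simpa using h

theorem exists_bound_iteratedDeriv_cutoff (i : ℕ) :
    ∃ C : ℝ, ∀ (n : ℕ) (x : ℝ), ‖iteratedDeriv i (cutoff n) x‖ ≤ C := by
  have h0 : ∀ n x, cutoff n x = cutoff 0 (((n : ℝ) + 1)⁻¹ • x) := by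
    intro n x; simp [cutoff]
  obtain ⟨C, hC⟩ := Continuous.bounded_above_of_compact_support
    ((contDiff_cutoff 0).continuous_iteratedFDeriv (m := i) (by exact_mod_cast le_top))
    ((hasCompactSupport_cutoff 0).iteratedFDeriv i)
  refine ⟨C, fun n x => ?_⟩
  rw [show cutoff n = fun x => cutoff 0 (((n : ℝ) + 1)⁻¹ • x) from funext (h0 n)]
  have h1 := congrFun (iteratedDeriv_comp_const_smul (n := i) (f := cutoff 0)
    ((contDiff_cutoff 0).of_le (by exact_mod_cast le_top)) ((n : ℝ) + 1)⁻¹) x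
  simp only [smul_eq_mul (a := ((n : ℝ) + 1)⁻¹)]
  rw [h1, norm_smul]
  have h2 : ‖(((n : ℝ) + 1)⁻¹) ^ i‖ ≤ 1 := by
    rw [norm_pow, norm_inv, Real.norm_of_nonneg (by positivity)]
    exact pow_le_one₀ (by positivity) (inv_le_one_of_one_le₀ (by linarith [n.cast_nonneg (α := ℝ)]))
  calc _ ≤ 1 * ‖iteratedDeriv i (cutoff 0) (((n : ℝ) + 1)⁻¹ * x)‖ := by gcongr
    _ ≤ C := by
      rw [one_mul, ← norm_iteratedFDeriv_eq_norm_iteratedDeriv]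
      exact hC _

theorem isTest_cutoff_mul (n : ℕ) {η : ℝ → ℂ} (hη : ContDiff ℝ ∞ η) :
    IsTest fun x => cutoff n x * η x :=
  ⟨(contDiff_cutoff n).mul hη, (hasCompactSupport_cutoff n).mul_right⟩

/-- Cutting off a test function does not change its pairings in the limit, as soon as the
pairings with its derivatives make sense.  The bound is uniform in the cutoff. -/
theorem tendsto_integral_cutoff {φ η : ℝ → ℂ} (hη : ContDiff ℝ ∞ η) (j : ℕ)
    (hφ : AEStronglyMeasurable φ volume)
    (hi : ∀ i ≤ j, Integrable fun x => φ x * iteratedDeriv i η x) :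
    Tendsto (fun n => ∫ x, φ x * iteratedDeriv j (fun x => cutoff n x * η x) x) atTop
      (𝓝 (∫ x, φ x * iteratedDeriv j η x)) := by
  choose C hC using exists_bound_iteratedDeriv_cutoff
  have hcont : ∀ (f : ℝ → ℂ), ContDiff ℝ ∞ f → Continuous (iteratedDeriv j f) := fun f hf =>
    hf.continuous_iteratedDeriv j (by exact_mod_cast le_top)
  refine tendsto_integral_of_dominated_convergence
    (fun x => ∑ i ∈ Finset.range (j + 1), j.choose i * C i * ‖φ x * iteratedDeriv (j - i) η x‖)
    ?_ ?_ ?_ ?_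
  · intro n
    exact hφ.mul (hcont _ (isTest_cutoff_mul n hη).1).aestronglyMeasurable
  · refine integrable_finsetSum _ fun i hi' => ?_
    exact ((hi (j - i) (Nat.sub_le _ _)).norm).const_mul _
  · intro n
    refine Eventually.of_forall fun x => ?_
    have hle : ∀ f : ℝ → ℂ, ContDiff ℝ ∞ f → ContDiffAt ℝ j f x := fun f hf =>
      (hf.of_le (by exact_mod_cast le_top)).contDiffAt
    rw [iteratedDeriv_fun_mul (hle _ (contDiff_cutoff n)) (hle _ hη), Finset.mul_sum]
    refine (norm_sum_le _ _).trans (Finset.sum_le_sum fun i _ => ?_)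
    calc _ = j.choose i * ‖iteratedDeriv i (cutoff n) x‖ * ‖φ x * iteratedDeriv (j - i) η x‖ := by
          simp only [norm_mul, Complex.norm_natCast]; ring
      _ ≤ _ := by gcongr; exact hC i n x
  · refine Eventually.of_forall fun x => ?_
    refine tendsto_const_nhds.congr' ?_
    filter_upwards [eventually_ge_atTop ⌈|x|⌉₊] with n hn
    have hx : |x| < (n : ℝ) + 1 := by
      have := Nat.ceil_le.mp hn; linarith
    have he : (fun y => cutoff n y * η y) =ᶠ[𝓝 x] η := by
      have : ∀ᶠ y in 𝓝 x, |y| < (n : ℝ) + 1 := continuous_abs.continuousAt.eventually_lt_const hx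
      filter_upwards [this] with y hy
      rw [cutoff_eq_one hy.le, one_mul]
    rw [he.iteratedDeriv_eq]

/-- The weak derivative can be paired with Schwartz functions. -/
theorem HasWeakDeriv.integral_schwartz {j : ℕ} {φ ψ : ℝ → ℂ} (h : HasWeakDeriv j φ ψ)
    (hφ : Integrable φ) (hψ : MemLp ψ 2 volume) (θ : 𝓢(ℝ, ℂ)) :
    ∫ x, φ x * iteratedDeriv j θ x = (-1) ^ j * ∫ x, ψ x * θ x := by
  have h1 := tendsto_integral_cutoff (φ := φ) (η := θ) (θ.smooth _) j hφ.1 fun i _ => by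
    obtain ⟨C, -, hC⟩ := θ.decay 0 i
    refine hφ.mul_bdd (c := C) ((θ.smooth ⊤).continuous_iteratedDeriv i
      (by exact_mod_cast le_top)).aestronglyMeasurable (Eventually.of_forall fun x => ?_)
    rw [← norm_iteratedFDeriv_eq_norm_iteratedDeriv]
    simpa using hC x
  have h2 := tendsto_integral_cutoff (φ := ψ) (η := θ) (θ.smooth _) 0 hψ.1 fun i hi => by
    obtain rfl : i = 0 := by omega
    simpa [Pi.mul_def] using hψ.integrable_mul (θ.memLp 2 volume)
  simp only [iteratedDeriv_zero] at h2
  refine tendsto_nhds_unique h1 ((h2.const_mul _).congr fun n => ?_)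
  exact (h.2.2 _ (isTest_cutoff_mul n (θ.smooth _))).symm

theorem integral_mul_iteratedDeriv_hat {φ : ℝ → ℂ} (hφ : Integrable φ) (j : ℕ) (θ : 𝓢(ℝ, ℂ)) :
    ∫ x, φ x * iteratedDeriv j (hat θ) x
      = (-1) ^ j * ∫ ξ, (Complex.I * ξ) ^ j * hat φ ξ * θ ξ := by
  rw [iteratedDeriv_hat (integrable_pow_mul_schwartz θ), ← integral_hat_mul hφ,
    ← integral_const_mul]
  · congr 1
    ext ξ
    rw [show -Complex.I * (ξ : ℂ) = (-1) * (Complex.I * ξ) by ring, mul_pow]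
    ring
  · refine ((integrable_pow_mul_schwartz θ j).const_mul ((-Complex.I) ^ j)).congr
      (Eventually.of_forall fun x => ?_)
    simp only [mul_pow]
    ring

/-- An `L²` weak derivative corresponds to multiplication by a power of `iξ`. -/
theorem HasWeakDeriv.ae_eq_hat {j : ℕ} {φ ψ χ : ℝ → ℂ} (h : HasWeakDeriv j φ ψ)
    (hφ : Integrable φ) (hψ : MemLp ψ 2 volume) (hχ : MemLp χ 2 volume)
    (hp : ∀ θ : 𝓢(ℝ, ℂ), ∫ ξ, χ ξ * θ ξ = ∫ x, ψ x * hat θ x) :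
    χ =ᵐ[volume] fun ξ => (Complex.I * ξ) ^ j * hat φ ξ := by
  have hc : Continuous fun ξ : ℝ => (Complex.I * ξ) ^ j * hat φ ξ := by
    have := continuous_hat hφ
    fun_prop
  refine ae_eq_of_forall_schwartz (locallyIntegrable_of_memLp hχ) hc.locallyIntegrable
    fun θ => ?_
  have h1 := h.integral_schwartz hφ hψ (hatSchwartz θ)
  rw [show (hatSchwartz θ : ℝ → ℂ) = hat θ from funext (hatSchwartz_apply θ),
    integral_mul_iteratedDeriv_hat hφ] at h1
  rw [hp θ]
  exact (mul_left_cancel₀ (by simp) h1).symm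

theorem norm_I_mul_pow (j : ℕ) (ξ : ℝ) (z : ℂ) : ‖(Complex.I * ξ) ^ j * z‖ = |ξ| ^ j * ‖z‖ := by
  simp

/-- The `L²` norm of a weak derivative on the Fourier side. -/
theorem HasWeakDeriv.memLp_hat {j : ℕ} {φ ψ : ℝ → ℂ} (h : HasWeakDeriv j φ ψ)
    (hφ : Integrable φ) (hψ : MemLp ψ 2 volume) :
    MemLp (fun ξ : ℝ => (Complex.I * ξ) ^ j * hat φ ξ) 2 volume ∧
      eLpNorm (fun ξ : ℝ => (Complex.I * ξ) ^ j * hat φ ξ) 2 volume = eLpNorm ψ 2 volume := by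
  obtain ⟨χ, hχ, hn, hp⟩ := exists_hat_of_memLp hψ
  have := h.ae_eq_hat hφ hψ hχ hp
  exact ⟨(memLp_congr_ae this).1 hχ, by rw [← hn]; exact eLpNorm_congr_ae this.symm⟩

/-- If `ξʲ φ̂` is square integrable, then `φ` has a weak derivative of order `j` in `L²`. -/
theorem exists_hasWeakDeriv {j : ℕ} {φ : ℝ → ℂ} (hφ : Integrable φ)
    (hm : MemLp (fun ξ : ℝ => (Complex.I * ξ) ^ j * hat φ ξ) 2 volume) :
    ∃ ψ : ℝ → ℂ, HasWeakDeriv j φ ψ ∧ MemLp ψ 2 volume ∧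
      eLpNorm ψ 2 volume = eLpNorm (fun ξ : ℝ => (Complex.I * ξ) ^ j * hat φ ξ) 2 volume ∧
      ∀ θ : 𝓢(ℝ, ℂ), ∫ ξ, (Complex.I * ξ) ^ j * hat φ ξ * θ ξ = ∫ x, ψ x * hat θ x := by
  obtain ⟨ψ, hψ, hn, hp⟩ := exists_hat_eq_of_memLp hm
  refine ⟨ψ, ⟨hφ.locallyIntegrable, locallyIntegrable_of_memLp hψ, fun η hη => ?_⟩, hψ, hn, hp⟩
  obtain ⟨θ, rfl⟩ := hη.exists_schwartz
  have h1 := integral_mul_iteratedDeriv_hat hφ j (ihatSchwartz θ)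
  rw [hp, show hat (ihatSchwartz θ) = θ from funext (hat_ihatSchwartz θ)] at h1
  exact h1

theorem weakDerivNorm_le {j : ℕ} {φ : ℝ → ℂ} (hφ : Integrable φ)
    (hm : MemLp (fun ξ : ℝ => (Complex.I * ξ) ^ j * hat φ ξ) 2 volume) :
    weakDerivNorm j φ ≤ eLpNorm (fun ξ : ℝ => (Complex.I * ξ) ^ j * hat φ ξ) 2 volume := by
  obtain ⟨ψ, hw, -, hn, -⟩ := exists_hasWeakDeriv hφ hm
  exact (iInf₂_le ψ hw).trans hn.le

theorem eLpNorm_le_weakDerivNorm {j : ℕ} {φ : ℝ → ℂ} (hφ : Integrable φ)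
    (hm : weakDerivNorm j φ < ⊤) :
    MemLp (fun ξ : ℝ => (Complex.I * ξ) ^ j * hat φ ξ) 2 volume ∧
      eLpNorm (fun ξ : ℝ => (Complex.I * ξ) ^ j * hat φ ξ) 2 volume ≤ weakDerivNorm j φ := by
  have key : ∀ ψ, HasWeakDeriv j φ ψ → eLpNorm ψ 2 volume < ⊤ →
      MemLp (fun ξ : ℝ => (Complex.I * ξ) ^ j * hat φ ξ) 2 volume ∧
      eLpNorm (fun ξ : ℝ => (Complex.I * ξ) ^ j * hat φ ξ) 2 volume = eLpNorm ψ 2 volume :=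
    fun ψ hw ht => hw.memLp_hat hφ ⟨hw.2.1.aestronglyMeasurable, ht⟩
  refine ⟨?_, le_iInf₂ fun ψ hw => ?_⟩
  · simp only [weakDerivNorm, iInf_lt_iff] at hm
    obtain ⟨ψ, hw, ht⟩ := hm
    exact (key ψ hw ht).1
  · rcases lt_or_eq_of_le (le_top : eLpNorm ψ 2 volume ≤ ⊤) with ht | ht
    · exact (key ψ hw ht).2.le
    · rw [ht]; exact le_top

end

/-! ### A Gagliardo–Nirenberg inequality for finite differences -/

/-- The forward difference `φ(x + h) - φ(x)`. -/
def fd (h : ℝ) (φ : ℝ → ℂ) (x : ℝ) : ℂ := φ (x + h) - φ x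

/-- Bounded continuous square integrable functions. -/
structure BddL2 (φ : ℝ → ℂ) : Prop where
  cont : Continuous φ
  memLp : MemLp φ 2 volume
  bdd : ∃ B : ℝ, ∀ x, ‖φ x‖ ≤ B

theorem BddL2.translate {φ : ℝ → ℂ} (hφ : BddL2 φ) (r : ℝ) : BddL2 fun x => φ (x + r) where
  cont := hφ.cont.comp (continuous_add_const r)
  memLp := hφ.memLp.comp_measurePreserving (measurePreserving_add_right volume r)
  bdd := let ⟨B, hB⟩ := hφ.bdd; ⟨B, fun x => hB (x + r)⟩

theorem BddL2.fd {φ : ℝ → ℂ} (hφ : BddL2 φ) (h : ℝ) : BddL2 (fd h φ) where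
  cont := (hφ.translate h).cont.sub hφ.cont
  memLp := (hφ.translate h).memLp.sub hφ.memLp
  bdd := let ⟨B, hB⟩ := hφ.bdd
    ⟨B + B, fun x => (norm_sub_le _ _).trans (add_le_add (hB (x + h)) (hB x))⟩

theorem BddL2.iterate_fd {φ : ℝ → ℂ} (hφ : BddL2 φ) (h : ℝ) (j : ℕ) :
    BddL2 ((CoupledNLS.fd h)^[j] φ) := by
  induction j with
  | zero => exact hφ
  | succ j ih => rw [Function.iterate_succ_apply']; exact ih.fd h

theorem BddL2.mul {φ ψ : ℝ → ℂ} (hφ : BddL2 φ) (hψ : BddL2 ψ) : BddL2 fun x => φ x * ψ x where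
  cont := hφ.cont.mul hψ.cont
  memLp := by
    obtain ⟨B, hB⟩ := hφ.bdd
    refine (hψ.memLp.const_mul (B : ℂ)).mono (hφ.cont.mul hψ.cont).aestronglyMeasurable
      (Eventually.of_forall fun x => ?_)
    rw [norm_mul, norm_mul, Complex.norm_real]
    gcongr
    exact (hB x).trans (le_abs_self B)
  bdd := by
    obtain ⟨B, hB⟩ := hφ.bdd
    obtain ⟨D, hD⟩ := hψ.bdd
    refine ⟨B * D, fun x => ?_⟩
    rw [norm_mul]
    exact mul_le_mul (hB x) (hD x) (norm_nonneg _) ((norm_nonneg _).trans (hB x))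

theorem BddL2.const_mul {φ : ℝ → ℂ} (hφ : BddL2 φ) (c : ℂ) : BddL2 fun x => c * φ x where
  cont := continuous_const.mul hφ.cont
  memLp := hφ.memLp.const_mul c
  bdd := let ⟨B, hB⟩ := hφ.bdd
    ⟨‖c‖ * B, fun x => by rw [norm_mul]; exact mul_le_mul_of_nonneg_left (hB x) (norm_nonneg _)⟩

theorem BddL2.star {φ : ℝ → ℂ} (hφ : BddL2 φ) : BddL2 fun x => starRingEnd ℂ (φ x) where
  cont := Complex.continuous_conj.comp hφ.cont
  memLp := hφ.memLp.of_le (Complex.continuous_conj.comp hφ.cont).aestronglyMeasurable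
    (Eventually.of_forall fun x => by simp)
  bdd := let ⟨B, hB⟩ := hφ.bdd; ⟨B, fun x => by simpa using hB x⟩

theorem BddL2.integrable_rpow {φ : ℝ → ℂ} (hφ : BddL2 φ) {p : ℝ} (hp : 2 ≤ p) :
    Integrable fun x => ‖φ x‖ ^ p := by
  obtain ⟨B, hB⟩ := hφ.bdd
  have h2 : Integrable fun x => ‖φ x‖ ^ 2 := hφ.memLp.integrable_norm_pow (by norm_num)
  refine (h2.const_mul (B ^ (p - 2))).mono'
    ((hφ.cont.norm.rpow_const fun _ => Or.inr (by linarith)).aestronglyMeasurable)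
    (Eventually.of_forall fun x => ?_)
  rw [Real.norm_of_nonneg (by positivity)]
  calc ‖φ x‖ ^ p = ‖φ x‖ ^ (p - 2) * ‖φ x‖ ^ 2 := by
        rw [← Real.rpow_natCast, ← Real.rpow_add_of_nonneg (norm_nonneg _) (by linarith)
          (by norm_num)]
        congr 1; norm_num
    _ ≤ _ := by
        gcongr
        exact hB x

theorem BddL2.integrable_sq {φ : ℝ → ℂ} (hφ : BddL2 φ) : Integrable fun x => ‖φ x‖ ^ 2 :=
  hφ.memLp.integrable_norm_pow (by norm_num)

theorem integral_translate (f : ℝ → ℝ) (r : ℝ) : ∫ x, f (x + r) = ∫ x, f x :=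
  integral_add_right_eq_self f r

/-- The map `z ↦ |z|^q z̄` is Lipschitz with constant growing like `|z|^q`. -/
theorem norm_rpow_smul_conj_sub_le {q : ℝ} (hq : 0 < q) (z w : ℂ) :
    ‖(‖z‖ ^ q : ℝ) • starRingEnd ℂ z - (‖w‖ ^ q : ℝ) • starRingEnd ℂ w‖
      ≤ (1 + max 1 q) * (‖z‖ ^ q + ‖w‖ ^ q) * ‖z - w‖ := by
  wlog h : ‖w‖ ≤ ‖z‖ generalizing z w
  · have := this w z (le_of_not_ge h)
    rwa [norm_sub_rev, norm_sub_rev w z, add_comm (‖w‖ ^ q)] at this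
  have key : ‖w‖ * (‖z‖ ^ q - ‖w‖ ^ q) ≤ max 1 q * ‖z‖ ^ q * (‖z‖ - ‖w‖) := by
    rcases (norm_nonneg z).eq_or_lt with h0 | h0
    · have : ‖w‖ = 0 := le_antisymm (h0 ▸ h) (norm_nonneg _)
      simp [this, ← h0]
    set s := ‖w‖ / ‖z‖ with hs
    have hs0 : 0 ≤ s := by positivity
    have hs1 : s ≤ 1 := (div_le_one h0).2 h
    have hw : ‖w‖ = s * ‖z‖ := by rw [hs]; field_simp
    have h1 : 1 - s ^ q ≤ max 1 q * (1 - s) := by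
      rcases le_total q 1 with hq1 | hq1
      · have : s ^ (1 : ℝ) ≤ s ^ q := Real.rpow_le_rpow_of_exponent_ge' hs0 hs1 hq.le hq1
        rw [Real.rpow_one] at this
        rw [max_eq_left hq1]; linarith
      · have := one_add_mul_self_le_rpow_one_add (s := s - 1) (by linarith) hq1
        rw [max_eq_right hq1]
        rw [add_sub_cancel] at this
        linarith
    rw [hw, Real.mul_rpow hs0 h0.le]
    have h2 : 0 ≤ 1 - s ^ q := sub_nonneg.2 (Real.rpow_le_one hs0 hs1 hq.le)
    calc s * ‖z‖ * (‖z‖ ^ q - s ^ q * ‖z‖ ^ q) = s * (‖z‖ * ‖z‖ ^ q * (1 - s ^ q)) := by ring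
      _ ≤ 1 * (‖z‖ * ‖z‖ ^ q * (1 - s ^ q)) := by gcongr
      _ ≤ 1 * (‖z‖ * ‖z‖ ^ q * (max 1 q * (1 - s))) := by gcongr
      _ = _ := by ring
  have h3 : (‖z‖ ^ q : ℝ) • starRingEnd ℂ z - (‖w‖ ^ q : ℝ) • starRingEnd ℂ w
      = (‖z‖ ^ q : ℝ) • starRingEnd ℂ (z - w) + (‖z‖ ^ q - ‖w‖ ^ q : ℝ) • starRingEnd ℂ w := by
    rw [map_sub, smul_sub, sub_smul]; ring
  have h4 : 0 ≤ ‖z‖ ^ q - ‖w‖ ^ q :=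
    sub_nonneg.2 (Real.rpow_le_rpow (norm_nonneg _) h hq.le)
  have h5 : ‖z‖ - ‖w‖ ≤ ‖z - w‖ := norm_sub_norm_le z w
  have h6 : (0 : ℝ) ≤ max 1 q := le_max_of_le_left zero_le_one
  rw [h3]
  refine (norm_add_le _ _).trans ?_
  rw [norm_smul, norm_smul, RCLike.norm_conj, RCLike.norm_conj, Real.norm_of_nonneg (by positivity),
    Real.norm_of_nonneg h4]
  have h7 : max 1 q * ‖z‖ ^ q * (‖z‖ - ‖w‖) ≤ max 1 q * ‖z‖ ^ q * ‖z - w‖ := by gcongr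
  have h8 : 0 ≤ (1 + max 1 q) * ‖w‖ ^ q * ‖z - w‖ := by positivity
  nlinarith

/-- A weighted Young inequality with two small coefficients. -/
theorem exists_young {w₁ w₂ w₃ : ℝ} (h₁ : 0 ≤ w₁) (h₂ : 0 ≤ w₂) (h₃ : 0 < w₃)
    (hw : w₁ + w₂ + w₃ = 1) {η σ : ℝ} (hη : 0 < η) (hσ : 0 < σ) :
    ∃ K : ℝ, 0 ≤ K ∧ ∀ X Y Z : ℝ, 0 ≤ X → 0 ≤ Y → 0 ≤ Z →
      X ^ w₁ * Y ^ w₂ * Z ^ w₃ ≤ η * X + σ * Y + K * Z := by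
  have hP : 0 < η ^ w₁ * σ ^ w₂ := by positivity
  refine ⟨(η ^ w₁ * σ ^ w₂) ^ (-(1 / w₃)), by positivity, fun X Y Z hX hY hZ => ?_⟩
  set K := (η ^ w₁ * σ ^ w₂) ^ (-(1 / w₃)) with hK
  have hK0 : 0 < K := by positivity
  have hKw : K ^ w₃ = (η ^ w₁ * σ ^ w₂)⁻¹ := by
    rw [hK, ← Real.rpow_mul hP.le, neg_mul, one_div_mul_cancel h₃.ne', Real.rpow_neg_one]
  have h := Real.geom_mean_le_arith_mean3_weighted h₁ h₂ h₃.le (by positivity : 0 ≤ η * X)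
    (by positivity : 0 ≤ σ * Y) (by positivity : 0 ≤ K * Z) hw
  rw [Real.mul_rpow hη.le hX, Real.mul_rpow hσ.le hY, Real.mul_rpow hK0.le hZ, hKw] at h
  have h4 : η ^ w₁ * X ^ w₁ * (σ ^ w₂ * Y ^ w₂) * ((η ^ w₁ * σ ^ w₂)⁻¹ * Z ^ w₃)
      = X ^ w₁ * Y ^ w₂ * Z ^ w₃ := by
    field_simp
  rw [h4] at h
  exact h.trans (add_le_add (add_le_add
    (mul_le_of_le_one_left (by positivity) (by linarith))
    (mul_le_of_le_one_left (by positivity) (by linarith)))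
    (mul_le_of_le_one_left (by positivity) (by linarith)))

/-- Summation by parts for finite differences, in the form used to control `∫ |δφ|^{q+2}`. -/
theorem integral_fd_rpow_le {D : ℝ → ℂ} (hD : BddL2 D) (h : ℝ) {q : ℝ} (hq : 0 < q) :
    ∫ x, ‖fd h D x‖ ^ (q + 2) ≤ ∫ x, (1 + max 1 q) * (‖D (x + h)‖ *
      (‖fd h D (x + h)‖ ^ q + ‖fd h D x‖ ^ q) * ‖fd h (fd h D) x‖) := by
  set e := fd h D with he
  have hE : BddL2 e := hD.fd h
  obtain ⟨B, hB⟩ := hE.bdd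
  -- `|e|^(q+2) = e G`, and the difference in `e` is moved from `D` to `G`
  let G : ℝ → ℂ := fun x => (‖e x‖ ^ q : ℝ) • starRingEnd ℂ (e x)
  have hGc : Continuous G := by
    have h1 : Continuous fun x => ‖e x‖ ^ q := hE.cont.norm.rpow_const fun _ => Or.inr hq.le
    exact h1.smul hE.star.cont
  have hG : MemLp G 2 volume := by
    refine (hE.memLp.const_mul ((B ^ q : ℝ) : ℂ)).mono hGc.aestronglyMeasurable
      (Eventually.of_forall fun x => ?_)
    have hB0 : 0 ≤ B := (norm_nonneg _).trans (hB x)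
    rw [norm_smul, RCLike.norm_conj, norm_mul, Complex.norm_real,
      Real.norm_of_nonneg (by positivity), Real.norm_of_nonneg (by positivity)]
    gcongr
    exact hB x
  have hG' : MemLp (fun x => G (x + h)) 2 volume :=
    hG.comp_measurePreserving (measurePreserving_add_right volume h)
  have hD' := (hD.translate h).memLp
  have i1 : Integrable fun x => D (x + h) * G x := hD'.integrable_mul hG
  have i2 : Integrable fun x => D x * G x := hD.memLp.integrable_mul hG
  have i3 : Integrable fun x => D (x + h) * G (x + h) := hD'.integrable_mul hG'
  have h1 : ∫ x, D x * G x = ∫ x, D (x + h) * G (x + h) :=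
    (integral_add_right_eq_self (fun x => D x * G x) h).symm
  have h2 : ((∫ x, ‖e x‖ ^ (q + 2) : ℝ) : ℂ) = ∫ x, D (x + h) * (G x - G (x + h)) := by
    simp only [mul_sub]
    rw [integral_sub i1 i3, ← h1, ← integral_sub i1 i2, ← integral_complex_ofReal]
    congr 1
    ext x
    rw [← sub_mul, show D (x + h) - D x = e x from rfl]
    simp only [G]
    rw [Complex.real_smul, mul_left_comm, Complex.mul_conj, Complex.normSq_eq_norm_sq,
      ← Complex.ofReal_mul]
    congr 1
    rw [Real.rpow_add_of_nonneg (norm_nonneg _) hq.le (by norm_num)]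
    norm_num
  have h3 : ∫ x, ‖e x‖ ^ (q + 2) ≤ ∫ x, ‖D (x + h) * (G x - G (x + h))‖ := by
    calc ∫ x, ‖e x‖ ^ (q + 2) ≤ ‖((∫ x, ‖e x‖ ^ (q + 2) : ℝ) : ℂ)‖ := by
          rw [Complex.norm_real]; exact le_abs_self _
      _ ≤ _ := by rw [h2]; exact norm_integral_le_integral_norm _
  refine h3.trans (integral_mono ((i1.sub i3).congr
    (Eventually.of_forall fun x => (mul_sub _ _ _).symm)).norm ?_ fun x => ?_)
  · have hE' := hE.translate h
    have hEE := hE.fd h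
    obtain ⟨K, hK⟩ := (hD.translate h).bdd
    have j1 : Integrable fun x => ‖D (x + h)‖ * ‖fd h e x‖ :=
      hD'.norm.integrable_mul hEE.memLp.norm
    have j2 : Integrable fun x => (‖e (x + h)‖ ^ q + ‖e x‖ ^ q) * (‖D (x + h)‖ * ‖fd h e x‖) := by
      refine j1.bdd_mul (c := B ^ q + B ^ q) ?_ (Eventually.of_forall fun x => ?_)
      · refine Continuous.aestronglyMeasurable (Continuous.add ?_ ?_)
        · exact hE'.cont.norm.rpow_const fun _ => Or.inr hq.le
        · exact hE.cont.norm.rpow_const fun _ => Or.inr hq.le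
      · rw [Real.norm_of_nonneg (by positivity)]
        gcongr
        · exact hB _
        · exact hB _
    refine (j2.const_mul (1 + max 1 q)).congr (Eventually.of_forall fun x => ?_)
    simp only
    ring
  · simp only
    rw [norm_mul]
    have := norm_rpow_smul_conj_sub_le hq (e x) (e (x + h))
    rw [norm_sub_rev (e x)] at this
    calc _ ≤ ‖D (x + h)‖ * ((1 + max 1 q) * (‖e x‖ ^ q + ‖e (x + h)‖ ^ q) * ‖e (x + h) - e x‖) := by
          gcongr
      _ = _ := by rw [show fd h e x = e (x + h) - e x from rfl]; ring

/-- The Gagliardo–Nirenberg quantity `∫ |δʲφ|^{2k/j}`. -/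
def gnInt (k j : ℕ) (h : ℝ) (φ : ℝ → ℂ) : ℝ := ∫ x, ‖(fd h)^[j] φ x‖ ^ (2 * k / j : ℝ)

theorem gnInt_nonneg (k j : ℕ) (h : ℝ) (φ : ℝ → ℂ) : 0 ≤ gnInt k j h φ :=
  integral_nonneg fun _ => by positivity

theorem two_le_gnExponent {k j : ℕ} (hj : 0 < j) (hjk : j ≤ k) : (2 : ℝ) ≤ 2 * k / j := by
  have h1 : (0 : ℝ) < j := by exact_mod_cast hj
  have h2 : (j : ℝ) ≤ k := by exact_mod_cast hjk
  rw [le_div_iff₀ h1]; linarith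

theorem BddL2.integrable_gn {φ : ℝ → ℂ} (hφ : BddL2 φ) {k j : ℕ} (hj : 0 < j) (hjk : j ≤ k)
    (h : ℝ) : Integrable fun x => ‖(CoupledNLS.fd h)^[j] φ x‖ ^ (2 * k / j : ℝ) :=
  (hφ.iterate_fd h j).integrable_rpow (two_le_gnExponent hj hjk)

/-- Pointwise Young inequality, with the exponents of the Gagliardo–Nirenberg quantities.  For
`j = 1` the first factor is bounded by one and its contribution is absent. -/
theorem exists_young_gn {k j : ℕ} (hj : 0 < j) (hjk : j < k) {η σ : ℝ} (hη : 0 < η) (hσ : 0 < σ) :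
    ∃ K : ℝ, 0 ≤ K ∧ ∀ x b c : ℝ, 0 ≤ x → 0 ≤ b → 0 ≤ c → (j = 1 → x ≤ 1) →
      x * b ^ (2 * k / j - 2 : ℝ) * c ≤
        (if j = 1 then 0 else η * x ^ (2 * k / (j - 1 : ℕ) : ℝ)) + σ * b ^ (2 * k / j : ℝ)
          + K * c ^ (2 * k / (j + 1 : ℕ) : ℝ) := by
  have h1 : (0 : ℝ) < j := by exact_mod_cast hj
  have h2 : (j : ℝ) < k := by exact_mod_cast hjk
  have h0 : (0 : ℝ) < k := h1.trans h2
  have h3 : (1 : ℝ) ≤ j := by exact_mod_cast hj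
  obtain ⟨K, hK, hy⟩ := exists_young (w₁ := (j - 1) / (2 * k)) (w₂ := 1 - j / k)
    (w₃ := (j + 1) / (2 * k)) (div_nonneg (by linarith) (by linarith))
    (sub_nonneg.2 ((div_le_one h0).2 h2.le)) (by positivity) (by field_simp; ring) hη hσ
  refine ⟨K, hK, fun x b c hx hb hc hx1 => ?_⟩
  have eb : (b ^ (2 * k / j : ℝ)) ^ (1 - j / k : ℝ) = b ^ (2 * k / j - 2 : ℝ) := by
    rw [← Real.rpow_mul hb]; congr 1; field_simp
  have ec : (c ^ (2 * k / (j + 1 : ℕ) : ℝ)) ^ ((j + 1) / (2 * k) : ℝ) = c := by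
    rw [← Real.rpow_mul hc]
    push_cast
    rw [div_mul_div_cancel₀ (by positivity), div_self (by positivity), Real.rpow_one]
  split_ifs with hj1
  · have := hy 0 (b ^ (2 * k / j : ℝ)) (c ^ (2 * k / (j + 1 : ℕ) : ℝ)) le_rfl (by positivity)
      (by positivity)
    rw [eb, ec, hj1] at this
    simp only [Nat.cast_one, sub_self, zero_div, Real.rpow_zero, one_mul, mul_zero] at this
    subst hj1
    simp only [Nat.cast_one]
    refine le_trans ?_ this
    have : x * b ^ (2 * k / 1 - 2 : ℝ) * c ≤ 1 * b ^ (2 * k / 1 - 2 : ℝ) * c := by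
      gcongr; exact hx1 rfl
    simpa using this
  · have hj2 : (0 : ℝ) < (j - 1 : ℕ) := by
      have : 0 < j - 1 := by omega
      exact_mod_cast this
    have hj3 : ((j - 1 : ℕ) : ℝ) = j - 1 := by rw [Nat.cast_sub hj]; simp
    have := hy (x ^ (2 * k / (j - 1 : ℕ) : ℝ)) (b ^ (2 * k / j : ℝ))
      (c ^ (2 * k / (j + 1 : ℕ) : ℝ)) (by positivity) (by positivity) (by positivity)
    have ex : (x ^ (2 * k / (j - 1 : ℕ) : ℝ)) ^ ((j - 1) / (2 * k) : ℝ) = x := by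
      rw [← Real.rpow_mul hx, ← hj3]
      rw [div_mul_div_cancel₀ hj2.ne', div_self (by positivity), Real.rpow_one]
    rwa [eb, ec, ex] at this

theorem integral_combination_three {F G H : ℝ → ℝ} (hF : Integrable F) (hG : Integrable G)
    (hH : Integrable H) (M a b c : ℝ) : ∫ x, M * (a * F x + b * G x + c * H x)
      = M * (a * (∫ x, F x) + b * (∫ x, G x) + c * ∫ x, H x) := by
  have h1 : Integrable fun x => a * F x + b * G x := (hF.const_mul a).add (hG.const_mul b)
  rw [integral_const_mul, integral_add h1 (hH.const_mul c),
    integral_add (hF.const_mul a) (hG.const_mul b), integral_const_mul, integral_const_mul,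
    integral_const_mul]

theorem integral_combination_four {F G H J : ℝ → ℝ} (hF : Integrable F) (hG : Integrable G)
    (hH : Integrable H) (hJ : Integrable J) (M a b c d : ℝ) :
    ∫ x, M * (a * F x + b * G x + c * H x + d * J x)
      = M * (a * (∫ x, F x) + b * (∫ x, G x) + c * (∫ x, H x) + d * ∫ x, J x) := by
  have h1 : Integrable fun x => a * F x + b * G x := (hF.const_mul a).add (hG.const_mul b)
  have h2 : Integrable fun x => a * F x + b * G x + c * H x := h1.add (hH.const_mul c)
  rw [integral_const_mul, integral_add h2 (hJ.const_mul d), integral_add h1 (hH.const_mul c),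
    integral_add (hF.const_mul a) (hG.const_mul b), integral_const_mul, integral_const_mul,
    integral_const_mul, integral_const_mul]

/-- Consecutive Gagliardo–Nirenberg quantities of a function bounded by one.  The contribution
of the lower one is absorbed with the help of the preceding case. -/
theorem exists_gnInt_le_succ (k j : ℕ) (hj : 0 < j) (hjk : j < k) :
    ∃ C : ℝ, 0 ≤ C ∧ ∀ (h : ℝ) (φ : ℝ → ℂ), BddL2 φ → (∀ x, ‖φ x‖ ≤ 1) →
      gnInt k j h φ ≤ C * gnInt k (j + 1) h φ := by
  induction j, hj using Nat.le_induction with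
  | base =>
    set q : ℝ := 2 * k / (1 : ℕ) - 2 with hq
    have hk : (1 : ℝ) < k := by exact_mod_cast hjk
    have hq0 : 0 < q := by rw [hq]; simp; linarith
    set M : ℝ := 1 + max 1 q with hM
    have hM0 : 0 < M := by
      have : (1 : ℝ) ≤ max 1 q := le_max_left _ _
      rw [hM]; linarith
    obtain ⟨K, hK, hy⟩ := exists_young_gn (k := k) (j := 1) one_pos hjk one_pos
      (by positivity : 0 < 1 / (4 * M))
    refine ⟨4 * M * K, by positivity, fun h φ hφ hb => ?_⟩
    have i1 := hφ.integrable_gn (k := k) (j := 1) one_pos hjk.le h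
    have i2 := hφ.integrable_gn (k := k) (j := 1 + 1) (by norm_num) hjk h
    have i1' := i1.comp_add_right h
    have main := integral_fd_rpow_le hφ h hq0
    have e1 : q + 2 = 2 * k / (1 : ℕ) := by rw [hq]; ring
    rw [e1] at main
    have step : ∫ x, M * (‖φ (x + h)‖ * (‖fd h φ (x + h)‖ ^ q + ‖fd h φ x‖ ^ q)
        * ‖fd h (fd h φ) x‖) ≤ ∫ x, M * (1 / (4 * M) * ‖(fd h)^[1] φ (x + h)‖ ^ (2 * k / (1 : ℕ) : ℝ)
          + 1 / (4 * M) * ‖(fd h)^[1] φ x‖ ^ (2 * k / (1 : ℕ) : ℝ)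
          + 2 * K * ‖(fd h)^[1 + 1] φ x‖ ^ (2 * k / (1 + 1 : ℕ) : ℝ)) := by
      refine integral_mono_of_nonneg (Eventually.of_forall fun x => by positivity)
        ((((i1'.const_mul _).add (i1.const_mul _)).add (i2.const_mul _)).const_mul _)
        (Eventually.of_forall fun x => ?_)
      have y1 := hy ‖φ (x + h)‖ ‖fd h φ (x + h)‖ ‖fd h (fd h φ) x‖ (norm_nonneg _)
        (norm_nonneg _) (norm_nonneg _) fun _ => hb _
      have y2 := hy ‖φ (x + h)‖ ‖fd h φ x‖ ‖fd h (fd h φ) x‖ (norm_nonneg _)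
        (norm_nonneg _) (norm_nonneg _) fun _ => hb _
      rw [if_pos rfl] at y1 y2
      simp only [Function.iterate_succ_apply', Function.iterate_zero_apply]
      refine mul_le_mul_of_nonneg_left ?_ hM0.le
      rw [← hq] at y1 y2
      linarith
    replace step := step.trans_eq (integral_combination_three i1' i1 i2 _ _ _ _)
    rw [integral_translate (fun x => ‖(fd h)^[1] φ x‖ ^ (2 * k / (1 : ℕ) : ℝ))] at step
    have f1 := main.trans step
    change gnInt k 1 h φ ≤ M * (1 / (4 * M) * gnInt k 1 h φ + 1 / (4 * M) * gnInt k 1 h φ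
      + 2 * K * gnInt k (1 + 1) h φ) at f1
    have f2 : M * (1 / (4 * M) * gnInt k 1 h φ + 1 / (4 * M) * gnInt k 1 h φ
      + 2 * K * gnInt k (1 + 1) h φ) = gnInt k 1 h φ / 2 + 2 * M * K * gnInt k (1 + 1) h φ := by
      field_simp; ring
    rw [f2] at f1
    linarith
  | succ j hj ih =>
    obtain ⟨C, hC, hprev⟩ := ih (by omega)
    set q : ℝ := 2 * k / (j + 1 : ℕ) - 2 with hq
    have hk : ((j + 1 : ℕ) : ℝ) < k := by exact_mod_cast hjk
    have hq0 : 0 < q := by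
      rw [hq, sub_pos, lt_div_iff₀ (by positivity)]; linarith
    set M : ℝ := 1 + max 1 q with hM
    have hM0 : 0 < M := by
      have : (1 : ℝ) ≤ max 1 q := le_max_left _ _
      rw [hM]; linarith
    -- with the bound `C` for the lower quantity, this coefficient leaves at most a quarter of the
    -- quantity to be estimated
    obtain ⟨K, hK, hy⟩ := exists_young_gn (k := k) (j := j + 1) (by omega) hjk
      (by positivity : 0 < 1 / (8 * M * (C + 1))) (by positivity : 0 < 1 / (8 * M))
    refine ⟨4 * M * K, by positivity, fun h φ hφ hb => ?_⟩
    set D := (fd h)^[j] φ with hDdef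
    have hD : BddL2 D := hφ.iterate_fd h j
    have hD1 : (fd h)^[j + 1] φ = fd h D := by rw [Function.iterate_succ_apply']
    have hD2 : (fd h)^[j + 1 + 1] φ = fd h (fd h D) := by
      rw [Function.iterate_succ_apply', hD1]
    have i0 := (hφ.integrable_gn (k := k) (j := j) (by omega) (by omega) h).comp_add_right h
    have i1 := hφ.integrable_gn (k := k) (j := j + 1) (by omega) hjk.le h
    have i2 := hφ.integrable_gn (k := k) (j := j + 1 + 1) (by omega) hjk h
    have i1' := i1.comp_add_right h
    have main := integral_fd_rpow_le hD h hq0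
    have e1 : q + 2 = 2 * k / (j + 1 : ℕ) := by rw [hq]; ring
    rw [e1] at main
    have step : ∫ x, M * (‖D (x + h)‖ * (‖fd h D (x + h)‖ ^ q + ‖fd h D x‖ ^ q)
        * ‖fd h (fd h D) x‖) ≤ ∫ x, M * (2 * (1 / (8 * M * (C + 1))) *
            ‖(fd h)^[j] φ (x + h)‖ ^ (2 * k / j : ℝ)
          + 1 / (8 * M) * ‖(fd h)^[j + 1] φ (x + h)‖ ^ (2 * k / (j + 1 : ℕ) : ℝ)
          + 1 / (8 * M) * ‖(fd h)^[j + 1] φ x‖ ^ (2 * k / (j + 1 : ℕ) : ℝ)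
          + 2 * K * ‖(fd h)^[j + 1 + 1] φ x‖ ^ (2 * k / (j + 1 + 1 : ℕ) : ℝ)) := by
      refine integral_mono_of_nonneg (Eventually.of_forall fun x => by positivity)
        (((((i0.const_mul _).add (i1'.const_mul _)).add (i1.const_mul _)).add
          (i2.const_mul _)).const_mul _)
        (Eventually.of_forall fun x => ?_)
      have y1 := hy ‖D (x + h)‖ ‖fd h D (x + h)‖ ‖fd h (fd h D) x‖ (norm_nonneg _)
        (norm_nonneg _) (norm_nonneg _) fun h => absurd h (by omega)
      have y2 := hy ‖D (x + h)‖ ‖fd h D x‖ ‖fd h (fd h D) x‖ (norm_nonneg _)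
        (norm_nonneg _) (norm_nonneg _) fun h => absurd h (by omega)
      rw [if_neg (by omega), Nat.add_sub_cancel] at y1 y2
      rw [hD1, hD2]
      refine mul_le_mul_of_nonneg_left ?_ hM0.le
      rw [← hq] at y1 y2
      rw [← hDdef]
      linarith
    replace step := step.trans_eq (integral_combination_four i0 i1' i1 i2 _ _ _ _ _)
    rw [integral_translate (fun x => ‖(fd h)^[j + 1] φ x‖ ^ (2 * k / (j + 1 : ℕ) : ℝ)),
      integral_translate (fun x => ‖(fd h)^[j] φ x‖ ^ (2 * k / j : ℝ))] at step
    have f1 := main.trans step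
    rw [← hD1] at f1
    change gnInt k (j + 1) h φ ≤ M * (2 * (1 / (8 * M * (C + 1))) * gnInt k j h φ
      + 1 / (8 * M) * gnInt k (j + 1) h φ + 1 / (8 * M) * gnInt k (j + 1) h φ
      + 2 * K * gnInt k (j + 1 + 1) h φ) at f1
    have f2 : M * (2 * (1 / (8 * M * (C + 1))) * gnInt k j h φ
      + 1 / (8 * M) * gnInt k (j + 1) h φ + 1 / (8 * M) * gnInt k (j + 1) h φ
      + 2 * K * gnInt k (j + 1 + 1) h φ) = (gnInt k j h φ / (C + 1)) / 4
        + gnInt k (j + 1) h φ / 4 + 2 * M * K * gnInt k (j + 1 + 1) h φ := by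
      field_simp; ring
    rw [f2] at f1
    have f3 : gnInt k j h φ / (C + 1) ≤ gnInt k (j + 1) h φ := by
      rw [div_le_iff₀ (by positivity)]
      have := hprev h φ hφ hb
      have := gnInt_nonneg k (j + 1) h φ
      nlinarith
    linarith

/-- Discrete Gagliardo–Nirenberg inequality for functions bounded by one. -/
theorem exists_gnInt_le (k j : ℕ) (hj : 0 < j) (hjk : j ≤ k) :
    ∃ C : ℝ, 0 ≤ C ∧ ∀ (h : ℝ) (φ : ℝ → ℂ), BddL2 φ → (∀ x, ‖φ x‖ ≤ 1) →
      gnInt k j h φ ≤ C * gnInt k k h φ := by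
  obtain ⟨d, hd⟩ : ∃ d, j + d = k := ⟨k - j, by omega⟩
  induction d generalizing j with
  | zero =>
    obtain rfl : j = k := by omega
    exact ⟨1, zero_le_one, fun h φ _ _ => by simp⟩
  | succ d ih =>
    obtain ⟨C, hC, h1⟩ := ih (j + 1) (by omega) (by omega) (by omega)
    obtain ⟨D, hD, h2⟩ := exists_gnInt_le_succ k j hj (by omega)
    refine ⟨D * C, by positivity, fun h φ hφ hb => (h2 h φ hφ hb).trans ?_⟩
    rw [mul_assoc]
    exact mul_le_mul_of_nonneg_left (h1 h φ hφ hb) hD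

theorem gnInt_self {k : ℕ} (hk : 0 < k) (h : ℝ) (φ : ℝ → ℂ) :
    gnInt k k h φ = (∫ x, ‖(fd h)^[k] φ x‖ ^ 2) := by
  have : (k : ℝ) ≠ 0 := by positivity
  unfold gnInt
  rw [mul_div_cancel_right₀ _ this]
  simp

theorem iterate_fd_add (h : ℝ) (m : ℕ) (φ ψ : ℝ → ℂ) :
    (fd h)^[m] (fun x => φ x + ψ x) = fun x => (fd h)^[m] φ x + (fd h)^[m] ψ x := by
  induction m with
  | zero => rfl
  | succ m ih =>
    simp only [Function.iterate_succ_apply', ih]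
    ext x; simp only [fd]; ring

theorem iterate_fd_const_mul (h : ℝ) (m : ℕ) (c : ℂ) (φ : ℝ → ℂ) :
    (fd h)^[m] (fun x => c * φ x) = fun x => c * (fd h)^[m] φ x := by
  induction m with
  | zero => rfl
  | succ m ih =>
    simp only [Function.iterate_succ_apply', ih]
    ext x; simp only [fd]; ring

theorem iterate_fd_star (h : ℝ) (m : ℕ) (φ : ℝ → ℂ) :
    (fd h)^[m] (fun x => starRingEnd ℂ (φ x)) = fun x => starRingEnd ℂ ((fd h)^[m] φ x) := by
  induction m with
  | zero => rfl
  | succ m ih =>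
    simp only [Function.iterate_succ_apply', ih]
    ext x; simp only [fd, map_sub]

/-- Leibniz-type estimate for products of functions bounded by one.  The induction distributes
the `m` remaining differences over the two factors. -/
theorem exists_fd_mul_le (k : ℕ) (hk : 0 < k) (m i j : ℕ) (hm : i + j + m = k) :
    ∃ C : ℝ, 0 ≤ C ∧ ∀ (h r : ℝ) (φ ψ : ℝ → ℂ), BddL2 φ → BddL2 ψ →
      (∀ x, ‖φ x‖ ≤ 1) → (∀ x, ‖ψ x‖ ≤ 1) →
      ∫ x, ‖(fd h)^[m] (fun x => (fd h)^[i] φ x * (fd h)^[j] ψ (x + r)) x‖ ^ 2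
        ≤ C * ((∫ x, ‖(fd h)^[k] φ x‖ ^ 2) + (∫ x, ‖(fd h)^[k] ψ x‖ ^ 2)) := by
  induction m generalizing i j with
  | zero =>
    rcases Nat.eq_zero_or_pos i with rfl | hi
    · obtain rfl : j = k := by omega
      refine ⟨1, zero_le_one, fun h r φ ψ hφ hψ h1 h2 => ?_⟩
      simp only [Function.iterate_zero_apply, norm_mul, mul_pow, one_mul]
      rw [← integral_translate (fun x => ‖(fd h)^[j] ψ x‖ ^ 2) r]
      refine le_add_of_nonneg_of_le (integral_nonneg fun _ => by positivity) ?_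
      refine integral_mono_of_nonneg (Eventually.of_forall fun x => by positivity)
        ((hψ.iterate_fd h j).translate r).integrable_sq (Eventually.of_forall fun x => ?_)
      exact mul_le_of_le_one_left (by positivity) (pow_le_one₀ (norm_nonneg _) (h1 x))
    rcases Nat.eq_zero_or_pos j with rfl | hj
    · obtain rfl : i = k := by omega
      refine ⟨1, zero_le_one, fun h r φ ψ hφ hψ h1 h2 => ?_⟩
      simp only [Function.iterate_zero_apply, norm_mul, mul_pow, one_mul]
      refine le_add_of_le_of_nonneg ?_ (integral_nonneg fun _ => by positivity)
      refine integral_mono_of_nonneg (Eventually.of_forall fun x => by positivity)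
        (hφ.iterate_fd h i).integrable_sq (Eventually.of_forall fun x => ?_)
      exact mul_le_of_le_one_right (by positivity) (pow_le_one₀ (norm_nonneg _) (h2 _))
    -- both factors carry differences: Young's inequality with the exponents `k/i` and `k/j`,
    -- conjugate because `i + j = k`
    · obtain ⟨C, hC, hc⟩ := exists_gnInt_le k i hi (by omega)
      obtain ⟨D, hD, hd⟩ := exists_gnInt_le k j hj (by omega)
      refine ⟨C + D, by positivity, fun h r φ ψ hφ hψ h1 h2 => ?_⟩
      have i1 := hφ.integrable_gn hi (by omega : i ≤ k) h
      have i2 := (hψ.integrable_gn hj (by omega : j ≤ k) h).comp_add_right r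
      have g1 := hc h φ hφ h1
      have g2 := hd h ψ hψ h2
      rw [gnInt_self hk] at g1 g2
      have hi' : (0 : ℝ) < i := by exact_mod_cast hi
      have hj' : (0 : ℝ) < j := by exact_mod_cast hj
      have hk' : (0 : ℝ) < k := by exact_mod_cast hk
      have hs : (i : ℝ) + j = k := by exact_mod_cast (by omega : i + j = k)
      have step : ∫ x, ‖(fd h)^[0] (fun x => (fd h)^[i] φ x * (fd h)^[j] ψ (x + r)) x‖ ^ 2 ≤
          ∫ x, (‖(fd h)^[i] φ x‖ ^ (2 * k / i : ℝ) + ‖(fd h)^[j] ψ (x + r)‖ ^ (2 * k / j : ℝ)) := by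
        refine integral_mono_of_nonneg (Eventually.of_forall fun x => by positivity)
          (i1.add i2) (Eventually.of_forall fun x => ?_)
        simp only [Function.iterate_zero_apply, norm_mul, mul_pow]
        set A := ‖(fd h)^[i] φ x‖
        set B := ‖(fd h)^[j] ψ (x + r)‖
        have hA : 0 ≤ A := norm_nonneg _
        have hB : 0 ≤ B := norm_nonneg _
        have := Real.geom_mean_le_arith_mean2_weighted (div_nonneg hi'.le hk'.le)
          (div_nonneg hj'.le hk'.le) (by positivity : 0 ≤ A ^ (2 * k / i : ℝ))
          (by positivity : 0 ≤ B ^ (2 * k / j : ℝ)) (by rw [← add_div, hs, div_self hk'.ne'])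
        rw [← Real.rpow_mul hA, ← Real.rpow_mul hB, div_mul_div_cancel₀ hi'.ne',
          div_mul_div_cancel₀ hj'.ne', mul_div_cancel_right₀ _ hk'.ne', Real.rpow_two,
          Real.rpow_two] at this
        refine this.trans (add_le_add ?_ ?_)
        · exact mul_le_of_le_one_left (by positivity) ((div_le_one hk').2 (by linarith))
        · exact mul_le_of_le_one_left (by positivity) ((div_le_one hk').2 (by linarith))
      rw [integral_add i1 i2,
        integral_translate (fun x => ‖(fd h)^[j] ψ x‖ ^ (2 * k / j : ℝ))] at step
      change _ ≤ gnInt k i h φ + gnInt k j h ψ at step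
      have n1 : 0 ≤ (∫ x, ‖(fd h)^[k] φ x‖ ^ 2) := integral_nonneg fun _ => by positivity
      have n2 : 0 ≤ (∫ x, ‖(fd h)^[k] ψ x‖ ^ 2) := integral_nonneg fun _ => by positivity
      nlinarith [mul_nonneg hC n2, mul_nonneg hD n1]
  | succ m ih =>
    obtain ⟨C, hC, hc⟩ := ih (i + 1) j (by omega)
    obtain ⟨D, hD, hd⟩ := ih i (j + 1) (by omega)
    refine ⟨2 * C + 2 * D, by positivity, fun h r φ ψ hφ hψ h1 h2 => ?_⟩
    have e : fd h (fun x => (fd h)^[i] φ x * (fd h)^[j] ψ (x + r)) = fun x =>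
        (fd h)^[i + 1] φ x * (fd h)^[j] ψ (x + (r + h))
          + (fd h)^[i] φ x * (fd h)^[j + 1] ψ (x + r) := by
      ext x
      simp only [Function.iterate_succ_apply', fd]
      rw [show x + h + r = x + (r + h) by ring, show x + r + h = x + (r + h) by ring]
      ring
    rw [Function.iterate_succ_apply, e, iterate_fd_add]
    have b1 : BddL2 ((fd h)^[m] fun x => (fd h)^[i + 1] φ x * (fd h)^[j] ψ (x + (r + h))) :=
      ((hφ.iterate_fd h _).mul ((hψ.iterate_fd h _).translate _)).iterate_fd h m
    have b2 : BddL2 ((fd h)^[m] fun x => (fd h)^[i] φ x * (fd h)^[j + 1] ψ (x + r)) :=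
      ((hφ.iterate_fd h _).mul ((hψ.iterate_fd h _).translate _)).iterate_fd h m
    have s1 := hc h (r + h) φ ψ hφ hψ h1 h2
    have s2 := hd h r φ ψ hφ hψ h1 h2
    have step : ∫ x, ‖(fd h)^[m] (fun x => (fd h)^[i + 1] φ x * (fd h)^[j] ψ (x + (r + h))) x
        + (fd h)^[m] (fun x => (fd h)^[i] φ x * (fd h)^[j + 1] ψ (x + r)) x‖ ^ 2 ≤
        ∫ x, (2 * ‖(fd h)^[m] (fun x => (fd h)^[i + 1] φ x * (fd h)^[j] ψ (x + (r + h))) x‖ ^ 2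
        + 2 * ‖(fd h)^[m] (fun x => (fd h)^[i] φ x * (fd h)^[j + 1] ψ (x + r)) x‖ ^ 2) := by
      refine integral_mono_of_nonneg (Eventually.of_forall fun x => by positivity)
        ((b1.integrable_sq.const_mul 2).add (b2.integrable_sq.const_mul 2))
        (Eventually.of_forall fun x => ?_)
      set a := (fd h)^[m] (fun x => (fd h)^[i + 1] φ x * (fd h)^[j] ψ (x + (r + h))) x
      set b := (fd h)^[m] (fun x => (fd h)^[i] φ x * (fd h)^[j + 1] ψ (x + r)) x
      have := norm_add_le a b
      have h3 : ‖a + b‖ ^ 2 ≤ (‖a‖ + ‖b‖) ^ 2 := by gcongr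
      simp only
      nlinarith [sq_nonneg (‖a‖ - ‖b‖)]
    rw [integral_add (b1.integrable_sq.const_mul 2) (b2.integrable_sq.const_mul 2),
      integral_const_mul, integral_const_mul] at step
    linarith

/-- Leibniz-type estimate for the product of two bounded functions. -/
theorem exists_iterate_fd_mul_le (k : ℕ) (hk : 0 < k) :
    ∃ C : ℝ, 0 ≤ C ∧ ∀ (h A B : ℝ) (φ ψ : ℝ → ℂ), BddL2 φ → BddL2 ψ →
      (∀ x, ‖φ x‖ ≤ A) → (∀ x, ‖ψ x‖ ≤ B) →
      ∫ x, ‖(fd h)^[k] (fun x => φ x * ψ x) x‖ ^ 2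
        ≤ C * (B ^ 2 * (∫ x, ‖(fd h)^[k] φ x‖ ^ 2) + A ^ 2 * (∫ x, ‖(fd h)^[k] ψ x‖ ^ 2)) := by
  obtain ⟨C, hC, hc⟩ := exists_fd_mul_le k hk k 0 0 (by omega)
  refine ⟨C, hC, fun h A B φ ψ hφ hψ hA hB => ?_⟩
  have n1 : 0 ≤ (∫ x, ‖(fd h)^[k] φ x‖ ^ 2) := integral_nonneg fun _ => by positivity
  have n2 : 0 ≤ (∫ x, ‖(fd h)^[k] ψ x‖ ^ 2) := integral_nonneg fun _ => by positivity
  have hA0 : 0 ≤ A := (norm_nonneg _).trans (hA 0)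
  have hB0 : 0 ≤ B := (norm_nonneg _).trans (hB 0)
  have hz : (∀ x, φ x * ψ x = 0) → ∫ x, ‖(fd h)^[k] (fun x => φ x * ψ x) x‖ ^ 2
        ≤ C * (B ^ 2 * (∫ x, ‖(fd h)^[k] φ x‖ ^ 2) + A ^ 2 * (∫ x, ‖(fd h)^[k] ψ x‖ ^ 2)) := by
    intro h0
    have e : (fun x => φ x * ψ x) = fun x => (0 : ℂ) * φ x := by ext x; simp [h0 x]
    rw [e, iterate_fd_const_mul]
    simp only [zero_mul, norm_zero, ne_eq, OfNat.ofNat_ne_zero, not_false_eq_true, zero_pow,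
      integral_zero]
    positivity
  rcases hA0.eq_or_lt with h0 | hA1
  · exact hz fun x => by
      have := hA x
      rw [← h0] at this
      simp [norm_le_zero_iff.1 this]
  rcases hB0.eq_or_lt with h0 | hB1
  · exact hz fun x => by
      have := hB x
      rw [← h0] at this
      simp [norm_le_zero_iff.1 this]
  have key := hc h 0 (fun x => ((A⁻¹ : ℝ) : ℂ) * φ x) (fun x => ((B⁻¹ : ℝ) : ℂ) * ψ x)
    (hφ.const_mul _) (hψ.const_mul _) (fun x => ?_) (fun x => ?_)
  · simp only [Function.iterate_zero_apply, add_zero] at key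
    have e : (fun x => ((A⁻¹ : ℝ) : ℂ) * φ x * (((B⁻¹ : ℝ) : ℂ) * ψ x)) =
        fun x => (((A * B)⁻¹ : ℝ) : ℂ) * (φ x * ψ x) := by
      ext x; push_cast; rw [mul_inv]; ring
    rw [e, iterate_fd_const_mul, iterate_fd_const_mul, iterate_fd_const_mul] at key
    simp only [norm_mul, Complex.norm_real, mul_pow, Real.norm_eq_abs, sq_abs] at key
    rw [integral_const_mul, integral_const_mul, integral_const_mul] at key
    have h2 := mul_le_mul_of_nonneg_left key (by positivity : 0 ≤ (A * B) ^ 2)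
    rw [← mul_assoc, ← mul_pow, mul_inv_cancel₀ (by positivity), one_pow, one_mul] at h2
    refine h2.trans (le_of_eq ?_)
    field_simp
  · rw [norm_mul, Complex.norm_real, norm_inv, Real.norm_of_nonneg hA0, inv_mul_le_iff₀ hA1]
    simpa using hA x
  · rw [norm_mul, Complex.norm_real, norm_inv, Real.norm_of_nonneg hB0, inv_mul_le_iff₀ hB1]
    simpa using hB x

/-- Leibniz-type estimate for the cubic nonlinearity. -/
theorem exists_iterate_fd_cubic_le (k : ℕ) (hk : 0 < k) :
    ∃ C : ℝ, 0 ≤ C ∧ ∀ (h A B D : ℝ) (φ ψ χ : ℝ → ℂ), BddL2 φ → BddL2 ψ → BddL2 χ →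
      (∀ x, ‖φ x‖ ≤ A) → (∀ x, ‖ψ x‖ ≤ B) → (∀ x, ‖χ x‖ ≤ D) →
      ∫ x, ‖(fd h)^[k] (fun x => φ x * starRingEnd ℂ (ψ x) * χ x) x‖ ^ 2
        ≤ C * ((B * D) ^ 2 * (∫ x, ‖(fd h)^[k] φ x‖ ^ 2) + (A * D) ^ 2 * (∫ x, ‖(fd h)^[k] ψ x‖ ^ 2)
          + (A * B) ^ 2 * (∫ x, ‖(fd h)^[k] χ x‖ ^ 2)) := by
  obtain ⟨C, hC, hc⟩ := exists_iterate_fd_mul_le k hk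
  refine ⟨C * (C + 1), by positivity, fun h A B D φ ψ χ hφ hψ hχ hA hB hD => ?_⟩
  have hA0 : 0 ≤ A := (norm_nonneg _).trans (hA 0)
  have h1 := hc h A B φ (fun x => starRingEnd ℂ (ψ x)) hφ hψ.star hA (by simpa using hB)
  have h2 := hc h (A * B) D (fun x => φ x * starRingEnd ℂ (ψ x)) χ (hφ.mul hψ.star) hχ
    (fun x => by
      rw [norm_mul, RCLike.norm_conj]; exact mul_le_mul (hA x) (hB x) (norm_nonneg _) hA0) hD
  simp only [iterate_fd_star, RCLike.norm_conj] at h1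
  have n3 : 0 ≤ (∫ x, ‖(fd h)^[k] χ x‖ ^ 2) := integral_nonneg fun _ => by positivity
  refine h2.trans ?_
  have h3 := mul_le_mul_of_nonneg_left h1 (by positivity : 0 ≤ D ^ 2)
  have n1 : 0 ≤ (∫ x, ‖(fd h)^[k] φ x‖ ^ 2) := integral_nonneg fun _ => by positivity
  have n2 : 0 ≤ (∫ x, ‖(fd h)^[k] ψ x‖ ^ 2) := integral_nonneg fun _ => by positivity
  rw [mul_assoc]
  refine mul_le_mul_of_nonneg_left ?_ hC
  set a := (∫ x, ‖(fd h)^[k] φ x‖ ^ 2)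
  set b := (∫ x, ‖(fd h)^[k] ψ x‖ ^ 2)
  set c := (∫ x, ‖(fd h)^[k] χ x‖ ^ 2)
  have p1 : 0 ≤ (B * D) ^ 2 * a := by positivity
  have p2 : 0 ≤ (A * D) ^ 2 * b := by positivity
  have p3 : 0 ≤ C * ((A * B) ^ 2 * c) := by positivity
  nlinarith

/-! ### Sobolev norms through finite differences -/

theorem eLpNorm_two_eq {φ : ℝ → ℂ} (hφ : MemLp φ 2 volume) :
    eLpNorm φ 2 volume = ENNReal.ofReal (Real.sqrt (∫ x, ‖φ x‖ ^ 2)) := by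
  rw [hφ.eLpNorm_eq_integral_rpow_norm (by norm_num) (by norm_num), Real.sqrt_eq_rpow]
  simp

theorem eLpNorm_two_le_iff {φ : ℝ → ℂ} (hφ : MemLp φ 2 volume) {M : ℝ} (hM : 0 ≤ M) :
    eLpNorm φ 2 volume ≤ ENNReal.ofReal M ↔ ∫ x, ‖φ x‖ ^ 2 ≤ M ^ 2 := by
  rw [eLpNorm_two_eq hφ, ENNReal.ofReal_le_ofReal_iff hM, Real.sqrt_le_left hM]

theorem integrable_iterate_fd {φ : ℝ → ℂ} (hφ : Integrable φ) (h : ℝ) (k : ℕ) :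
    Integrable ((fd h)^[k] φ) := by
  induction k with
  | zero => exact hφ
  | succ k ih =>
    rw [Function.iterate_succ_apply']
    exact (ih.comp_add_right h).sub ih

theorem hat_iterate_fd {φ : ℝ → ℂ} (hφ : Integrable φ) (h : ℝ) (k : ℕ) (ξ : ℝ) :
    hat ((fd h)^[k] φ) ξ = (Complex.exp (Complex.I * h * ξ) - 1) ^ k * hat φ ξ := by
  induction k with
  | zero => simp
  | succ k ih =>
    have hi := integrable_iterate_fd hφ h k
    rw [Function.iterate_succ_apply', pow_succ']
    unfold fd at hi ⊢
    rw [hat_sub (hi.comp_add_right h) hi, hat_comp_add]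
    change _ * hat ((fd h)^[k] φ) ξ - hat ((fd h)^[k] φ) ξ = _
    rw [ih]; ring

theorem norm_exp_I_sub_one_le (h ξ : ℝ) : ‖Complex.exp (Complex.I * h * ξ) - 1‖ ≤ |h| * |ξ| := by
  have := Real.norm_exp_I_mul_ofReal_sub_one_le (x := h * ξ)
  rw [Real.norm_eq_abs, abs_mul] at this
  simpa [mul_assoc] using this

/-- The homogeneous Sobolev norm `‖ξᵏ φ̂‖_{L²}`. -/
def semi (k : ℕ) (φ : ℝ → ℂ) : ℝ≥0∞ := eLpNorm (fun ξ : ℝ => (Complex.I * ξ) ^ k * hat φ ξ) 2 volume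

theorem eLpNorm_iterate_fd_le {φ : ℝ → ℂ} (hφ : Integrable φ) (hφ2 : BddL2 φ) (h : ℝ) (k : ℕ) :
    eLpNorm ((fd h)^[k] φ) 2 volume ≤ ENNReal.ofReal (|h| ^ k) * semi k φ := by
  rw [← eLpNorm_hat (integrable_iterate_fd hφ h k) (hφ2.iterate_fd h k).memLp]
  refine eLpNorm_le_mul_eLpNorm_of_ae_le_mul (Eventually.of_forall fun ξ => ?_) 2
  rw [hat_iterate_fd hφ, norm_I_mul_pow, norm_mul, norm_pow, ← mul_assoc, ← mul_pow]
  gcongr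
  exact norm_exp_I_sub_one_le h ξ

/-- Converse to `eLpNorm_iterate_fd_le`, by Fatou's lemma. -/
theorem semi_le_of_fd_le {φ : ℝ → ℂ} (hφ : Integrable φ) (hφ2 : BddL2 φ) (k : ℕ) {M : ℝ≥0∞}
    (hM : ∀ h : ℝ, 0 < h → h ≤ 1 →
      eLpNorm ((fd h)^[k] φ) 2 volume ≤ ENNReal.ofReal (h ^ k) * M) :
    semi k φ ≤ M := by
  have hh : ∀ n : ℕ, 0 < (1 : ℝ) / (n + 1) := fun n => by positivity
  have hlim : Tendsto (fun n : ℕ => (1 : ℝ) / (n + 1)) atTop (𝓝[≠] 0) := by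
    rw [tendsto_nhdsWithin_iff]
    exact ⟨tendsto_one_div_add_atTop_nhds_zero_nat, Eventually.of_forall fun n => (hh n).ne'⟩
  have hcont := continuous_hat hφ
  refine (Lp.eLpNorm_lim_le_liminf_eLpNorm (f := fun (n : ℕ) (ξ : ℝ) =>
    (((((1 : ℝ) / (n + 1)) : ℝ) : ℂ)⁻¹ *
      (Complex.exp (Complex.I * ((1 : ℝ) / (n + 1) : ℝ) * ξ) - 1)) ^ k * hat φ ξ)
    (fun n => ?_) _ (Eventually.of_forall fun ξ => ?_)).trans ?_
  · exact Continuous.aestronglyMeasurable (by fun_prop)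
  · refine Tendsto.mul (Tendsto.pow ?_ k) tendsto_const_nhds
    have hd : HasDerivAt (fun h : ℝ => Complex.exp (Complex.I * h * ξ)) (Complex.I * ξ) 0 := by
      have h1 : HasDerivAt (fun h : ℝ => Complex.I * h * ξ) (Complex.I * ξ) 0 := by
        simpa using (((Complex.ofRealCLM.hasDerivAt (x := (0 : ℝ))).const_mul Complex.I).mul_const
          (ξ : ℂ))
      simpa using h1.cexp
    have h2 := (hasDerivAt_iff_tendsto_slope_zero.1 hd).comp hlim
    refine h2.congr fun n => ?_
    simp
  · refine liminf_le_of_frequently_le' (Frequently.of_forall fun n => ?_)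
    set h : ℝ := 1 / (n + 1) with hdef
    have h0 : 0 < h := hh n
    have h1 : h ≤ 1 := by
      rw [hdef, div_le_one (by positivity)]; linarith [n.cast_nonneg (α := ℝ)]
    have e : (fun ξ : ℝ => (((h : ℝ) : ℂ)⁻¹ * (Complex.exp (Complex.I * h * ξ) - 1)) ^ k * hat φ ξ)
        = (((h : ℝ) : ℂ)⁻¹) ^ k • hat ((fd h)^[k] φ) := by
      ext ξ
      rw [Pi.smul_apply, hat_iterate_fd hφ, mul_pow, smul_eq_mul, mul_assoc]
    rw [e, eLpNorm_const_smul, eLpNorm_hat (integrable_iterate_fd hφ h k)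
      (hφ2.iterate_fd h k).memLp]
    have hn : ‖(((h : ℝ) : ℂ)⁻¹) ^ k‖ₑ = (ENNReal.ofReal (h ^ k))⁻¹ := by
      rw [← ofReal_norm, norm_pow, norm_inv, Complex.norm_real, Real.norm_of_nonneg h0.le, inv_pow,
        ENNReal.ofReal_inv_of_pos (by positivity)]
    rw [hn]
    refine (mul_le_mul_right (hM h h0 h1) _).trans ?_
    rw [← mul_assoc, ENNReal.inv_mul_cancel (by simpa using pow_pos h0 k) (by simp), one_mul]

/-- The cubic nonlinearity `φ ψ̄ χ`. -/
def cubic (φ ψ χ : ℝ → ℂ) (x : ℝ) : ℂ := φ x * starRingEnd ℂ (ψ x) * χ x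

theorem BddL2.cubic {φ ψ χ : ℝ → ℂ} (hφ : BddL2 φ) (hψ : BddL2 ψ) (hχ : BddL2 χ) :
    BddL2 (cubic φ ψ χ) :=
  (hφ.mul hψ.star).mul hχ

theorem norm_cubic (φ ψ χ : ℝ → ℂ) (x : ℝ) : ‖cubic φ ψ χ x‖ = ‖φ x‖ * ‖ψ x‖ * ‖χ x‖ := by
  simp [cubic]

theorem norm_cubic_le {φ ψ χ : ℝ → ℂ} {A B : ℝ} (hA : ∀ x, ‖φ x‖ ≤ A) (hB : ∀ x, ‖ψ x‖ ≤ B)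
    (x : ℝ) : ‖cubic φ ψ χ x‖ ≤ A * B * ‖χ x‖ := by
  rw [norm_cubic]
  gcongr
  · exact (norm_nonneg _).trans (hA x)
  · exact hA x
  · exact hB x

theorem integrable_cubic {φ ψ χ : ℝ → ℂ} (hφ : BddL2 φ) (hψ : BddL2 ψ) (hχ : BddL2 χ)
    (hi : Integrable χ) : Integrable (cubic φ ψ χ) := by
  obtain ⟨A, hA⟩ := hφ.bdd
  obtain ⟨B, hB⟩ := hψ.bdd
  exact (hi.norm.const_mul (A * B)).mono' (hφ.cubic hψ hχ).cont.aestronglyMeasurable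
    (Eventually.of_forall fun x => norm_cubic_le hA hB x)

/-- Tame estimate for the cubic nonlinearity in the homogeneous Sobolev norm. -/
theorem exists_semi_cubic_le (k : ℕ) (hk : 0 < k) :
    ∃ C : ℝ, 0 ≤ C ∧ ∀ (A B D a b c : ℝ) (φ ψ χ : ℝ → ℂ), BddL2 φ → BddL2 ψ → BddL2 χ →
      Integrable φ → Integrable ψ → Integrable χ →
      (∀ x, ‖φ x‖ ≤ A) → (∀ x, ‖ψ x‖ ≤ B) → (∀ x, ‖χ x‖ ≤ D) → 0 ≤ a → 0 ≤ b → 0 ≤ c →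
      semi k φ ≤ ENNReal.ofReal a → semi k ψ ≤ ENNReal.ofReal b → semi k χ ≤ ENNReal.ofReal c →
      semi k (cubic φ ψ χ) ≤ ENNReal.ofReal (C * (B * D * a + A * D * b + A * B * c)) := by
  obtain ⟨C, hC, hc⟩ := exists_iterate_fd_cubic_le k hk
  refine ⟨Real.sqrt C, by positivity, fun A B D a b c φ ψ χ hφ hψ hχ iφ iψ iχ hA hB hD ha hb hc0
    sa sb sc => ?_⟩
  have hA0 : 0 ≤ A := (norm_nonneg _).trans (hA 0)
  have hB0 : 0 ≤ B := (norm_nonneg _).trans (hB 0)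
  have hD0 : 0 ≤ D := (norm_nonneg _).trans (hD 0)
  refine semi_le_of_fd_le (integrable_cubic hφ hψ hχ iχ) (hφ.cubic hψ hχ) k fun h h0 h1 => ?_
  have key : ∀ {κ : ℝ → ℂ} {r : ℝ}, BddL2 κ → Integrable κ → 0 ≤ r →
      semi k κ ≤ ENNReal.ofReal r → ∫ x, ‖(fd h)^[k] κ x‖ ^ 2 ≤ (h ^ k * r) ^ 2 := by
    intro κ r hκ iκ hr sr
    rw [← eLpNorm_two_le_iff (hκ.iterate_fd h k).memLp (by positivity)]
    refine (eLpNorm_iterate_fd_le iκ hκ h k).trans ?_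
    rw [abs_of_pos h0, ENNReal.ofReal_mul (by positivity)]
    gcongr
  rw [← ENNReal.ofReal_mul (by positivity),
    eLpNorm_two_le_iff ((hφ.cubic hψ hχ).iterate_fd h k).memLp (by positivity)]
  refine (hc h A B D φ ψ χ hφ hψ hχ hA hB hD).trans ?_
  have e : (h ^ k * (Real.sqrt C * (B * D * a + A * D * b + A * B * c))) ^ 2 =
      C * ((h ^ k) ^ 2 * (B * D * a + A * D * b + A * B * c) ^ 2) := by
    rw [mul_pow, mul_pow, Real.sq_sqrt hC]; ring
  rw [e]
  refine mul_le_mul_of_nonneg_left ?_ hC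
  have k1 := mul_le_mul_of_nonneg_left (key hφ iφ ha sa) (by positivity : 0 ≤ (B * D) ^ 2)
  have k2 := mul_le_mul_of_nonneg_left (key hψ iψ hb sb) (by positivity : 0 ≤ (A * D) ^ 2)
  have k3 := mul_le_mul_of_nonneg_left (key hχ iχ hc0 sc) (by positivity : 0 ≤ (A * B) ^ 2)
  refine (add_le_add (add_le_add k1 k2) k3).trans ?_
  have p1 : 0 ≤ B * D * a := by positivity
  have p2 : 0 ≤ A * D * b := by positivity
  have p3 : 0 ≤ A * B * c := by positivity
  have : (B * D) ^ 2 * (h ^ k * a) ^ 2 + (A * D) ^ 2 * (h ^ k * b) ^ 2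
      + (A * B) ^ 2 * (h ^ k * c) ^ 2
      = (h ^ k) ^ 2 * ((B * D * a) ^ 2 + (A * D * b) ^ 2 + (A * B * c) ^ 2) := by ring
  rw [this]
  refine mul_le_mul_of_nonneg_left ?_ (by positivity)
  nlinarith [mul_nonneg p1 p2, mul_nonneg p1 p3, mul_nonneg p2 p3]

/-! ### Weighted `L²` spaces -/

/-- The weight `1 + |x|ᵏ`. -/
def wt (k : ℕ) (x : ℝ) : ℝ := 1 + |x| ^ k

theorem wt_pos (k : ℕ) (x : ℝ) : 0 < wt k x := by unfold wt; positivity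

theorem one_le_wt (k : ℕ) (x : ℝ) : 1 ≤ wt k x := by
  unfold wt; linarith [pow_nonneg (abs_nonneg x) k]

theorem continuous_wt (k : ℕ) : Continuous (wt k) := by unfold wt; fun_prop

theorem pow_le_wt {i k : ℕ} (hik : i ≤ k) (x : ℝ) : |x| ^ i ≤ wt k x := by
  unfold wt
  rcases le_total |x| 1 with h | h
  · have := pow_le_one₀ (n := i) (abs_nonneg x) h
    linarith [pow_nonneg (abs_nonneg x) k]
  · have := pow_le_pow_right₀ h hik
    linarith

theorem wt_le_two_mul_wt {i k : ℕ} (hik : i ≤ k) (x : ℝ) : wt i x ≤ 2 * wt k x := by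
  have h1 := pow_le_wt hik x
  have h2 := one_le_wt k x
  have : wt i x = 1 + |x| ^ i := rfl
  linarith

/-- Square integrability against the weight `1 + |x|ᵏ`. -/
def MemWt (k : ℕ) (φ : ℝ → ℂ) : Prop := MemLp (fun x => (wt k x : ℂ) * φ x) 2 volume

/-- The weighted norm `‖(1 + |x|ᵏ)φ‖_{L²}`. -/
def wtNorm (k : ℕ) (φ : ℝ → ℂ) : ℝ := (eLpNorm (fun x => (wt k x : ℂ) * φ x) 2 volume).toReal

theorem wtNorm_nonneg (k : ℕ) (φ : ℝ → ℂ) : 0 ≤ wtNorm k φ := ENNReal.toReal_nonneg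

theorem MemWt.eLpNorm_eq {k : ℕ} {φ : ℝ → ℂ} (h : MemWt k φ) :
    eLpNorm (fun x => (wt k x : ℂ) * φ x) 2 volume = ENNReal.ofReal (wtNorm k φ) :=
  (ENNReal.ofReal_toReal h.2.ne).symm

theorem norm_wt_mul (k : ℕ) (x : ℝ) (z : ℂ) : ‖(wt k x : ℂ) * z‖ = wt k x * ‖z‖ := by
  rw [norm_mul, Complex.norm_real, Real.norm_of_nonneg (wt_pos k x).le]

theorem MemWt.aesm {k : ℕ} {φ : ℝ → ℂ} (h : MemWt k φ) : AEStronglyMeasurable φ volume := by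
  have h1 : AEStronglyMeasurable (fun x => ((wt k x : ℂ))⁻¹ * ((wt k x : ℂ) * φ x)) volume := by
    refine AEStronglyMeasurable.mul (Continuous.aestronglyMeasurable ?_) h.1
    exact (Complex.continuous_ofReal.comp (continuous_wt k)).inv₀ fun x =>
      Complex.ofReal_ne_zero.2 (wt_pos k x).ne'
  refine h1.congr (Eventually.of_forall fun x => ?_)
  simp only
  rw [inv_mul_cancel_left₀]
  exact_mod_cast (wt_pos k x).ne'

/-- Functions dominated by the weight times `φ` are square integrable. -/
theorem MemWt.bound {k : ℕ} {φ : ℝ → ℂ} (h : MemWt k φ) {ψ : ℝ → ℂ}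
    (hψ : AEStronglyMeasurable ψ volume) {C : ℝ} (hC : ∀ x, ‖ψ x‖ ≤ C * (wt k x * ‖φ x‖)) :
    MemLp ψ 2 volume ∧ eLpNorm ψ 2 volume ≤ ENNReal.ofReal (C * wtNorm k φ) := by
  have h1 : ∀ᵐ x ∂(volume : Measure ℝ), ‖ψ x‖ ≤ C * ‖(wt k x : ℂ) * φ x‖ :=
    Eventually.of_forall fun x => by rw [norm_wt_mul]; exact hC x
  refine ⟨h.of_le_mul hψ h1, ?_⟩
  rw [mul_comm, ENNReal.ofReal_mul (wtNorm_nonneg k φ), mul_comm, ← h.eLpNorm_eq]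
  exact eLpNorm_le_mul_eLpNorm_of_ae_le_mul h1 2

theorem MemWt.memLp {k : ℕ} {φ : ℝ → ℂ} (h : MemWt k φ) : MemLp φ 2 volume :=
  (h.bound h.aesm (C := 1) fun x => by
    rw [one_mul]; exact le_mul_of_one_le_left (norm_nonneg _) (one_le_wt k x)).1

theorem MemWt.of_le {i k : ℕ} (hik : i ≤ k) {φ : ℝ → ℂ} (h : MemWt k φ) :
    MemWt i φ ∧ wtNorm i φ ≤ 2 * wtNorm k φ := by
  have h1 := h.bound (ψ := fun x => (wt i x : ℂ) * φ x) (C := 2)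
    ((Complex.continuous_ofReal.comp (continuous_wt i)).aestronglyMeasurable.mul h.aesm) fun x => by
      rw [norm_wt_mul, ← mul_assoc]
      exact mul_le_mul_of_nonneg_right (wt_le_two_mul_wt hik x) (norm_nonneg _)
  exact ⟨h1.1, ENNReal.toReal_le_of_le_ofReal
    (mul_nonneg zero_le_two (wtNorm_nonneg k φ)) h1.2⟩

theorem memLp_inv_wt : MemLp (fun x => ((wt 1 x)⁻¹ : ℝ)) 2 (volume : Measure ℝ) := by
  have hc : Continuous fun x => (wt 1 x)⁻¹ := (continuous_wt 1).inv₀ fun x => (wt_pos 1 x).ne'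
  rw [memLp_two_iff_integrable_sq hc.aestronglyMeasurable]
  have := integrable_one_add_norm (E := ℝ) (μ := volume) (r := 2) (by simp)
  refine this.congr (Eventually.of_forall fun x => ?_)
  simp only [wt, pow_one, Real.norm_eq_abs]
  rw [Real.rpow_neg (by positivity), Real.rpow_two, inv_pow]

/-- The constant in the embedding of the weighted `L²` space into `L¹`. -/
def embConst : ℝ := (eLpNorm (fun x => ((wt 1 x)⁻¹ : ℝ)) 2 (volume : Measure ℝ)).toReal

theorem embConst_nonneg : 0 ≤ embConst := ENNReal.toReal_nonneg

/-- The weighted `L²` space embeds into `L¹`. -/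
theorem MemWt.integrable {φ : ℝ → ℂ} (h : MemWt 1 φ) :
    Integrable φ ∧ ∫ x, ‖φ x‖ ≤ embConst * wtNorm 1 φ := by
  have e : (fun x => ((wt 1 x)⁻¹ : ℝ) • ((wt 1 x : ℂ) * φ x)) = φ := by
    ext x
    rw [Complex.real_smul, Complex.ofReal_inv, inv_mul_cancel_left₀]
    exact_mod_cast (wt_pos 1 x).ne'
  have hm : MemLp φ 1 volume := by
    have := MemLp.smul (p := 2) (q := 2) (r := 1) h memLp_inv_wt
    change MemLp (fun x => ((wt 1 x)⁻¹ : ℝ) • ((wt 1 x : ℂ) * φ x)) 1 volume at this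
    rwa [e] at this
  have hi := memLp_one_iff_integrable.1 hm
  refine ⟨hi, ?_⟩
  have h2 := eLpNorm_smul_le_mul_eLpNorm (p := 2) (q := 2) (r := 1) (μ := (volume : Measure ℝ))
    (f := fun x => (wt 1 x : ℂ) * φ x) h.1 (φ := fun x => ((wt 1 x)⁻¹ : ℝ)) memLp_inv_wt.1
  change eLpNorm (fun x => ((wt 1 x)⁻¹ : ℝ) • ((wt 1 x : ℂ) * φ x)) 1 volume ≤ _ at h2
  rw [e, eLpNorm_one_eq_lintegral_enorm] at h2
  rw [integral_norm_eq_lintegral_enorm hi.1]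
  refine (ENNReal.toReal_mono ?_ h2).trans (by rw [ENNReal.toReal_mul]; rfl)
  exact (ENNReal.mul_lt_top memLp_inv_wt.2 h.2).ne

theorem semi_le_wtNorm {i k : ℕ} (hik : i ≤ k) {φ : ℝ → ℂ} (hφ : Integrable φ)
    (h : MemWt k (hat φ)) : semi i φ ≤ ENNReal.ofReal (wtNorm k (hat φ)) := by
  have hc := continuous_hat hφ
  have := (h.bound (ψ := fun ξ : ℝ => (Complex.I * ξ) ^ i * hat φ ξ) (C := 1)
    (Continuous.aestronglyMeasurable (by fun_prop)) fun ξ => by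
      rw [norm_I_mul_pow, one_mul]
      exact mul_le_mul_of_nonneg_right (pow_le_wt hik ξ) (norm_nonneg _)).2
  rwa [one_mul] at this

/-- The weighted norm is controlled by its unweighted and homogeneous parts. -/
theorem memWt_of_bounds {k : ℕ} {φ : ℝ → ℂ} (hφ : AEStronglyMeasurable φ volume) {a b : ℝ}
    (ha0 : 0 ≤ a) (hb0 : 0 ≤ b)
    (ha : eLpNorm φ 2 volume ≤ ENNReal.ofReal a)
    (hb : eLpNorm (fun x : ℝ => (Complex.I * x) ^ k * φ x) 2 volume ≤ ENNReal.ofReal b) :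
    MemWt k φ ∧ wtNorm k φ ≤ a + b := by
  have hm : AEStronglyMeasurable (fun x => (wt k x : ℂ) * φ x) volume :=
    (Complex.continuous_ofReal.comp (continuous_wt k)).aestronglyMeasurable.mul hφ
  have hm' : AEStronglyMeasurable (fun x : ℝ => (Complex.I * x) ^ k * φ x) volume :=
    (Continuous.aestronglyMeasurable (by fun_prop)).mul hφ
  have h1 : eLpNorm (fun x => (wt k x : ℂ) * φ x) 2 volume ≤ ENNReal.ofReal (a + b) := by
    calc eLpNorm (fun x => (wt k x : ℂ) * φ x) 2 volume
        ≤ eLpNorm (fun x => ‖φ x‖ + ‖(Complex.I * x) ^ k * φ x‖) 2 volume := by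
          refine eLpNorm_mono_real fun x => ?_
          rw [norm_wt_mul, norm_I_mul_pow, wt]
          exact le_of_eq (by ring)
      _ ≤ eLpNorm (fun x => ‖φ x‖) 2 volume
            + eLpNorm (fun x : ℝ => ‖(Complex.I * x) ^ k * φ x‖) 2 volume :=
          eLpNorm_add_le hφ.norm hm'.norm (by norm_num)
      _ ≤ _ := by
          rw [eLpNorm_norm, eLpNorm_norm, ENNReal.ofReal_add ha0 hb0]
          exact add_le_add ha hb
  exact ⟨⟨hm, h1.trans_lt ENNReal.ofReal_lt_top⟩, ENNReal.toReal_le_of_le_ofReal (by positivity) h1⟩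

/-! ### The basic class of functions and the free group -/

/-- Continuous representatives of functions in `H^{1,0} ∩ H^{0,1}`. -/
structure Nice (φ : ℝ → ℂ) : Prop where
  cont : Continuous φ
  wx : MemWt 1 φ
  wxi : MemWt 1 (hat φ)

theorem Nice.integrable {φ : ℝ → ℂ} (h : Nice φ) : Integrable φ := h.wx.integrable.1

theorem Nice.integrable_hat {φ : ℝ → ℂ} (h : Nice φ) : Integrable (hat φ) := h.wxi.integrable.1

theorem Nice.hat_hat {φ : ℝ → ℂ} (h : Nice φ) (x : ℝ) : hat (hat φ) x = φ (-x) :=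
  CoupledNLS.hat_hat h.cont h.integrable h.integrable_hat x

theorem Nice.eq_hat {φ : ℝ → ℂ} (h : Nice φ) (x : ℝ) : φ x = hat (CoupledNLS.hat φ) (-x) := by
  rw [h.hat_hat, neg_neg]

/-- The constant in the embedding into bounded functions. -/
def supConst : ℝ := hatConst * embConst

theorem supConst_nonneg : 0 ≤ supConst := mul_nonneg hatConst_pos.le embConst_nonneg

theorem norm_hat_le_wtNorm {φ : ℝ → ℂ} (h : MemWt 1 φ) (ξ : ℝ) :
    ‖hat φ ξ‖ ≤ supConst * wtNorm 1 φ := by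
  refine (norm_hat_le φ ξ).trans ?_
  rw [supConst, mul_assoc]
  exact mul_le_mul_of_nonneg_left h.integrable.2 hatConst_pos.le

theorem Nice.norm_le {φ : ℝ → ℂ} (h : Nice φ) (x : ℝ) :
    ‖φ x‖ ≤ supConst * wtNorm 1 (CoupledNLS.hat φ) := by
  rw [h.eq_hat]
  exact norm_hat_le_wtNorm h.wxi _

theorem Nice.bddL2 {φ : ℝ → ℂ} (h : Nice φ) : BddL2 φ where
  cont := h.cont
  memLp := h.wx.memLp
  bdd := ⟨_, h.norm_le⟩

theorem MemWt.comp_neg {k : ℕ} {φ : ℝ → ℂ} (h : MemWt k φ) :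
    MemWt k (fun x => φ (-x)) ∧ wtNorm k (fun x => φ (-x)) = wtNorm k φ := by
  have hneg : MeasurePreserving (fun x : ℝ => -x) volume volume := Measure.measurePreserving_neg _
  have e : (fun x => (wt k x : ℂ) * φ (-x)) = (fun x => (wt k x : ℂ) * φ x) ∘ fun x => -x := by
    ext x; simp [wt]
  constructor
  · unfold MemWt; rw [e]; exact h.comp_measurePreserving hneg
  · unfold wtNorm; rw [e, eLpNorm_comp_measurePreserving h.1 hneg]

theorem Nice.hat {φ : ℝ → ℂ} (h : Nice φ) : Nice (hat φ) where
  cont := continuous_hat h.integrable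
  wx := h.wxi
  wxi := by
    rw [show CoupledNLS.hat (CoupledNLS.hat φ) = fun x => φ (-x) from funext h.hat_hat]
    exact h.wx.comp_neg.1

theorem Nice.wtNorm_hat_hat {φ : ℝ → ℂ} (h : Nice φ) (k : ℕ) (hk : MemWt k φ) :
    wtNorm k (CoupledNLS.hat (CoupledNLS.hat φ)) = wtNorm k φ := by
  rw [show CoupledNLS.hat (CoupledNLS.hat φ) = fun x => φ (-x) from funext h.hat_hat]
  exact hk.comp_neg.2

theorem Nice.ext_hat {φ ψ : ℝ → ℂ} (hφ : Nice φ) (hψ : Nice ψ)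
    (h : ∀ ξ, CoupledNLS.hat φ ξ = CoupledNLS.hat ψ ξ) : φ = ψ := by
  ext x
  rw [hφ.eq_hat, hψ.eq_hat, show CoupledNLS.hat φ = CoupledNLS.hat ψ from funext h]

theorem MemWt.add {k : ℕ} {φ ψ : ℝ → ℂ} (hφ : MemWt k φ) (hψ : MemWt k ψ) :
    MemWt k fun x => φ x + ψ x := by
  have := MemLp.add hφ hψ
  unfold MemWt
  simp only [mul_add]
  exact this

theorem MemWt.sub {k : ℕ} {φ ψ : ℝ → ℂ} (hφ : MemWt k φ) (hψ : MemWt k ψ) :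
    MemWt k fun x => φ x - ψ x := by
  have := MemLp.sub hφ hψ
  unfold MemWt
  simp only [mul_sub]
  exact this

theorem MemWt.const_mul {k : ℕ} {φ : ℝ → ℂ} (hφ : MemWt k φ) (c : ℂ) :
    MemWt k fun x => c * φ x := by
  have := MemLp.const_mul hφ c
  unfold MemWt
  simp only [mul_left_comm _ c]
  exact this

theorem Nice.add {φ ψ : ℝ → ℂ} (hφ : Nice φ) (hψ : Nice ψ) : Nice fun x => φ x + ψ x where
  cont := hφ.cont.add hψ.cont
  wx := hφ.wx.add hψ.wx
  wxi := by
    rw [show CoupledNLS.hat (fun x => φ x + ψ x) = fun ξ => CoupledNLS.hat φ ξ + CoupledNLS.hat ψ ξ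
      from funext (hat_add hφ.integrable hψ.integrable)]
    exact hφ.wxi.add hψ.wxi

theorem Nice.sub {φ ψ : ℝ → ℂ} (hφ : Nice φ) (hψ : Nice ψ) : Nice fun x => φ x - ψ x where
  cont := hφ.cont.sub hψ.cont
  wx := hφ.wx.sub hψ.wx
  wxi := by
    rw [show CoupledNLS.hat (fun x => φ x - ψ x) = fun ξ => CoupledNLS.hat φ ξ - CoupledNLS.hat ψ ξ
      from funext (hat_sub hφ.integrable hψ.integrable)]
    exact hφ.wxi.sub hψ.wxi

theorem Nice.const_mul {φ : ℝ → ℂ} (hφ : Nice φ) (c : ℂ) : Nice fun x => c * φ x where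
  cont := continuous_const.mul hφ.cont
  wx := hφ.wx.const_mul c
  wxi := by
    rw [show CoupledNLS.hat (fun x => c * φ x) = fun ξ => c * CoupledNLS.hat φ ξ
      from funext (hat_const_mul c φ)]
    exact hφ.wxi.const_mul c

/-- The class is stable under the cubic nonlinearity. -/
theorem Nice.cubic {φ ψ χ : ℝ → ℂ} (hφ : Nice φ) (hψ : Nice ψ) (hχ : Nice χ) :
    Nice (cubic φ ψ χ) := by
  have hb := hφ.bddL2.cubic hψ.bddL2 hχ.bddL2
  have hi := integrable_cubic hφ.bddL2 hψ.bddL2 hχ.bddL2 hχ.integrable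
  refine ⟨hb.cont, ?_, ?_⟩
  · obtain ⟨A, hA⟩ := hφ.bddL2.bdd
    obtain ⟨B, hB⟩ := hψ.bddL2.bdd
    refine (hχ.wx.bound (C := A * B) ((Complex.continuous_ofReal.comp
      (continuous_wt 1)).mul hb.cont).aestronglyMeasurable fun x => ?_).1
    change ‖(wt 1 x : ℂ) * _‖ ≤ _
    rw [norm_wt_mul, mul_left_comm]
    exact mul_le_mul_of_nonneg_left (norm_cubic_le hA hB x) (wt_pos 1 x).le
  · obtain ⟨C, hC, hc⟩ := exists_semi_cubic_le 1 one_pos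
    have hs := hc _ _ _ _ _ _ φ ψ χ hφ.bddL2 hψ.bddL2 hχ.bddL2 hφ.integrable hψ.integrable
      hχ.integrable hφ.norm_le hψ.norm_le hχ.norm_le (wtNorm_nonneg 1 _) (wtNorm_nonneg 1 _)
      (wtNorm_nonneg 1 _) (semi_le_wtNorm le_rfl hφ.integrable hφ.wxi)
      (semi_le_wtNorm le_rfl hψ.integrable hψ.wxi) (semi_le_wtNorm le_rfl hχ.integrable hχ.wxi)
    have h2 := memLp_hat hi hb.memLp
    have p1 := supConst_nonneg
    have p2 := wtNorm_nonneg 1 (CoupledNLS.hat φ)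
    have p3 := wtNorm_nonneg 1 (CoupledNLS.hat ψ)
    have p4 := wtNorm_nonneg 1 (CoupledNLS.hat χ)
    refine (memWt_of_bounds (continuous_hat hi).aestronglyMeasurable
      (Real.sqrt_nonneg _) ?_ (eLpNorm_two_eq h2).le hs).1
    positivity

/-- The symbol `e^{-isξ²}` of the free group. -/
def symb (s ξ : ℝ) : ℂ := Complex.exp (-Complex.I * s * (ξ : ℂ) ^ 2)

theorem norm_symb (s ξ : ℝ) : ‖symb s ξ‖ = 1 := by
  simp [symb, Complex.norm_exp, ← Complex.ofReal_pow]

theorem symb_add (s r ξ : ℝ) : symb (s + r) ξ = symb s ξ * symb r ξ := by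
  simp only [symb, ← Complex.exp_add]
  congr 1; push_cast; ring

theorem symb_zero (ξ : ℝ) : symb 0 ξ = 1 := by simp [symb]

theorem contDiff_symb (s : ℝ) : ContDiff ℝ ∞ (symb s) := by
  unfold symb
  have : ContDiff ℝ ∞ fun ξ : ℝ => (ξ : ℂ) := Complex.ofRealCLM.contDiff
  fun_prop

theorem continuous_symb : Continuous fun p : ℝ × ℝ => symb p.1 p.2 := by
  unfold symb; fun_prop

theorem continuous_symb_right (s : ℝ) : Continuous (symb s) := (contDiff_symb s).continuous

theorem hasDerivAt_symb (s ξ : ℝ) :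
    HasDerivAt (symb s) (-2 * Complex.I * s * ξ * symb s ξ) ξ := by
  have h1 : HasDerivAt (fun ξ : ℝ => -Complex.I * s * (ξ : ℂ) ^ 2) (-Complex.I * s * (2 * ξ)) ξ := by
    have := ((Complex.ofRealCLM.hasDerivAt (x := ξ)).pow 2).const_mul (-Complex.I * s)
    simpa using this
  exact h1.cexp.congr_deriv (by rw [symb]; ring)

theorem freeGroup_eq (s : ℝ) (φ : ℝ → ℂ) (x : ℝ) :
    freeGroup s φ x = hat (fun ξ => symb s ξ * hat φ ξ) (-x) := by
  unfold freeGroup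
  rw [hat]
  congr 2
  ext ξ
  simp only [symb]
  rw [mul_assoc]
  congr 2
  push_cast; ring

theorem integrable_symb_mul {F : ℝ → ℂ} (hF : Integrable F) (s : ℝ) :
    Integrable fun ξ => symb s ξ * F ξ :=
  hF.bdd_mul (c := 1) (continuous_symb_right s).aestronglyMeasurable
    (Eventually.of_forall fun ξ => (norm_symb s ξ).le)

/-- Product rule for a weak derivative and a smooth multiplier. -/
theorem HasWeakDeriv.smooth_mul {F g m m' : ℝ → ℂ} (h : HasWeakDeriv 1 F g)
    (hm : ContDiff ℝ ∞ m) (hm' : ∀ ξ, HasDerivAt m (m' ξ) ξ)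
    (hF : Continuous F) :
    HasWeakDeriv 1 (fun ξ => m ξ * F ξ) (fun ξ => m ξ * g ξ + m' ξ * F ξ) := by
  have hmc : Continuous m' := by
    have : m' = deriv m := funext fun ξ => (hm' ξ).deriv.symm
    rw [this]
    exact hm.continuous_deriv (by exact_mod_cast le_top)
  have l1 : LocallyIntegrable fun ξ => m ξ * g ξ := by
    simpa [smul_eq_mul] using h.2.1.continuous_smul hm.continuous
  have l2 : LocallyIntegrable fun ξ => m' ξ * F ξ := (hmc.mul hF).locallyIntegrable
  refine ⟨(hm.continuous.mul hF).locallyIntegrable, l1.add l2, fun η hη => ?_⟩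
  have ht : IsTest fun ξ => m ξ * η ξ := ⟨hm.mul hη.1, hη.2.mul_left⟩
  have h1 := h.2.2 _ ht
  rw [iteratedDeriv_one] at h1 ⊢
  have e : ∀ ξ, deriv (fun ξ => m ξ * η ξ) ξ = m' ξ * η ξ + m ξ * deriv η ξ := fun ξ =>
    ((hm' ξ).mul ((hη.1.differentiable (by simp)).differentiableAt).hasDerivAt).deriv
  simp only [e] at h1
  have hηc := hη.1.continuous
  have hη' : Continuous (deriv η) := hη.1.continuous_deriv (by exact_mod_cast le_top)
  have i1 : Integrable fun ξ => m' ξ * F ξ * η ξ :=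
    ((hmc.mul hF).mul hηc).integrable_of_hasCompactSupport hη.2.mul_left
  have i2 : Integrable fun ξ => m ξ * F ξ * deriv η ξ :=
    ((hm.continuous.mul hF).mul hη').integrable_of_hasCompactSupport hη.2.deriv.mul_left
  have i3 : Integrable fun ξ => m ξ * g ξ * η ξ := by
    have := l1.integrable_smul_left_of_hasCompactSupport hηc hη.2
    simpa [smul_eq_mul, mul_comm] using this
  have h2 : ∫ ξ, F ξ * (m' ξ * η ξ + m ξ * deriv η ξ)
      = (∫ ξ, m' ξ * F ξ * η ξ) + ∫ ξ, m ξ * F ξ * deriv η ξ := by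
    rw [← integral_add i1 i2]
    congr 1; ext ξ; ring
  have h3 : ∫ ξ, (m ξ * g ξ + m' ξ * F ξ) * η ξ
      = (∫ ξ, g ξ * (m ξ * η ξ)) + ∫ ξ, m' ξ * F ξ * η ξ := by
    rw [show (fun ξ => g ξ * (m ξ * η ξ)) = fun ξ => m ξ * g ξ * η ξ by ext ξ; ring,
      ← integral_add i3 i1]
    congr 1; ext ξ; ring
  rw [h3]
  rw [h2] at h1
  linear_combination h1

/-- A weak derivative of `φ`, chosen in `L²`. -/
theorem Nice.exists_weakDeriv {φ : ℝ → ℂ} (h : Nice φ) :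
    ∃ g : ℝ → ℂ, HasWeakDeriv 1 φ g ∧ MemLp g 2 volume ∧ eLpNorm g 2 volume = semi 1 φ := by
  have hc := continuous_hat h.integrable
  have hm : MemLp (fun ξ : ℝ => (Complex.I * ξ) ^ 1 * CoupledNLS.hat φ ξ) 2 volume :=
    ⟨Continuous.aestronglyMeasurable (by fun_prop),
      (semi_le_wtNorm le_rfl h.integrable h.wxi).trans_lt ENNReal.ofReal_lt_top⟩
  obtain ⟨g, h1, h2, h3, -⟩ := exists_hasWeakDeriv h.integrable hm
  exact ⟨g, h1, h2, h3⟩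

/-- Multiplication by a smooth symbol of at most linear derivative, seen from the other side of
the Fourier transform. -/
theorem Nice.hat_smooth_mul {F g m m' : ℝ → ℂ} (hF : Nice F) (hg : HasWeakDeriv 1 F g)
    (hg2 : MemLp g 2 volume) (hm : ContDiff ℝ ∞ m) (hm' : ∀ ξ, HasDerivAt m (m' ξ) ξ) {K : ℝ}
    (hK : ∀ ξ, ‖m ξ‖ ≤ K) (hK' : ∀ ξ, ‖m' ξ‖ ≤ K * wt 1 ξ) :
    MemLp (fun x : ℝ => (Complex.I * x) ^ 1 * CoupledNLS.hat (fun ξ => m ξ * F ξ) x) 2 volume ∧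
      semi 1 (fun ξ => m ξ * F ξ) = eLpNorm (fun ξ => m ξ * g ξ + m' ξ * F ξ) 2 volume := by
  have hmc : Continuous m' := by
    have : m' = deriv m := funext fun ξ => (hm' ξ).deriv.symm
    rw [this]
    exact hm.continuous_deriv (by exact_mod_cast le_top)
  have h1 : Integrable fun ξ => m ξ * F ξ :=
    hF.integrable.bdd_mul hm.continuous.aestronglyMeasurable (Eventually.of_forall hK)
  have h2 : MemLp (fun ξ => m ξ * g ξ) 2 volume := by
    refine hg2.of_le_mul (hm.continuous.aestronglyMeasurable.mul hg2.1)
      (Eventually.of_forall fun ξ => ?_) (c := K)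
    rw [norm_mul]
    exact mul_le_mul_of_nonneg_right (hK ξ) (norm_nonneg _)
  have h3 : MemLp (fun ξ => m' ξ * F ξ) 2 volume :=
    (hF.wx.bound (hmc.mul hF.cont).aestronglyMeasurable (C := K) fun ξ => by
      change ‖m' ξ * F ξ‖ ≤ _
      rw [norm_mul, ← mul_assoc]
      exact mul_le_mul_of_nonneg_right (hK' ξ) (norm_nonneg _)).1
  exact (hg.smooth_mul hm hm' hF.cont).memLp_hat h1 (h2.add h3)

theorem norm_symb_deriv_le (s ξ : ℝ) :
    ‖-2 * Complex.I * s * ξ * symb s ξ‖ ≤ (1 + 2 * |s|) * wt 1 ξ := by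
  simp only [norm_mul, norm_neg, Complex.norm_I, Complex.norm_real, norm_symb, Complex.norm_ofNat,
    Real.norm_eq_abs, mul_one, wt, pow_one]
  nlinarith [abs_nonneg s, abs_nonneg ξ]

/-- Multiplication by the symbol of the free group preserves the basic class. -/
theorem Nice.symb_mul {F : ℝ → ℂ} (hF : Nice F) (s : ℝ) : Nice fun ξ => symb s ξ * F ξ := by
  have hi := integrable_symb_mul hF.integrable s
  have hc : Continuous fun ξ => symb s ξ * F ξ := (continuous_symb_right s).mul hF.cont
  have hx : MemWt 1 fun ξ => symb s ξ * F ξ :=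
    (hF.wx.bound (C := 1) (((Complex.continuous_ofReal.comp (continuous_wt 1)).mul
      hc).aestronglyMeasurable) fun ξ => by
        change ‖(wt 1 ξ : ℂ) * _‖ ≤ _
        rw [norm_wt_mul, norm_mul, norm_symb, one_mul, one_mul]).1
  obtain ⟨g, hg, hg2, -⟩ := hF.exists_weakDeriv
  obtain ⟨h1, -⟩ := hF.hat_smooth_mul hg hg2 (contDiff_symb s) (hasDerivAt_symb s)
    (K := 1 + 2 * |s|) (fun ξ => by rw [norm_symb]; linarith [abs_nonneg s])
    (norm_symb_deriv_le s)
  have h2 := memLp_hat hi hx.memLp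
  exact ⟨hc, hx, (memWt_of_bounds (continuous_hat hi).aestronglyMeasurable (Real.sqrt_nonneg _)
    (Real.sqrt_nonneg _) (eLpNorm_two_eq h2).le (eLpNorm_two_eq h1).le).1⟩

theorem Nice.reflect {φ : ℝ → ℂ} (h : Nice φ) : Nice fun x => φ (-x) := by
  have := h.hat.hat
  rwa [show CoupledNLS.hat (CoupledNLS.hat φ) = fun x => φ (-x) from funext h.hat_hat] at this

theorem Nice.freeGroup {φ : ℝ → ℂ} (h : Nice φ) (s : ℝ) : Nice (freeGroup s φ) := by
  rw [show CoupledNLS.freeGroup s φ = fun x => CoupledNLS.hat (fun ξ => symb s ξ *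
    CoupledNLS.hat φ ξ) (-x) from funext (freeGroup_eq s φ)]
  exact (h.hat.symb_mul s).hat.reflect

theorem Nice.hat_freeGroup {φ : ℝ → ℂ} (h : Nice φ) (s ξ : ℝ) :
    CoupledNLS.hat (CoupledNLS.freeGroup s φ) ξ = symb s ξ * CoupledNLS.hat φ ξ := by
  rw [show CoupledNLS.freeGroup s φ = fun x => CoupledNLS.hat (fun ξ => symb s ξ *
    CoupledNLS.hat φ ξ) (-x) from funext (freeGroup_eq s φ), hat_comp_neg,
    (h.hat.symb_mul s).hat_hat, neg_neg]

theorem Nice.freeGroup_freeGroup {φ : ℝ → ℂ} (h : Nice φ) (s r : ℝ) :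
    CoupledNLS.freeGroup s (CoupledNLS.freeGroup r φ) = CoupledNLS.freeGroup (s + r) φ :=
  ((h.freeGroup r).freeGroup s).ext_hat (h.freeGroup _) fun ξ => by
    rw [(h.freeGroup r).hat_freeGroup, h.hat_freeGroup, h.hat_freeGroup, symb_add, mul_assoc]

theorem Nice.freeGroup_zero {φ : ℝ → ℂ} (h : Nice φ) : CoupledNLS.freeGroup 0 φ = φ :=
  (h.freeGroup 0).ext_hat h fun ξ => by rw [h.hat_freeGroup, symb_zero, one_mul]

theorem Nice.freeGroup_neg_freeGroup {φ : ℝ → ℂ} (h : Nice φ) (s : ℝ) :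
    CoupledNLS.freeGroup (-s) (CoupledNLS.freeGroup s φ) = φ := by
  rw [h.freeGroup_freeGroup, neg_add_cancel, h.freeGroup_zero]

theorem Nice.freeGroup_sub {φ ψ : ℝ → ℂ} (hφ : Nice φ) (hψ : Nice ψ) (s : ℝ) :
    CoupledNLS.freeGroup s (fun x => φ x - ψ x)
      = fun x => CoupledNLS.freeGroup s φ x - CoupledNLS.freeGroup s ψ x :=
  ((hφ.sub hψ).freeGroup s).ext_hat ((hφ.freeGroup s).sub (hψ.freeGroup s)) fun ξ => by
    rw [(hφ.sub hψ).hat_freeGroup, hat_sub hφ.integrable hψ.integrable,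
      hat_sub (hφ.freeGroup s).integrable (hψ.freeGroup s).integrable, hφ.hat_freeGroup,
      hψ.hat_freeGroup, mul_sub]

theorem Nice.freeGroup_add {φ ψ : ℝ → ℂ} (hφ : Nice φ) (hψ : Nice ψ) (s : ℝ) :
    CoupledNLS.freeGroup s (fun x => φ x + ψ x)
      = fun x => CoupledNLS.freeGroup s φ x + CoupledNLS.freeGroup s ψ x :=
  ((hφ.add hψ).freeGroup s).ext_hat ((hφ.freeGroup s).add (hψ.freeGroup s)) fun ξ => by
    rw [(hφ.add hψ).hat_freeGroup, hat_add hφ.integrable hψ.integrable,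
      hat_add (hφ.freeGroup s).integrable (hψ.freeGroup s).integrable, hφ.hat_freeGroup,
      hψ.hat_freeGroup, mul_add]

/-- The free group preserves frequency weights. -/
theorem Nice.memWt_hat_freeGroup {φ : ℝ → ℂ} (h : Nice φ) (s : ℝ) {k : ℕ}
    (hk : MemWt k (CoupledNLS.hat φ)) : MemWt k (CoupledNLS.hat (CoupledNLS.freeGroup s φ)) ∧
      wtNorm k (CoupledNLS.hat (CoupledNLS.freeGroup s φ)) = wtNorm k (CoupledNLS.hat φ) := by
  have e : eLpNorm (fun ξ => (wt k ξ : ℂ) * CoupledNLS.hat (CoupledNLS.freeGroup s φ) ξ) 2 volume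
      = eLpNorm (fun ξ => (wt k ξ : ℂ) * CoupledNLS.hat φ ξ) 2 volume := by
    refine eLpNorm_congr_norm_ae (Eventually.of_forall fun ξ => ?_)
    rw [norm_wt_mul, norm_wt_mul, h.hat_freeGroup, norm_mul, norm_symb, one_mul]
  refine ⟨⟨?_, by rw [e]; exact hk.2⟩, by unfold wtNorm; rw [e]⟩
  exact ((Complex.continuous_ofReal.comp (continuous_wt k)).mul
    (continuous_hat (h.freeGroup s).integrable)).aestronglyMeasurable

theorem Nice.semi_freeGroup {φ : ℝ → ℂ} (h : Nice φ) (s : ℝ) (k : ℕ) :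
    semi k (CoupledNLS.freeGroup s φ) = semi k φ := by
  refine eLpNorm_congr_norm_ae (Eventually.of_forall fun ξ => ?_)
  rw [norm_I_mul_pow, norm_I_mul_pow, h.hat_freeGroup, norm_mul, norm_symb, one_mul]

/-! ### The pseudo-conformal representation of the free group -/

theorem norm_symb_sub_one_sq_le (s ξ : ℝ) :
    ‖symb s ξ - 1‖ ^ 2 ≤ 8 * (|s| * ξ ^ 2) / (1 + |s| * ξ ^ 2) := by
  have h1 : ‖symb s ξ - 1‖ ≤ |s| * ξ ^ 2 := by
    have := Real.norm_exp_I_mul_ofReal_sub_one_le (x := -(s * ξ ^ 2))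
    rw [Real.norm_eq_abs, abs_neg, abs_mul, abs_of_nonneg (sq_nonneg ξ)] at this
    refine le_of_eq_of_le ?_ this
    rw [symb]
    congr 3
    push_cast; ring
  have h2 : ‖symb s ξ - 1‖ ≤ 2 := by
    refine (norm_sub_le _ _).trans ?_
    rw [norm_symb, norm_one]; norm_num
  set y := |s| * ξ ^ 2
  have hy : 0 ≤ y := by positivity
  have h0 := norm_nonneg (symb s ξ - 1)
  rw [le_div_iff₀ (by positivity)]
  rcases le_total y 2 with h | h
  · calc ‖symb s ξ - 1‖ ^ 2 * (1 + y) ≤ y ^ 2 * (1 + y) := by gcongr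
      _ ≤ 8 * y := by nlinarith [mul_nonneg hy hy]
  · calc ‖symb s ξ - 1‖ ^ 2 * (1 + y) ≤ 2 ^ 2 * (1 + y) := by gcongr
      _ ≤ 8 * y := by nlinarith

theorem integral_inv_one_add_mul_sq {s : ℝ} (hs : 0 < s) :
    Integrable (fun x : ℝ => (1 + s * x ^ 2)⁻¹) ∧
      ∫ x : ℝ, (1 + s * x ^ 2)⁻¹ = Real.pi / Real.sqrt s := by
  have e : (fun x : ℝ => (1 + s * x ^ 2)⁻¹) = fun x => (1 + (Real.sqrt s * x) ^ 2)⁻¹ := by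
    ext x
    rw [mul_pow, Real.sq_sqrt hs.le]
  rw [e]
  refine ⟨integrable_inv_one_add_sq.comp_mul_left' (Real.sqrt_pos.2 hs).ne', ?_⟩
  rw [Measure.integral_comp_mul_left (fun y : ℝ => (1 + y ^ 2)⁻¹), integral_univ_inv_one_add_sq,
    abs_of_pos (by positivity), smul_eq_mul]
  field_simp

/-- Hölder continuity in time of the free group, measured by one derivative in `L²`. -/
theorem Nice.norm_freeGroup_sub_le {φ : ℝ → ℂ} (h : Nice φ) (s : ℝ) {b : ℝ} (hb : 0 ≤ b)
    (hs : semi 1 φ ≤ ENNReal.ofReal b) (x : ℝ) :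
    ‖CoupledNLS.freeGroup s φ x - φ x‖ ≤ 2 * |s| ^ (1 / 4 : ℝ) * b := by
  rcases eq_or_ne s 0 with rfl | hs0
  · rw [h.freeGroup_zero, sub_self, norm_zero]; positivity
  have hsp : 0 < |s| := abs_pos.2 hs0
  set F := CoupledNLS.hat φ with hF
  have hFc : Continuous F := continuous_hat h.integrable
  have e : CoupledNLS.freeGroup s φ x - φ x
      = CoupledNLS.hat (fun ξ => symb s ξ * F ξ - F ξ) (-x) := by
    rw [hat_sub (integrable_symb_mul h.integrable_hat s) h.integrable_hat, ← freeGroup_eq,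
      ← h.eq_hat]
  rw [e]
  refine (norm_hat_le _ _).trans ?_
  -- `|e^{-isξ²} - 1| ≤ w(ξ)|ξ|`, with a square integrable `w` of norm `O(|s|^{1/4})`
  set w : ℝ → ℝ := fun ξ => Real.sqrt (8 * |s| * (1 + |s| * ξ ^ 2)⁻¹) with hw
  have hden : ∀ ξ : ℝ, 0 < 1 + |s| * ξ ^ 2 := fun ξ => by positivity
  have hw2 : ∀ ξ, w ξ ^ 2 = 8 * |s| * (1 + |s| * ξ ^ 2)⁻¹ := fun ξ =>
    Real.sq_sqrt (mul_nonneg (by positivity) (inv_nonneg.2 (hden ξ).le))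
  have hwc : Continuous w := by
    refine (continuous_const.mul (Continuous.inv₀ (by fun_prop) fun ξ => (hden ξ).ne')).sqrt
  obtain ⟨i1, i2⟩ := integral_inv_one_add_mul_sq hsp
  have hwm : MemLp w 2 volume := by
    rw [memLp_two_iff_integrable_sq hwc.aestronglyMeasurable]
    simp only [hw2]
    exact i1.const_mul _
  set g : ℝ → ℝ := fun ξ => |ξ| * ‖F ξ‖ with hg
  have hm : MemLp (fun ξ : ℝ => (Complex.I * ξ) ^ 1 * F ξ) 2 volume :=
    ⟨Continuous.aestronglyMeasurable (by fun_prop), hs.trans_lt ENNReal.ofReal_lt_top⟩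
  have hgn : ∀ ξ : ℝ, ‖(Complex.I * ξ) ^ 1 * F ξ‖ = g ξ := fun ξ => by
    rw [norm_I_mul_pow, pow_one]
  have hgm : MemLp g 2 volume := by
    have := hm.norm
    simpa only [hgn] using this
  have hgI : ∫ ξ, g ξ ^ 2 ≤ b ^ 2 := by
    have := (eLpNorm_two_le_iff hm hb).1 hs
    simpa only [hgn] using this
  have hpt : ∀ ξ, ‖symb s ξ * F ξ - F ξ‖ ≤ w ξ * g ξ := by
    intro ξ
    rw [show symb s ξ * F ξ - F ξ = (symb s ξ - 1) * F ξ by ring, norm_mul, hg, ← mul_assoc]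
    refine mul_le_mul_of_nonneg_right ?_ (norm_nonneg _)
    refine abs_le_of_sq_le_sq' ?_ (by positivity) |>.2
    rw [mul_pow, hw2, sq_abs]
    refine (norm_symb_sub_one_sq_le s ξ).trans (le_of_eq ?_)
    rw [div_eq_mul_inv]; ring
  have hwg : Integrable fun ξ => w ξ * g ξ := hwm.integrable_mul hgm
  have h1 : ∫ ξ, ‖symb s ξ * F ξ - F ξ‖ ≤ ∫ ξ, w ξ * g ξ :=
    integral_mono ((integrable_symb_mul h.integrable_hat s).sub h.integrable_hat).norm hwg hpt
  have h2 := integral_mul_le_Lp_mul_Lq_of_nonneg (μ := volume) Real.HolderConjugate.two_two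
    (f := w) (g := g)
    (Eventually.of_forall fun ξ => Real.sqrt_nonneg _)
    (Eventually.of_forall fun ξ => by positivity) (by simpa using hwm) (by simpa using hgm)
  simp only [Real.rpow_two, ← Real.sqrt_eq_rpow] at h2
  have h3 : ∫ ξ, w ξ ^ 2 = 8 * Real.pi * Real.sqrt |s| := by
    simp only [hw2]
    rw [integral_const_mul, i2]
    have := Real.sqrt_pos.2 hsp
    field_simp
    rw [Real.sq_sqrt hsp.le]
  have h4 : Real.sqrt (∫ ξ, g ξ ^ 2) ≤ b := Real.sqrt_le_iff.2 ⟨hb, hgI⟩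
  calc hatConst * ∫ ξ, ‖symb s ξ * F ξ - F ξ‖
      ≤ hatConst * (Real.sqrt (∫ ξ, w ξ ^ 2) * b) := by
        refine mul_le_mul_of_nonneg_left ?_ hatConst_pos.le
        exact h1.trans (h2.trans (mul_le_mul_of_nonneg_left h4 (Real.sqrt_nonneg _)))
    _ = 2 * |s| ^ (1 / 4 : ℝ) * b := by
        rw [h3, ← mul_assoc]
        congr 1
        have p1 : 0 ≤ hatConst * Real.sqrt (8 * Real.pi * Real.sqrt |s|) :=
          mul_nonneg hatConst_pos.le (Real.sqrt_nonneg _)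
        rw [← abs_of_nonneg p1, ← abs_of_nonneg (show 0 ≤ 2 * |s| ^ (1 / 4 : ℝ) by positivity),
          ← sq_eq_sq_iff_abs_eq_abs, mul_pow, hatConst_sq, Real.sq_sqrt (by positivity), mul_pow,
          ← Real.rpow_natCast (|s| ^ (1 / 4 : ℝ)), ← Real.rpow_mul hsp.le, Real.sqrt_eq_rpow]
        have := Real.pi_pos
        norm_num
        field_simp
        norm_num

theorem hat_gaussian {b : ℂ} (hb : 0 < b.re) (x y : ℝ) :
    hat (fun ξ : ℝ => Complex.exp (Complex.I * x * ξ) * Complex.exp (-b * (ξ : ℂ) ^ 2)) y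
      = hatConst * ((Real.pi / b) ^ (1 / 2 : ℂ) * Complex.exp (-((x - y : ℝ) : ℂ) ^ 2 / (4 * b))) := by
  rw [← fourierIntegral_gaussian hb, hat]
  congr 2
  ext ξ
  rw [← mul_assoc, ← Complex.exp_add]
  congr 2
  push_cast; ring

/-- The phase factor `(2it)^{-1/2}` of the fundamental solution. -/
def kern (t : ℝ) : ℂ := hatConst * (Real.pi / (Complex.I * t)) ^ (1 / 2 : ℂ)

theorem kern_eq {t : ℝ} (ht : 0 < t) : kern t = 1 / (2 * Complex.I * (t : ℂ)) ^ (1 / 2 : ℂ) := by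
  have hp := Real.pi_pos
  have ht0 : (t : ℂ) ≠ 0 := by exact_mod_cast ht.ne'
  have l1 : Complex.log (2 * Complex.I * t) = Real.log (2 * t) + Real.pi / 2 * Complex.I := by
    rw [← Complex.log_I, ← Complex.log_ofReal_mul (by positivity) Complex.I_ne_zero]
    congr 1; push_cast; ring
  have l2 : Complex.log (Real.pi / (Complex.I * t))
      = Real.log (Real.pi / t) + -(Real.pi / 2) * Complex.I := by
    rw [← Complex.log_neg_I, ← Complex.log_ofReal_mul (by positivity)
      (neg_ne_zero.2 Complex.I_ne_zero)]
    congr 1; push_cast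
    field_simp
    rw [Complex.I_sq]; ring
  have n1 : 2 * Complex.I * (t : ℂ) ≠ 0 :=
    mul_ne_zero (mul_ne_zero two_ne_zero Complex.I_ne_zero) ht0
  have n2 : (Real.pi : ℂ) / (Complex.I * t) ≠ 0 :=
    div_ne_zero (by exact_mod_cast hp.ne') (mul_ne_zero Complex.I_ne_zero ht0)
  have n3 : (2 * Complex.I * (t : ℂ)) ^ (1 / 2 : ℂ) ≠ 0 := by
    rw [Complex.cpow_def_of_ne_zero n1]; exact Complex.exp_ne_zero _
  rw [eq_div_iff n3, kern, mul_assoc, Complex.cpow_def_of_ne_zero n1,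
    Complex.cpow_def_of_ne_zero n2, ← Complex.exp_add, l1, l2, hatConst]
  have e3 : (Real.log (Real.pi / t) + -(Real.pi / 2) * Complex.I) * (1 / 2 : ℂ)
      + (Real.log (2 * t) + Real.pi / 2 * Complex.I) * (1 / 2 : ℂ)
      = ((Real.log (2 * Real.pi) / 2 : ℝ) : ℂ) := by
    have : Real.log (2 * Real.pi) = Real.log (Real.pi / t) + Real.log (2 * t) := by
      rw [← Real.log_mul (by positivity) (by positivity)]
      congr 1; field_simp
    rw [this]; push_cast; ring
  rw [e3, ← Complex.ofReal_exp, Real.exp_half, Real.exp_log (by positivity), ← Complex.ofReal_mul,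
    inv_mul_cancel₀ (by positivity), Complex.ofReal_one]

theorem norm_cpow_half (z : ℂ) : ‖z ^ (1 / 2 : ℂ)‖ = Real.sqrt ‖z‖ := by
  rw [show (1 / 2 : ℂ) = ((1 / 2 : ℝ) : ℂ) by norm_num, Complex.norm_cpow_real,
    Real.sqrt_eq_rpow]

theorem norm_kern_sq {t : ℝ} (ht : 0 < t) : ‖kern t‖ ^ 2 = 1 / (2 * t) := by
  rw [kern_eq ht, norm_div, norm_one, norm_cpow_half, div_pow, one_pow,
    Real.sq_sqrt (norm_nonneg _)]
  simp [abs_of_pos ht]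

/-- The fundamental solution of the free Schrödinger equation. -/
theorem Nice.freeGroup_eq_integral {φ : ℝ → ℂ} (h : Nice φ) {t : ℝ} (ht : 0 < t) (x : ℝ) :
    CoupledNLS.freeGroup t φ x = kern t * (hatConst *
      ∫ y, Complex.exp (-((x - y : ℝ) : ℂ) ^ 2 / (4 * (Complex.I * t))) * φ y) := by
  -- `it` is approximated by `δ + it`, for which the Gaussian is integrable
  set b : ℝ → ℂ := fun δ => δ + Complex.I * t with hbdef
  have hbre : ∀ δ, (b δ).re = δ := fun δ => by simp [b]
  have hbim : ∀ δ, (b δ).im = t := fun δ => by simp [b]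
  have hbc : Continuous b := by fun_prop
  have hb0 : ∀ δ, b δ ≠ 0 := fun δ h0 => ht.ne' (by rw [← hbim δ, h0]; rfl)
  set G : ℝ → ℝ → ℂ := fun δ ξ => Complex.exp (Complex.I * x * ξ) *
    Complex.exp (-b δ * (ξ : ℂ) ^ 2) with hG
  have hGc : ∀ δ, Continuous (G δ) := fun δ => by fun_prop
  have hGn : ∀ δ, 0 ≤ δ → ∀ ξ, ‖G δ ξ‖ ≤ 1 := by
    intro δ hδ ξ
    rw [hG]
    simp only [norm_mul, Complex.norm_exp]
    rw [← Real.exp_add, Real.exp_le_one_iff]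
    simp only [← Complex.ofReal_pow, Complex.re_mul_ofReal, Complex.neg_re, hbre, Complex.I_re,
      zero_mul, zero_add]
    nlinarith [mul_nonneg hδ (sq_nonneg ξ)]
  have hGi : ∀ δ, 0 < δ → Integrable (G δ) := by
    intro δ hδ
    have := integrable_cexp_neg_mul_sq (b := b δ) (by rw [hbre]; exact hδ)
    refine this.bdd_mul (c := 1) (Continuous.aestronglyMeasurable (by fun_prop))
      (Eventually.of_forall fun ξ => ?_)
    simp [Complex.norm_exp]
  have key : ∀ δ, 0 < δ → ∫ ξ, CoupledNLS.hat φ ξ * G δ ξ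
      = ∫ y, φ y * (hatConst * ((Real.pi / b δ) ^ (1 / 2 : ℂ) *
        Complex.exp (-((x - y : ℝ) : ℂ) ^ 2 / (4 * b δ)))) := by
    intro δ hδ
    rw [integral_hat_mul h.integrable (hGi δ hδ)]
    congr 1; ext y
    rw [hat_gaussian (by rw [hbre]; exact hδ)]
  have hδ : Tendsto (fun n : ℕ => (1 : ℝ) / (n + 1)) atTop (𝓝 0) :=
    tendsto_one_div_add_atTop_nhds_zero_nat
  have hpos : ∀ n : ℕ, (0 : ℝ) < 1 / (n + 1) := fun n => by positivity
  have l1 : Tendsto (fun n : ℕ => ∫ ξ, CoupledNLS.hat φ ξ * G (1 / (n + 1)) ξ) atTop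
      (𝓝 (∫ ξ, CoupledNLS.hat φ ξ * G 0 ξ)) := by
    refine tendsto_integral_of_dominated_convergence (fun ξ => ‖CoupledNLS.hat φ ξ‖)
      (fun n => ((continuous_hat h.integrable).mul (hGc _)).aestronglyMeasurable)
      h.integrable_hat.norm (fun n => Eventually.of_forall fun ξ => ?_)
      (Eventually.of_forall fun ξ => ?_)
    · rw [norm_mul]
      exact mul_le_of_le_one_right (norm_nonneg _) (hGn _ (hpos n).le ξ)
    · have : Continuous fun δ => CoupledNLS.hat φ ξ * G δ ξ := by
        simp only [hG]; fun_prop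
      exact (this.tendsto 0).comp hδ
  have hcpow : ContinuousAt (fun δ => ((Real.pi : ℂ) / b δ) ^ (1 / 2 : ℂ)) 0 := by
    have h1 : ContinuousAt (fun δ => (Real.pi : ℂ) / b δ) 0 :=
      continuousAt_const.div hbc.continuousAt (hb0 0)
    refine ContinuousAt.cpow h1 continuousAt_const ?_
    rw [Complex.mem_slitPlane_iff]
    right
    rw [hbdef]
    simp [Complex.div_im, Complex.normSq, Real.pi_ne_zero, ht.ne']
  have hbd : ∀ δ, 0 ≤ δ → ‖((Real.pi : ℂ) / b δ) ^ (1 / 2 : ℂ)‖ ≤ Real.sqrt (Real.pi / t) := by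
    intro δ _
    rw [norm_cpow_half, norm_div, Complex.norm_real, Real.norm_of_nonneg Real.pi_pos.le]
    have : t ≤ ‖b δ‖ := by
      have := Complex.abs_im_le_norm (b δ)
      rwa [hbim, abs_of_pos ht] at this
    exact Real.sqrt_le_sqrt (by gcongr)
  have l2 : Tendsto (fun n : ℕ => ∫ y, φ y * (hatConst *
      ((Real.pi / b (1 / (n + 1))) ^ (1 / 2 : ℂ) *
        Complex.exp (-((x - y : ℝ) : ℂ) ^ 2 / (4 * b (1 / (n + 1))))))) atTop
      (𝓝 (∫ y, φ y * (hatConst * ((Real.pi / b 0) ^ (1 / 2 : ℂ) *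
        Complex.exp (-((x - y : ℝ) : ℂ) ^ 2 / (4 * b 0)))))) := by
    refine tendsto_integral_of_dominated_convergence
      (fun y => ‖φ y‖ * (hatConst * Real.sqrt (Real.pi / t)))
      (fun n => Continuous.aestronglyMeasurable ?_)
      (h.integrable.norm.mul_const _) (fun n => Eventually.of_forall fun y => ?_)
      (Eventually.of_forall fun y => ?_)
    · have := h.cont
      fun_prop
    · rw [norm_mul, norm_mul, norm_mul, Complex.norm_real, Real.norm_of_nonneg hatConst_pos.le]
      refine mul_le_mul_of_nonneg_left (mul_le_mul_of_nonneg_left ?_ hatConst_pos.le)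
        (norm_nonneg _)
      refine (mul_le_of_le_one_right (norm_nonneg _) ?_).trans (hbd _ (hpos n).le)
      rw [Complex.norm_exp, Real.exp_le_one_iff, ← Complex.ofReal_pow, ← Complex.ofReal_neg,
        Complex.div_re, Complex.ofReal_im, zero_mul, zero_div, add_zero, Complex.ofReal_re]
      refine div_nonpos_of_nonpos_of_nonneg (mul_nonpos_of_nonpos_of_nonneg
        (neg_nonpos.2 (sq_nonneg _)) ?_) (Complex.normSq_nonneg _)
      have : (4 * b (1 / ((n : ℝ) + 1))).re = 4 * (1 / (n + 1)) := by
        rw [← hbre (1 / ((n : ℝ) + 1)), show (4 : ℂ) = ((4 : ℝ) : ℂ) by norm_num,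
          Complex.re_ofReal_mul, hbre]
      rw [this]
      have := hpos n
      positivity
    · have : ContinuousAt (fun δ => φ y * (hatConst * ((Real.pi / b δ) ^ (1 / 2 : ℂ) *
        Complex.exp (-((x - y : ℝ) : ℂ) ^ 2 / (4 * b δ))))) 0 := by
        refine continuousAt_const.mul (continuousAt_const.mul (hcpow.mul
          (ContinuousAt.cexp (continuousAt_const.div (continuousAt_const.mul hbc.continuousAt)
            ?_))))
        exact mul_ne_zero (by norm_num) (hb0 0)
      exact this.tendsto.comp hδ
  have l3 := tendsto_nhds_unique (l1.congr fun n => key _ (hpos n)) l2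
  have hb00 : b 0 = Complex.I * t := by simp [b]
  have e0 : CoupledNLS.freeGroup t φ x = hatConst * ∫ ξ, CoupledNLS.hat φ ξ * G 0 ξ := by
    unfold CoupledNLS.freeGroup
    congr 2; ext ξ
    simp only [hG, hb00, neg_mul]
    ring
  rw [e0, l3, hb00]
  simp only [← integral_const_mul]
  congr 1; ext y
  rw [kern]; ring

/-- The profile seen in pseudo-conformal coordinates. -/
def pconf (t : ℝ) (φ : ℝ → ℂ) : ℝ → ℂ := freeGroup (-(1 / (4 * t))) (hat φ)

theorem Nice.pconf {φ : ℝ → ℂ} (h : Nice φ) (t : ℝ) : Nice (pconf t φ) := h.hat.freeGroup _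

theorem symb_neg_right (s x : ℝ) : symb s (-x) = symb s x := by simp [symb]

theorem freeGroup_hat_eq {φ : ℝ → ℂ} (h : Nice φ) (s x : ℝ) :
    freeGroup s (hat φ) x = hat (fun y => symb s y * φ y) x := by
  rw [freeGroup_eq]
  have : (fun ξ => symb s ξ * hat (hat φ) ξ) = fun ξ => (fun y => symb s y * φ y) (-ξ) := by
    ext ξ; simp only [h.hat_hat, symb_neg_right]
  rw [this, hat_comp_neg (fun y => symb s y * φ y), neg_neg]

/-- The pseudo-conformal factorisation `e^{it∂ₓₓ}φ(x) = (2it)^{-1/2} e^{ix²/4t} U(x/2t)`. -/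
theorem Nice.freeGroup_eq_pconf {φ : ℝ → ℂ} (h : Nice φ) {t : ℝ} (ht : 0 < t) (x : ℝ) :
    CoupledNLS.freeGroup t φ x = kern t * Complex.exp (Complex.I * ((x ^ 2 / (4 * t) : ℝ) : ℂ)) *
      CoupledNLS.pconf t φ (x / (2 * t)) := by
  rw [h.freeGroup_eq_integral ht, CoupledNLS.pconf, freeGroup_hat_eq h, CoupledNLS.hat, mul_assoc,
    mul_left_comm (Complex.exp _)]
  congr 2
  rw [← integral_const_mul]
  congr 1; ext y
  rw [symb, ← mul_assoc, ← mul_assoc (Complex.exp (-Complex.I * y * _)), ← mul_assoc,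
    ← Complex.exp_add, ← Complex.exp_add]
  congr 2
  have h0 : (t : ℂ) ≠ 0 := by exact_mod_cast ht.ne'
  rw [div_eq_iff (by simp [h0])]
  push_cast
  field_simp
  linear_combination (-2 * (x - y : ℂ) ^ 2) * Complex.I_sq

theorem Nice.freeGroup_const_mul {φ : ℝ → ℂ} (h : Nice φ) (c : ℂ) (s : ℝ) :
    CoupledNLS.freeGroup s (fun x => c * φ x) = fun x => c * CoupledNLS.freeGroup s φ x :=
  ((h.const_mul c).freeGroup s).ext_hat ((h.freeGroup s).const_mul c) fun ξ => by
    rw [(h.const_mul c).hat_freeGroup, hat_const_mul, hat_const_mul, h.hat_freeGroup,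
      mul_left_comm]

/-- The nonlinearity written on profiles:
`e^{-it∂ₓₓ}(e^{it∂ₓₓ}φ · conj(e^{it∂ₓₓ}ψ) · e^{it∂ₓₓ}χ)`. -/
def trip (t : ℝ) (φ ψ χ : ℝ → ℂ) : ℝ → ℂ :=
  freeGroup (-t) (cubic (freeGroup t φ) (freeGroup t ψ) (freeGroup t χ))

/-- In pseudo-conformal coordinates the nonlinearity is a pointwise product, up to the factor
`1/(2t)`. -/
theorem trip_eq {φ ψ χ : ℝ → ℂ} (hφ : Nice φ) (hψ : Nice ψ) (hχ : Nice χ) {t : ℝ} (ht : 0 < t) :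
    trip t φ ψ χ = fun x => ((1 / (2 * t) : ℝ) : ℂ) *
      hat (freeGroup (1 / (4 * t)) (cubic (pconf t φ) (pconf t ψ) (pconf t χ))) (-x) := by
  have hQ : Nice (cubic (pconf t φ) (pconf t ψ) (pconf t χ)) :=
    (hφ.pconf t).cubic (hψ.pconf t) (hχ.pconf t)
  set Q := cubic (pconf t φ) (pconf t ψ) (pconf t χ) with hQd
  have hR := hQ.freeGroup (1 / (4 * t))
  set R := freeGroup (1 / (4 * t)) Q with hRd
  have hP : Nice fun x => ((1 / (2 * t) : ℝ) : ℂ) * hat R (-x) := hR.hat.reflect.const_mul _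
  set P := fun x => ((1 / (2 * t) : ℝ) : ℂ) * hat R (-x) with hPd
  have hhat : hat P = fun ξ => ((1 / (2 * t) : ℝ) : ℂ) * R ξ := by
    ext ξ
    rw [hPd, hat_const_mul _ (fun x => hat R (-x)), hat_comp_neg (hat R), hR.hat_hat, neg_neg]
  have key : cubic (freeGroup t φ) (freeGroup t ψ) (freeGroup t χ) = freeGroup t P := by
    ext x
    have hpc : pconf t P = fun ξ => ((1 / (2 * t) : ℝ) : ℂ) * Q ξ := by
      rw [pconf, hhat, hR.freeGroup_const_mul, hRd, hQ.freeGroup_neg_freeGroup]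
    rw [hP.freeGroup_eq_pconf ht, hpc, cubic, hφ.freeGroup_eq_pconf ht, hψ.freeGroup_eq_pconf ht,
      hχ.freeGroup_eq_pconf ht, ← norm_kern_sq ht, hQd]
    simp only [cubic]
    set e := Complex.exp (Complex.I * ((x ^ 2 / (4 * t) : ℝ) : ℂ)) with he
    have e1 : e * (starRingEnd ℂ) e = 1 := by
      rw [Complex.mul_conj', he, mul_comm Complex.I, Complex.norm_exp_ofReal_mul_I]; norm_num
    have e2 := Complex.mul_conj' (kern t)
    simp only [map_mul, Complex.ofReal_pow]
    rw [← e2]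
    linear_combination (kern t * (starRingEnd ℂ) (kern t) * kern t * e * pconf t φ (x / (2 * t)) *
      (starRingEnd ℂ) (pconf t ψ (x / (2 * t))) * pconf t χ (x / (2 * t))) * e1
  rw [trip, key, hP.freeGroup_neg_freeGroup]

theorem hat_trip {φ ψ χ : ℝ → ℂ} (hφ : Nice φ) (hψ : Nice ψ) (hχ : Nice χ) {t : ℝ} (ht : 0 < t)
    (ξ : ℝ) : hat (trip t φ ψ χ) ξ = ((1 / (2 * t) : ℝ) : ℂ) *
      freeGroup (1 / (4 * t)) (cubic (pconf t φ) (pconf t ψ) (pconf t χ)) ξ := by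
  have hR := ((hφ.pconf t).cubic (hψ.pconf t) (hχ.pconf t)).freeGroup (1 / (4 * t))
  rw [trip_eq hφ hψ hχ ht, hat_const_mul _ (fun x => hat (freeGroup _ _) (-x)),
    hat_comp_neg (hat _), hR.hat_hat, neg_neg]

theorem Nice.semi_hat_le {φ : ℝ → ℂ} (h : Nice φ) :
    semi 1 (CoupledNLS.hat φ) ≤ ENNReal.ofReal (wtNorm 1 φ) := by
  have := semi_le_wtNorm le_rfl h.integrable_hat (h.hat.wxi)
  rwa [h.wtNorm_hat_hat 1 h.wx] at this

theorem Nice.semi_pconf_le {φ : ℝ → ℂ} (h : Nice φ) (t : ℝ) :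
    semi 1 (CoupledNLS.pconf t φ) ≤ ENNReal.ofReal (wtNorm 1 φ) := by
  rw [CoupledNLS.pconf, h.hat.semi_freeGroup]
  exact h.semi_hat_le

theorem rpow_quarter_le {t : ℝ} (ht : 0 < t) (s : ℝ) (hs : |s| = 1 / (4 * t)) :
    |s| ^ (1 / 4 : ℝ) ≤ t ^ (-1 / 4 : ℝ) := by
  rw [hs, neg_div, Real.rpow_neg ht.le, ← Real.inv_rpow ht.le]
  refine Real.rpow_le_rpow (by positivity) ?_ (by norm_num)
  rw [one_div]
  exact inv_anti₀ ht (by linarith)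

theorem Nice.norm_pconf_sub_le {φ : ℝ → ℂ} (h : Nice φ) {t : ℝ} (ht : 0 < t) (ξ : ℝ) :
    ‖CoupledNLS.pconf t φ ξ - CoupledNLS.hat φ ξ‖ ≤ 2 * t ^ (-1 / 4 : ℝ) * wtNorm 1 φ := by
  refine (h.hat.norm_freeGroup_sub_le _ (wtNorm_nonneg 1 φ) h.semi_hat_le ξ).trans ?_
  have := wtNorm_nonneg 1 φ
  gcongr
  exact rpow_quarter_le ht _ (by rw [abs_neg, abs_of_pos (by positivity)])

theorem Nice.norm_pconf_eq {φ : ℝ → ℂ} (h : Nice φ) {t : ℝ} (ht : 0 < t) (ξ : ℝ) :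
    ‖CoupledNLS.freeGroup t φ (2 * t * ξ)‖
      = (Real.sqrt (2 * t))⁻¹ * ‖CoupledNLS.pconf t φ ξ‖ := by
  have hk : ‖kern t‖ = (Real.sqrt (2 * t))⁻¹ := by
    rw [← Real.sqrt_inv, ← one_div, ← norm_kern_sq ht, Real.sqrt_sq (norm_nonneg _)]
  rw [h.freeGroup_eq_pconf ht, norm_mul, norm_mul, hk, mul_comm Complex.I,
    Complex.norm_exp_ofReal_mul_I, mul_one]
  congr 3
  field_simp

/-! ### The Banach space of profiles -/

theorem nice_zero : Nice (0 : ℝ → ℂ) ∧ hat (0 : ℝ → ℂ) = 0 := by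
  have h : hat (0 : ℝ → ℂ) = 0 := by ext ξ; simp [hat]
  have hm : MemWt 1 (0 : ℝ → ℂ) := by simp [MemWt]
  exact ⟨⟨continuous_zero, hm, by rw [h]; exact hm⟩, h⟩

/-- The continuous representatives of the functions in `H^{k+1,0} ∩ H^{0,1}`. -/
def profSubmodule (k : ℕ) : Submodule ℂ (ℝ → ℂ) where
  carrier := {φ | Nice φ ∧ MemWt (k + 1) (hat φ)}
  zero_mem' := ⟨nice_zero.1, by rw [nice_zero.2]; simp [MemWt]⟩
  add_mem' {φ ψ} hφ hψ := ⟨hφ.1.add hψ.1, by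
    rw [show hat (φ + ψ) = fun ξ => hat φ ξ + hat ψ ξ from
      funext (hat_add hφ.1.integrable hψ.1.integrable)]
    exact hφ.2.add hψ.2⟩
  smul_mem' c φ hφ := ⟨hφ.1.const_mul c, by
    rw [show hat (c • φ) = fun ξ => c * hat φ ξ from funext (hat_const_mul c φ)]
    exact hφ.2.const_mul c⟩

/-- The space `H^{k+1,0} ∩ H^{0,1}`, realised by continuous functions and normed by
`max ‖(1+|x|)φ‖ ‖(1+|ξ|^{k+1})φ̂‖`.  It is a type of its own so that it does not inherit the
topology of pointwise convergence. -/
def Prof (k : ℕ) : Type := profSubmodule k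

instance (k : ℕ) : AddCommGroup (Prof k) := inferInstanceAs (AddCommGroup (profSubmodule k))

instance (k : ℕ) : Module ℂ (Prof k) := inferInstanceAs (Module ℂ (profSubmodule k))

/-- The underlying function. -/
def Prof.val {k : ℕ} (f : Prof k) : ℝ → ℂ := Subtype.val (p := (· ∈ profSubmodule k)) f

instance (k : ℕ) : CoeFun (Prof k) fun _ => ℝ → ℂ := ⟨Prof.val⟩

theorem MemWt.memLp_wt {k : ℕ} {φ : ℝ → ℂ} (h : MemWt k φ) :
    MemLp (fun x => (wt k x : ℂ) * φ x) 2 volume := h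

namespace Prof

variable {k : ℕ}

theorem nice (f : Prof k) : Nice f := (Subtype.property (p := (· ∈ profSubmodule k)) f).1

theorem freq (f : Prof k) : MemWt (k + 1) (hat f) :=
  (Subtype.property (p := (· ∈ profSubmodule k)) f).2

/-- The element of the space given by a function. -/
def mk (φ : ℝ → ℂ) (h : Nice φ) (h' : MemWt (k + 1) (hat φ)) : Prof k := ⟨φ, h, h'⟩

@[ext]
theorem ext {f g : Prof k} (h : ∀ x, f x = g x) : f = g :=
  Subtype.ext (p := (· ∈ profSubmodule k)) (funext h)

theorem coe_add (f g : Prof k) : ⇑(f + g) = fun x => f x + g x := rfl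

theorem coe_sub (f g : Prof k) : ⇑(f - g) = fun x => f x - g x := rfl

theorem coe_smul (c : ℂ) (f : Prof k) : ⇑(c • f) = fun x => c * f x := rfl

theorem hat_add (f g : Prof k) (ξ : ℝ) : hat (f + g : Prof k) ξ = hat f ξ + hat g ξ :=
  CoupledNLS.hat_add f.nice.integrable g.nice.integrable ξ

theorem hat_sub (f g : Prof k) (ξ : ℝ) : hat (f - g : Prof k) ξ = hat f ξ - hat g ξ :=
  CoupledNLS.hat_sub f.nice.integrable g.nice.integrable ξ

theorem hat_smul (c : ℂ) (f : Prof k) (ξ : ℝ) : hat (c • f : Prof k) ξ = c * hat f ξ :=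
  hat_const_mul c f ξ

/-- The embedding of the space into `L² × L²` that defines the norm. -/
def toL2 (k : ℕ) : Prof k →ₗ[ℂ] Lp ℂ 2 (volume : Measure ℝ) × Lp ℂ 2 (volume : Measure ℝ) where
  toFun f := (f.nice.wx.memLp_wt.toLp, f.freq.memLp_wt.toLp)
  map_add' f g := by
    refine Prod.ext ?_ ?_
    · simp only [Prod.fst_add]
      rw [← MemLp.toLp_add]
      exact MemLp.toLp_congr _ _ (Eventually.of_forall fun x => by
        simp only [coe_add, Pi.add_apply, mul_add])
    · simp only [Prod.snd_add]
      rw [← MemLp.toLp_add]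
      exact MemLp.toLp_congr _ _ (Eventually.of_forall fun x => by
        simp only [hat_add, Pi.add_apply, mul_add])
  map_smul' c f := by
    refine Prod.ext ?_ ?_
    · simp only [Prod.smul_fst, RingHom.id_apply]
      rw [← MemLp.toLp_const_smul]
      exact MemLp.toLp_congr _ _ (Eventually.of_forall fun x => by
        simp only [coe_smul, Pi.smul_apply, smul_eq_mul, mul_left_comm])
    · simp only [Prod.smul_snd, RingHom.id_apply]
      rw [← MemLp.toLp_const_smul]
      exact MemLp.toLp_congr _ _ (Eventually.of_forall fun x => by
        simp only [hat_smul, Pi.smul_apply, smul_eq_mul, mul_left_comm])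

theorem toL2_injective : Function.Injective (toL2 k) := by
  intro f g h
  have h1 := (MemLp.toLp_eq_toLp_iff f.nice.wx.memLp_wt g.nice.wx.memLp_wt).1
    (congrArg Prod.fst h)
  have h2 : (f : ℝ → ℂ) =ᵐ[volume] g := h1.mono fun x hx =>
    mul_left_cancel₀ (Complex.ofReal_ne_zero.2 (wt_pos 1 x).ne') hx
  exact Prof.ext (congrFun ((f.nice.cont.ae_eq_iff_eq volume g.nice.cont).1 h2))

instance : NormedAddCommGroup (Prof k) :=
  NormedAddCommGroup.induced (Prof k) _ (toL2 k) toL2_injective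

theorem norm_toL2 (f : Prof k) : ‖toL2 k f‖ = ‖f‖ := rfl

instance : NormedSpace ℂ (Prof k) where
  norm_smul_le c f := by
    rw [← norm_toL2, ← norm_toL2, map_smul]
    exact norm_smul_le _ _

theorem norm_eq (f : Prof k) : ‖f‖ = max (wtNorm 1 f) (wtNorm (k + 1) (hat f)) := by
  rw [← norm_toL2, Prod.norm_def]
  change max ‖f.nice.wx.memLp_wt.toLp‖ ‖f.freq.memLp_wt.toLp‖ = _
  rw [Lp.norm_toLp, Lp.norm_toLp]
  rfl

theorem wtNorm_le (f : Prof k) : wtNorm 1 f ≤ ‖f‖ := by rw [norm_eq]; exact le_max_left _ _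

theorem wtNorm_hat_le (f : Prof k) : wtNorm (k + 1) (hat f) ≤ ‖f‖ := by
  rw [norm_eq]; exact le_max_right _ _

theorem norm_hat_le (f : Prof k) (ξ : ℝ) : ‖hat f ξ‖ ≤ supConst * ‖f‖ :=
  (norm_hat_le_wtNorm f.nice.wx ξ).trans
    (mul_le_mul_of_nonneg_left f.wtNorm_le supConst_nonneg)

theorem wtNorm_one_hat_le (f : Prof k) : wtNorm 1 (hat f) ≤ 2 * ‖f‖ :=
  (f.freq.of_le (Nat.le_add_left 1 k)).2.trans
    (mul_le_mul_of_nonneg_left f.wtNorm_hat_le zero_le_two)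

/-- Evaluation of the Fourier transform at a frequency. -/
def evalHat (k : ℕ) (ξ : ℝ) : Prof k →L[ℂ] ℂ :=
  LinearMap.mkContinuous
    { toFun := fun f => hat f ξ
      map_add' := fun f g => hat_add f g ξ
      map_smul' := fun c f => hat_smul c f ξ } supConst fun f => f.norm_hat_le ξ

/-- `L²` limits and pointwise limits agree. -/
theorem ae_eq_of_tendsto_toLp {F : ℕ → ℝ → ℂ} (hF : ∀ n, MemLp (F n) 2 volume) {G : ℝ → ℂ}
    (hG : ∀ x, Tendsto (fun n => F n x) atTop (𝓝 (G x))) {a : Lp ℂ 2 (volume : Measure ℝ)}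
    (ha : Tendsto (fun n => (hF n).toLp) atTop (𝓝 a)) : a =ᵐ[volume] G := by
  obtain ⟨ns, hns, h⟩ := (tendstoInMeasure_of_tendsto_Lp ha).exists_seq_tendsto_ae
  have h2 : ∀ᵐ x ∂(volume : Measure ℝ), ∀ n, (hF n).toLp (F n) x = F n x :=
    ae_all_iff.2 fun n => (hF n).coeFn_toLp
  filter_upwards [h, h2] with x hx h2x
  refine tendsto_nhds_unique hx ?_
  simp only [h2x]
  exact (hG x).comp hns.tendsto_atTop

instance : CompleteSpace (Prof k) := by
  have hiso : Isometry (toL2 k) := AddMonoidHomClass.isometry_of_norm _ norm_toL2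
  rw [completeSpace_iff_isComplete_range hiso.isUniformInducing]
  refine IsClosed.isComplete (isClosed_of_closure_subset fun p hp => ?_)
  obtain ⟨y, hy, hlim⟩ := mem_closure_iff_seq_limit.1 hp
  choose f hf using hy
  have hl1 : Tendsto (fun n => (f n).nice.wx.memLp_wt.toLp) atTop (𝓝 p.1) := by
    refine ((continuous_fst.tendsto p).comp hlim).congr fun n => ?_
    rw [Function.comp, ← hf]
    rfl
  have hl2 : Tendsto (fun n => (f n).freq.memLp_wt.toLp) atTop (𝓝 p.2) := by
    refine ((continuous_snd.tendsto p).comp hlim).congr fun n => ?_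
    rw [Function.comp, ← hf]
    rfl
  -- the limit function is the inverse transform of the limit of the transforms
  set B : ℝ → ℂ := fun ξ => (wt (k + 1) ξ : ℂ)⁻¹ * p.2 ξ with hB
  have hw0 : ∀ i x, (wt i x : ℂ) ≠ 0 := fun i x => Complex.ofReal_ne_zero.2 (wt_pos i x).ne'
  have hBw : (fun ξ => (wt (k + 1) ξ : ℂ) * B ξ) = p.2 := by
    ext ξ; rw [hB]; exact mul_inv_cancel_left₀ (hw0 _ _) _
  have hBm : MemWt (k + 1) B := by
    unfold MemWt; rw [hBw]; exact Lp.memLp p.2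
  have hB1 := (hBm.of_le (Nat.le_add_left 1 k)).1
  have hdist : Tendsto (fun n => wtNorm (k + 1) (fun ξ => hat (f n) ξ - B ξ)) atTop (𝓝 0) := by
    have h1 := tendsto_iff_norm_sub_tendsto_zero.1 hl2
    refine h1.congr fun n => ?_
    rw [wtNorm, Lp.norm_def]
    congr 1
    refine eLpNorm_congr_ae ?_
    filter_upwards [Lp.coeFn_sub ((f n).freq.memLp_wt.toLp) p.2, (f n).freq.memLp_wt.coeFn_toLp]
      with ξ h2 h3
    rw [h2, Pi.sub_apply, h3, mul_sub, ← congrFun hBw ξ]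
  set φ : ℝ → ℂ := fun x => hat B (-x) with hφ
  have hφc : Continuous φ := (continuous_hat hB1.integrable.1).comp continuous_neg
  have hptw : ∀ x, Tendsto (fun n => f n x) atTop (𝓝 (φ x)) := by
    intro x
    rw [tendsto_iff_norm_sub_tendsto_zero]
    have h0 : Tendsto (fun n => supConst * (2 * wtNorm (k + 1) (fun ξ => hat (f n) ξ - B ξ))) atTop
        (𝓝 0) := by simpa using (hdist.const_mul 2).const_mul supConst
    refine squeeze_zero (fun n => norm_nonneg _) (fun n => ?_) h0
    rw [(f n).nice.eq_hat, hφ, ← CoupledNLS.hat_sub (f n).nice.integrable_hat hB1.integrable.1]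
    have hm := (f n).freq.sub hBm
    have hm1 := hm.of_le (Nat.le_add_left 1 k)
    exact (norm_hat_le_wtNorm hm1.1 _).trans (mul_le_mul_of_nonneg_left hm1.2 supConst_nonneg)
  have e1 : p.1 =ᵐ[volume] fun x => (wt 1 x : ℂ) * φ x :=
    ae_eq_of_tendsto_toLp (fun n => (f n).nice.wx.memLp_wt) (fun x => (hptw x).const_mul _) hl1
  have hφm : MemWt 1 φ := (memLp_congr_ae e1).1 (Lp.memLp p.1)
  have hdist1 : Tendsto (fun n => wtNorm 1 (fun x => f n x - φ x)) atTop (𝓝 0) := by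
    have h1 := tendsto_iff_norm_sub_tendsto_zero.1 hl1
    refine h1.congr fun n => ?_
    rw [wtNorm, Lp.norm_def]
    congr 1
    refine eLpNorm_congr_ae ?_
    filter_upwards [Lp.coeFn_sub ((f n).nice.wx.memLp_wt.toLp) p.1,
      (f n).nice.wx.memLp_wt.coeFn_toLp, e1]
      with ξ h2 h3 h4
    rw [h2, Pi.sub_apply, h3, mul_sub, h4]
  have hptw2 : ∀ ξ, Tendsto (fun n => hat (f n) ξ) atTop (𝓝 (hat φ ξ)) := by
    intro ξ
    rw [tendsto_iff_norm_sub_tendsto_zero]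
    have h0 : Tendsto (fun n => supConst * wtNorm 1 (fun x => f n x - φ x)) atTop (𝓝 0) := by
      simpa using hdist1.const_mul supConst
    refine squeeze_zero (fun n => norm_nonneg _) (fun n => ?_) h0
    rw [← CoupledNLS.hat_sub (f n).nice.integrable hφm.integrable.1]
    exact norm_hat_le_wtNorm ((f n).nice.wx.sub hφm) _
  have e2 : p.2 =ᵐ[volume] fun ξ => (wt (k + 1) ξ : ℂ) * hat φ ξ :=
    ae_eq_of_tendsto_toLp (fun n => (f n).freq.memLp_wt) (fun ξ => (hptw2 ξ).const_mul _) hl2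
  have hφf : MemWt (k + 1) (hat φ) := (memLp_congr_ae e2).1 (Lp.memLp p.2)
  refine ⟨mk φ ⟨hφc, hφm, (hφf.of_le (Nat.le_add_left 1 k)).1⟩ hφf, Prod.ext ?_ ?_⟩
  · exact Lp.ext ((MemLp.coeFn_toLp hφm.memLp_wt).trans e1.symm)
  · exact Lp.ext ((MemLp.coeFn_toLp hφf.memLp_wt).trans e2.symm)

end Prof

/-! ### The free group and the nonlinearity on profiles -/

/-- Cubic estimate for the frequency weight. -/
theorem exists_wtNorm_hat_cubic_le (k : ℕ) : ∃ C : ℝ, 0 ≤ C ∧ ∀ (A B D : ℝ) (φ ψ χ : ℝ → ℂ),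
    Nice φ → Nice ψ → Nice χ → MemWt (k + 1) (hat φ) → MemWt (k + 1) (hat ψ) →
    MemWt (k + 1) (hat χ) →
    (∀ x, ‖φ x‖ ≤ A) → (∀ x, ‖ψ x‖ ≤ B) → (∀ x, ‖χ x‖ ≤ D) →
    MemWt (k + 1) (hat (cubic φ ψ χ)) ∧
      wtNorm (k + 1) (hat (cubic φ ψ χ)) ≤ C * (B * D * wtNorm (k + 1) (hat φ)
        + A * D * wtNorm (k + 1) (hat ψ) + A * B * wtNorm (k + 1) (hat χ)) := by
  obtain ⟨C, hC, hc⟩ := exists_semi_cubic_le (k + 1) k.succ_pos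
  refine ⟨C + 1, by positivity, fun A B D φ ψ χ hφ hψ hχ wφ wψ wχ hA hB hD => ?_⟩
  have hA0 : 0 ≤ A := (norm_nonneg _).trans (hA 0)
  have hB0 : 0 ≤ B := (norm_nonneg _).trans (hB 0)
  have hD0 : 0 ≤ D := (norm_nonneg _).trans (hD 0)
  have p1 := wtNorm_nonneg (k + 1) (hat φ)
  have p2 := wtNorm_nonneg (k + 1) (hat ψ)
  have p3 := wtNorm_nonneg (k + 1) (hat χ)
  have hs := hc A B D _ _ _ φ ψ χ hφ.bddL2 hψ.bddL2 hχ.bddL2 hφ.integrable hψ.integrable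
    hχ.integrable hA hB hD p1 p2 p3 (semi_le_wtNorm le_rfl hφ.integrable wφ)
    (semi_le_wtNorm le_rfl hψ.integrable wψ) (semi_le_wtNorm le_rfl hχ.integrable wχ)
  have hq := hφ.cubic hψ hχ
  have h2 : eLpNorm (hat (cubic φ ψ χ)) 2 volume
      ≤ ENNReal.ofReal (A * B * wtNorm (k + 1) (hat χ)) := by
    rw [eLpNorm_hat hq.integrable hq.bddL2.memLp]
    have h3 : eLpNorm χ 2 volume ≤ ENNReal.ofReal (wtNorm (k + 1) (hat χ)) := by
      rw [← eLpNorm_hat hχ.integrable hχ.bddL2.memLp]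
      have := (wχ.bound wχ.aesm (C := 1) fun x => by
        rw [one_mul]; exact le_mul_of_one_le_left (norm_nonneg _) (one_le_wt (k + 1) x)).2
      rwa [one_mul] at this
    have h4 : eLpNorm (cubic φ ψ χ) 2 volume ≤ ENNReal.ofReal (A * B) * eLpNorm χ 2 volume :=
      eLpNorm_le_mul_eLpNorm_of_ae_le_mul (Eventually.of_forall (norm_cubic_le hA hB)) 2
    rw [ENNReal.ofReal_mul (by positivity)]
    exact h4.trans (by gcongr)
  obtain ⟨h5, h6⟩ := memWt_of_bounds (continuous_hat hq.integrable).aestronglyMeasurable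
    (by positivity) (by positivity) h2 hs
  refine ⟨h5, h6.trans ?_⟩
  have q1 : 0 ≤ B * D * wtNorm (k + 1) (hat φ) := by positivity
  have q2 : 0 ≤ A * D * wtNorm (k + 1) (hat ψ) := by positivity
  nlinarith

theorem Nice.semi_symb_mul_le {F : ℝ → ℂ} (hF : Nice F) (s : ℝ) {a b : ℝ} (ha : 0 ≤ a)
    (hb : 0 ≤ b) (h1 : semi 1 F ≤ ENNReal.ofReal a)
    (h2 : eLpNorm (fun ξ : ℝ => (Complex.I * ξ) ^ 1 * F ξ) 2 volume ≤ ENNReal.ofReal b) :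
    semi 1 (fun ξ => symb s ξ * F ξ) ≤ ENNReal.ofReal (a + 2 * |s| * b) := by
  obtain ⟨g, hg, hg2, hg3⟩ := hF.exists_weakDeriv
  rw [(hF.hat_smooth_mul hg hg2 (contDiff_symb s) (hasDerivAt_symb s)
    (K := 1 + 2 * |s|) (fun ξ => by rw [norm_symb]; linarith [abs_nonneg s])
    (norm_symb_deriv_le s)).2, ENNReal.ofReal_add ha (by positivity)]
  have hc := (contDiff_symb s).continuous
  have hFc := hF.cont
  refine (eLpNorm_add_le (hc.aestronglyMeasurable.mul hg2.1)
    (Continuous.aestronglyMeasurable (by fun_prop)) (by norm_num)).trans (add_le_add ?_ ?_)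
  · refine le_trans (le_of_eq (eLpNorm_congr_norm_ae (Eventually.of_forall fun ξ => ?_)))
      (hg3.trans_le h1)
    change ‖symb s ξ * g ξ‖ = _
    rw [norm_mul, norm_symb, one_mul]
  · rw [ENNReal.ofReal_mul (by positivity)]
    refine le_trans (eLpNorm_le_mul_eLpNorm_of_ae_le_mul (Eventually.of_forall fun ξ => ?_) 2)
      (mul_le_mul_right h2 _)
    rw [norm_I_mul_pow, norm_mul, ← mul_assoc]
    refine mul_le_mul_of_nonneg_right (le_of_eq ?_) (norm_nonneg _)
    simp only [norm_mul, norm_neg, Complex.norm_I, Complex.norm_real, norm_symb,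
      Complex.norm_ofNat, Real.norm_eq_abs, mul_one, pow_one]

theorem eLpNorm_I_mul_reflect (φ : ℝ → ℂ) :
    eLpNorm (fun x : ℝ => (Complex.I * x) ^ 1 * hat φ (-x)) 2 volume = semi 1 φ := by
  have hneg : MeasurePreserving (fun x : ℝ => -x) volume volume := Measure.measurePreserving_neg _
  have hemb : MeasurableEmbedding (fun x : ℝ => -x) := (MeasurableEquiv.neg ℝ).measurableEmbedding
  rw [semi, ← hneg.map_eq, hemb.eLpNorm_map_measure, hneg.map_eq]
  refine eLpNorm_congr_norm_ae (Eventually.of_forall fun x => ?_)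
  rw [Function.comp, norm_I_mul_pow, norm_I_mul_pow, abs_neg, neg_neg]

namespace Prof

variable {k : ℕ}

theorem semi_hat_le (f : Prof k) : semi 1 (hat f) ≤ ENNReal.ofReal ‖f‖ :=
  f.nice.semi_hat_le.trans (ENNReal.ofReal_le_ofReal f.wtNorm_le)

theorem norm_apply_le (f : Prof k) (x : ℝ) : ‖f x‖ ≤ 2 * supConst * ‖f‖ := by
  refine (f.nice.norm_le x).trans ?_
  rw [mul_comm 2, mul_assoc]
  exact mul_le_mul_of_nonneg_left f.wtNorm_one_hat_le supConst_nonneg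

theorem norm_le_of {f : Prof k} {a : ℝ} (h1 : wtNorm 1 f ≤ a) (h2 : wtNorm (k + 1) (hat f) ≤ a) :
    ‖f‖ ≤ a := by rw [norm_eq]; exact max_le h1 h2

/-- The free group on the space. -/
def group (t : ℝ) (f : Prof k) : Prof k :=
  mk (freeGroup t f) (f.nice.freeGroup t) (f.nice.memWt_hat_freeGroup t f.freq).1

theorem group_apply (t : ℝ) (f : Prof k) (x : ℝ) : group t f x = freeGroup t f x := rfl

theorem coe_group (t : ℝ) (f : Prof k) : ⇑(group t f) = freeGroup t f := rfl

theorem hat_group (t : ℝ) (f : Prof k) (ξ : ℝ) : hat (group t f) ξ = symb t ξ * hat f ξ :=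
  f.nice.hat_freeGroup t ξ

theorem group_add (t : ℝ) (f g : Prof k) : group t (f + g) = group t f + group t g :=
  Prof.ext fun x => congrFun (f.nice.freeGroup_add g.nice t) x

theorem group_sub (t : ℝ) (f g : Prof k) : group t (f - g) = group t f - group t g :=
  Prof.ext fun x => congrFun (f.nice.freeGroup_sub g.nice t) x

theorem group_neg_group (t : ℝ) (f : Prof k) : group (-t) (group t f) = f :=
  Prof.ext fun x => congrFun (f.nice.freeGroup_neg_freeGroup t) x

theorem wtNorm_hat_group (t : ℝ) (f : Prof k) :
    wtNorm (k + 1) (hat (group t f)) = wtNorm (k + 1) (hat f) :=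
  (f.nice.memWt_hat_freeGroup t f.freq).2

/-- Norm bounds from the frequency side and the first moment. -/
theorem norm_le_of_semi {f : Prof k} {a b : ℝ} (ha : 0 ≤ a) (hb : 0 ≤ b)
    (h1 : wtNorm (k + 1) (hat f) ≤ a)
    (h2 : eLpNorm (fun x : ℝ => (Complex.I * x) ^ 1 * f x) 2 volume ≤ ENNReal.ofReal b) :
    ‖f‖ ≤ a + b := by
  refine norm_le_of ((memWt_of_bounds f.nice.wx.aesm ha hb ?_ h2).2) (by linarith)
  rw [← eLpNorm_hat f.nice.integrable f.nice.bddL2.memLp]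
  have := (f.freq.bound f.freq.aesm (C := 1) fun x => by
    rw [one_mul]; exact le_mul_of_one_le_left (norm_nonneg _) (one_le_wt (k + 1) x)).2
  rw [one_mul] at this
  exact this.trans (ENNReal.ofReal_le_ofReal h1)

theorem eLpNorm_I_mul_hat_le (f : Prof k) :
    eLpNorm (fun ξ : ℝ => (Complex.I * ξ) ^ 1 * hat f ξ) 2 volume
      ≤ ENNReal.ofReal (2 * ‖f‖) :=
  (semi_le_wtNorm le_rfl f.nice.integrable f.nice.wxi).trans
    (ENNReal.ofReal_le_ofReal f.wtNorm_one_hat_le)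

theorem norm_group_le (t : ℝ) (f : Prof k) : ‖group t f‖ ≤ (2 + 4 * |t|) * ‖f‖ := by
  have h : ‖group t f‖ ≤ ‖f‖ + (‖f‖ + 2 * |t| * (2 * ‖f‖)) := by
    refine norm_le_of_semi (norm_nonneg _) (by positivity)
      ((wtNorm_hat_group t f).trans_le f.wtNorm_hat_le) ?_
    simp only [group_apply, freeGroup_eq]
    rw [eLpNorm_I_mul_reflect fun ξ => symb t ξ * hat f ξ]
    exact f.nice.hat.semi_symb_mul_le t (norm_nonneg _) (by positivity) f.semi_hat_le
      f.eLpNorm_I_mul_hat_le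
  linarith

/-- `L²` norms tend to zero under dominated pointwise convergence. -/
theorem tendsto_eLpNorm_zero {F : ℝ → ℝ → ℂ} {G : ℝ → ℝ} (hG : MemLp G 2 volume) {t₀ : ℝ}
    (hF : ∀ t, AEStronglyMeasurable (F t) volume) (hb : ∀ᶠ t in 𝓝 t₀, ∀ x, ‖F t x‖ ≤ G x)
    (hl : ∀ x, Tendsto (fun t => F t x) (𝓝 t₀) (𝓝 0)) :
    Tendsto (fun t => eLpNorm (F t) 2 volume) (𝓝 t₀) (𝓝 0) := by
  have h1 : Tendsto (fun t => ∫ x, ‖F t x‖ ^ 2) (𝓝 t₀) (𝓝 (∫ _ : ℝ, (0 : ℝ))) := by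
    refine tendsto_integral_filter_of_dominated_convergence (fun x => G x ^ 2)
      (Eventually.of_forall fun t => (hF t).norm.pow 2) ?_ hG.integrable_sq
      (Eventually.of_forall fun x => ?_)
    · filter_upwards [hb] with t ht
      refine Eventually.of_forall fun x => ?_
      rw [Real.norm_of_nonneg (by positivity)]
      exact pow_le_pow_left₀ (norm_nonneg _) (ht x) 2
    · simpa using ((hl x).norm.pow 2)
  rw [integral_zero] at h1
  have h2 : Tendsto (fun t => ENNReal.ofReal (Real.sqrt (∫ x, ‖F t x‖ ^ 2))) (𝓝 t₀) (𝓝 0) := by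
    have := (ENNReal.continuous_ofReal.comp Real.continuous_sqrt).tendsto 0
    rw [Function.comp, Real.sqrt_zero, ENNReal.ofReal_zero] at this
    exact this.comp h1
  refine h2.congr' ?_
  filter_upwards [hb] with t ht
  refine (eLpNorm_two_eq (hG.of_le (hF t) (Eventually.of_forall fun x => ?_))).symm
  exact (ht x).trans (le_abs_self _)

theorem tendsto_group (f : Prof k) (t₀ : ℝ) :
    Tendsto (fun t => group t f) (𝓝 t₀) (𝓝 (group t₀ f)) := by
  set F := hat f with hFd
  have hF : Nice F := f.nice.hat
  have hFc := hF.cont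
  have hsy : ∀ t, Continuous (symb t) := continuous_symb_right
  have hsl : ∀ ξ, Tendsto (fun t => symb t ξ) (𝓝 t₀) (𝓝 (symb t₀ ξ)) := fun ξ =>
    (continuous_symb.comp (continuous_id.prodMk continuous_const)).tendsto t₀
  have hsl0 : ∀ ξ, Tendsto (fun t => symb t ξ - symb t₀ ξ) (𝓝 t₀) (𝓝 0) := fun ξ => by
    simpa using (hsl ξ).sub_const (symb t₀ ξ)
  have hs2 : ∀ t ξ, ‖symb t ξ - symb t₀ ξ‖ ≤ 2 := fun t ξ => by
    refine (norm_sub_le _ _).trans ?_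
    rw [norm_symb, norm_symb]; norm_num
  obtain ⟨g, hg, hg2, -⟩ := hF.exists_weakDeriv
  -- on the frequency side the symbol has modulus one, so pointwise convergence is dominated
  have l1 : Tendsto (fun t => wtNorm (k + 1) (hat (group t f - group t₀ f : Prof k))) (𝓝 t₀)
      (𝓝 0) := by
    have := tendsto_eLpNorm_zero (t₀ := t₀)
      (F := fun t ξ => (symb t ξ - symb t₀ ξ) * ((wt (k + 1) ξ : ℂ) * F ξ))
      (f.freq.memLp_wt.norm.const_mul 2)
      (fun t => ((hsy t).sub (hsy t₀)).aestronglyMeasurable.mul f.freq.1)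
      (Eventually.of_forall fun t ξ => by
        rw [norm_mul]
        exact mul_le_mul_of_nonneg_right (hs2 t ξ) (norm_nonneg _))
      (fun ξ => by simpa using (hsl0 ξ).mul_const _)
    have h2 := (ENNReal.tendsto_toReal ENNReal.zero_ne_top).comp this
    refine h2.congr fun t => ?_
    rw [Function.comp, wtNorm]
    congr 2; ext ξ
    rw [hat_sub, hat_group, hat_group]
    ring
  -- the first moment is the derivative of the transform, where the symbol costs a factor `|t||ξ|`
  have e2 : ∀ t, eLpNorm (fun x : ℝ => (Complex.I * x) ^ 1 * (group t f - group t₀ f : Prof k) x) 2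
      volume = eLpNorm (fun ξ => (symb t ξ - symb t₀ ξ) * g ξ + (-2 * Complex.I * t * ξ * symb t ξ -
        -2 * Complex.I * t₀ * ξ * symb t₀ ξ) * F ξ) 2 volume := by
    intro t
    have e3 : (fun x : ℝ => (Complex.I * x) ^ 1 * (group t f - group t₀ f : Prof k) x)
        = fun x : ℝ => (Complex.I * x) ^ 1 *
          hat (fun ξ => (symb t ξ - symb t₀ ξ) * F ξ) (-x) := by
      ext x
      congr 1
      simp only [coe_sub, group_apply, freeGroup_eq, sub_mul]
      rw [CoupledNLS.hat_sub (integrable_symb_mul hF.integrable t)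
        (integrable_symb_mul hF.integrable t₀)]
    rw [e3, eLpNorm_I_mul_reflect]
    refine (hF.hat_smooth_mul hg hg2 ((contDiff_symb t).sub (contDiff_symb t₀))
      (fun ξ => (hasDerivAt_symb t ξ).sub (hasDerivAt_symb t₀ ξ)) (K := 2 + 2 * |t| + 2 * |t₀|)
      (fun ξ => ?_) (fun ξ => ?_)).2
    · have := hs2 t ξ
      change ‖symb t ξ - symb t₀ ξ‖ ≤ _
      linarith [abs_nonneg t, abs_nonneg t₀]
    · refine (norm_sub_le _ _).trans ?_
      have h1 := norm_symb_deriv_le t ξ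
      have h2 := norm_symb_deriv_le t₀ ξ
      linarith
  have l2 : Tendsto (fun t => (eLpNorm (fun x : ℝ => (Complex.I * x) ^ 1 *
      (group t f - group t₀ f : Prof k) x) 2 volume).toReal) (𝓝 t₀) (𝓝 0) := by
    simp only [e2]
    refine (ENNReal.tendsto_toReal ENNReal.zero_ne_top).comp ?_
    have hGm : MemLp (fun ξ => 2 * ‖g ξ‖ + (2 + 2 * (|t₀| + 1) + 2 * |t₀|) *
        ‖(wt 1 ξ : ℂ) * F ξ‖) 2 volume :=
      (hg2.norm.const_mul 2).add (hF.wx.memLp_wt.norm.const_mul _)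
    refine tendsto_eLpNorm_zero hGm (fun t => ?_) ?_ fun ξ => ?_
    · have := hsy t
      have := hsy t₀
      exact ((((hsy t).sub (hsy t₀)).aestronglyMeasurable).mul hg2.1).add
        (Continuous.aestronglyMeasurable (by fun_prop))
    · have hev : ∀ᶠ t in 𝓝 t₀, |t| < |t₀| + 1 :=
        (continuous_abs.tendsto t₀).eventually_lt_const (lt_add_one _)
      filter_upwards [hev] with t ht ξ
      refine (norm_add_le _ _).trans (add_le_add ?_ ?_)
      · rw [norm_mul]
        exact mul_le_mul_of_nonneg_right (hs2 t ξ) (norm_nonneg _)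
      · rw [norm_mul, norm_wt_mul, ← mul_assoc]
        refine mul_le_mul_of_nonneg_right ?_ (norm_nonneg _)
        refine (norm_sub_le _ _).trans ?_
        have h1 := norm_symb_deriv_le t ξ
        have h2 := norm_symb_deriv_le t₀ ξ
        have h3 := (wt_pos 1 ξ).le
        have h4 := mul_le_mul_of_nonneg_right ht.le h3
        nlinarith
    · have t1 : Tendsto (fun t : ℝ => -2 * Complex.I * t * ξ * symb t ξ) (𝓝 t₀)
          (𝓝 (-2 * Complex.I * t₀ * ξ * symb t₀ ξ)) :=
        ((tendsto_const_nhds.mul (Complex.continuous_ofReal.tendsto t₀)).mul_const _).mul (hsl ξ)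
      have t2 := ((hsl0 ξ).mul_const (g ξ)).add
        ((t1.sub_const (-2 * Complex.I * t₀ * ξ * symb t₀ ξ)).mul_const (F ξ))
      simpa using t2
  rw [tendsto_iff_norm_sub_tendsto_zero]
  have l3 := l1.add l2
  rw [add_zero] at l3
  refine squeeze_zero (fun t => norm_nonneg _) (fun t => ?_) l3
  refine norm_le_of_semi (wtNorm_nonneg _ _) ENNReal.toReal_nonneg le_rfl ?_
  refine le_of_eq (ENNReal.ofReal_toReal ?_).symm
  set D : Prof k := group t f - group t₀ f
  refine ne_top_of_le_ne_top ENNReal.ofReal_ne_top (D.nice.wx.bound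
    (ψ := fun x : ℝ => (Complex.I * x) ^ 1 * D x) ?_ (C := 1) fun x => ?_).2
  · have := D.nice.cont
    exact Continuous.aestronglyMeasurable (by fun_prop)
  · rw [norm_I_mul_pow, one_mul]
    exact mul_le_mul_of_nonneg_right (pow_le_wt le_rfl x) (norm_nonneg _)

theorem continuous_group : Continuous fun p : ℝ × Prof k => group p.1 p.2 := by
  rw [continuous_iff_continuousAt]
  rintro ⟨t₀, f₀⟩
  rw [ContinuousAt, tendsto_iff_norm_sub_tendsto_zero]
  have h1 : Tendsto (fun p : ℝ × Prof k => (2 + 4 * |p.1|) * ‖p.2 - f₀‖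
      + ‖group p.1 f₀ - group t₀ f₀‖) (𝓝 (t₀, f₀)) (𝓝 ((2 + 4 * |t₀|) * ‖f₀ - f₀‖ + 0)) := by
    refine Tendsto.add ?_ ?_
    · exact Continuous.tendsto (by fun_prop) _
    · have := tendsto_iff_norm_sub_tendsto_zero.1 (tendsto_group f₀ t₀)
      exact this.comp (continuous_fst.tendsto _)
  simp only [sub_self, norm_zero, mul_zero, add_zero] at h1
  refine squeeze_zero (fun p => norm_nonneg _) (fun p => ?_) h1
  have : group p.1 p.2 - group t₀ f₀ = group p.1 (p.2 - f₀) + (group p.1 f₀ - group t₀ f₀) := by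
    rw [group_sub]; abel
  change ‖group p.1 p.2 - group t₀ f₀‖ ≤ _
  rw [this]
  refine (norm_add_le _ _).trans ?_
  gcongr
  exact norm_group_le _ _

end Prof

theorem norm_cubic_sub_le {z w p z' w' p' : ℂ} :
    ‖z * (starRingEnd ℂ) w * p - z' * (starRingEnd ℂ) w' * p'‖
      ≤ ‖z - z'‖ * ‖w‖ * ‖p‖ + ‖z'‖ * ‖w - w'‖ * ‖p‖ + ‖z'‖ * ‖w'‖ * ‖p - p'‖ := by
  have e : z * (starRingEnd ℂ) w * p - z' * (starRingEnd ℂ) w' * p'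
      = (z - z') * (starRingEnd ℂ) w * p + z' * (starRingEnd ℂ) (w - w') * p
        + z' * (starRingEnd ℂ) w' * (p - p') := by
    rw [map_sub]; ring
  rw [e]
  refine (norm_add₃_le).trans (le_of_eq ?_)
  simp only [norm_mul, RCLike.norm_conj]

/-- Telescoping estimate for a trilinear bounded map. -/
theorem norm_trilinear_sub_le {E : Type*} [SeminormedAddCommGroup E] {M : E → E → E → E}
    (h1 : ∀ f f' g h, M (f - f') g h = M f g h - M f' g h)
    (h2 : ∀ f g g' h, M f (g - g') h = M f g h - M f g' h)
    (h3 : ∀ f g h h', M f g (h - h') = M f g h - M f g h') {C : ℝ}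
    (hC : ∀ f g h, ‖M f g h‖ ≤ C * ‖f‖ * ‖g‖ * ‖h‖) (f g h f' g' h' : E) :
    ‖M f g h - M f' g' h'‖ ≤ C * (‖f - f'‖ * ‖g‖ * ‖h‖ + ‖f'‖ * ‖g - g'‖ * ‖h‖
      + ‖f'‖ * ‖g'‖ * ‖h - h'‖) := by
  have e : M f g h - M f' g' h' = M (f - f') g h + M f' (g - g') h + M f' g' (h - h') := by
    rw [h1, h2, h3]; abel
  rw [e]
  refine norm_add₃_le.trans ?_
  have a1 := hC (f - f') g h
  have a2 := hC f' (g - g') h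
  have a3 := hC f' g' (h - h')
  nlinarith

theorem continuous_trilinear {E : Type*} [SeminormedAddCommGroup E] {M : E → E → E → E}
    (h1 : ∀ f f' g h, M (f - f') g h = M f g h - M f' g h)
    (h2 : ∀ f g g' h, M f (g - g') h = M f g h - M f g' h)
    (h3 : ∀ f g h h', M f g (h - h') = M f g h - M f g h') {C : ℝ}
    (hC : ∀ f g h, ‖M f g h‖ ≤ C * ‖f‖ * ‖g‖ * ‖h‖) :
    Continuous fun p : E × E × E => M p.1 p.2.1 p.2.2 := by
  rw [continuous_iff_continuousAt]
  rintro ⟨f', g', h'⟩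
  rw [ContinuousAt, tendsto_iff_norm_sub_tendsto_zero]
  have hl : Tendsto (fun p : E × E × E => C * (‖p.1 - f'‖ * ‖p.2.1‖ * ‖p.2.2‖
      + ‖f'‖ * ‖p.2.1 - g'‖ * ‖p.2.2‖ + ‖f'‖ * ‖g'‖ * ‖p.2.2 - h'‖)) (𝓝 (f', g', h'))
      (𝓝 (C * (‖f' - f'‖ * ‖g'‖ * ‖h'‖ + ‖f'‖ * ‖g' - g'‖ * ‖h'‖ + ‖f'‖ * ‖g'‖ * ‖h' - h'‖))) :=
    Continuous.tendsto (by fun_prop) _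
  simp only [sub_self, norm_zero, mul_zero, zero_mul, add_zero] at hl
  exact squeeze_zero (fun _ => norm_nonneg _)
    (fun p => norm_trilinear_sub_le h1 h2 h3 hC p.1 p.2.1 p.2.2 f' g' h') hl

theorem Nice.norm_pconf_le {φ : ℝ → ℂ} (h : Nice φ) (t x : ℝ) :
    ‖CoupledNLS.pconf t φ x‖ ≤ supConst * wtNorm 1 φ := by
  refine ((h.hat.freeGroup (-(1 / (4 * t)))).norm_le x).trans ?_
  rw [(h.hat.memWt_hat_freeGroup (-(1 / (4 * t))) h.hat.wxi).2, h.wtNorm_hat_hat 1 h.wx]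

namespace Prof

variable {k : ℕ}

theorem memWt_hat_cubic (f g h : Prof k) : MemWt (k + 1) (hat (cubic f g h)) := by
  obtain ⟨C, -, hc⟩ := exists_wtNorm_hat_cubic_le k
  exact (hc _ _ _ f g h f.nice g.nice h.nice f.freq g.freq h.freq f.norm_apply_le g.norm_apply_le
    h.norm_apply_le).1

/-- The product `f · conj g · h`. -/
def cub (f g h : Prof k) : Prof k :=
  mk (cubic f g h) (f.nice.cubic g.nice h.nice) (memWt_hat_cubic f g h)

theorem cub_apply (f g h : Prof k) (x : ℝ) :
    cub f g h x = f x * (starRingEnd ℂ) (g x) * h x := rfl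

theorem cub_sub_left (f f' g h : Prof k) : cub (f - f') g h = cub f g h - cub f' g h :=
  Prof.ext fun x => by simp only [cub_apply, coe_sub]; ring

theorem cub_sub_mid (f g g' h : Prof k) : cub f (g - g') h = cub f g h - cub f g' h :=
  Prof.ext fun x => by simp only [cub_apply, coe_sub, map_sub]; ring

theorem cub_sub_right (f g h h' : Prof k) : cub f g (h - h') = cub f g h - cub f g h' :=
  Prof.ext fun x => by simp only [cub_apply, coe_sub]; ring

theorem exists_norm_cub_le (k : ℕ) :
    ∃ C : ℝ, 0 ≤ C ∧ ∀ f g h : Prof k, ‖cub f g h‖ ≤ C * ‖f‖ * ‖g‖ * ‖h‖ := by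
  obtain ⟨C, hC, hc⟩ := exists_wtNorm_hat_cubic_le k
  have hs := supConst_nonneg
  refine ⟨(1 + 3 * C) * (2 * supConst) ^ 2, by positivity, fun f g h => norm_le_of ?_ ?_⟩
  · have hb := (h.nice.wx.bound (ψ := fun x => (wt 1 x : ℂ) * cub f g h x)
      (C := (2 * supConst * ‖f‖) * (2 * supConst * ‖g‖)) (cub f g h).nice.wx.1 fun x => by
        rw [norm_wt_mul, mul_left_comm]
        exact mul_le_mul_of_nonneg_left (norm_cubic_le f.norm_apply_le g.norm_apply_le x)
          (wt_pos 1 x).le).2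
    refine (ENNReal.toReal_le_of_le_ofReal (mul_nonneg (by positivity) (wtNorm_nonneg _ _))
      hb).trans ?_
    calc 2 * supConst * ‖f‖ * (2 * supConst * ‖g‖) * wtNorm 1 h
        ≤ 2 * supConst * ‖f‖ * (2 * supConst * ‖g‖) * ‖h‖ := by gcongr; exact h.wtNorm_le
      _ = 1 * (2 * supConst) ^ 2 * ‖f‖ * ‖g‖ * ‖h‖ := by ring
      _ ≤ _ := by gcongr; linarith
  · refine (hc _ _ _ f g h f.nice g.nice h.nice f.freq g.freq h.freq f.norm_apply_le
      g.norm_apply_le h.norm_apply_le).2.trans ?_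
    have e1 := f.wtNorm_hat_le
    have e2 := g.wtNorm_hat_le
    have e3 := h.wtNorm_hat_le
    calc _ ≤ C * (2 * supConst * ‖g‖ * (2 * supConst * ‖h‖) * ‖f‖
          + 2 * supConst * ‖f‖ * (2 * supConst * ‖h‖) * ‖g‖
          + 2 * supConst * ‖f‖ * (2 * supConst * ‖g‖) * ‖h‖) := by gcongr
      _ = (3 * C) * (2 * supConst) ^ 2 * ‖f‖ * ‖g‖ * ‖h‖ := by ring
      _ ≤ _ := by gcongr; linarith

/-- The nonlinearity acting on profiles. -/
def tri (t : ℝ) (f g h : Prof k) : Prof k := group (-t) (cub (group t f) (group t g) (group t h))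

theorem coe_tri (t : ℝ) (f g h : Prof k) : ⇑(tri t f g h) = trip t f g h := rfl

theorem group_tri (t : ℝ) (f g h : Prof k) :
    group t (tri t f g h) = cub (group t f) (group t g) (group t h) := by
  have := group_neg_group (-t) (cub (group t f) (group t g) (group t h))
  rwa [neg_neg] at this

theorem tri_sub_left (t : ℝ) (f f' g h : Prof k) :
    tri t (f - f') g h = tri t f g h - tri t f' g h := by
  simp only [tri, group_sub, cub_sub_left]

theorem tri_sub_mid (t : ℝ) (f g g' h : Prof k) :
    tri t f (g - g') h = tri t f g h - tri t f g' h := by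
  simp only [tri, group_sub, cub_sub_mid]

theorem tri_sub_right (t : ℝ) (f g h h' : Prof k) :
    tri t f g (h - h') = tri t f g h - tri t f g h' := by
  simp only [tri, group_sub, cub_sub_right]

theorem continuous_cub : Continuous fun p : Prof k × Prof k × Prof k => cub p.1 p.2.1 p.2.2 := by
  obtain ⟨C, -, hC⟩ := exists_norm_cub_le k
  have h1 := @cub_sub_left k
  have h2 := @cub_sub_mid k
  have h3 := @cub_sub_right k
  have := @continuous_trilinear (Prof k) _ cub h1 h2 h3 C hC
  exact this

theorem _root_.Continuous.prof_group {α : Type*} [TopologicalSpace α] {s : α → ℝ} {f : α → Prof k}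
    (hs : Continuous s) (hf : Continuous f) : Continuous fun a => group (s a) (f a) := by
  have h1 := hs.prodMk hf
  have h2 := continuous_group (k := k)
  have h3 := Continuous.comp h2 h1
  exact h3

theorem _root_.Continuous.prof_cub {α : Type*} [TopologicalSpace α] {f g h : α → Prof k}
    (hf : Continuous f) (hg : Continuous g) (hh : Continuous h) :
    Continuous fun a => cub (f a) (g a) (h a) := by
  have h1 := hf.prodMk (hg.prodMk hh)
  have h2 := continuous_cub (k := k)
  have h3 := Continuous.comp h2 h1
  exact h3

theorem _root_.Continuous.prof_tri {α : Type*} [TopologicalSpace α] {s : α → ℝ}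
    {f g h : α → Prof k} (hs : Continuous s) (hf : Continuous f) (hg : Continuous g)
    (hh : Continuous h) : Continuous fun a => tri (s a) (f a) (g a) (h a) :=
  Continuous.prof_group hs.neg ((hs.prof_group hf).prof_cub (hs.prof_group hg) (hs.prof_group hh))

/-- The nonlinearity is bounded on the space uniformly in time, with the gain of two sup norms of
the linear evolutions. -/
theorem exists_norm_tri_le (k : ℕ) : ∃ C : ℝ, 0 ≤ C ∧ ∀ (t A B D : ℝ) (f g h : Prof k), 0 < t →
    (∀ x, ‖group t f x‖ ≤ A) → (∀ x, ‖group t g x‖ ≤ B) → (∀ x, ‖group t h x‖ ≤ D) →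
    ‖tri t f g h‖ ≤ C * (B * D * ‖f‖ + A * D * ‖g‖ + A * B * ‖h‖) := by
  obtain ⟨C, hC, hc⟩ := exists_wtNorm_hat_cubic_le k
  obtain ⟨C', hC', hc'⟩ := exists_semi_cubic_le 1 one_pos
  refine ⟨C + C', by positivity, fun t A B D f g h ht hA hB hD => ?_⟩
  have hA0 : 0 ≤ A := (norm_nonneg _).trans (hA 0)
  have hB0 : 0 ≤ B := (norm_nonneg _).trans (hB 0)
  have hD0 : 0 ≤ D := (norm_nonneg _).trans (hD 0)
  have hsum : 0 ≤ B * D * ‖f‖ + A * D * ‖g‖ + A * B * ‖h‖ := by positivity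
  rw [add_mul]
  refine norm_le_of_semi (by positivity) (by positivity) ?_ ?_
  · rw [tri, wtNorm_hat_group]
    refine (hc A B D _ _ _ (group t f).nice (group t g).nice (group t h).nice (group t f).freq
      (group t g).freq (group t h).freq hA hB hD).2.trans ?_
    simp only [wtNorm_hat_group]
    have e1 := f.wtNorm_hat_le
    have e2 := g.wtNorm_hat_le
    have e3 := h.wtNorm_hat_le
    gcongr
  · have hp : ∀ {φ : Prof k} {M : ℝ}, (∀ x, ‖group t φ x‖ ≤ M) →
        ∀ ξ, ‖pconf t φ ξ‖ ≤ Real.sqrt (2 * t) * M := by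
      intro φ M hM ξ
      have := hM (2 * t * ξ)
      rw [group_apply, φ.nice.norm_pconf_eq ht, inv_mul_le_iff₀ (by positivity)] at this
      exact this
    have hse : ∀ φ : Prof k, semi 1 (pconf t φ) ≤ ENNReal.ofReal ‖φ‖ := fun φ =>
      (φ.nice.semi_pconf_le t).trans (ENNReal.ofReal_le_ofReal φ.wtNorm_le)
    have n1 := f.nice.pconf t
    have n2 := g.nice.pconf t
    have n3 := h.nice.pconf t
    have h1 := hc' _ _ _ _ _ _ _ _ _ n1.bddL2 n2.bddL2 n3.bddL2 n1.integrable n2.integrable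
      n3.integrable (hp hA) (hp hB) (hp hD) (norm_nonneg _) (norm_nonneg _) (norm_nonneg _)
      (hse f) (hse g) (hse h)
    have n4 := n1.cubic n2 n3
    rw [coe_tri, trip_eq f.nice g.nice h.nice ht]
    have e1 : (fun x : ℝ => (Complex.I * x) ^ 1 * (((1 / (2 * t) : ℝ) : ℂ) *
        hat (freeGroup (1 / (4 * t)) (cubic (pconf t f) (pconf t g) (pconf t h))) (-x)))
        = ((1 / (2 * t) : ℝ) : ℂ) • fun x : ℝ => (Complex.I * x) ^ 1 *
        hat (freeGroup (1 / (4 * t)) (cubic (pconf t f) (pconf t g) (pconf t h))) (-x) := by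
      ext x; simp only [Pi.smul_apply, smul_eq_mul]; ring
    rw [e1, eLpNorm_const_smul, eLpNorm_I_mul_reflect, n4.semi_freeGroup, ← ofReal_norm,
      Complex.norm_real, Real.norm_of_nonneg (by positivity)]
    refine (mul_le_mul_right h1 _).trans ?_
    rw [← ENNReal.ofReal_mul (by positivity)]
    refine ENNReal.ofReal_le_ofReal (le_of_eq ?_)
    have hq : Real.sqrt (2 * t) * Real.sqrt (2 * t) = 2 * t := Real.mul_self_sqrt (by positivity)
    set q := Real.sqrt (2 * t)
    rw [show C' * (q * B * (q * D) * ‖f‖ + q * A * (q * D) * ‖g‖ + q * A * (q * B) * ‖h‖)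
      = q * q * (C' * (B * D * ‖f‖ + A * D * ‖g‖ + A * B * ‖h‖)) by ring, hq]
    field_simp

theorem norm_group_apply_le (t : ℝ) (f : Prof k) (x : ℝ) :
    ‖group t f x‖ ≤ 2 * supConst * ‖f‖ := by
  refine ((group t f).nice.norm_le x).trans ?_
  rw [coe_group, (f.nice.memWt_hat_freeGroup t f.nice.wxi).2, mul_comm 2, mul_assoc]
  exact mul_le_mul_of_nonneg_left f.wtNorm_one_hat_le supConst_nonneg

theorem exists_norm_tri_le' (k : ℕ) : ∃ C : ℝ, 0 ≤ C ∧ ∀ (t : ℝ) (f g h : Prof k), 0 < t →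
    ‖tri t f g h‖ ≤ C * ‖f‖ * ‖g‖ * ‖h‖ := by
  obtain ⟨C, hC, hc⟩ := exists_norm_tri_le k
  have hs := supConst_nonneg
  refine ⟨C * (3 * (2 * supConst) ^ 2), by positivity, fun t f g h ht => ?_⟩
  refine (hc t _ _ _ f g h ht (norm_group_apply_le t f) (norm_group_apply_le t g)
    (norm_group_apply_le t h)).trans (le_of_eq ?_)
  ring

/-- Dispersive decay of the linear evolution. -/
theorem norm_group_apply_le_of_hat (f : Prof k) {t : ℝ} (ht : 0 < t) {a : ℝ}
    (ha : ∀ ξ, ‖hat f ξ‖ ≤ a) (x : ℝ) :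
    ‖group t f x‖ ≤ (Real.sqrt (2 * t))⁻¹ * (a + 2 * t ^ (-1 / 4 : ℝ) * ‖f‖) := by
  have h1 := f.nice.norm_pconf_eq ht (x / (2 * t))
  rw [show 2 * t * (x / (2 * t)) = x by field_simp] at h1
  rw [group_apply, h1]
  refine mul_le_mul_of_nonneg_left ?_ (by positivity)
  have h2 := f.nice.norm_pconf_sub_le ht (x / (2 * t))
  have h3 := norm_le_norm_add_norm_sub' (pconf t f (x / (2 * t))) (hat f (x / (2 * t)))
  have h4 : 2 * t ^ (-1 / 4 : ℝ) * wtNorm 1 f ≤ 2 * t ^ (-1 / 4 : ℝ) * ‖f‖ := by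
    gcongr; exact f.wtNorm_le
  linarith [ha (x / (2 * t))]

/-- To leading order the nonlinearity acts on the Fourier side as the pointwise product
`(2t)⁻¹ f̂ · conj ĝ · ĥ`. -/
theorem exists_norm_hat_tri_sub_le (k : ℕ) : ∃ C : ℝ, 0 ≤ C ∧ ∀ (t : ℝ) (f g h : Prof k), 0 < t →
    ∀ ξ, ‖hat (tri t f g h) ξ - ((1 / (2 * t) : ℝ) : ℂ) * cubic (hat f) (hat g) (hat h) ξ‖
      ≤ C * t ^ (-5 / 4 : ℝ) * (‖f‖ * ‖g‖ * ‖h‖) := by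
  obtain ⟨C', hC', hc'⟩ := exists_semi_cubic_le 1 one_pos
  have hs := supConst_nonneg
  refine ⟨(3 * C' + 3) * supConst ^ 2, by positivity, fun t f g h ht ξ => ?_⟩
  have n1 := f.nice.pconf t
  have n2 := g.nice.pconf t
  have n3 := h.nice.pconf t
  have hp : ∀ (φ : Prof k) x, ‖pconf t φ x‖ ≤ supConst * ‖φ‖ := fun φ x =>
    (φ.nice.norm_pconf_le t x).trans (mul_le_mul_of_nonneg_left φ.wtNorm_le hs)
  have hse : ∀ φ : Prof k, semi 1 (pconf t φ) ≤ ENNReal.ofReal ‖φ‖ := fun φ =>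
    (φ.nice.semi_pconf_le t).trans (ENNReal.ofReal_le_ofReal φ.wtNorm_le)
  have hd : ∀ φ : Prof k, ‖pconf t φ ξ - hat φ ξ‖ ≤ 2 * t ^ (-1 / 4 : ℝ) * ‖φ‖ := fun φ =>
    (φ.nice.norm_pconf_sub_le ht ξ).trans
      (mul_le_mul_of_nonneg_left φ.wtNorm_le (by positivity))
  have h1 := hc' _ _ _ _ _ _ _ _ _ n1.bddL2 n2.bddL2 n3.bddL2 n1.integrable n2.integrable
    n3.integrable (hp f) (hp g) (hp h) (norm_nonneg _) (norm_nonneg _) (norm_nonneg _)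
    (hse f) (hse g) (hse h)
  have n4 := n1.cubic n2 n3
  set Q := cubic (pconf t f) (pconf t g) (pconf t h) with hQ
  set N := ‖f‖ * ‖g‖ * ‖h‖ with hN
  have hN0 : 0 ≤ N := by positivity
  have h2 := n4.norm_freeGroup_sub_le (1 / (4 * t)) (by positivity) h1 ξ
  have h3 : ‖freeGroup (1 / (4 * t)) Q ξ - Q ξ‖
      ≤ 2 * t ^ (-1 / 4 : ℝ) * (3 * C' * supConst ^ 2 * N) := by
    refine h2.trans (le_trans (mul_le_mul_of_nonneg_right (mul_le_mul_of_nonneg_left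
      (rpow_quarter_le ht _ (abs_of_pos (by positivity))) zero_le_two) (by positivity))
      (le_of_eq ?_))
    rw [hN]; ring
  have h4 : ‖Q ξ - cubic (hat f) (hat g) (hat h) ξ‖
      ≤ 2 * t ^ (-1 / 4 : ℝ) * (3 * supConst ^ 2 * N) := by
    refine (norm_cubic_sub_le).trans ?_
    have a1 := hp g ξ
    have a2 := hp h ξ
    have a3 := f.norm_hat_le ξ
    have a4 := g.norm_hat_le ξ
    have b1 := hd f
    have b2 := hd g
    have b3 := hd h
    calc _ ≤ 2 * t ^ (-1 / 4 : ℝ) * ‖f‖ * (supConst * ‖g‖) * (supConst * ‖h‖)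
          + supConst * ‖f‖ * (2 * t ^ (-1 / 4 : ℝ) * ‖g‖) * (supConst * ‖h‖)
          + supConst * ‖f‖ * (supConst * ‖g‖) * (2 * t ^ (-1 / 4 : ℝ) * ‖h‖) := by gcongr
      _ = _ := by rw [hN]; ring
  have h5 : hat (tri t f g h) ξ - ((1 / (2 * t) : ℝ) : ℂ) * cubic (hat f) (hat g) (hat h) ξ
      = ((1 / (2 * t) : ℝ) : ℂ) * ((freeGroup (1 / (4 * t)) Q ξ - Q ξ)
        + (Q ξ - cubic (hat f) (hat g) (hat h) ξ)) := by
    rw [coe_tri, hat_trip f.nice g.nice h.nice ht]; ring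
  rw [h5, norm_mul, Complex.norm_real, Real.norm_of_nonneg (by positivity)]
  have h6 : t ^ (-5 / 4 : ℝ) = t⁻¹ * t ^ (-1 / 4 : ℝ) := by
    rw [← Real.rpow_neg_one, ← Real.rpow_add ht]; norm_num
  calc 1 / (2 * t) * ‖(freeGroup (1 / (4 * t)) Q ξ - Q ξ)
        + (Q ξ - cubic (hat f) (hat g) (hat h) ξ)‖
      ≤ 1 / (2 * t) * (2 * t ^ (-1 / 4 : ℝ) * (3 * C' * supConst ^ 2 * N)
        + 2 * t ^ (-1 / 4 : ℝ) * (3 * supConst ^ 2 * N)) := by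
        gcongr
        exact (norm_add_le _ _).trans (add_le_add h3 h4)
    _ = _ := by
        rw [h6]; field_simp

end Prof

/-! ### Global solutions of Lipschitz differential equations -/

section Retraction

variable {E : Type*} [NormedAddCommGroup E] [NormedSpace ℝ E]

/-- The radial retraction onto the closed ball of radius `R > 0`. -/
def retract (R : ℝ) (x : E) : E := (R / max R ‖x‖) • x

theorem retract_of_le {R : ℝ} (hR : 0 < R) {x : E} (hx : ‖x‖ ≤ R) : retract R x = x := by
  rw [retract, max_eq_left hx, div_self hR.ne', one_smul]

theorem norm_retract_le {R : ℝ} (hR : 0 < R) (x : E) : ‖retract R x‖ ≤ R := by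
  have hm : 0 < max R ‖x‖ := lt_max_of_lt_left hR
  rw [retract, norm_smul, Real.norm_of_nonneg (by positivity), div_mul_eq_mul_div,
    div_le_iff₀ hm]
  exact mul_le_mul_of_nonneg_left (le_max_right _ _) hR.le

theorem norm_retract_sub_le {R : ℝ} (hR : 0 < R) (x y : E) :
    ‖retract R x - retract R y‖ ≤ 2 * ‖x - y‖ := by
  set a := max R ‖x‖ with ha
  set b := max R ‖y‖ with hb
  have ha0 : 0 < a := lt_max_of_lt_left hR
  have hb0 : 0 < b := lt_max_of_lt_left hR
  have e : retract R x - retract R y = (R / a) • (x - y) + (R / a - R / b) • y := by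
    rw [retract, retract, smul_sub, sub_smul]; abel
  have h1 : R / a ≤ 1 := (div_le_one ha0).2 (le_max_left _ _)
  have h2 : ‖y‖ / b ≤ 1 := (div_le_one hb0).2 (le_max_right _ _)
  have h3 : |b - a| ≤ ‖x - y‖ := by
    rw [ha, hb]
    refine (abs_max_sub_max_le_max _ _ _ _).trans ?_
    rw [sub_self, abs_zero, max_eq_right (abs_nonneg _), abs_sub_comm]
    exact abs_norm_sub_norm_le x y
  have h4 : ‖(R / a - R / b) • y‖ ≤ ‖x - y‖ := by
    have e2 : R / a - R / b = R / a * ((b - a) / b) := by field_simp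
    rw [norm_smul, e2, norm_mul, Real.norm_of_nonneg (by positivity : 0 ≤ R / a), norm_div,
      Real.norm_of_nonneg hb0.le, Real.norm_eq_abs]
    calc R / a * (|b - a| / b) * ‖y‖ = R / a * (|b - a| * (‖y‖ / b)) := by ring
      _ ≤ 1 * (|b - a| * 1) := by gcongr
      _ ≤ ‖x - y‖ := by linarith
  rw [e]
  refine (norm_add_le _ _).trans ?_
  have h5 : ‖(R / a) • (x - y)‖ ≤ ‖x - y‖ := by
    rw [norm_smul, Real.norm_of_nonneg (by positivity)]
    exact mul_le_of_le_one_left (norm_nonneg _) h1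
  linarith

end Retraction

/-- A bounded, globally Lipschitz, time dependent vector field has global integral curves. -/
theorem exists_integralCurve {E : Type*} [NormedAddCommGroup E] [NormedSpace ℝ E] [CompleteSpace E]
    {F : ℝ → E → E} (hc : ∀ x, Continuous fun t => F t x)
    (hl : ∀ T : ℝ, ∃ K : NNReal, ∀ t, |t| ≤ T → LipschitzWith K (F t))
    (hb : ∀ T : ℝ, ∃ L : NNReal, ∀ t, |t| ≤ T → ∀ x, ‖F t x‖ ≤ L) (x₀ : E) :
    ∃ α : ℝ → E, α 1 = x₀ ∧ ∀ t, HasDerivAt α (F t (α t)) t := by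
  have hloc : ∀ n : ℕ, ∃ α : ℝ → E, α 1 = x₀ ∧
      ∀ t ∈ Icc (-(n + 2 : ℝ)) (n + 2), HasDerivWithinAt α (F t (α t)) (Icc (-(n + 2)) (n + 2)) t := by
    intro n
    obtain ⟨K, hK⟩ := hl (n + 2)
    obtain ⟨L, hL⟩ := hb (n + 2)
    have hn : (0 : ℝ) ≤ n := n.cast_nonneg
    let t₀ : Icc (-(n + 2 : ℝ)) (n + 2) := ⟨1, by constructor <;> linarith⟩
    have : IsPicardLindelof F t₀ x₀ (L * (2 * (n + 2))) 0 L K :=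
      { lipschitzOnWith := fun t ht => (hK t (abs_le.2 ht)).lipschitzOnWith
        continuousOn := fun x _ => (hc x).continuousOn
        norm_le := fun t ht x _ => hL t (abs_le.2 ht) x
        mul_max_le := by
          push_cast
          rw [sub_zero]
          refine mul_le_mul_of_nonneg_left (max_le ?_ ?_) L.2 <;> simp [t₀] <;> linarith }
    exact this.exists_eq_forall_mem_Icc_hasDerivWithinAt₀
  choose α hα1 hα using hloc
  have hd : ∀ n : ℕ, ∀ t ∈ Ioo (-(n + 2 : ℝ)) (n + 2), HasDerivAt (α n) (F t (α n t)) t :=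
    fun n t ht => (hα n t (Ioo_subset_Icc_self ht)).hasDerivAt (Icc_mem_nhds ht.1 ht.2)
  have heq : ∀ n m : ℕ, n ≤ m → EqOn (α n) (α m) (Ioo (-(n + 2 : ℝ)) (n + 2)) := by
    intro n m hnm
    have hn : (0 : ℝ) ≤ n := n.cast_nonneg
    have hnm' : (n : ℝ) ≤ m := Nat.cast_le.2 hnm
    obtain ⟨K, hK⟩ := hl (n + 2)
    refine ODE_solution_unique_of_mem_Ioo (v := F) (s := fun _ => univ) (K := K) (t₀ := 1)
      (fun t ht => (hK t (abs_le.2 ⟨ht.1.le, ht.2.le⟩)).lipschitzOnWith)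
      (by constructor <;> linarith)
      (fun t ht => ⟨hd n t ht, mem_univ _⟩)
      (fun t ht => ⟨hd m t ⟨by linarith [ht.1], by linarith [ht.2]⟩, mem_univ _⟩)
      (by rw [hα1, hα1])
  refine ⟨fun t => α ⌈|t|⌉₊ t, by simpa using hα1 _, fun t => ?_⟩
  set n := ⌈|t|⌉₊ with hn
  have h1 : |t| ≤ n := Nat.le_ceil _
  have ht : t ∈ Ioo (-(n + 2 : ℝ)) (n + 2) := by
    have := abs_le.1 h1
    constructor <;> linarith
  refine (hd n t ht).congr_of_eventuallyEq ?_
  have hev : ∀ᶠ τ in 𝓝 t, |τ| < |t| + 1 :=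
    (continuous_abs.tendsto t).eventually_lt_const (lt_add_one _)
  filter_upwards [hev] with τ hτ
  have h2 : |τ| ≤ ⌈|τ|⌉₊ := Nat.le_ceil _
  rcases le_total ⌈|τ|⌉₊ n with h | h
  · refine heq _ _ h ?_
    have := abs_le.1 h2
    constructor <;> linarith
  · refine (heq _ _ h ?_).symm
    have := abs_lt.1 (hτ.trans_le (add_le_add_left h1 1))
    constructor <;> linarith

/-- Continuous induction: a closed condition that improves itself to a stable one persists. -/
theorem forall_of_bootstrap {P : ℝ → Prop} (hcl : ∀ T, IsClosed ({t | P t} ∩ Icc 1 T)) (h1 : P 1)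
    (hstep : ∀ t, 1 ≤ t → (∀ s ∈ Icc 1 t, P s) → ∀ᶠ s in 𝓝 t, P s) (t : ℝ) (ht : 1 ≤ t) : P t :=
  (hcl t).Icc_subset_of_forall_mem_nhdsGT_of_Icc_subset h1
    (fun s hs hsub => mem_nhdsWithin_of_mem_nhds (hstep s hs.1 fun _ hr => hsub hr)) ⟨ht, le_rfl⟩

/-! ### The equation for the profiles -/

/-- The vector field of the system, written on the pair of profiles. -/
def field (k : ℕ) (t : ℝ) (p : Prof k × Prof k) : Prof k × Prof k :=
  ((-Complex.I) • Prof.tri t p.2 p.2 p.1, (-Complex.I) • Prof.tri t p.1 p.1 p.2)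

theorem _root_.Continuous.field {k : ℕ} {α : Type*} [TopologicalSpace α] {s : α → ℝ}
    {p : α → Prof k × Prof k} (hs : Continuous s) (hp : Continuous p) :
    Continuous fun a => field k (s a) (p a) := by
  have h1 := (hs.prof_tri hp.snd hp.snd hp.fst).const_smul (-Complex.I)
  have h2 := (hs.prof_tri hp.fst hp.fst hp.snd).const_smul (-Complex.I)
  exact h1.prodMk h2

theorem norm_neg_I_smul {k : ℕ} (f : Prof k) : ‖(-Complex.I) • f‖ = ‖f‖ := by
  rw [norm_smul, norm_neg, Complex.norm_I, one_mul]

theorem exists_field_bounds (k : ℕ) : ∃ C : ℝ, 0 ≤ C ∧ ∀ t : ℝ, 1 ≤ t → ∀ R : ℝ,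
    (∀ p : Prof k × Prof k, ‖p‖ ≤ R → ‖field k t p‖ ≤ C * R ^ 3) ∧
    ∀ p q : Prof k × Prof k, ‖p‖ ≤ R → ‖q‖ ≤ R →
      ‖field k t p - field k t q‖ ≤ C * R ^ 2 * ‖p - q‖ := by
  obtain ⟨C, hC, hc⟩ := Prof.exists_norm_tri_le' k
  have h1 : ∀ t : ℝ, 1 ≤ t → ∀ (f g : Prof k) (R : ℝ), ‖f‖ ≤ R → ‖g‖ ≤ R →
      ‖Prof.tri t g g f‖ ≤ C * R ^ 3 := by
    intro t ht f g R hf hg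
    have hR : 0 ≤ R := (norm_nonneg _).trans hf
    refine (hc t g g f (by linarith)).trans ?_
    calc C * ‖g‖ * ‖g‖ * ‖f‖ ≤ C * R * R * R := by gcongr
      _ = C * R ^ 3 := by ring
  have h2 : ∀ t : ℝ, 1 ≤ t → ∀ (f g f' g' : Prof k) (R d : ℝ), ‖f‖ ≤ R → ‖g‖ ≤ R → ‖f'‖ ≤ R →
      ‖g'‖ ≤ R → ‖f - f'‖ ≤ d → ‖g - g'‖ ≤ d →
      ‖Prof.tri t g g f - Prof.tri t g' g' f'‖ ≤ 3 * C * R ^ 2 * d := by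
    intro t ht f g f' g' R d hf hg hf' hg' hd hd'
    have hR : 0 ≤ R := (norm_nonneg _).trans hf
    have hdp : 0 ≤ d := (norm_nonneg _).trans hd
    have b1 := @Prof.tri_sub_left k t
    have b2 := @Prof.tri_sub_mid k t
    have b3 := @Prof.tri_sub_right k t
    have b4 := fun f g h : Prof k => hc t f g h (by linarith)
    have := @norm_trilinear_sub_le (Prof k) _ (Prof.tri t) b1 b2 b3 C b4 g g f g' g' f'
    refine this.trans ?_
    calc C * (‖g - g'‖ * ‖g‖ * ‖f‖ + ‖g'‖ * ‖g - g'‖ * ‖f‖ + ‖g'‖ * ‖g'‖ * ‖f - f'‖)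
        ≤ C * (d * R * R + R * d * R + R * R * d) := by gcongr
      _ = _ := by ring
  refine ⟨3 * C, by positivity, fun t ht R => ⟨fun p hp => ?_, fun p q hp hq => ?_⟩⟩
  · have hR : 0 ≤ R := (norm_nonneg _).trans hp
    have e : C * R ^ 3 ≤ 3 * C * R ^ 3 := by nlinarith [pow_nonneg hR 3]
    refine norm_prod_le_iff.2 ⟨?_, ?_⟩ <;> refine le_trans (norm_neg_I_smul _).le (le_trans ?_ e)
    · exact h1 t ht _ _ R ((norm_fst_le p).trans hp) ((norm_snd_le p).trans hp)
    · exact h1 t ht _ _ R ((norm_snd_le p).trans hp) ((norm_fst_le p).trans hp)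
  · have a1 := norm_fst_le (p - q)
    have a2 := norm_snd_le (p - q)
    have b1 := (norm_fst_le p).trans hp
    have b2 := (norm_snd_le p).trans hp
    have b3 := (norm_fst_le q).trans hq
    have b4 := (norm_snd_le q).trans hq
    refine norm_prod_le_iff.2 ⟨?_, ?_⟩
    · change ‖(-Complex.I) • Prof.tri t p.2 p.2 p.1 - (-Complex.I) • Prof.tri t q.2 q.2 q.1‖ ≤ _
      rw [← smul_sub, norm_neg_I_smul]
      exact h2 t ht _ _ _ _ R _ b1 b2 b3 b4 a1 a2
    · change ‖(-Complex.I) • Prof.tri t p.1 p.1 p.2 - (-Complex.I) • Prof.tri t q.1 q.1 q.2‖ ≤ _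
      rw [← smul_sub, norm_neg_I_smul]
      exact h2 t ht _ _ _ _ R _ b2 b1 b4 b3 a2 a1

/-- Solutions of the profile equation are determined by their initial value. -/
theorem field_unique {k : ℕ} {α β : ℝ → Prof k × Prof k}
    (hα : ∀ t, 1 ≤ t → HasDerivWithinAt α (field k t (α t)) (Ici 1) t)
    (hβ : ∀ t, 1 ≤ t → HasDerivWithinAt β (field k t (β t)) (Ici 1) t) (h1 : α 1 = β 1)
    (T : ℝ) (hT : 1 ≤ T) : α T = β T := by
  obtain ⟨C, hC, hc⟩ := exists_field_bounds k
  have ca : ContinuousOn α (Icc 1 T) := fun t ht =>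
    ((hα t ht.1).continuousWithinAt).mono Icc_subset_Ici_self
  have cb : ContinuousOn β (Icc 1 T) := fun t ht =>
    ((hβ t ht.1).continuousWithinAt).mono Icc_subset_Ici_self
  obtain ⟨A, hA⟩ := isCompact_Icc.exists_bound_of_continuousOn ca
  obtain ⟨B, hB⟩ := isCompact_Icc.exists_bound_of_continuousOn cb
  set R := max A B
  have hR : 0 ≤ C * R ^ 2 := by positivity
  refine ODE_solution_unique_of_mem_Icc_right (v := field k) (K := ⟨C * R ^ 2, hR⟩)
    (s := fun _ => {p | ‖p‖ ≤ R}) (fun t ht => ?_) ca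
    (fun t ht => (hα t ht.1).mono (Ici_subset_Ici.2 ht.1))
    (fun t ht => (hA t (Ico_subset_Icc_self ht)).trans (le_max_left _ _)) cb
    (fun t ht => (hβ t ht.1).mono (Ici_subset_Ici.2 ht.1))
    (fun t ht => (hB t (Ico_subset_Icc_self ht)).trans (le_max_right _ _)) h1 ⟨hT, le_rfl⟩
  refine LipschitzOnWith.of_dist_le_mul fun p hp q hq => ?_
  rw [dist_eq_norm, dist_eq_norm]
  exact (hc t ht.1 R).2 p q hp hq

/-! ### Small data: the a priori bounds and global existence -/

/-- Integration of a power bound on a derivative. -/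
theorem norm_sub_le_of_deriv_rpow {E : Type*} [NormedAddCommGroup E] [NormedSpace ℝ E]
    {y y' : ℝ → E} {s t r K : ℝ} (hs : 0 < s) (hst : s ≤ t) (hr : r ≠ 0)
    (hy : ∀ τ ∈ Icc s t, HasDerivAt y (y' τ) τ) (hK : ∀ τ ∈ Icc s t, ‖y' τ‖ ≤ K * τ ^ (r - 1)) :
    ‖y t - y s‖ ≤ K / r * (t ^ r - s ^ r) := by
  have hB : ∀ τ ∈ Icc s t, HasDerivAt (fun τ : ℝ => K / r * (τ ^ r - s ^ r)) (K * τ ^ (r - 1)) τ := by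
    intro τ hτ
    have h1 := (((Real.hasDerivAt_rpow_const (p := r) (Or.inl (hs.trans_le hτ.1).ne')).sub_const
      (s ^ r))).const_mul (K / r)
    refine h1.congr_deriv ?_
    field_simp
  refine image_norm_le_of_norm_deriv_right_le_deriv_boundary' (f := fun τ => y τ - y s)
    (B := fun τ : ℝ => K / r * (τ ^ r - s ^ r))
    (f' := y') (B' := fun τ => K * τ ^ (r - 1)) (a := s) (b := t)
    (fun τ hτ => ((hy τ hτ).continuousAt.sub continuousAt_const).continuousWithinAt)
    (fun τ hτ => ((hy τ (Ico_subset_Icc_self hτ)).sub_const _).hasDerivWithinAt) (by simp)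
    (fun τ hτ => (hB τ hτ).continuousAt.continuousWithinAt)
    (fun τ hτ => (hB τ (Ico_subset_Icc_self hτ)).hasDerivWithinAt)
    (fun τ hτ => hK τ (Ico_subset_Icc_self hτ)) ⟨hst, le_rfl⟩

/-- The accumulated phase `∫₁ᵗ s⁻¹|ĝ(s,ξ)|² ds` along a curve of profiles. -/
def phaseOf {k : ℕ} (g : ℝ → Prof k) (t ξ : ℝ) : ℝ :=
  ∫ s in (1 : ℝ)..t, 1 / s * ‖hat (g s) ξ‖ ^ 2

theorem continuous_hat_curve {k : ℕ} {g : ℝ → Prof k} (hg : Continuous g) (ξ : ℝ) :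
    Continuous fun s => hat (g s) ξ :=
  (Prof.evalHat k ξ).continuous.comp hg

theorem hasDerivAt_phaseOf {k : ℕ} {g : ℝ → Prof k} (hg : Continuous g) {t : ℝ} (ht : 0 < t)
    (ξ : ℝ) : HasDerivAt (fun t => phaseOf g t ξ) (1 / t * ‖hat (g t) ξ‖ ^ 2) t := by
  have hc := continuous_hat_curve hg ξ
  have hco : ContinuousOn (fun s : ℝ => 1 / s * ‖hat (g s) ξ‖ ^ 2) (Ioi 0) := by
    refine ContinuousOn.mul (continuousOn_const.div continuousOn_id fun s hs => ne_of_gt hs) ?_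
    exact (hc.norm.pow 2).continuousOn
  refine intervalIntegral.integral_hasDerivAt_right ?_ ?_ (hco.continuousAt (Ioi_mem_nhds ht))
  · refine (hco.mono fun s hs => ?_).intervalIntegrable
    exact (lt_min one_pos ht).trans_le hs.1
  · exact hco.stronglyMeasurableAtFilter isOpen_Ioi t ht

/-- The Fourier transform of the profile with the phase removed. -/
def corrOf {k : ℕ} (f g : ℝ → Prof k) (t ξ : ℝ) : ℂ :=
  hat (f t) ξ * Complex.exp (Complex.I / 2 * (phaseOf g t ξ : ℂ))

theorem norm_exp_half_I (x : ℝ) : ‖Complex.exp (Complex.I / 2 * (x : ℂ))‖ = 1 := by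
  rw [show Complex.I / 2 * (x : ℂ) = ((x / 2 : ℝ) : ℂ) * Complex.I by push_cast; ring,
    Complex.norm_exp_ofReal_mul_I]

theorem norm_corrOf {k : ℕ} (f g : ℝ → Prof k) (t ξ : ℝ) : ‖corrOf f g t ξ‖ = ‖hat (f t) ξ‖ := by
  rw [corrOf, norm_mul, norm_exp_half_I, mul_one]

/-- The constant in the remainder estimate for the nonlinearity on the Fourier side. -/
def remConst (k : ℕ) : ℝ := (Prof.exists_norm_hat_tri_sub_le k).choose

theorem remConst_nonneg (k : ℕ) : 0 ≤ remConst k :=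
  (Prof.exists_norm_hat_tri_sub_le k).choose_spec.1

/-- Removing the phase cancels the part of the nonlinearity that is not integrable in time. -/
theorem exists_hasDerivAt_corrOf {k : ℕ} {f g : ℝ → Prof k} (hg : Continuous g) {t : ℝ}
    (ht : 0 < t) (hf : HasDerivAt f ((-Complex.I) • Prof.tri t (g t) (g t) (f t)) t) (ξ : ℝ) :
    ∃ w : ℂ, HasDerivAt (fun t => corrOf f g t ξ) w t ∧
      ‖w‖ ≤ remConst k * t ^ (-5 / 4 : ℝ) * (‖g t‖ * ‖g t‖ * ‖f t‖) := by
  have h1 : HasDerivAt (fun t => hat (f t) ξ)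
      (-Complex.I * hat (Prof.tri t (g t) (g t) (f t)) ξ) t := by
    have := ((Prof.evalHat k ξ).restrictScalars ℝ).hasFDerivAt.comp_hasDerivAt t hf
    refine this.congr_deriv ?_
    exact Prof.hat_smul _ _ ξ
  have h2 : HasDerivAt (fun t => Complex.exp (Complex.I / 2 * (phaseOf g t ξ : ℂ)))
      (Complex.exp (Complex.I / 2 * (phaseOf g t ξ : ℂ)) *
        (Complex.I / 2 * ((1 / t * ‖hat (g t) ξ‖ ^ 2 : ℝ) : ℂ))) t :=
    (((hasDerivAt_phaseOf hg ht ξ).ofReal_comp).const_mul (Complex.I / 2)).cexp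
  refine ⟨_, h1.mul h2, ?_⟩
  set e := Complex.exp (Complex.I / 2 * (phaseOf g t ξ : ℂ)) with he
  have hen : ‖e‖ = 1 := norm_exp_half_I _
  have h3 := (Prof.exists_norm_hat_tri_sub_le k).choose_spec.2 t (g t) (g t) (f t) ht ξ
  have e1 : -Complex.I * hat (Prof.tri t (g t) (g t) (f t)) ξ * e
      + hat (f t) ξ * (e * (Complex.I / 2 * ((1 / t * ‖hat (g t) ξ‖ ^ 2 : ℝ) : ℂ)))
      = -Complex.I * e * (hat (Prof.tri t (g t) (g t) (f t)) ξ
        - ((1 / (2 * t) : ℝ) : ℂ) * cubic (hat (g t)) (hat (g t)) (hat (f t)) ξ) := by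
    rw [cubic, Complex.mul_conj']
    push_cast
    have : (t : ℂ) ≠ 0 := by exact_mod_cast ht.ne'
    field_simp
    ring
  rw [e1, norm_mul, norm_mul, norm_neg, Complex.norm_I, hen, one_mul, one_mul]
  exact h3

/-- Growth estimate for the vector field under the bootstrap assumptions. -/
theorem exists_norm_field_le (k : ℕ) : ∃ C : ℝ, 0 ≤ C ∧ ∀ (t M δ : ℝ) (p : Prof k × Prof k),
    1 ≤ t → δ ≤ 1 / 4 → ‖p‖ ≤ M * t ^ δ → (∀ ξ, ‖hat p.1 ξ‖ ≤ M) → (∀ ξ, ‖hat p.2 ξ‖ ≤ M) →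
    ‖field k t p‖ ≤ C * M ^ 3 * t ^ (δ - 1) := by
  obtain ⟨C, hC, hc⟩ := Prof.exists_norm_tri_le k
  refine ⟨27 * C, by positivity, fun t M δ p ht hδ hp h1 h2 => ?_⟩
  have ht0 : 0 < t := by linarith
  have hM : 0 ≤ M := (norm_nonneg _).trans (h1 0)
  have hsup : ∀ f : Prof k, ‖f‖ ≤ M * t ^ δ → (∀ ξ, ‖hat f ξ‖ ≤ M) → ∀ x,
      ‖Prof.group t f x‖ ≤ 3 * M * t ^ (-1 / 2 : ℝ) := by
    intro f hf hfM x
    refine (f.norm_group_apply_le_of_hat ht0 hfM x).trans ?_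
    have e1 : t ^ (-1 / 4 : ℝ) * t ^ δ ≤ 1 := by
      rw [← Real.rpow_add ht0]
      exact Real.rpow_le_one_of_one_le_of_nonpos ht (by linarith)
    have e2 : (Real.sqrt (2 * t))⁻¹ ≤ t ^ (-1 / 2 : ℝ) := by
      rw [neg_div, Real.rpow_neg ht0.le, ← Real.sqrt_eq_rpow]
      exact inv_anti₀ (by positivity) (Real.sqrt_le_sqrt (by linarith))
    have e3 : M + 2 * t ^ (-1 / 4 : ℝ) * ‖f‖ ≤ 3 * M := by
      have : 2 * t ^ (-1 / 4 : ℝ) * ‖f‖ ≤ 2 * t ^ (-1 / 4 : ℝ) * (M * t ^ δ) := by gcongr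
      nlinarith
    calc _ ≤ t ^ (-1 / 2 : ℝ) * (3 * M) := by gcongr
      _ = _ := by ring
  have key : ∀ f g : Prof k, ‖f‖ ≤ M * t ^ δ → ‖g‖ ≤ M * t ^ δ → (∀ ξ, ‖hat f ξ‖ ≤ M) →
      (∀ ξ, ‖hat g ξ‖ ≤ M) → ‖Prof.tri t g g f‖ ≤ 27 * C * M ^ 3 * t ^ (δ - 1) := by
    intro f g hf hg hfM hgM
    refine (hc t _ _ _ g g f ht0 (hsup g hg hgM) (hsup g hg hgM) (hsup f hf hfM)).trans ?_
    have e4 : t ^ (δ - 1) = t ^ (-1 / 2 : ℝ) * t ^ (-1 / 2 : ℝ) * t ^ δ := by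
      rw [← Real.rpow_add ht0, ← Real.rpow_add ht0]; congr 1; ring
    set q := t ^ (-1 / 2 : ℝ)
    calc _ ≤ C * (3 * M * q * (3 * M * q) * (M * t ^ δ) + 3 * M * q * (3 * M * q) * (M * t ^ δ)
          + 3 * M * q * (3 * M * q) * (M * t ^ δ)) := by gcongr
      _ = _ := by rw [e4]; ring
  refine norm_prod_le_iff.2 ⟨?_, ?_⟩ <;> refine le_trans (norm_neg_I_smul _).le ?_
  · exact key _ _ ((norm_fst_le p).trans hp) ((norm_snd_le p).trans hp) h1 h2
  · exact key _ _ ((norm_snd_le p).trans hp) ((norm_fst_le p).trans hp) h2 h1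

/-- A global solution of the profile equation with the growth bound `t^δ` and bounded Fourier
transforms. -/
structure SmallFlow (k : ℕ) (M δ : ℝ) (α : ℝ → Prof k × Prof k) : Prop where
  cont : Continuous α
  deriv : ∀ t, 1 ≤ t → HasDerivAt α (field k t (α t)) t
  growth : ∀ t, 1 ≤ t → ‖α t‖ ≤ M * t ^ δ
  hat_fst : ∀ t, 1 ≤ t → ∀ ξ, ‖hat (α t).1 ξ‖ ≤ M
  hat_snd : ∀ t, 1 ≤ t → ∀ ξ, ‖hat (α t).2 ξ‖ ≤ M

theorem hasDerivAt_fst_of_field {k : ℕ} {α : ℝ → Prof k × Prof k} {t : ℝ}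
    (h : HasDerivAt α (field k t (α t)) t) : HasDerivAt (fun t => (α t).1)
      ((-Complex.I) • Prof.tri t (α t).2 (α t).2 (α t).1) t :=
  (hasFDerivAt_fst (𝕜 := ℝ) (p := α t)).comp_hasDerivAt t h

theorem hasDerivAt_snd_of_field {k : ℕ} {α : ℝ → Prof k × Prof k} {t : ℝ}
    (h : HasDerivAt α (field k t (α t)) t) : HasDerivAt (fun t => (α t).2)
      ((-Complex.I) • Prof.tri t (α t).1 (α t).1 (α t).2) t :=
  (hasFDerivAt_snd (𝕜 := ℝ) (p := α t)).comp_hasDerivAt t h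

/-- Under the bootstrap assumptions the sup norm of the transform of the profile grows by at most
a cubic amount. -/
theorem norm_hat_le_of_bootstrap {k : ℕ} {f g : ℝ → Prof k} (hg : Continuous g) {t M δ : ℝ}
    (ht : 1 ≤ t) (hδ : δ ≤ 1 / 16)
    (hf : ∀ τ ∈ Icc 1 t, HasDerivAt f ((-Complex.I) • Prof.tri τ (g τ) (g τ) (f τ)) τ)
    (hfM : ∀ τ ∈ Icc 1 t, ‖f τ‖ ≤ M * τ ^ δ) (hgM : ∀ τ ∈ Icc 1 t, ‖g τ‖ ≤ M * τ ^ δ) (ξ : ℝ) :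
    ‖hat (f t) ξ‖ ≤ ‖hat (f 1) ξ‖ + 16 * remConst k * M ^ 3 := by
  have hM : 0 ≤ M := by
    have := (norm_nonneg _).trans (hfM 1 ⟨le_rfl, ht⟩)
    rwa [Real.one_rpow, mul_one] at this
  have hK := remConst_nonneg k
  have hex : ∀ τ, ∃ w : ℂ, τ ∈ Icc 1 t → HasDerivAt (fun t => corrOf f g t ξ) w τ ∧
      ‖w‖ ≤ remConst k * τ ^ (-5 / 4 : ℝ) * (‖g τ‖ * ‖g τ‖ * ‖f τ‖) := by
    intro τ
    by_cases hτ : τ ∈ Icc 1 t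
    · obtain ⟨w, hw⟩ := exists_hasDerivAt_corrOf hg (by linarith [hτ.1]) (hf τ hτ) ξ
      exact ⟨w, fun _ => hw⟩
    · exact ⟨0, fun h => absurd h hτ⟩
  choose w hw using hex
  have h1 := norm_sub_le_of_deriv_rpow (y := fun t => corrOf f g t ξ) (y' := w) (r := -1 / 16)
    (K := remConst k * M ^ 3) one_pos ht (by norm_num) (fun τ hτ => (hw τ hτ).1) fun τ hτ => by
      have hτ0 : 0 < τ := by linarith [hτ.1]
      refine (hw τ hτ).2.trans ?_
      have e1 := hfM τ hτ
      have e2 := hgM τ hτ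
      have e3 : τ ^ (-5 / 4 : ℝ) * (τ ^ δ * τ ^ δ * τ ^ δ) ≤ τ ^ (-1 / 16 - 1 : ℝ) := by
        rw [← Real.rpow_add hτ0, ← Real.rpow_add hτ0, ← Real.rpow_add hτ0]
        exact Real.rpow_le_rpow_of_exponent_le hτ.1 (by linarith)
      calc _ ≤ remConst k * τ ^ (-5 / 4 : ℝ) * ((M * τ ^ δ) * (M * τ ^ δ) * (M * τ ^ δ)) := by
            gcongr
        _ = remConst k * M ^ 3 * (τ ^ (-5 / 4 : ℝ) * (τ ^ δ * τ ^ δ * τ ^ δ)) := by ring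
        _ ≤ _ := by gcongr
  have h2 := norm_le_norm_add_norm_sub' (corrOf f g t ξ) (corrOf f g 1 ξ)
  rw [norm_corrOf, norm_corrOf] at h2
  refine h2.trans (add_le_add le_rfl (h1.trans ?_))
  have h3 : 0 ≤ t ^ (-1 / 16 : ℝ) := by positivity
  rw [Real.one_rpow]
  have h4 : 0 ≤ remConst k * M ^ 3 := by positivity
  nlinarith

/-- Global existence for small data, by continuous induction on the growth of the norm and on the
sup norms of the transforms. -/
theorem exists_smallFlow (k : ℕ) {δ : ℝ} (hδ0 : 0 < δ) (hδ : δ ≤ 1 / 16) :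
    ∃ ε M : ℝ, 0 < ε ∧ 0 < M ∧ M ≤ 1 ∧ ∀ p : Prof k × Prof k, ‖p‖ ≤ ε →
      ∃ α, SmallFlow k M δ α ∧ α 1 = p := by
  obtain ⟨C, hC, hc⟩ := exists_norm_field_le k
  obtain ⟨L, hL, hl⟩ := exists_field_bounds k
  have hS := supConst_nonneg
  have hRC := remConst_nonneg k
  -- `1/δ` comes from integrating `t^(δ-1)`, and `16` from integrating the bound `t^(-1/16-1)` of
  -- the derivative of the corrected profiles
  obtain ⟨M, hM0, hM1, hMa, hMb⟩ : ∃ M : ℝ, 0 < M ∧ M ≤ 1 ∧ C * M / δ ≤ 1 / 4 ∧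
      16 * remConst k * M ≤ 1 / 4 := by
    refine ⟨1 / (1 + 4 * (C / δ) + 64 * remConst k), by positivity, ?_, ?_, ?_⟩
    · rw [div_le_one (by positivity)]
      have : 0 ≤ C / δ := by positivity
      linarith
    · have : 0 ≤ C / δ := by positivity
      rw [mul_div_right_comm, mul_one_div, div_le_iff₀ (by positivity)]
      linarith
    · have : 0 ≤ C / δ := by positivity
      rw [mul_one_div, div_le_iff₀ (by positivity)]
      linarith
  refine ⟨M / (4 * (1 + supConst)), M, by positivity, hM0, hM1, fun p hp => ?_⟩
  have hp1 : ‖p‖ ≤ M / 4 := by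
    refine hp.trans ?_
    gcongr
    linarith
  have hp2 : supConst * ‖p‖ ≤ M / 4 := by
    calc supConst * ‖p‖ ≤ (1 + supConst) * (M / (4 * (1 + supConst))) := by gcongr; linarith
      _ = M / 4 := by field_simp
  -- the field is only locally Lipschitz: composed with the retraction onto a ball growing like
  -- `t^δ` it has global integral curves
  set m : ℝ → ℝ := fun t => (max t 1) ^ δ with hm
  have hmc : Continuous m := (continuous_id.max continuous_const).rpow_const fun _ => Or.inr hδ0.le
  have hm1 : ∀ t, 1 ≤ m t := fun t => Real.one_le_rpow (le_max_right _ _) hδ0.le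
  have hmt : ∀ t, 1 ≤ t → m t = t ^ δ := fun t ht => by simp only [hm, max_eq_left ht]
  set R : ℝ → ℝ := fun t => 2 * M * m t with hR
  have hR0 : ∀ t, 0 < R t := fun t => by have := hm1 t; positivity
  set F : ℝ → Prof k × Prof k → Prof k × Prof k := fun t x =>
    field k (max t 1) (retract (R t) x) with hF
  have hRb : ∀ T t : ℝ, |t| ≤ T → R t ≤ R T := by
    intro T t ht
    have h1 : max t 1 ≤ max T 1 := max_le_max ((le_abs_self t).trans ht) le_rfl
    have h2 : m t ≤ m T := Real.rpow_le_rpow (by positivity) h1 hδ0.le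
    simp only [hR]
    gcongr
  have hFc : ∀ x, Continuous fun t => F t x := by
    intro x
    refine Continuous.field (continuous_id.max continuous_const) ?_
    unfold retract
    have : ∀ t, max (R t) ‖x‖ ≠ 0 := fun t => (lt_max_of_lt_left (hR0 t)).ne'
    have hRc : Continuous R := continuous_const.mul hmc
    exact (hRc.div (hRc.max continuous_const) this).smul continuous_const
  obtain ⟨α, hα1, hα⟩ := exists_integralCurve (F := F) hFc
    (fun T => ⟨⟨L * R T ^ 2 * 2, by positivity⟩, fun t ht => by
      refine LipschitzWith.of_dist_le_mul fun x y => ?_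
      rw [dist_eq_norm, dist_eq_norm]
      have h1 := (hl (max t 1) (le_max_right _ _) (R t)).2 _ _ (norm_retract_le (hR0 t) x)
        (norm_retract_le (hR0 t) y)
      have h2 := norm_retract_sub_le (hR0 t) x y
      have h3 := hRb T t ht
      have h4 := (hR0 t).le
      calc _ ≤ L * R t ^ 2 * ‖retract (R t) x - retract (R t) y‖ := h1
        _ ≤ L * R T ^ 2 * (2 * ‖x - y‖) := by gcongr
        _ = L * R T ^ 2 * 2 * ‖x - y‖ := by ring⟩)
    (fun T => ⟨⟨L * R T ^ 3, by have := (hR0 T).le; positivity⟩, fun t ht x => by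
      have h3 := hRb T t ht
      have h4 := (hR0 t).le
      refine ((hl (max t 1) (le_max_right _ _) (R t)).1 _ (norm_retract_le (hR0 t) x)).trans ?_
      change L * R t ^ 3 ≤ L * R T ^ 3
      gcongr⟩) p
  have hαc : Continuous α := continuous_iff_continuousAt.2 fun t => (hα t).continuousAt
  -- inside the ball the truncation is inactive
  have hder : ∀ t, 1 ≤ t → ‖α t‖ ≤ M * m t → HasDerivAt α (field k t (α t)) t := by
    intro t ht h
    have h1 := hα t
    simp only [hF] at h1
    rwa [max_eq_left ht, retract_of_le (hR0 t)] at h1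
    refine h.trans ?_
    have := hm1 t
    simp only [hR]
    nlinarith
  have hcf : Continuous fun t => (α t).1 := hαc.fst
  have hcg : Continuous fun t => (α t).2 := hαc.snd
  have key : ∀ t, 1 ≤ t → ‖α t‖ ≤ M * m t ∧ (∀ ξ, ‖hat (α t).1 ξ‖ ≤ M) ∧
      ∀ ξ, ‖hat (α t).2 ξ‖ ≤ M := by
    refine forall_of_bootstrap (fun T => IsClosed.inter ?_ isClosed_Icc) ?_ ?_
    · have hset : {t | ‖α t‖ ≤ M * m t ∧ (∀ ξ, ‖hat (α t).1 ξ‖ ≤ M) ∧ ∀ ξ, ‖hat (α t).2 ξ‖ ≤ M}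
          = {t | ‖α t‖ ≤ M * m t} ∩ ((⋂ ξ, {t | ‖hat (α t).1 ξ‖ ≤ M}) ∩
            ⋂ ξ, {t | ‖hat (α t).2 ξ‖ ≤ M}) := by
        ext t; simp
      rw [hset]
      exact (isClosed_le hαc.norm (continuous_const.mul hmc)).inter
        ((isClosed_iInter fun ξ => isClosed_le (continuous_hat_curve hcf ξ).norm
          continuous_const).inter (isClosed_iInter fun ξ =>
            isClosed_le (continuous_hat_curve hcg ξ).norm continuous_const))
    · have h1 := hm1 1
      rw [hα1]
      refine ⟨by nlinarith, fun ξ => (p.1.norm_hat_le ξ).trans ?_,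
        fun ξ => (p.2.norm_hat_le ξ).trans ?_⟩
      · have := mul_le_mul_of_nonneg_left (norm_fst_le p) hS
        linarith
      · have := mul_le_mul_of_nonneg_left (norm_snd_le p) hS
        linarith
    · intro t ht hP
      have hP1 : ∀ τ ∈ Icc 1 t, ‖α τ‖ ≤ M * τ ^ δ := fun τ hτ => by
        rw [← hmt τ hτ.1]; exact (hP τ hτ).1
      have hd : ∀ τ ∈ Icc 1 t, HasDerivAt α (field k τ (α τ)) τ := fun τ hτ =>
        hder τ hτ.1 (hP τ hτ).1
      have hM3 : M ^ 3 ≤ M ^ 2 := pow_le_pow_of_le_one hM0.le hM1 (by norm_num)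
      -- integrating the bound on the vector field recovers half of the assumed growth
      have i1 : ‖α t‖ ≤ M / 2 * t ^ δ := by
        have h1 := norm_sub_le_of_deriv_rpow one_pos ht hδ0.ne' hd fun τ hτ =>
          hc τ M δ (α τ) hτ.1 (by linarith) (hP1 τ hτ) (hP τ hτ).2.1 (hP τ hτ).2.2
        rw [hα1, Real.one_rpow] at h1
        have h2 := norm_le_norm_add_norm_sub' (α t) p
        have h3 : 1 ≤ t ^ δ := Real.one_le_rpow ht hδ0.le
        have h4 : C * M ^ 3 / δ ≤ M / 4 := by
          calc C * M ^ 3 / δ ≤ C * M ^ 2 / δ := by gcongr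
            _ = C * M / δ * M := by ring
            _ ≤ 1 / 4 * M := by gcongr
            _ = M / 4 := by ring
        have h5 : C * M ^ 3 / δ * (t ^ δ - 1) ≤ M / 4 * (t ^ δ - 1) :=
          mul_le_mul_of_nonneg_right h4 (by linarith)
        nlinarith
      -- the corrected profiles recover half of the assumed bound on the transforms
      have hM4 : 16 * remConst k * M ^ 3 ≤ M / 4 := by
        calc 16 * remConst k * M ^ 3 ≤ 16 * remConst k * M ^ 2 := by gcongr
          _ = 16 * remConst k * M * M := by ring
          _ ≤ 1 / 4 * M := by gcongr
          _ = M / 4 := by ring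
      have i2 : ∀ ξ, ‖hat (α t).1 ξ‖ ≤ M / 2 := by
        intro ξ
        refine (norm_hat_le_of_bootstrap hcg ht hδ
          (fun τ hτ => hasDerivAt_fst_of_field (hd τ hτ))
          (fun τ hτ => (norm_fst_le _).trans (hP1 τ hτ))
          (fun τ hτ => (norm_snd_le _).trans (hP1 τ hτ)) ξ).trans ?_
        have h1 := (α 1).1.norm_hat_le ξ
        rw [hα1] at h1 ⊢
        have h2 := mul_le_mul_of_nonneg_left (norm_fst_le p) hS
        linarith
      have i3 : ∀ ξ, ‖hat (α t).2 ξ‖ ≤ M / 2 := by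
        intro ξ
        refine (norm_hat_le_of_bootstrap hcf ht hδ
          (fun τ hτ => hasDerivAt_snd_of_field (hd τ hτ))
          (fun τ hτ => (norm_snd_le _).trans (hP1 τ hτ))
          (fun τ hτ => (norm_fst_le _).trans (hP1 τ hτ)) ξ).trans ?_
        have h1 := (α 1).2.norm_hat_le ξ
        rw [hα1] at h1 ⊢
        have h2 := mul_le_mul_of_nonneg_left (norm_snd_le p) hS
        linarith
      have ev1 : ∀ᶠ s in 𝓝 t, ‖α s‖ < M * m s := by
        refine hαc.norm.continuousAt.eventually_lt (continuous_const.mul hmc).continuousAt ?_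
        rw [hmt t ht]
        have : 1 ≤ t ^ δ := Real.one_le_rpow ht hδ0.le
        nlinarith
      have ev2 : ∀ᶠ s in 𝓝 t, supConst * ‖α s - α t‖ < M / 2 := by
        have hcn : Continuous fun s => supConst * ‖α s - α t‖ := by fun_prop
        refine (hcn.tendsto t).eventually_lt_const ?_
        simpa using hM0
      filter_upwards [ev1, ev2] with s h1 h2
      refine ⟨h1.le, fun ξ => ?_, fun ξ => ?_⟩
      · have h3 := norm_le_norm_add_norm_sub' (hat (α s).1 ξ) (hat (α t).1 ξ)
        have h4 := ((α s).1 - (α t).1).norm_hat_le ξ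
        rw [Prof.hat_sub] at h4
        have h5 := mul_le_mul_of_nonneg_left (norm_fst_le (α s - α t)) hS
        have h6 : (α s - α t).1 = (α s).1 - (α t).1 := rfl
        rw [h6] at h5
        linarith [i2 ξ]
      · have h3 := norm_le_norm_add_norm_sub' (hat (α s).2 ξ) (hat (α t).2 ξ)
        have h4 := ((α s).2 - (α t).2).norm_hat_le ξ
        rw [Prof.hat_sub] at h4
        have h5 := mul_le_mul_of_nonneg_left (norm_snd_le (α s - α t)) hS
        have h6 : (α s - α t).2 = (α s).2 - (α t).2 := rfl
        rw [h6] at h5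
        linarith [i3 ξ]
  exact ⟨α, ⟨hαc, fun t ht => hder t ht (key t ht).1,
    fun t ht => by rw [← hmt t ht]; exact (key t ht).1, fun t ht => (key t ht).2.1,
    fun t ht => (key t ht).2.2⟩, hα1⟩

section

open scoped SchwartzMap

/-! ### From profiles to solutions of the system -/

namespace Prof

variable {k : ℕ}

theorem ext_ae {f g : Prof k} (h : (f : ℝ → ℂ) =ᵐ[volume] g) : f = g :=
  Prof.ext (congrFun ((f.nice.cont.ae_eq_iff_eq volume g.nice.cont).1 h))

theorem ext_hat {f g : Prof k} (h : ∀ ξ, hat f ξ = hat g ξ) : f = g :=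
  Prof.ext (congrFun (f.nice.ext_hat g.nice h))

theorem dataNorm_le (f : Prof k) : dataNorm (k + 1) f ≤ ENNReal.ofReal ((k + 4) * ‖f‖) := by
  have h1 : ∀ i ∈ Finset.range (k + 1 + 1), weakDerivNorm i f ≤ ENNReal.ofReal ‖f‖ := by
    intro i hi
    have hi' : i ≤ k + 1 := Nat.lt_succ_iff.1 (Finset.mem_range.1 hi)
    have hs : eLpNorm (fun ξ : ℝ => (Complex.I * ξ) ^ i * hat f ξ) 2 volume
        ≤ ENNReal.ofReal ‖f‖ := (semi_le_wtNorm hi' f.nice.integrable f.freq).trans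
      (ENNReal.ofReal_le_ofReal f.wtNorm_hat_le)
    have hc := continuous_hat f.nice.integrable
    exact (weakDerivNorm_le f.nice.integrable ⟨Continuous.aestronglyMeasurable (by fun_prop),
      hs.trans_lt ENNReal.ofReal_lt_top⟩).trans hs
  have h2 : ∀ i ∈ Finset.range (1 + 1),
      eLpNorm (fun x : ℝ => (x : ℂ) ^ i * f x) 2 volume ≤ ENNReal.ofReal ‖f‖ := by
    intro i hi
    have hi' : i ≤ 1 := Nat.lt_succ_iff.1 (Finset.mem_range.1 hi)
    have hc := f.nice.cont
    have := (f.nice.wx.bound (ψ := fun x : ℝ => (x : ℂ) ^ i * f x) (C := 1)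
      (Continuous.aestronglyMeasurable (by fun_prop)) fun x => by
        rw [norm_mul, norm_pow, Complex.norm_real, Real.norm_eq_abs, one_mul]
        exact mul_le_mul_of_nonneg_right (pow_le_wt hi' x) (norm_nonneg _)).2
    rw [one_mul] at this
    exact this.trans (ENNReal.ofReal_le_ofReal f.wtNorm_le)
  rw [dataNorm, sobolevNorm, weightNorm]
  refine (add_le_add (Finset.sum_le_card_nsmul _ _ _ h1)
    (Finset.sum_le_card_nsmul _ _ _ h2)).trans ?_
  rw [Finset.card_range, Finset.card_range, ← add_smul, nsmul_eq_mul,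
    ENNReal.ofReal_mul (by positivity)]
  refine mul_le_mul_left (le_of_eq ?_) _
  rw [← ENNReal.ofReal_natCast]
  congr 1; push_cast; ring

/-- Every function of finite norm has a continuous representative in the space. -/
theorem exists_of_dataNorm {φ : ℝ → ℂ} (h : dataNorm (k + 1) φ < ⊤) :
    ∃ f : Prof k, (f : ℝ → ℂ) =ᵐ[volume] φ ∧ ‖f‖ ≤ (dataNorm (k + 1) φ).toReal := by
  have hs : sobolevNorm (k + 1) φ < ⊤ := lt_of_le_of_lt le_self_add h
  have hw : weightNorm 1 φ < ⊤ := lt_of_le_of_lt le_add_self h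
  have hw' : weightNorm 1 φ = eLpNorm φ 2 volume
      + eLpNorm (fun x : ℝ => (x : ℂ) * φ x) 2 volume := by
    simp [weightNorm, Finset.sum_range_succ]
  have hd : ∀ i ≤ k + 1, weakDerivNorm i φ ≤ sobolevNorm (k + 1) φ := fun i hi =>
    Finset.single_le_sum (f := fun i => weakDerivNorm i φ) (fun _ _ => zero_le)
      (Finset.mem_range.2 (Nat.lt_succ_of_le hi))
  have hmeas : AEStronglyMeasurable φ volume := by
    have := (hd 0 (Nat.zero_le _)).trans_lt hs
    simp only [weakDerivNorm, iInf_lt_iff] at this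
    obtain ⟨ψ, hψ, -⟩ := this
    exact hψ.1.aestronglyMeasurable
  have hf1 : eLpNorm φ 2 volume ≠ ⊤ := (lt_of_le_of_lt le_self_add (hw'.symm.trans_lt hw)).ne
  have hf2 : eLpNorm (fun x : ℝ => (x : ℂ) * φ x) 2 volume ≠ ⊤ :=
    (lt_of_le_of_lt le_add_self (hw'.symm.trans_lt hw)).ne
  have he : eLpNorm (fun x : ℝ => (Complex.I * x) ^ 1 * φ x) 2 volume
      = eLpNorm (fun x : ℝ => (x : ℂ) * φ x) 2 volume :=
    eLpNorm_congr_norm_ae (Eventually.of_forall fun x => by simp)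
  obtain ⟨m1, m2⟩ := memWt_of_bounds (k := 1) hmeas ENNReal.toReal_nonneg ENNReal.toReal_nonneg
    (ENNReal.ofReal_toReal hf1).ge (he.trans (ENNReal.ofReal_toReal hf2).symm).le
  rw [← ENNReal.toReal_add hf1 hf2, ← hw'] at m2
  have hi := m1.integrable.1
  obtain ⟨a1, a2⟩ := eLpNorm_le_weakDerivNorm (j := 0) hi ((hd 0 (Nat.zero_le _)).trans_lt hs)
  obtain ⟨b1, b2⟩ := eLpNorm_le_weakDerivNorm (j := k + 1) hi ((hd _ le_rfl).trans_lt hs)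
  simp only [pow_zero, one_mul] at a1 a2
  have hw0 : weakDerivNorm 0 φ ≠ ⊤ := ((hd 0 (Nat.zero_le _)).trans_lt hs).ne
  have hw1 : weakDerivNorm (k + 1) φ ≠ ⊤ := ((hd _ le_rfl).trans_lt hs).ne
  obtain ⟨c1, c2⟩ := memWt_of_bounds (k := k + 1) (continuous_hat hi).aestronglyMeasurable
    ENNReal.toReal_nonneg ENNReal.toReal_nonneg (a2.trans (ENNReal.ofReal_toReal hw0).ge)
    (b2.trans (ENNReal.ofReal_toReal hw1).ge)
  have c3 : wtNorm (k + 1) (hat φ) ≤ (sobolevNorm (k + 1) φ).toReal := by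
    refine c2.trans ?_
    rw [← ENNReal.toReal_add hw0 hw1]
    refine ENNReal.toReal_mono hs.ne ?_
    have := Finset.sum_le_sum_of_subset (f := fun i => weakDerivNorm i φ)
      (s := {0, k + 1}) (t := Finset.range (k + 1 + 1)) (by
        intro i; simp only [Finset.mem_insert, Finset.mem_singleton, Finset.mem_range]; omega)
    rwa [Finset.sum_pair (by omega)] at this
  have hih : Integrable (hat φ) := (c1.of_le (Nat.le_add_left 1 k)).1.integrable.1
  have hae := ae_eq_hat_hat hi hih
  set F : ℝ → ℂ := fun x => hat (hat φ) (-x) with hF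
  have hFh : hat F = hat φ := hat_congr_ae hae.symm
  have hFw : MemWt 1 F := (memLp_congr_ae (by
    filter_upwards [hae] with x hx; rw [hx])).1 m1.memLp_wt
  have hFn : wtNorm 1 F = wtNorm 1 φ := by
    rw [wtNorm, wtNorm]
    congr 1
    exact eLpNorm_congr_ae (by filter_upwards [hae] with x hx; rw [hx])
  have hN : Nice F := ⟨(continuous_hat hih).comp continuous_neg, hFw, by
    rw [hFh]; exact (c1.of_le (Nat.le_add_left 1 k)).1⟩
  refine ⟨mk F hN (by rw [hFh]; exact c1), hae.symm, norm_le_of ?_ ?_⟩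
  · change wtNorm 1 F ≤ _
    rw [hFn]
    exact m2.trans (ENNReal.toReal_mono h.ne le_add_self)
  · change wtNorm (k + 1) (hat F) ≤ _
    rw [hFh]
    exact c3.trans (ENNReal.toReal_mono h.ne le_self_add)

/-- The free group as a bounded operator. -/
def groupL (k : ℕ) (t : ℝ) : Prof k →L[ℂ] Prof k :=
  LinearMap.mkContinuous
    { toFun := group t
      map_add' := group_add t
      map_smul' := fun c f => Prof.ext fun x => congrFun (f.nice.freeGroup_const_mul c t) x }
    (2 + 4 * |t|) (norm_group_le t)

theorem groupL_apply (t : ℝ) (f : Prof k) : groupL k t f = group t f := rfl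

/-- Pairing with a bounded continuous function. -/
def pairL (k : ℕ) (η : ℝ → ℂ) (hη : Continuous η) (B : ℝ) (hB : ∀ x, ‖η x‖ ≤ B) :
    Prof k →L[ℂ] ℂ :=
  LinearMap.mkContinuous
    { toFun := fun f => ∫ x, f x * η x
      map_add' := fun f g => by
        simp only [coe_add, add_mul]
        exact integral_add (f.nice.integrable.mul_bdd (c := B) hη.aestronglyMeasurable
          (Eventually.of_forall hB)) (g.nice.integrable.mul_bdd (c := B) hη.aestronglyMeasurable
          (Eventually.of_forall hB))
      map_smul' := fun c f => by
        simp only [coe_smul, mul_assoc, RingHom.id_apply, smul_eq_mul]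
        exact integral_const_mul _ _ } (B * embConst) fun f => by
    have hB0 : 0 ≤ B := (norm_nonneg _).trans (hB 0)
    have h1 : ‖∫ x, f x * η x‖ ≤ ∫ x, B * ‖f x‖ := by
      refine norm_integral_le_of_norm_le (f.nice.integrable.norm.const_mul B)
        (Eventually.of_forall fun x => ?_)
      rw [norm_mul, mul_comm]
      exact mul_le_mul_of_nonneg_right (hB x) (norm_nonneg _)
    refine h1.trans ?_
    rw [integral_const_mul, mul_assoc]
    refine mul_le_mul_of_nonneg_left (f.nice.wx.integrable.2.trans ?_) hB0
    exact mul_le_mul_of_nonneg_left f.wtNorm_le embConst_nonneg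

theorem pairL_apply {η : ℝ → ℂ} (hη : Continuous η) {B : ℝ} (hB : ∀ x, ‖η x‖ ≤ B) (f : Prof k) :
    pairL k η hη B hB f = ∫ x, f x * η x := rfl

/-- Differentiation of `e^{is∂ₓₓ}` applied to a curve that vanishes at the base point. -/
theorem hasDerivAt_group_sub {f : ℝ → Prof k} {f' : Prof k} {t : ℝ} (hf : HasDerivAt f f' t) :
    HasDerivAt (fun s => group s (f s - f t)) (group t f') t := by
  rw [hasDerivAt_iff_tendsto_slope] at hf ⊢
  have h1 : Tendsto (fun s => group s (slope f t s)) (𝓝[≠] t) (𝓝 (group t f')) := by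
    have h2 : Tendsto (fun s => (s, slope f t s)) (𝓝[≠] t) (𝓝 (t, f')) :=
      (tendsto_nhdsWithin_of_tendsto_nhds tendsto_id).prodMk_nhds hf
    have h3 := (continuous_group (k := k)).tendsto (t, f')
    have h4 := Tendsto.comp h3 h2
    exact h4
  refine h1.congr fun s => ?_
  rw [slope_def_module, slope_def_module, sub_self, ← groupL_apply, ← groupL_apply,
    ← groupL_apply, (groupL k t).map_zero, sub_zero]
  exact (groupL k s).map_smul_of_tower _ _

end Prof

theorem hasDerivAt_symb_time (ξ t : ℝ) :
    HasDerivAt (fun s => symb s ξ) (-Complex.I * (ξ : ℂ) ^ 2 * symb t ξ) t := by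
  have h1 : HasDerivAt (fun s : ℝ => -Complex.I * s * (ξ : ℂ) ^ 2) (-Complex.I * (ξ : ℂ) ^ 2) t := by
    have := (((Complex.ofRealCLM.hasDerivAt (x := t)).const_mul (-Complex.I)).mul_const
      ((ξ : ℂ) ^ 2))
    simpa using this
  exact h1.cexp.congr_deriv (by rw [symb]; ring)

/-- The evolution of a differentiable curve of profiles solves the linear equation with the source
`i e^{it∂ₓₓ} f'`, in the sense of distributions. -/
theorem hasDerivAt_integral_group {k : ℕ} {f : ℝ → Prof k} {f' : Prof k} {t : ℝ}
    (hf : HasDerivAt f f' t) {η : ℝ → ℂ} (hη : IsTest η) :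
    ∃ d : ℂ, HasDerivAt (fun s => ∫ x, Prof.group s (f s) x * η x) d t ∧
      Complex.I * d + ∫ x, Prof.group t (f t) x * iteratedDeriv 2 η x
        = Complex.I * ∫ x, Prof.group t f' x * η x := by
  obtain ⟨θ', hθ'⟩ := hη.exists_schwartz
  set θ := ihatSchwartz θ' with hθ
  have hθη : hat θ = η := by rw [← hθ']; exact funext (hat_ihatSchwartz θ')
  obtain ⟨B, hB⟩ := hη.2.exists_bound_of_continuous hη.1.continuous
  have hpair : ∀ (g : Prof k) (j : ℕ), ∫ x, g x * iteratedDeriv j η x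
      = (-1) ^ j * ∫ ξ : ℝ, (Complex.I * ξ) ^ j * hat g ξ * θ ξ := fun g j => by
    rw [← hθη]; exact integral_mul_iteratedDeriv_hat g.nice.integrable j θ
  have hpair0 : ∀ g : Prof k, ∫ x, g x * η x = ∫ ξ, hat g ξ * θ ξ := fun g => by
    have := hpair g 0
    simpa using this
  -- for a fixed profile the time derivative falls on the symbol
  have hlin : HasDerivAt (fun s => ∫ ξ, hat (Prof.group s (f t)) ξ * θ ξ)
      (∫ ξ : ℝ, -Complex.I * (ξ : ℂ) ^ 2 * symb t ξ * hat (f t) ξ * θ ξ) t := by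
    have hc := continuous_hat (f t).nice.integrable
    have hθc : Continuous θ := θ.continuous
    simp only [Prof.hat_group]
    refine (hasDerivAt_integral_of_dominated_loc_of_deriv_le (x₀ := t) (s := univ)
      (bound := fun ξ : ℝ => supConst * ‖f t‖ * ‖(ξ : ℂ) ^ 2 * θ ξ‖)
      (F := fun s ξ => symb s ξ * hat (f t) ξ * θ ξ)
      (F' := fun s ξ => -Complex.I * (ξ : ℂ) ^ 2 * symb s ξ * hat (f t) ξ * θ ξ)
      univ_mem (Eventually.of_forall fun s => ?_) ?_ ?_ ?_ ?_ ?_).2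
    · have := continuous_symb_right s
      exact Continuous.aestronglyMeasurable (by fun_prop)
    · refine (integrable_symb_mul (f t).nice.integrable_hat t).mul_bdd
        (c := (SchwartzMap.seminorm ℝ 0 0) θ) hθc.aestronglyMeasurable
        (Eventually.of_forall fun ξ => θ.norm_le_seminorm ℝ ξ)
    · have := continuous_symb_right t
      exact Continuous.aestronglyMeasurable (by fun_prop)
    · refine Eventually.of_forall fun ξ s _ => ?_
      rw [norm_mul, norm_mul, norm_mul, norm_mul, norm_neg, Complex.norm_I, norm_symb, one_mul,
        mul_one, norm_mul]
      have := mul_le_mul_of_nonneg_right ((f t).norm_hat_le ξ)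
        (mul_nonneg (norm_nonneg ((ξ : ℂ) ^ 2)) (norm_nonneg (θ ξ)))
      linarith
    · exact (integrable_pow_mul_schwartz θ 2).norm.const_mul _
    · refine Eventually.of_forall fun ξ s _ => ?_
      exact ((hasDerivAt_symb_time ξ s).mul_const _).mul_const _
  -- the increment of the profile vanishes at `t`, so the unbounded generator does not act on it
  have hnl := ((Prof.pairL k η hη.1.continuous B hB).restrictScalars ℝ).hasFDerivAt.comp_hasDerivAt
    t (Prof.hasDerivAt_group_sub hf)
  refine ⟨_, (hlin.add hnl).congr_of_eventuallyEq (Eventually.of_forall fun s => ?_), ?_⟩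
  · change ∫ x, Prof.group s (f s) x * η x = (∫ ξ, hat (Prof.group s (f t)) ξ * θ ξ)
      + Prof.pairL k η hη.1.continuous B hB (Prof.group s (f s - f t))
    rw [← hpair0, Prof.group_sub, map_sub, Prof.pairL_apply, Prof.pairL_apply]
    ring
  · change Complex.I * ((∫ ξ : ℝ, -Complex.I * (ξ : ℂ) ^ 2 * symb t ξ * hat (f t) ξ * θ ξ)
      + Prof.pairL k η hη.1.continuous B hB (Prof.group t f')) + _ = _
    rw [hpair, Prof.pairL_apply, mul_add]
    have e : Complex.I * (∫ ξ : ℝ, -Complex.I * (ξ : ℂ) ^ 2 * symb t ξ * hat (f t) ξ * θ ξ)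
        + (-1) ^ 2 * ∫ ξ : ℝ, (Complex.I * ξ) ^ 2 * hat (Prof.group t (f t)) ξ * θ ξ = 0 := by
      rw [← integral_const_mul, neg_one_sq, one_mul, ← sub_neg_eq_add, sub_eq_zero,
        ← integral_neg]
      congr 1; ext ξ
      rw [Prof.hat_group]
      linear_combination (-(ξ : ℂ) ^ 2 * symb t ξ * hat (f t) ξ * θ ξ
        + (ξ : ℂ) ^ 2 * symb t ξ * hat (f t) ξ * θ ξ) * Complex.I_sq
    linear_combination e

/-- The evolution of a curve of profiles. -/
def evol {k : ℕ} (f : ℝ → Prof k) (t : ℝ) : ℝ → ℂ := Prof.group t (f t)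

theorem solvesEquation_evol {k : ℕ} {f g : ℝ → Prof k}
    (hf : ∀ t, 1 ≤ t → HasDerivAt f ((-Complex.I) • Prof.tri t (g t) (g t) (f t)) t) :
    SolvesEquation (evol f) (evol g) := by
  intro η hη t ht
  obtain ⟨d, hd, he⟩ := hasDerivAt_integral_group (hf t ht) hη
  refine ⟨d, hd.hasDerivWithinAt, ?_⟩
  change Complex.I * d + ∫ x, Prof.group t (f t) x * iteratedDeriv 2 η x = _
  rw [he, ← Prof.groupL_apply, map_smul, Prof.groupL_apply, Prof.group_tri, ← integral_const_mul]
  congr 1; ext x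
  simp only [Prof.coe_smul, Prof.cub_apply, evol]
  rw [Complex.mul_conj']
  push_cast
  linear_combination (-(((‖Prof.group t (g t) x‖ : ℂ)) ^ 2 * Prof.group t (f t) x * η x)) *
    Complex.I_sq

theorem continuousInSpace_evol {k : ℕ} {f : ℝ → Prof k} (hf : Continuous f) :
    ContinuousInSpace (k + 1) (evol f) := by
  refine ⟨fun t _ => (Prof.dataNorm_le (Prof.group t (f t))).trans_lt ENNReal.ofReal_lt_top,
    fun t₀ _ => ?_⟩
  have hc : Continuous fun t => Prof.group t (f t) := continuous_id.prof_group hf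
  have h1 : Tendsto (fun t => ENNReal.ofReal ((k + 4) * ‖Prof.group t (f t)
      - Prof.group t₀ (f t₀)‖)) (𝓝[Ici 1] t₀) (𝓝 0) := by
    have h2 : Continuous fun t => ENNReal.ofReal ((k + 4) * ‖Prof.group t (f t)
      - Prof.group t₀ (f t₀)‖) := ENNReal.continuous_ofReal.comp (by fun_prop)
    have h3 := (h2.tendsto t₀).mono_left (nhdsWithin_le_nhds (s := Ici 1))
    simpa using h3
  exact tendsto_of_tendsto_of_tendsto_of_le_of_le tendsto_const_nhds h1 (fun _ => zero_le)
    fun t => Prof.dataNorm_le (Prof.group t (f t) - Prof.group t₀ (f t₀))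

end

/-! ### From solutions of the system to profiles -/

theorem ContinuousInSpace.exists_curve {k : ℕ} {u : ℝ → ℝ → ℂ} (hu : ContinuousInSpace (k + 1) u) :
    ∃ U : ℝ → Prof k, (∀ t, 1 ≤ t → (U t : ℝ → ℂ) =ᵐ[volume] u t) ∧
      Continuous fun t => U (max t 1) := by
  have hex : ∀ t, ∃ f : Prof k, 1 ≤ t → (f : ℝ → ℂ) =ᵐ[volume] u t := by
    intro t
    by_cases ht : 1 ≤ t
    · obtain ⟨f, hf, -⟩ := Prof.exists_of_dataNorm (hu.1 t ht)
      exact ⟨f, fun _ => hf⟩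
    · exact ⟨0, fun h => absurd h ht⟩
  choose U hU using hex
  refine ⟨U, hU, ?_⟩
  have hon : ContinuousOn U (Ici 1) := by
    intro t₀ ht₀
    have h1 := hu.2 t₀ ht₀
    have h2 := (ENNReal.tendsto_toReal ENNReal.zero_ne_top).comp h1
    rw [ENNReal.toReal_zero] at h2
    rw [ContinuousWithinAt, tendsto_iff_norm_sub_tendsto_zero]
    have hfin : ∀ᶠ t in 𝓝[Ici 1] t₀, dataNorm (k + 1) (fun x => u t x - u t₀ x) < ⊤ :=
      h1.eventually_lt_const ENNReal.zero_lt_top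
    refine squeeze_zero' (Eventually.of_forall fun _ => norm_nonneg _) ?_ h2
    filter_upwards [hfin, self_mem_nhdsWithin] with t ht ht1
    obtain ⟨g, hg, hgn⟩ := Prof.exists_of_dataNorm ht
    have : U t - U t₀ = g := Prof.ext_ae (by
      filter_upwards [hg, hU t ht1, hU t₀ ht₀] with x h3 h4 h5
      rw [Prof.coe_sub, h3]
      simp only [h4, h5])
    rw [this]
    exact hgn
  exact hon.comp_continuous (continuous_id.max continuous_const) fun t => le_max_right t 1

/-- A curve whose Fourier transforms satisfy a differential equation pointwise satisfies it in the
space. -/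
theorem hasDerivWithinAt_of_hat {k : ℕ} {f N : ℝ → Prof k}
    (hN : Continuous N)
    (hd : ∀ ξ t, 1 ≤ t → HasDerivWithinAt (fun s => hat (f s) ξ) (hat (N t) ξ) (Ici 1) t)
    (t : ℝ) (ht : 1 ≤ t) : HasDerivWithinAt f (N t) (Ici 1) t := by
  have hint : ∀ a b, IntervalIntegrable N volume a b := fun a b => hN.intervalIntegrable a b
  have e : ∀ T, 1 ≤ T → f T = f 1 + ∫ s in (1 : ℝ)..T, N s := by
    intro T hT
    refine Prof.ext_hat fun ξ => ?_
    rw [Prof.hat_add]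
    have h1 := ((Prof.evalHat k ξ).restrictScalars ℝ).intervalIntegral_comp_comm (hint 1 T)
    change ∫ s in (1 : ℝ)..T, hat (N s) ξ = hat (∫ s in (1 : ℝ)..T, N s : Prof k) ξ at h1
    rw [← h1, intervalIntegral.integral_eq_sub_of_hasDeriv_right_of_le hT
      (f := fun s => hat (f s) ξ)]
    · ring
    · exact fun s hs => (hd ξ s hs.1).continuousWithinAt.mono Icc_subset_Ici_self
    · exact fun s hs => (hd ξ s hs.1.le).mono fun r hr => hs.1.le.trans (le_of_lt hr)
    · exact (continuous_hat_curve hN ξ).intervalIntegrable _ _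
  have h2 : HasDerivAt (fun T => f 1 + ∫ s in (1 : ℝ)..T, N s) (N t) t :=
    (intervalIntegral.integral_hasDerivAt_right (hint 1 t)
      (hN.stronglyMeasurableAtFilter _ _) hN.continuousAt).const_add _
  exact h2.hasDerivWithinAt.congr (fun T hT => e T hT) (e t ht)

theorem contDiff_planeWave (ξ : ℝ) : ContDiff ℝ ∞ fun x : ℝ => Complex.exp (-Complex.I * x * ξ) := by
  have : ContDiff ℝ ∞ fun x : ℝ => (x : ℂ) := Complex.ofRealCLM.contDiff
  fun_prop

theorem iteratedDeriv_planeWave (ξ : ℝ) (j : ℕ) (x : ℝ) :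
    iteratedDeriv j (fun x : ℝ => Complex.exp (-Complex.I * x * ξ)) x
      = (-Complex.I * ξ) ^ j * Complex.exp (-Complex.I * x * ξ) := by
  induction j generalizing x with
  | zero => simp
  | succ j ih =>
    rw [iteratedDeriv_succ, funext ih]
    have h1 : HasDerivAt (fun x : ℝ => -Complex.I * x * (ξ : ℂ)) (-Complex.I * ξ) x := by
      have := ((Complex.ofRealCLM.hasDerivAt (x := x)).const_mul (-Complex.I)).mul_const (ξ : ℂ)
      simpa using this
    rw [(h1.cexp.const_mul _).deriv]
    ring

theorem norm_iteratedDeriv_planeWave (ξ : ℝ) (j : ℕ) (x : ℝ) :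
    ‖iteratedDeriv j (fun x : ℝ => Complex.exp (-Complex.I * x * ξ)) x‖ = |ξ| ^ j := by
  rw [iteratedDeriv_planeWave, norm_mul, norm_exp_I_mul, mul_one, norm_pow, norm_mul, norm_neg,
    Complex.norm_I, one_mul, Complex.norm_real, Real.norm_eq_abs]

/-- The truncated plane waves have derivatives bounded uniformly in the truncation. -/
theorem exists_bound_cutoff_planeWave (ξ : ℝ) (j : ℕ) : ∃ B : ℝ, ∀ (n : ℕ) (x : ℝ),
    ‖iteratedDeriv j (fun x : ℝ => cutoff n x * Complex.exp (-Complex.I * x * ξ)) x‖ ≤ B := by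
  choose C hC using exists_bound_iteratedDeriv_cutoff
  refine ⟨∑ i ∈ Finset.range (j + 1), j.choose i * C i * |ξ| ^ (j - i), fun n x => ?_⟩
  have hle : ∀ f : ℝ → ℂ, ContDiff ℝ ∞ f → ContDiffAt ℝ j f x := fun f hf =>
    (hf.of_le (by exact_mod_cast le_top)).contDiffAt
  rw [iteratedDeriv_fun_mul (hle _ (contDiff_cutoff n)) (hle _ (contDiff_planeWave ξ))]
  refine (norm_sum_le _ _).trans (Finset.sum_le_sum fun i _ => ?_)
  rw [norm_mul, norm_mul, Complex.norm_natCast, norm_iteratedDeriv_planeWave]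
  gcongr
  exact hC i n x

theorem norm_integral_mul_le {k : ℕ} (f : Prof k) {η : ℝ → ℂ} {B : ℝ} (hB : ∀ x, ‖η x‖ ≤ B) :
    ‖∫ x, f x * η x‖ ≤ B * embConst * ‖f‖ := by
  have hB0 : 0 ≤ B := (norm_nonneg _).trans (hB 0)
  have h1 : ‖∫ x, f x * η x‖ ≤ ∫ x, B * ‖f x‖ := by
    refine norm_integral_le_of_norm_le (f.nice.integrable.norm.const_mul B)
      (Eventually.of_forall fun x => ?_)
    rw [norm_mul, mul_comm]
    exact mul_le_mul_of_nonneg_right (hB x) (norm_nonneg _)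
  refine h1.trans ?_
  rw [integral_const_mul, mul_assoc]
  exact mul_le_mul_of_nonneg_left (f.nice.wx.integrable.2.trans
    (mul_le_mul_of_nonneg_left f.wtNorm_le embConst_nonneg)) hB0

theorem integral_planeWave {k : ℕ} (f : Prof k) (ξ : ℝ) :
    ∫ x, f x * Complex.exp (-Complex.I * x * ξ) = (hatConst : ℂ)⁻¹ * hat f ξ := by
  rw [hat, inv_mul_cancel_left₀ (Complex.ofReal_ne_zero.2 hatConst_pos.ne')]
  congr 1; ext x; ring

/-- The equation for a fixed frequency, obtained by testing with truncated plane waves. -/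
theorem hasDerivWithinAt_hat_of_solves {k : ℕ} {u v : ℝ → ℝ → ℂ} (hs : SolvesEquation u v)
    {U V : ℝ → Prof k} (hU : ∀ t, 1 ≤ t → (U t : ℝ → ℂ) =ᵐ[volume] u t)
    (hV : ∀ t, 1 ≤ t → (V t : ℝ → ℂ) =ᵐ[volume] v t)
    (hUc : Continuous fun t => U (max t 1)) (hVc : Continuous fun t => V (max t 1))
    (ξ t : ℝ) (ht : 1 ≤ t) : HasDerivWithinAt (fun s => hat (U s) ξ)
      (-Complex.I * (ξ : ℂ) ^ 2 * hat (U t) ξ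
        - Complex.I * hat (Prof.cub (V t) (V t) (U t)) ξ) (Ici 1) t := by
  set Ue := fun t => U (max t 1) with hUe
  set Ne := fun t => Prof.cub (V (max t 1)) (V (max t 1)) (U (max t 1)) with hNe
  have hNc : Continuous Ne := hVc.prof_cub hVc hUc
  set e : ℝ → ℂ := fun x => Complex.exp (-Complex.I * x * ξ) with he
  have hec : ContDiff ℝ ∞ e := contDiff_planeWave ξ
  set η : ℕ → ℝ → ℂ := fun n x => cutoff n x * e x with hη
  have hηt : ∀ n, IsTest (η n) := fun n => isTest_cutoff_mul n hec
  obtain ⟨B0, hB0⟩ := exists_bound_cutoff_planeWave ξ 0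
  obtain ⟨B2, hB2⟩ := exists_bound_cutoff_planeWave ξ 2
  simp only [iteratedDeriv_zero] at hB0
  have hc0 : ∀ n, Continuous (η n) := fun n => (hηt n).1.continuous
  have hcj : ∀ j n, Continuous (iteratedDeriv j (η n)) := fun j n =>
    (hηt n).1.continuous_iteratedDeriv j (by exact_mod_cast le_top)
  have hc2 : ∀ n, Continuous (iteratedDeriv 2 (η n)) := hcj 2
  -- the equation tested with a truncated plane wave
  set d : ℕ → ℝ → ℂ := fun n s => Complex.I * (∫ x, Ue s x * iteratedDeriv 2 (η n) x)
    - Complex.I * ∫ x, Ne s x * η n x with hd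
  have hdc : ∀ n, Continuous (d n) := fun n =>
    (continuous_const.mul ((Prof.pairL k _ (hc2 n) B2 (hB2 n)).continuous.comp hUc)).sub
      (continuous_const.mul ((Prof.pairL k _ (hc0 n) B0 (hB0 n)).continuous.comp hNc))
  have hmax : ∀ s : ℝ, 1 ≤ s → max s 1 = s := fun s hs => max_eq_left hs
  have hder : ∀ n s, 1 ≤ s → HasDerivWithinAt (fun s => ∫ x, Ue s x * η n x) (d n s) (Ici 1) s := by
    intro n s hs1
    obtain ⟨d', hd', he'⟩ := hs (η n) (hηt n) s hs1
    have e1 : ∀ r, 1 ≤ r → ∀ ψ : ℝ → ℂ, ∫ x, Ue r x * ψ x = ∫ x, u r x * ψ x := by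
      intro r hr ψ
      simp only [hUe, hmax r hr]
      exact integral_congr_ae (by filter_upwards [hU r hr] with x hx; rw [hx])
    have e2 : ∫ x, Ne s x * η n x = ∫ x, ((‖v s x‖ ^ 2 : ℝ) : ℂ) * u s x * η n x := by
      simp only [hNe, hmax s hs1]
      refine integral_congr_ae ?_
      filter_upwards [hU s hs1, hV s hs1] with x hx hx'
      rw [Prof.cub_apply, hx, hx', Complex.mul_conj']
      push_cast; ring
    have e3 : d' = d n s := by
      simp only [hd]
      rw [e1 s hs1, e2]
      linear_combination (-Complex.I) * he' + d' * Complex.I_sq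
    rw [← e3]
    exact hd'.congr (fun r hr => e1 r hr _) (e1 s hs1 _)
  have hftc : ∀ n T, 1 ≤ T → ∫ s in (1 : ℝ)..T, d n s
      = (∫ x, Ue T x * η n x) - ∫ x, Ue 1 x * η n x := by
    intro n T hT
    refine intervalIntegral.integral_eq_sub_of_hasDeriv_right_of_le hT
      (f := fun s => ∫ x, Ue s x * η n x) ?_ ?_ ((hdc n).intervalIntegrable _ _)
    · exact fun s hs => (hder n s hs.1).continuousWithinAt.mono Icc_subset_Ici_self
    · exact fun s hs => (hder n s hs.1.le).mono fun r hr => hs.1.le.trans (le_of_lt hr)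
  -- removing the truncation turns the pairings into Fourier transforms
  have hlim : ∀ (f : Prof k) (j : ℕ), Tendsto (fun n => ∫ x, f x * iteratedDeriv j (η n) x) atTop
      (𝓝 ((-Complex.I * ξ) ^ j * ((hatConst : ℂ)⁻¹ * hat f ξ))) := by
    intro f j
    have h1 := tendsto_integral_cutoff hec j f.nice.integrable.1 fun i _ =>
      f.nice.integrable.mul_bdd (c := |ξ| ^ i) (hec.continuous_iteratedDeriv i
        (by exact_mod_cast le_top)).aestronglyMeasurable
        (Eventually.of_forall fun x => (norm_iteratedDeriv_planeWave ξ i x).le)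
    convert h1 using 2
    rw [← integral_planeWave, ← integral_const_mul]
    congr 1; ext x
    rw [iteratedDeriv_planeWave]; ring
  have hlim0 : ∀ f : Prof k, Tendsto (fun n => ∫ x, f x * η n x) atTop
      (𝓝 ((hatConst : ℂ)⁻¹ * hat f ξ)) := fun f => by
    have := hlim f 0
    simpa only [iteratedDeriv_zero, pow_zero, one_mul] using this
  set D : ℝ → ℂ := fun s => Complex.I * ((-Complex.I * ξ) ^ 2 * ((hatConst : ℂ)⁻¹ * hat (Ue s) ξ))
    - Complex.I * ((hatConst : ℂ)⁻¹ * hat (Ne s) ξ) with hD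
  have hDc : Continuous D := by
    have h1 := continuous_hat_curve hUc ξ
    have h2 := continuous_hat_curve hNc ξ
    exact (continuous_const.mul (continuous_const.mul (continuous_const.mul h1))).sub
      (continuous_const.mul (continuous_const.mul h2))
  have hfin : ∀ T, 1 ≤ T → ∫ s in (1 : ℝ)..T, D s
      = (hatConst : ℂ)⁻¹ * hat (Ue T) ξ - (hatConst : ℂ)⁻¹ * hat (Ue 1) ξ := by
    intro T hT
    have l1 : Tendsto (fun n => ∫ s in (1 : ℝ)..T, d n s) atTop (𝓝 (∫ s in (1 : ℝ)..T, D s)) := by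
      refine intervalIntegral.tendsto_integral_filter_of_dominated_convergence
        (fun s => B2 * embConst * ‖Ue s‖ + B0 * embConst * ‖Ne s‖)
        (Eventually.of_forall fun n => (hdc n).aestronglyMeasurable)
        (Eventually.of_forall fun n => Eventually.of_forall fun s _ => ?_)
        (Continuous.intervalIntegrable ((continuous_const.mul hUc.norm).add
          (continuous_const.mul hNc.norm)) _ _)
        (Eventually.of_forall fun s _ =>
          ((hlim (Ue s) 2).const_mul _).sub ((hlim0 (Ne s)).const_mul _))
      refine (norm_sub_le _ _).trans (add_le_add ?_ ?_)
      · rw [norm_mul, Complex.norm_I, one_mul]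
        exact norm_integral_mul_le _ (hB2 n)
      · rw [norm_mul, Complex.norm_I, one_mul]
        exact norm_integral_mul_le _ (hB0 n)
    refine tendsto_nhds_unique l1 ?_
    simp only [hftc _ T hT]
    exact (hlim0 (Ue T)).sub (hlim0 (Ue 1))
  have hh : (hatConst : ℂ) ≠ 0 := Complex.ofReal_ne_zero.2 hatConst_pos.ne'
  have heq : ∀ T, 1 ≤ T → hat (U T) ξ = hat (Ue 1) ξ + hatConst * ∫ s in (1 : ℝ)..T, D s := by
    intro T hT
    rw [hfin T hT, mul_sub, mul_inv_cancel_left₀ hh, mul_inv_cancel_left₀ hh, hUe]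
    simp only [hmax T hT]
    ring
  have hdd : HasDerivAt (fun T => hat (Ue 1) ξ + hatConst * ∫ s in (1 : ℝ)..T, D s)
      (hatConst * D t) t :=
    ((intervalIntegral.integral_hasDerivAt_right (hDc.intervalIntegrable _ _)
      (hDc.stronglyMeasurableAtFilter _ _) hDc.continuousAt).const_mul _).const_add _
  refine (hdd.hasDerivWithinAt.congr (fun T hT => heq T hT) (heq t ht)).congr_deriv ?_
  simp only [hD, hUe, hNe, hmax t ht]
  rw [mul_sub, mul_left_comm (hatConst : ℂ), mul_left_comm (hatConst : ℂ) ((-Complex.I * ξ) ^ 2),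
    mul_inv_cancel_left₀ hh, mul_left_comm (hatConst : ℂ), mul_inv_cancel_left₀ hh]
  linear_combination (Complex.I * (ξ : ℂ) ^ 2 * hat (U t) ξ) * Complex.I_sq

/-- The profiles of a solution satisfy the profile equation. -/
theorem hasDerivWithinAt_profile {k : ℕ} {u v : ℝ → ℝ → ℂ} (hs : SolvesEquation u v)
    {U V : ℝ → Prof k} (hU : ∀ t, 1 ≤ t → (U t : ℝ → ℂ) =ᵐ[volume] u t)
    (hV : ∀ t, 1 ≤ t → (V t : ℝ → ℂ) =ᵐ[volume] v t)
    (hUc : Continuous fun t => U (max t 1)) (hVc : Continuous fun t => V (max t 1))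
    (t : ℝ) (ht : 1 ≤ t) : HasDerivWithinAt (fun t => Prof.group (-t) (U t))
      ((-Complex.I) • Prof.tri t (Prof.group (-t) (V t)) (Prof.group (-t) (V t))
        (Prof.group (-t) (U t))) (Ici 1) t := by
  have hgg : ∀ (s : ℝ) (f : Prof k), Prof.group s (Prof.group (-s) f) = f := fun s f => by
    have := Prof.group_neg_group (-s) f
    rwa [neg_neg] at this
  have htri : ∀ s (f g : Prof k), Prof.tri s (Prof.group (-s) g) (Prof.group (-s) g)
      (Prof.group (-s) f) = Prof.group (-s) (Prof.cub g g f) := fun s f g => by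
    rw [Prof.tri, hgg, hgg]
  have hmc : Continuous fun s : ℝ => max s 1 := continuous_id.max continuous_const
  set N : ℝ → Prof k := fun s => (-Complex.I) • Prof.group (-(max s 1))
    (Prof.cub (V (max s 1)) (V (max s 1)) (U (max s 1))) with hN
  have hNc : Continuous N := (hmc.neg.prof_group (hVc.prof_cub hVc hUc)).const_smul (-Complex.I)
  have hNt : ∀ s, 1 ≤ s → N s = (-Complex.I) • Prof.group (-s) (Prof.cub (V s) (V s) (U s)) :=
    fun s h => by simp only [hN, max_eq_left h]
  rw [htri, ← hNt t ht]
  refine hasDerivWithinAt_of_hat hNc (fun ξ s h => ?_) t ht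
  rw [hNt s h]
  simp only [Prof.hat_group, Prof.hat_smul]
  have h1 : HasDerivAt (fun r => symb (-r) ξ) (Complex.I * (ξ : ℂ) ^ 2 * symb (-s) ξ) s := by
    have := (hasDerivAt_symb_time ξ (-s)).scomp s (hasDerivAt_neg s)
    refine this.congr_deriv ?_
    simp
  refine (h1.hasDerivWithinAt.mul
    (hasDerivWithinAt_hat_of_solves hs hU hV hUc hVc ξ s h)).congr_deriv ?_
  ring

/-- Uniqueness for the system: every solution is the evolution of the given profiles. -/
theorem IsSolution.eq_evol {k : ℕ} {u₁ v₁ : ℝ → ℂ} {u v : ℝ → ℝ → ℂ}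
    (h : IsSolution (k + 1) u₁ v₁ u v) {α : ℝ → Prof k × Prof k}
    (hα : ∀ t, 1 ≤ t → HasDerivAt α (field k t (α t)) t)
    (h1 : (Prof.group 1 (α 1).1 : ℝ → ℂ) =ᵐ[volume] u₁)
    (h2 : (Prof.group 1 (α 1).2 : ℝ → ℂ) =ᵐ[volume] v₁) (t : ℝ) (ht : 1 ≤ t) :
    u t =ᵐ[volume] evol (fun t => (α t).1) t ∧ v t =ᵐ[volume] evol (fun t => (α t).2) t := by
  obtain ⟨U, hU, hUc⟩ := h.cont_u.exists_curve
  obtain ⟨V, hV, hVc⟩ := h.cont_v.exists_curve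
  have e1 : U 1 = Prof.group 1 (α 1).1 :=
    Prof.ext_ae ((hU 1 le_rfl).trans (h.init_u.trans h1.symm))
  have e2 : V 1 = Prof.group 1 (α 1).2 :=
    Prof.ext_ae ((hV 1 le_rfl).trans (h.init_v.trans h2.symm))
  have huniq := field_unique (α := fun t => (Prof.group (-t) (U t), Prof.group (-t) (V t))) (β := α)
    (fun s hs => (hasDerivWithinAt_profile h.eq_u hU hV hUc hVc s hs).prodMk
      (hasDerivWithinAt_profile h.eq_v hV hU hVc hUc s hs))
    (fun s hs => (hα s hs).hasDerivWithinAt)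
    (by rw [e1, e2, Prof.group_neg_group, Prof.group_neg_group]) t ht
  have hgg : ∀ f : Prof k, Prof.group t (Prof.group (-t) f) = f := fun f => by
    have := Prof.group_neg_group (-t) f
    rwa [neg_neg] at this
  constructor
  · change u t =ᵐ[volume] (Prof.group t (α t).1 : Prof k)
    rw [← huniq, hgg]
    exact (hU t ht).symm
  · change v t =ᵐ[volume] (Prof.group t (α t).2 : Prof k)
    rw [← huniq, hgg]
    exact (hV t ht).symm

/-! ### Limits of the corrected profiles -/

theorem norm_sub_le_of_deriv_rpow_neg {E : Type*} [NormedAddCommGroup E] [NormedSpace ℝ E]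
    {y y' : ℝ → E} {s t r K : ℝ} (hs : 0 < s) (hst : s ≤ t) (hr : r < 0) (hK0 : 0 ≤ K)
    (hy : ∀ τ ∈ Icc s t, HasDerivAt y (y' τ) τ) (hK : ∀ τ ∈ Icc s t, ‖y' τ‖ ≤ K * τ ^ (r - 1)) :
    ‖y t - y s‖ ≤ K / -r * s ^ r := by
  refine (norm_sub_le_of_deriv_rpow hs hst hr.ne hy hK).trans ?_
  have h1 : 0 ≤ t ^ r := by
    have : 0 ≤ t := by linarith
    positivity
  have h2 : 0 ≤ K / -r := div_nonneg hK0 (by linarith)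
  rw [show K / r = -(K / -r) by rw [div_neg, neg_neg]]
  nlinarith

theorem exists_limit_of_rate {E : Type*} [NormedAddCommGroup E] [CompleteSpace E] {y : ℝ → E}
    {A r : ℝ} (hr : r < 0) (h : ∀ s t, 1 ≤ s → s ≤ t → ‖y t - y s‖ ≤ A * s ^ r) :
    ∃ l, Tendsto y atTop (𝓝 l) ∧ ∀ t, 1 ≤ t → ‖y t - l‖ ≤ A * t ^ r := by
  have hb : Tendsto (fun s : ℝ => A * (max s 1) ^ r) atTop (𝓝 0) := by
    have h1 : Tendsto (fun s : ℝ => A * s ^ r) atTop (𝓝 (A * 0)) := by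
      have h2 := tendsto_rpow_neg_atTop (y := -r) (by linarith)
      rw [neg_neg] at h2
      exact h2.const_mul A
    rw [mul_zero] at h1
    refine h1.congr' ?_
    filter_upwards [eventually_ge_atTop 1] with s hs
    rw [max_eq_left hs]
  have hc : CauchySeq fun t => y (max t 1) := by
    refine cauchySeq_of_le_tendsto_0' _ (fun s t hst => ?_) hb
    rw [dist_eq_norm, norm_sub_rev]
    exact h _ _ (le_max_right _ _) (max_le_max_right _ hst)
  obtain ⟨l, hl⟩ := cauchySeq_tendsto_of_complete hc
  have hl' : Tendsto y atTop (𝓝 l) := hl.congr' (by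
    filter_upwards [eventually_ge_atTop 1] with s hs
    rw [max_eq_left hs])
  refine ⟨l, hl', fun t ht => ?_⟩
  have h3 : Tendsto (fun T => ‖y t - y T‖) atTop (𝓝 ‖y t - l‖) :=
    (tendsto_const_nhds.sub hl').norm
  refine le_of_tendsto h3 ?_
  filter_upwards [eventually_ge_atTop t] with T hT
  rw [norm_sub_rev]
  exact h t T ht hT

/-- A power bound on the dyadic increments, summed as a geometric series, gives the same power
bound on the distance to the limit in `L²`. -/
theorem eLpNorm_sub_le_of_dyadic {F : ℝ → ℝ → ℂ} {G : ℝ → ℂ} {A σ : ℝ} (hA : 0 ≤ A) (hσ : σ < 0)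
    (hF : ∀ t, 1 ≤ t → AEStronglyMeasurable (F t) volume)
    (hd : ∀ t, 1 ≤ t → eLpNorm (fun ξ => F (2 * t) ξ - F t ξ) 2 volume
      ≤ ENNReal.ofReal (A * t ^ σ))
    (hl : ∀ ξ, Tendsto (fun t => F t ξ) atTop (𝓝 (G ξ))) {t : ℝ} (ht : 1 ≤ t) :
    eLpNorm (fun ξ => F t ξ - G ξ) 2 volume ≤ ENNReal.ofReal (A / (1 - 2 ^ σ) * t ^ σ) := by
  have hq : (2 : ℝ) ^ σ < 1 := Real.rpow_lt_one_of_one_lt_of_neg one_lt_two hσ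
  have ht0 : 0 < t := by linarith
  have hpow : ∀ N : ℕ, 1 ≤ 2 ^ N * t := fun N =>
    one_le_mul_of_one_le_of_one_le (one_le_pow₀ one_le_two) ht
  have hN : ∀ N : ℕ, eLpNorm (fun ξ => F t ξ - F (2 ^ N * t) ξ) 2 volume
      ≤ ENNReal.ofReal (A / (1 - 2 ^ σ) * (t ^ σ - (2 ^ N * t) ^ σ)) := by
    intro N
    induction N with
    | zero => simp
    | succ N ih =>
      set r := 2 ^ N * t with hr
      have hr0 : 0 < r := by positivity
      have e : 2 ^ (N + 1) * t = 2 * r := by rw [hr]; ring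
      rw [e]
      have h1 : (fun ξ => F t ξ - F (2 * r) ξ)
          = (fun ξ => F t ξ - F r ξ) - fun ξ => F (2 * r) ξ - F r ξ := by
        ext ξ; simp
      rw [h1]
      have hle : r ^ σ ≤ t ^ σ := Real.rpow_le_rpow_of_nonpos ht0
        (le_mul_of_one_le_left ht0.le (one_le_pow₀ one_le_two)) hσ.le
      have hpos : 0 ≤ A / (1 - 2 ^ σ) := div_nonneg hA (by linarith)
      refine (eLpNorm_sub_le ((hF t ht).sub (hF r (hpow N)))
        ((hF _ (by linarith [hpow N])).sub (hF r (hpow N))) (by norm_num)).trans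
        ((add_le_add ih (hd r (hpow N))).trans ?_)
      rw [← ENNReal.ofReal_add (mul_nonneg hpos (by linarith)) (by positivity)]
      refine ENNReal.ofReal_le_ofReal (le_of_eq ?_)
      rw [Real.mul_rpow zero_le_two hr0.le]
      have : 1 - (2 : ℝ) ^ σ ≠ 0 := by linarith
      field_simp
      ring
  have hlim : ∀ ξ, Tendsto (fun N : ℕ => F t ξ - F (2 ^ N * t) ξ) atTop (𝓝 (F t ξ - G ξ)) := by
    intro ξ
    have h1 : Tendsto (fun N : ℕ => (2 : ℝ) ^ N * t) atTop atTop :=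
      (tendsto_pow_atTop_atTop_of_one_lt one_lt_two).atTop_mul_const ht0
    exact tendsto_const_nhds.sub ((hl ξ).comp h1)
  refine (Lp.eLpNorm_lim_le_liminf_eLpNorm (fun N => (hF t ht).sub (hF _ (hpow N))) _
    (Eventually.of_forall hlim)).trans ?_
  refine Filter.liminf_le_of_frequently_le' (Frequently.of_forall fun N => (hN N).trans ?_)
  refine ENNReal.ofReal_le_ofReal (mul_le_mul_of_nonneg_left ?_ (div_nonneg hA (by linarith)))
  have : 0 ≤ (2 ^ N * t) ^ σ := by positivity
  linarith

theorem Prof.integral_pow_mul_norm_hat_le {k j : ℕ} (f : Prof k) (hj : j ≤ k) :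
    Integrable (fun ξ : ℝ => |ξ| ^ j * ‖hat f ξ‖) ∧
      ∫ ξ : ℝ, |ξ| ^ j * ‖hat f ξ‖ ≤ 2 * embConst * ‖f‖ := by
  have hm : AEStronglyMeasurable (fun ξ : ℝ => (ξ : ℂ) ^ j * hat f ξ) volume :=
    (Continuous.aestronglyMeasurable (by fun_prop)).mul f.freq.aesm
  have h1 := f.freq.bound (ψ := fun ξ : ℝ => (wt 1 ξ : ℂ) * ((ξ : ℂ) ^ j * hat f ξ)) (C := 2)
    ((Complex.continuous_ofReal.comp (continuous_wt 1)).aestronglyMeasurable.mul hm) fun ξ => by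
      rw [norm_wt_mul, norm_mul, norm_pow, Complex.norm_real, Real.norm_eq_abs, ← mul_assoc,
        ← mul_assoc]
      refine mul_le_mul_of_nonneg_right ?_ (norm_nonneg _)
      have h2 := pow_le_wt (show j ≤ k + 1 by omega) ξ
      have h3 := pow_le_wt (show j + 1 ≤ k + 1 by omega) ξ
      rw [wt, pow_one, add_mul, one_mul, ← pow_succ']
      linarith
  have h2 : MemWt 1 (fun ξ : ℝ => (ξ : ℂ) ^ j * hat f ξ) := h1.1
  have h3 : wtNorm 1 (fun ξ : ℝ => (ξ : ℂ) ^ j * hat f ξ) ≤ 2 * ‖f‖ :=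
    (ENNReal.toReal_le_of_le_ofReal (mul_nonneg zero_le_two (wtNorm_nonneg _ _)) h1.2).trans
      (mul_le_mul_of_nonneg_left f.wtNorm_hat_le zero_le_two)
  have e : ∀ ξ : ℝ, ‖(ξ : ℂ) ^ j * hat f ξ‖ = |ξ| ^ j * ‖hat f ξ‖ := fun ξ => by
    rw [norm_mul, norm_pow, Complex.norm_real, Real.norm_eq_abs]
  have h4 := h2.integrable.1.norm
  have h5 := h2.integrable.2
  simp only [e] at h4 h5
  refine ⟨h4, h5.trans ?_⟩
  calc _ ≤ embConst * (2 * ‖f‖) := mul_le_mul_of_nonneg_left h3 embConst_nonneg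
    _ = _ := by ring

/-- The a priori bounds of a small global solution `(f, g)` of the profile equation, as far as the
first component is concerned. -/
structure SmallProfile (k : ℕ) (δ : ℝ) (f g : ℝ → Prof k) : Prop where
  cont_f : Continuous f
  cont_g : Continuous g
  deriv : ∀ t, 1 ≤ t → HasDerivAt f ((-Complex.I) • Prof.tri t (g t) (g t) (f t)) t
  growth_f : ∀ t, 1 ≤ t → ‖f t‖ ≤ t ^ δ
  growth_g : ∀ t, 1 ≤ t → ‖g t‖ ≤ t ^ δ
  hat_f : ∀ t, 1 ≤ t → ∀ ξ, ‖hat (f t) ξ‖ ≤ 1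

theorem SmallFlow.smallProfile {k : ℕ} {M δ : ℝ} {α : ℝ → Prof k × Prof k}
    (h : SmallFlow k M δ α) (hM : M ≤ 1) :
    SmallProfile k δ (fun t => (α t).1) (fun t => (α t).2) ∧
      SmallProfile k δ (fun t => (α t).2) (fun t => (α t).1) := by
  have hg : ∀ t, 1 ≤ t → ‖α t‖ ≤ t ^ δ := fun t ht =>
    (h.growth t ht).trans (mul_le_of_le_one_left (by positivity) hM)
  have h1 : Continuous fun t => (α t).1 := continuous_fst.comp h.cont
  have h2 : Continuous fun t => (α t).2 := continuous_snd.comp h.cont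
  have g1 : ∀ t, 1 ≤ t → ‖(α t).1‖ ≤ t ^ δ := fun t ht => (norm_fst_le _).trans (hg t ht)
  have g2 : ∀ t, 1 ≤ t → ‖(α t).2‖ ≤ t ^ δ := fun t ht => (norm_snd_le _).trans (hg t ht)
  exact ⟨⟨h1, h2, fun t ht => hasDerivAt_fst_of_field (h.deriv t ht), g1, g2,
      fun t ht ξ => (h.hat_fst t ht ξ).trans hM⟩,
    ⟨h2, h1, fun t ht => hasDerivAt_snd_of_field (h.deriv t ht), g2, g1,
      fun t ht ξ => (h.hat_snd t ht ξ).trans hM⟩⟩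

/-- The constant in the rate of convergence of the corrected profiles. -/
def rateConst (k : ℕ) (δ : ℝ) : ℝ := remConst k / (1 / 4 - 3 * δ)

theorem rateConst_nonneg (k : ℕ) {δ : ℝ} (hδ : δ ≤ 1 / 16) : 0 ≤ rateConst k δ :=
  div_nonneg (remConst_nonneg k) (by linarith)

namespace SmallProfile

variable {k : ℕ} {δ : ℝ} {f g : ℝ → Prof k}

theorem norm_corrOf_le (h : SmallProfile k δ f g) {t : ℝ} (ht : 1 ≤ t) (ξ : ℝ) :
    ‖corrOf f g t ξ‖ ≤ 1 := by
  rw [norm_corrOf]; exact h.hat_f t ht ξ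

theorem norm_corrOf_sub_le (h : SmallProfile k δ f g) (hδ : δ ≤ 1 / 16) (ξ : ℝ) (s t : ℝ)
    (hs : 1 ≤ s) (hst : s ≤ t) :
    ‖corrOf f g t ξ - corrOf f g s ξ‖ ≤ rateConst k δ * s ^ (-1 / 4 + 3 * δ) := by
  have hex : ∀ τ, ∃ w : ℂ, 1 ≤ τ → HasDerivAt (fun t => corrOf f g t ξ) w τ ∧
      ‖w‖ ≤ remConst k * τ ^ (-5 / 4 : ℝ) * (‖g τ‖ * ‖g τ‖ * ‖f τ‖) := by
    intro τ
    by_cases hτ : 1 ≤ τ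
    · obtain ⟨w, hw⟩ := exists_hasDerivAt_corrOf h.cont_g (by linarith) (h.deriv τ hτ) ξ
      exact ⟨w, fun _ => hw⟩
    · exact ⟨0, fun h => absurd h hτ⟩
  choose w hw using hex
  have hK := remConst_nonneg k
  have h1 := norm_sub_le_of_deriv_rpow_neg (y := fun t => corrOf f g t ξ) (y' := w)
    (r := -1 / 4 + 3 * δ) (K := remConst k) (s := s) (t := t) (by linarith) hst (by linarith) hK
    (fun τ hτ => (hw τ (hs.trans hτ.1)).1) fun τ hτ => by
      have hτ1 : 1 ≤ τ := hs.trans hτ.1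
      have hτ0 : 0 < τ := by linarith
      refine (hw τ hτ1).2.trans ?_
      have e1 := h.growth_f τ hτ1
      have e2 := h.growth_g τ hτ1
      calc _ ≤ remConst k * τ ^ (-5 / 4 : ℝ) * (τ ^ δ * τ ^ δ * τ ^ δ) := by gcongr
        _ = remConst k * τ ^ (-1 / 4 + 3 * δ - 1) := by
            rw [mul_assoc, ← Real.rpow_add hτ0, ← Real.rpow_add hτ0, ← Real.rpow_add hτ0]
            congr 2; ring
  rwa [show -(-1 / 4 + 3 * δ) = 1 / 4 - 3 * δ by ring] at h1

theorem exists_limit (h : SmallProfile k δ f g) (hδ : δ ≤ 1 / 16) :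
    ∃ W : ℝ → ℂ, (∀ ξ, Tendsto (fun t => corrOf f g t ξ) atTop (𝓝 (W ξ))) ∧
      (∀ t, 1 ≤ t → ∀ ξ, ‖corrOf f g t ξ - W ξ‖ ≤ rateConst k δ * t ^ (-1 / 4 + 3 * δ)) ∧
      ∀ ξ, ‖W ξ‖ ≤ 1 := by
  choose W hW hW' using fun ξ => exists_limit_of_rate (by linarith) (h.norm_corrOf_sub_le hδ ξ)
  refine ⟨W, hW, fun t ht ξ => hW' ξ t ht, fun ξ => le_of_tendsto (hW ξ).norm ?_⟩
  filter_upwards [eventually_ge_atTop 1] with t ht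
  exact h.norm_corrOf_le ht ξ

end SmallProfile

theorem continuous_phaseOf {k : ℕ} {g : ℝ → Prof k} (hg : Continuous g) {t : ℝ} (ht : 1 ≤ t) :
    Continuous (phaseOf g t) := by
  obtain ⟨B, hB⟩ := (isCompact_Icc (a := (1 : ℝ)) (b := t)).exists_bound_of_continuousOn
    hg.continuousOn
  have hsub : uIoc 1 t ⊆ Icc 1 t := by
    rw [uIoc_of_le ht]; exact Ioc_subset_Icc_self
  refine intervalIntegral.continuous_of_dominated_interval (bound := fun _ => (supConst * B) ^ 2)
    (fun ξ => ?_) (fun ξ => Eventually.of_forall fun s hs => ?_) intervalIntegrable_const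
    (Eventually.of_forall fun s _ => ?_)
  · exact ((measurable_const.div measurable_id).mul
      ((continuous_hat_curve hg ξ).norm.pow 2).measurable).aestronglyMeasurable
  · have hs' := hsub hs
    have h0 : 0 < s := by linarith [hs'.1]
    have h1 : ‖hat (g s) ξ‖ ≤ supConst * B := ((g s).norm_hat_le ξ).trans
      (mul_le_mul_of_nonneg_left (hB s hs') supConst_nonneg)
    rw [norm_mul, norm_pow, norm_norm, Real.norm_of_nonneg (by positivity)]
    have h2 : 1 / s ≤ 1 := by rw [div_le_one h0]; exact hs'.1
    calc _ ≤ 1 * (supConst * B) ^ 2 := by gcongr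
      _ = _ := one_mul _
  · exact continuous_const.mul ((g s).nice.hat.cont.norm.pow 2)

theorem continuous_corrOf {k : ℕ} (f : ℝ → Prof k) {g : ℝ → Prof k} (hg : Continuous g) {t : ℝ}
    (ht : 1 ≤ t) : Continuous (corrOf f g t) :=
  (f t).nice.hat.cont.mul (Complex.continuous_exp.comp
    (continuous_const.mul (Complex.continuous_ofReal.comp (continuous_phaseOf hg ht))))

/-- The `L²` bound on a dyadic increment interpolates between the sup norm rate and a weighted
`L¹` bound of order `2i`, which the weight `2n+1` of the space controls. -/
theorem SmallProfile.eLpNorm_dyadic_le {k n i : ℕ} {δ : ℝ} {f g : ℝ → Prof k}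
    (h : SmallProfile k δ f g) (hδ : δ ≤ 1 / 16) (hn : 2 * n ≤ k) (hi : i ≤ n) {t : ℝ}
    (ht : 1 ≤ t) :
    eLpNorm (fun ξ : ℝ => (ξ : ℂ) ^ i * corrOf f g (2 * t) ξ - (ξ : ℂ) ^ i * corrOf f g t ξ) 2
      volume ≤ ENNReal.ofReal (Real.sqrt (6 * rateConst k δ * embConst) * t ^ (-1 / 8 + 2 * δ)) := by
  have ht0 : 0 < t := by linarith
  have ht2 : 1 ≤ 2 * t := by linarith
  have hK := rateConst_nonneg k hδ
  have hE := embConst_nonneg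
  set φ : ℝ → ℂ := fun ξ : ℝ => (ξ : ℂ) ^ i * corrOf f g (2 * t) ξ - (ξ : ℂ) ^ i * corrOf f g t ξ
    with hφ
  have hφc : Continuous φ := by
    have h1 := continuous_corrOf f h.cont_g ht2
    have h2 := continuous_corrOf f h.cont_g ht
    exact (Continuous.mul (by fun_prop) h1).sub (Continuous.mul (by fun_prop) h2)
  obtain ⟨i1, b1⟩ := (f (2 * t)).integral_pow_mul_norm_hat_le (j := 2 * i) (by omega)
  obtain ⟨i2, b2⟩ := (f t).integral_pow_mul_norm_hat_le (j := 2 * i) (by omega)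
  set R := rateConst k δ * t ^ (-1 / 4 + 3 * δ) with hR
  have hR0 : 0 ≤ R := by positivity
  have hpt : ∀ ξ : ℝ, ‖φ ξ‖ ^ 2 ≤ R * (|ξ| ^ (2 * i) * ‖hat (f (2 * t)) ξ‖
      + |ξ| ^ (2 * i) * ‖hat (f t) ξ‖) := by
    intro ξ
    have e1 := h.norm_corrOf_sub_le hδ ξ t (2 * t) ht (by linarith)
    have e2 := norm_sub_le (corrOf f g (2 * t) ξ) (corrOf f g t ξ)
    rw [norm_corrOf, norm_corrOf] at e2
    have e3 : ‖φ ξ‖ = |ξ| ^ i * ‖corrOf f g (2 * t) ξ - corrOf f g t ξ‖ := by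
      simp only [hφ]
      rw [← mul_sub, norm_mul, norm_pow, Complex.norm_real, Real.norm_eq_abs]
    rw [e3, mul_pow, ← pow_mul, mul_comm i 2, sq]
    calc _ ≤ |ξ| ^ (2 * i) * (R * (‖hat (f (2 * t)) ξ‖ + ‖hat (f t) ξ‖)) := by gcongr
      _ = _ := by ring
  have hint := (i1.add i2).const_mul R
  have hsq : Integrable fun ξ => ‖φ ξ‖ ^ 2 := hint.mono'
    (hφc.norm.pow 2).aestronglyMeasurable (Eventually.of_forall fun ξ => by
      rw [norm_pow, norm_norm]; exact hpt ξ)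
  have hmem : MemLp φ 2 volume := (memLp_two_iff_integrable_sq_norm hφc.aestronglyMeasurable).2 hsq
  have hle : ∫ ξ, ‖φ ξ‖ ^ 2 ≤ R * (2 * embConst * ‖f (2 * t)‖ + 2 * embConst * ‖f t‖) := by
    refine (integral_mono hsq hint hpt).trans ?_
    rw [integral_const_mul, integral_add' i1 i2]
    exact mul_le_mul_of_nonneg_left (add_le_add b1 b2) hR0
  have g1 : ‖f (2 * t)‖ ≤ 2 * t ^ δ := by
    refine (h.growth_f _ ht2).trans ?_
    rw [Real.mul_rpow zero_le_two ht0.le]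
    refine mul_le_mul_of_nonneg_right ?_ (by positivity)
    calc (2 : ℝ) ^ δ ≤ 2 ^ (1 : ℝ) := Real.rpow_le_rpow_of_exponent_le one_le_two (by linarith)
      _ = 2 := Real.rpow_one 2
  have g2 := h.growth_f t ht
  rw [eLpNorm_two_eq hmem]
  refine ENNReal.ofReal_le_ofReal (Real.sqrt_le_iff.2 ⟨by positivity, hle.trans ?_⟩)
  rw [mul_pow, Real.sq_sqrt (by positivity)]
  calc _ ≤ R * (2 * embConst * (2 * t ^ δ) + 2 * embConst * t ^ δ) := by gcongr
    _ = 6 * rateConst k δ * embConst * (t ^ (-1 / 4 + 3 * δ) * t ^ δ) := by rw [hR]; ring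
    _ = _ := by
      rw [← Real.rpow_natCast, ← Real.rpow_mul ht0.le, ← Real.rpow_add ht0]
      congr 2; push_cast; ring

/-! ### Bounds in the sup norm and uniqueness of the asymptotic data -/

theorem supBound_of_norm_le {C T r : ℝ} {φ : ℝ → ℝ → ℂ}
    (h : ∀ t, T ≤ t → ∀ x, ‖φ t x‖ ≤ C * t ^ r) : SupBound C T r φ := fun t ht => by
  rw [eLpNorm_exponent_top]
  exact eLpNormEssSup_le_of_ae_bound (Eventually.of_forall (h t ht))

theorem SupBound.mono {C C' r r' : ℝ} {φ : ℝ → ℝ → ℂ} (h : SupBound C 1 r φ) (hC0 : 0 ≤ C)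
    (hC : C ≤ C') (hr : r ≤ r') : SupBound C' 1 r' φ := fun t ht =>
  (h t ht).trans (ENNReal.ofReal_le_ofReal (mul_le_mul hC
    (Real.rpow_le_rpow_of_exponent_le ht hr) (by positivity) (hC0.trans hC)))

/-- Along integer times the exceptional null sets can be united.  The points `2Nξ` are those at
which the asymptotic formula sees the frequency `ξ`; dilations preserve null sets. -/
theorem SupBound.ae_norm_le {C T r : ℝ} {φ : ℝ → ℝ → ℂ} (h : SupBound C T r φ) :
    (∀ᵐ ξ : ℝ, ∀ᶠ N : ℕ in atTop, ‖φ N ξ‖ ≤ |C| * (N : ℝ) ^ r) ∧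
      ∀ᵐ ξ : ℝ, ∀ᶠ N : ℕ in atTop, ‖φ N (2 * N * ξ)‖ ≤ |C| * (N : ℝ) ^ r := by
  have h1 : ∀ N : ℕ, ∀ᵐ x : ℝ, T ≤ N → ‖φ N x‖ ≤ |C| * (N : ℝ) ^ r := by
    intro N
    by_cases hN : T ≤ N
    · have h2 := h N hN
      rw [eLpNorm_exponent_top] at h2
      filter_upwards [ae_le_eLpNormEssSup (f := φ N) (μ := volume)] with x hx _
      have h3 := ENNReal.toReal_mono ENNReal.ofReal_ne_top (hx.trans h2)
      rw [toReal_enorm, ENNReal.toReal_ofReal'] at h3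
      have h4 : 0 ≤ (N : ℝ) ^ r := by positivity
      refine h3.trans (max_le (mul_le_mul_of_nonneg_right (le_abs_self C) h4) (by positivity))
    · exact Eventually.of_forall fun _ h => absurd h hN
  have hT : ∀ᶠ N : ℕ in atTop, T ≤ N ∧ 0 < N :=
    ((tendsto_natCast_atTop_atTop (R := ℝ)).eventually_ge_atTop T).and (eventually_gt_atTop 0)
  have h5 : ∀ N : ℕ, ∀ᵐ ξ : ℝ, 0 < N → T ≤ N → ‖φ N (2 * N * ξ)‖ ≤ |C| * (N : ℝ) ^ r := by
    intro N
    by_cases hN : 0 < N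
    · have hN' : (2 * N : ℝ) ≠ 0 := by positivity
      have h6 := h1 N
      rw [ae_iff] at h6 ⊢
      have h7 := Real.volume_preimage_mul_left hN' {x : ℝ | ¬(T ≤ N → ‖φ N x‖ ≤ |C| * (N : ℝ) ^ r)}
      rw [h6, mul_zero] at h7
      refine measure_mono_null (fun ξ hξ => ?_) h7
      exact fun h => hξ fun _ => h
    · exact Eventually.of_forall fun _ h => absurd h hN
  constructor
  · filter_upwards [ae_all_iff.2 h1] with ξ hξ
    filter_upwards [hT] with N hN using hξ N hN.1
  · filter_upwards [ae_all_iff.2 h5] with ξ hξ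
    filter_upwards [hT] with N hN using hξ N hN.2 hN.1

theorem tendsto_natCast_rpow_neg {r : ℝ} (hr : r < 0) (C : ℝ) :
    Tendsto (fun N : ℕ => C * (N : ℝ) ^ r) atTop (𝓝 0) := by
  have h2 := (tendsto_rpow_neg_atTop (y := -r) (by linarith)).comp
    (tendsto_natCast_atTop_atTop (R := ℝ))
  rw [neg_neg] at h2
  simpa using h2.const_mul C

theorem SupBound.tendsto_ae {C T r : ℝ} {φ : ℝ → ℝ → ℂ} (h : SupBound C T r φ) (hr : r < 0) :
    ∀ᵐ ξ : ℝ, Tendsto (fun N : ℕ => φ N ξ) atTop (𝓝 0) := by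
  filter_upwards [h.ae_norm_le.1] with ξ hξ
  exact squeeze_zero_norm' hξ (tendsto_natCast_rpow_neg hr _)

theorem ScattersTo.ae_eq {n : ℕ} {ν C C' : ℝ} {u v : ℝ → ℝ → ℂ} {W W' : ℝ → ℂ} (hν : ν < 1 / 4)
    (h : ScattersTo n ν C u v W) (h' : ScattersTo n ν C' u v W') : W' =ᵐ[volume] W := by
  filter_upwards [h.1.tendsto_ae (by linarith), h'.1.tendsto_ae (by linarith)] with ξ h1 h2
  have h3 := h1.sub h2
  simp only [sub_sub_sub_cancel_left, sub_zero] at h3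
  exact sub_eq_zero.1 (tendsto_nhds_unique tendsto_const_nhds h3)

theorem PhaseExpansion.ae_eq {ν C C' : ℝ} {v : ℝ → ℝ → ℂ} {W : ℝ → ℂ} {Γ Γ' : ℝ → ℝ}
    (hν : ν < 1 / 4) (h : PhaseExpansion ν C v W Γ) (h' : PhaseExpansion ν C' v W Γ') :
    Γ' =ᵐ[volume] Γ := by
  filter_upwards [SupBound.tendsto_ae h (by linarith), SupBound.tendsto_ae h' (by linarith)]
    with ξ h1 h2
  have h3 := h1.sub h2
  simp only [← Complex.ofReal_sub, sub_sub_sub_cancel_left, add_sub_add_left_eq_sub, sub_zero] at h3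
  exact sub_eq_zero.1 (Complex.ofReal_eq_zero.1 (tendsto_nhds_unique tendsto_const_nhds h3))

theorem norm_kern {t : ℝ} (ht : 0 < t) : ‖kern t‖ = (Real.sqrt (2 * t))⁻¹ := by
  rw [← Real.sqrt_inv, ← one_div, ← norm_kern_sq ht, Real.sqrt_sq (norm_nonneg _)]

theorem asymptoticProfile_eq (W W' : ℝ → ℂ) (Γ : ℝ → ℝ) {t : ℝ} (ht : 0 < t) (x : ℝ) :
    asymptoticProfile W W' Γ t x = kern t * Complex.exp (Complex.I * ((x ^ 2 / (4 * t) : ℝ) : ℂ)) *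
      (W (x / (2 * t)) * Complex.exp (-(Complex.I / 2 *
        ((‖W' (x / (2 * t))‖ ^ 2 * Real.log t + Γ (x / (2 * t)) : ℝ) : ℂ)))) := by
  rw [asymptoticProfile, ← kern_eq ht, sub_eq_add_neg, Complex.exp_add]
  ring

/-- On the set where the amplitude does not vanish, the leading term determines the phase up to
the period `4π` of `exp(-iΓ/2)`. -/
theorem AsymptoticFormula.ae_eq_add {ν C C' T T' : ℝ} {u : ℝ → ℝ → ℂ} {W W' : ℝ → ℂ} {Γ Γ' : ℝ → ℝ}
    (hν : ν < 1 / 4) (h : AsymptoticFormula ν C T u W W' Γ)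
    (h' : AsymptoticFormula ν C' T' u W W' Γ') :
    ∀ᵐ ξ : ℝ, W ξ ≠ 0 → ∃ k : ℤ, Γ' ξ = Γ ξ + 4 * Real.pi * k := by
  filter_upwards [(SupBound.ae_norm_le h).2, (SupBound.ae_norm_le h').2] with ξ h1 h2 hW
  set e : ℝ → ℂ := fun γ => Complex.exp (-(Complex.I / 2 * (γ : ℂ))) with he
  have hlim : Tendsto (fun N : ℕ => (Real.sqrt 2 * (|C| + |C'|)) * (N : ℝ) ^ (-1 / 4 + ν)) atTop
      (𝓝 0) := tendsto_natCast_rpow_neg (by linarith) _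
  have hle : ‖W ξ‖ * ‖e (Γ' ξ) - e (Γ ξ)‖ ≤ 0 := by
    refine ge_of_tendsto hlim ?_
    filter_upwards [h1, h2, eventually_gt_atTop 0] with N h3 h4 hN
    have hN0 : (0 : ℝ) < N := by exact_mod_cast hN
    have hx : 2 * (N : ℝ) * ξ / (2 * N) = ξ := mul_div_cancel_left₀ ξ (by positivity)
    rw [asymptoticProfile_eq _ _ _ hN0, hx] at h3 h4
    set E := Complex.exp (Complex.I * (((2 * (N : ℝ) * ξ) ^ 2 / (4 * N) : ℝ) : ℂ)) with hE
    have hEn : ‖E‖ = 1 := by rw [hE, mul_comm, Complex.norm_exp_ofReal_mul_I]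
    set L : ℝ := ‖W' ξ‖ ^ 2 * Real.log N with hL
    have hsplit : ∀ γ : ℝ, Complex.exp (-(Complex.I / 2 * ((L + γ : ℝ) : ℂ))) = e L * e γ := by
      intro γ
      rw [he, ← Complex.exp_add]
      congr 1; push_cast; ring
    have heL : ‖e L‖ = 1 := by
      have := norm_exp_half_I (-L)
      rw [he]
      convert this using 3
      push_cast; ring
    rw [hsplit] at h3 h4
    have h5 := norm_sub_le (u N (2 * N * ξ) - kern N * E * (W ξ * (e L * e (Γ ξ))))
      (u N (2 * N * ξ) - kern N * E * (W ξ * (e L * e (Γ' ξ))))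
    rw [show u N (2 * N * ξ) - kern N * E * (W ξ * (e L * e (Γ ξ)))
      - (u N (2 * N * ξ) - kern N * E * (W ξ * (e L * e (Γ' ξ))))
      = kern N * E * e L * (W ξ * (e (Γ' ξ) - e (Γ ξ))) by ring] at h5
    rw [norm_mul, norm_mul, norm_mul, hEn, heL, mul_one, mul_one, norm_kern hN0, norm_mul] at h5
    have hs : 0 < Real.sqrt (2 * N) := Real.sqrt_pos.2 (by positivity)
    have h6 : ‖W ξ‖ * ‖e (Γ' ξ) - e (Γ ξ)‖
        ≤ Real.sqrt (2 * N) * (|C| * (N : ℝ) ^ (-3 / 4 + ν) + |C'| * (N : ℝ) ^ (-3 / 4 + ν)) := by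
      rw [← div_le_iff₀' hs, div_eq_inv_mul]
      exact h5.trans (add_le_add h3 h4)
    refine h6.trans (le_of_eq ?_)
    rw [Real.sqrt_mul zero_le_two, Real.sqrt_eq_rpow (N : ℝ),
      show (-1 / 4 + ν : ℝ) = 1 / 2 + (-3 / 4 + ν) by ring, Real.rpow_add hN0 (1 / 2)]
    ring
  have hWn : 0 < ‖W ξ‖ := norm_pos_iff.2 hW
  have hz : ‖e (Γ' ξ) - e (Γ ξ)‖ = 0 := le_antisymm (by
    by_contra hc
    push Not at hc
    exact absurd hle (not_le.2 (mul_pos hWn hc))) (norm_nonneg _)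
  have heq : e (Γ' ξ) = e (Γ ξ) := sub_eq_zero.1 (norm_eq_zero.1 hz)
  obtain ⟨m, hm⟩ := Complex.exp_eq_exp_iff_exists_int.1 heq
  refine ⟨-m, ?_⟩
  have h7 : ((Γ' ξ : ℝ) : ℂ) = ((Γ ξ + 4 * Real.pi * ((-m : ℤ) : ℝ) : ℝ) : ℂ) := by
    push_cast
    linear_combination (2 * Complex.I) * hm
      + (((Γ' ξ : ℝ) : ℂ) - (Γ ξ : ℂ) + 4 * (Real.pi : ℂ) * m) * Complex.I_sq
  exact_mod_cast h7

/-! ### Asymptotics of small solutions -/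

theorem profile_evol {k : ℕ} (f : ℝ → Prof k) (t : ℝ) : profile (evol f) t = f t := by
  have h := congrArg Prof.val (Prof.group_neg_group t (f t))
  exact h

theorem phase_evol {k : ℕ} (g : ℝ → Prof k) : phase (evol g) = phaseOf g := by
  have h : ∀ s ξ, ‖hat (evol g s) ξ‖ = ‖hat (g s) ξ‖ := fun s ξ => by
    rw [evol, Prof.hat_group, norm_mul, norm_symb, one_mul]
  ext t ξ
  simp only [phase, phaseOf, h]

theorem correctedProfile_evol {k : ℕ} (f g : ℝ → Prof k) :
    correctedProfile (evol f) (evol g) = corrOf f g := by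
  ext t ξ
  rw [correctedProfile, corrOf, profile_evol, phase_evol]

theorem continuous_of_rate {E : Type*} [NormedAddCommGroup E] {F : ℝ → ℝ → E} {G : ℝ → E}
    {A r : ℝ} (hr : r < 0) (hF : ∀ t, 1 ≤ t → Continuous (F t))
    (h : ∀ t, 1 ≤ t → ∀ ξ, ‖F t ξ - G ξ‖ ≤ A * t ^ r) : Continuous G := by
  have h1 : Tendsto (fun s : ℝ => A * s ^ r) atTop (𝓝 0) := by
    have h2 := tendsto_rpow_neg_atTop (y := -r) (by linarith)
    rw [neg_neg] at h2
    simpa using h2.const_mul A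
  have h3 : TendstoUniformly F G atTop := by
    rw [Metric.tendstoUniformly_iff]
    intro ε hε
    filter_upwards [h1.eventually_lt_const hε, eventually_ge_atTop 1] with t ht ht1 ξ
    rw [dist_comm, dist_eq_norm]
    exact (h t ht1 ξ).trans_lt ht
  refine h3.continuous (Eventually.frequently ?_)
  filter_upwards [eventually_ge_atTop 1] with t ht using hF t ht

theorem memLp_top_of_continuous {E : Type*} [NormedAddCommGroup E] [SecondCountableTopology E]
    {G : ℝ → E} (hG : Continuous G) {B : ℝ} (hB : ∀ ξ, ‖G ξ‖ ≤ B) : MemLp G ⊤ volume :=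
  memLp_top_of_bound hG.aestronglyMeasurable B (Eventually.of_forall hB)

/-- `W` is the limit of the corrected profiles of `f`, with the expected rate. -/
structure IsLimitProfile (k : ℕ) (δ : ℝ) (f g : ℝ → Prof k) (W : ℝ → ℂ) : Prop where
  tendsto : ∀ ξ, Tendsto (fun t => corrOf f g t ξ) atTop (𝓝 (W ξ))
  rate : ∀ t, 1 ≤ t → ∀ ξ, ‖corrOf f g t ξ - W ξ‖ ≤ rateConst k δ * t ^ (-1 / 4 + 3 * δ)
  norm_le : ∀ ξ, ‖W ξ‖ ≤ 1
  cont : Continuous W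

/-- The constant in the weighted `L²` rate of convergence of the corrected profiles. -/
def rateConst₂ (k : ℕ) (δ : ℝ) : ℝ :=
  Real.sqrt (6 * rateConst k δ * embConst) / (1 - 2 ^ (-1 / 8 + 2 * δ))

theorem rateConst₂_nonneg (k : ℕ) {δ : ℝ} (hδ : δ < 1 / 16) : 0 ≤ rateConst₂ k δ :=
  div_nonneg (Real.sqrt_nonneg _)
    (by linarith [Real.rpow_lt_one_of_one_lt_of_neg one_lt_two (show -1 / 8 + 2 * δ < 0 by linarith)])

namespace SmallProfile

variable {k : ℕ} {δ : ℝ} {f g : ℝ → Prof k}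

theorem exists_isLimitProfile (h : SmallProfile k δ f g) (hδ : δ ≤ 1 / 16) :
    ∃ W, IsLimitProfile k δ f g W := by
  obtain ⟨W, h1, h2, h3⟩ := h.exists_limit hδ
  exact ⟨W, h1, h2, h3, continuous_of_rate (by linarith)
    (fun t ht => continuous_corrOf f h.cont_g ht) h2⟩

theorem eLpNorm_pow_mul_sub_le (h : SmallProfile k δ f g) (hδ : δ < 1 / 16) {n i : ℕ}
    (hn : 2 * n ≤ k) (hi : i ≤ n) {W : ℝ → ℂ} (hW : IsLimitProfile k δ f g W) {t : ℝ}
    (ht : 1 ≤ t) :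
    eLpNorm (fun ξ : ℝ => (ξ : ℂ) ^ i * (corrOf f g t ξ - W ξ)) 2 volume
      ≤ ENNReal.ofReal (rateConst₂ k δ * t ^ (-1 / 8 + 2 * δ)) := by
  simp only [mul_sub]
  refine eLpNorm_sub_le_of_dyadic (F := fun t (ξ : ℝ) => (ξ : ℂ) ^ i * corrOf f g t ξ)
    (G := fun ξ : ℝ => (ξ : ℂ) ^ i * W ξ) (Real.sqrt_nonneg _) (by linarith) (fun s hs => ?_)
    (fun s hs => h.eLpNorm_dyadic_le hδ.le hn hi hs) (fun ξ => (hW.tendsto ξ).const_mul _) ht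
  exact (Continuous.mul (by fun_prop) (continuous_corrOf f h.cont_g hs)).aestronglyMeasurable

theorem weightNorm_sub_le (h : SmallProfile k δ f g) (hδ : δ < 1 / 16) {n : ℕ}
    (hn : 2 * n ≤ k) {W : ℝ → ℂ} (hW : IsLimitProfile k δ f g W) {t : ℝ} (ht : 1 ≤ t) :
    weightNorm n (fun ξ => corrOf f g t ξ - W ξ)
      ≤ ENNReal.ofReal ((n + 1) * rateConst₂ k δ * t ^ (-1 / 8 + 2 * δ)) := by
  refine (Finset.sum_le_card_nsmul _ _ _ fun i hi => h.eLpNorm_pow_mul_sub_le hδ hn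
    (Nat.lt_succ_iff.1 (Finset.mem_range.1 hi)) hW ht).trans (le_of_eq ?_)
  rw [Finset.card_range, nsmul_eq_mul, ← ENNReal.ofReal_natCast,
    ← ENNReal.ofReal_mul (by positivity)]
  congr 1
  push_cast; ring

theorem memLimitSpace (h : SmallProfile k δ f g) (hδ : δ < 1 / 16) {n : ℕ}
    (hn : 2 * n ≤ k) {W : ℝ → ℂ} (hW : IsLimitProfile k δ f g W) : MemLimitSpace n W := by
  refine ⟨memLp_top_of_continuous hW.cont hW.norm_le, ENNReal.sum_lt_top.2 fun i hi => ?_⟩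
  have hi' : i ≤ n := Nat.lt_succ_iff.1 (Finset.mem_range.1 hi)
  have h1 := h.eLpNorm_pow_mul_sub_le hδ hn hi' hW le_rfl
  have h2 : MemLp (fun ξ : ℝ => (ξ : ℂ) ^ i * corrOf f g 1 ξ) 2 volume := by
    refine ((f 1).freq.bound (C := 1) (Continuous.mul (by fun_prop)
      (continuous_corrOf f h.cont_g le_rfl)).aestronglyMeasurable fun ξ => ?_).1
    rw [Pi.mul_apply, norm_mul, norm_corrOf, norm_pow, Complex.norm_real, Real.norm_eq_abs,
      one_mul]
    exact mul_le_mul_of_nonneg_right (pow_le_wt (by omega) ξ) (norm_nonneg _)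
  have hc : Continuous fun ξ : ℝ => (ξ : ℂ) ^ i * (corrOf f g 1 ξ - W ξ) :=
    Continuous.mul (by fun_prop) ((continuous_corrOf f h.cont_g le_rfl).sub hW.cont)
  have h3 : MemLp (fun ξ : ℝ => (ξ : ℂ) ^ i * (corrOf f g 1 ξ - W ξ)) 2 volume :=
    ⟨hc.aestronglyMeasurable, h1.trans_lt ENNReal.ofReal_lt_top⟩
  have h4 := (h2.sub h3).2
  convert h4 using 2
  ext ξ
  simp only [Pi.sub_apply]
  ring

theorem scattersTo (h : SmallProfile k δ f g) {n : ℕ} (hn : 2 * n ≤ k) {ν C : ℝ} (hν : 0 ≤ ν)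
    (hν' : ν < 1 / 4) (hδ : δ = ν / 4) {W : ℝ → ℂ} (hW : IsLimitProfile k δ f g W)
    (hC1 : rateConst k δ ≤ C) (hC2 : (n + 1) * rateConst₂ k δ ≤ C) :
    ScattersTo n ν C (evol f) (evol g) W := by
  rw [ScattersTo, correctedProfile_evol]
  refine ⟨(supBound_of_norm_le hW.rate).mono (rateConst_nonneg k (by linarith)) hC1 (by linarith),
    fun t ht => (h.weightNorm_sub_le (by linarith) hn hW ht).trans (ENNReal.ofReal_le_ofReal ?_)⟩
  rw [show -1 / 8 + 2 * δ = -1 / 8 + ν / 2 by rw [hδ]; ring]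
  have : 0 ≤ t := by linarith
  exact mul_le_mul_of_nonneg_right hC2 (by positivity)

theorem supBound_evol (h : SmallProfile k δ f g) (hδ : δ ≤ 1 / 16) :
    SupBound 3 1 (-1 / 2) (evol f) := by
  refine supBound_of_norm_le fun t ht x => ?_
  have ht0 : 0 < t := by linarith
  refine ((f t).norm_group_apply_le_of_hat ht0 (h.hat_f t ht) x).trans ?_
  have e1 : t ^ (-1 / 4 : ℝ) * t ^ δ ≤ 1 := by
    rw [← Real.rpow_add ht0]
    exact Real.rpow_le_one_of_one_le_of_nonpos ht (by linarith)
  have e2 : (Real.sqrt (2 * t))⁻¹ ≤ t ^ (-1 / 2 : ℝ) := by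
    rw [neg_div, Real.rpow_neg ht0.le, ← Real.sqrt_eq_rpow]
    exact inv_anti₀ (by positivity) (Real.sqrt_le_sqrt (by linarith))
  have e3 : 1 + 2 * t ^ (-1 / 4 : ℝ) * ‖f t‖ ≤ 3 := by
    have : 2 * t ^ (-1 / 4 : ℝ) * ‖f t‖ ≤ 2 * t ^ (-1 / 4 : ℝ) * t ^ δ := by
      gcongr; exact h.growth_f t ht
    linarith
  calc _ ≤ t ^ (-1 / 2 : ℝ) * 3 := by gcongr
    _ = _ := by ring

end SmallProfile

/-- The constant in the expansion of the accumulated phase. -/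
def phaseConst (k : ℕ) (δ : ℝ) : ℝ := 2 * rateConst k δ / (1 / 4 - 3 * δ)

theorem phaseConst_nonneg (k : ℕ) {δ : ℝ} (hδ : δ ≤ 1 / 16) : 0 ≤ phaseConst k δ :=
  div_nonneg (mul_nonneg zero_le_two (rateConst_nonneg k hδ)) (by linarith)

/-- After subtraction of `|W|² ln t` the accumulated phase has an integrable time derivative,
since the modulus of the transformed profile is that of the corrected profile. -/
theorem SmallProfile.exists_phase {k : ℕ} {δ : ℝ} {f g : ℝ → Prof k} (h : SmallProfile k δ f g)
    (hδ : δ ≤ 1 / 16) {W : ℝ → ℂ} (hW : IsLimitProfile k δ f g W) :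
    ∃ Γ : ℝ → ℝ, Continuous Γ ∧ (∀ ξ, ‖Γ ξ‖ ≤ phaseConst k δ) ∧
      ∀ t, 1 ≤ t → ∀ ξ, ‖phaseOf f t ξ - (‖W ξ‖ ^ 2 * Real.log t + Γ ξ)‖
        ≤ phaseConst k δ * t ^ (-1 / 4 + 3 * δ) := by
  have hrate : ∀ ξ s t, 1 ≤ s → s ≤ t → ‖(phaseOf f t ξ - ‖W ξ‖ ^ 2 * Real.log t)
      - (phaseOf f s ξ - ‖W ξ‖ ^ 2 * Real.log s)‖ ≤ phaseConst k δ * s ^ (-1 / 4 + 3 * δ) := by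
    intro ξ s t hs hst
    have h1 := norm_sub_le_of_deriv_rpow_neg
      (y := fun t => phaseOf f t ξ - ‖W ξ‖ ^ 2 * Real.log t)
      (y' := fun t => 1 / t * ‖hat (f t) ξ‖ ^ 2 - ‖W ξ‖ ^ 2 * t⁻¹)
      (r := -1 / 4 + 3 * δ) (K := 2 * rateConst k δ) (s := s) (t := t) (by linarith) hst
      (by linarith) (mul_nonneg zero_le_two (rateConst_nonneg k hδ))
      (fun τ hτ => by
        have hτ0 : 0 < τ := by linarith [hτ.1]
        exact (hasDerivAt_phaseOf h.cont_f hτ0 ξ).sub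
          ((Real.hasDerivAt_log hτ0.ne').const_mul _)) fun τ hτ => by
        have hτ1 : 1 ≤ τ := hs.trans hτ.1
        have hτ0 : 0 < τ := by linarith
        have e1 := hW.rate τ hτ1 ξ
        have e0 : 0 ≤ rateConst k δ * τ ^ (-1 / 4 + 3 * δ) := (norm_nonneg _).trans e1
        have e2 := h.norm_corrOf_le hτ1 ξ
        have e3 := hW.norm_le ξ
        have e4 := (abs_norm_sub_norm_le (corrOf f g τ ξ) (W ξ)).trans e1
        rw [← norm_corrOf f g]
        rw [show 1 / τ * ‖corrOf f g τ ξ‖ ^ 2 - ‖W ξ‖ ^ 2 * τ⁻¹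
          = τ⁻¹ * ((‖corrOf f g τ ξ‖ - ‖W ξ‖) * (‖corrOf f g τ ξ‖ + ‖W ξ‖)) by
            rw [one_div]; ring, norm_mul, norm_mul, Real.norm_of_nonneg (inv_pos.2 hτ0).le,
          Real.norm_eq_abs, Real.norm_of_nonneg (by positivity : 0 ≤ ‖corrOf f g τ ξ‖ + ‖W ξ‖)]
        calc _ ≤ τ⁻¹ * ((rateConst k δ * τ ^ (-1 / 4 + 3 * δ)) * (1 + 1)) := by
              gcongr
          _ = _ := by
              rw [Real.rpow_sub_one hτ0.ne']; ring
    rwa [show -(-1 / 4 + 3 * δ) = 1 / 4 - 3 * δ by ring] at h1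
  choose Γ hΓ hΓ' using fun ξ => exists_limit_of_rate (by linarith) (hrate ξ)
  have hle : ∀ t, 1 ≤ t → ∀ ξ, ‖(phaseOf f t ξ - ‖W ξ‖ ^ 2 * Real.log t) - Γ ξ‖
      ≤ phaseConst k δ * t ^ (-1 / 4 + 3 * δ) := fun t ht ξ => hΓ' ξ t ht
  refine ⟨Γ, continuous_of_rate (by linarith) (fun t ht => ?_) hle, fun ξ => ?_, fun t ht ξ => ?_⟩
  · exact (continuous_phaseOf h.cont_f ht).sub ((hW.cont.norm.pow 2).mul continuous_const)
  · have := hle 1 le_rfl ξ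
    rwa [phaseOf, intervalIntegral.integral_same, Real.log_one, mul_zero, sub_zero, zero_sub,
      norm_neg, Real.one_rpow, mul_one] at this
  · rw [← sub_sub]
    exact hle t ht ξ

theorem norm_exp_neg_half_I_sub_le (a b : ℝ) :
    ‖Complex.exp (-(Complex.I / 2 * (a : ℂ))) - Complex.exp (-(Complex.I / 2 * (b : ℂ)))‖
      ≤ ‖a - b‖ := by
  have e1 : Complex.exp (-(Complex.I / 2 * (a : ℂ))) - Complex.exp (-(Complex.I / 2 * (b : ℂ)))
      = Complex.exp (Complex.I / 2 * ((-b : ℝ) : ℂ))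
        * (Complex.exp (Complex.I * (((b - a) / 2 : ℝ) : ℂ)) - 1) := by
    rw [mul_sub, ← Complex.exp_add, mul_one]
    congr 2
    · push_cast; ring
    · push_cast; ring
  rw [e1, norm_mul, norm_exp_half_I, one_mul]
  refine (Real.norm_exp_I_mul_ofReal_sub_one_le).trans ?_
  rw [Real.norm_eq_abs, Real.norm_eq_abs, abs_div, abs_sub_comm, abs_two]
  linarith [abs_nonneg (a - b)]

/-- The evolution of `f` is, up to the phase and the dilation, the transform of `f` with an error
`O(t^{-1/4+δ})`; there the corrected profile and the phase are replaced by their limits. -/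
theorem SmallProfile.asymptoticFormula {k : ℕ} {δ : ℝ} {f g : ℝ → Prof k}
    (h : SmallProfile k δ f g) {ν C : ℝ} (hν : 0 ≤ ν) (hν' : ν < 1 / 4)
    (hδ : δ = ν / 4) {W W' : ℝ → ℂ} (hW : IsLimitProfile k δ f g W) {Γ : ℝ → ℝ}
    (hΓ : ∀ t, 1 ≤ t → ∀ ξ, ‖phaseOf g t ξ - (‖W' ξ‖ ^ 2 * Real.log t + Γ ξ)‖
      ≤ phaseConst k δ * t ^ (-1 / 4 + 3 * δ))
    (hC : 2 + rateConst k δ + phaseConst k δ ≤ C) :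
    AsymptoticFormula ν C 1 (evol f) W W' Γ := by
  have hK := rateConst_nonneg k (show δ ≤ 1 / 16 by linarith)
  have hP := phaseConst_nonneg k (show δ ≤ 1 / 16 by linarith)
  refine supBound_of_norm_le fun t ht x => ?_
  have ht0 : 0 < t := by linarith
  rw [asymptoticProfile_eq _ _ _ ht0, evol, Prof.group_apply, (f t).nice.freeGroup_eq_pconf ht0]
  set ξ := x / (2 * t) with hξ
  set E := Complex.exp (Complex.I * ((x ^ 2 / (4 * t) : ℝ) : ℂ)) with hE
  set e : ℝ → ℂ := fun a => Complex.exp (-(Complex.I / 2 * (a : ℂ))) with he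
  set θ : ℝ := ‖W' ξ‖ ^ 2 * Real.log t + Γ ξ with hθ
  change ‖kern t * E * pconf t (f t) ξ - kern t * E * (W ξ * e θ)‖ ≤ _
  have hEn : ‖E‖ = 1 := by rw [hE, mul_comm, Complex.norm_exp_ofReal_mul_I]
  have hen : ∀ a, ‖e a‖ = 1 := fun a => by
    have := norm_exp_half_I (-a)
    rw [he]
    convert this using 3
    push_cast; ring
  have hcorr : corrOf f g t ξ * e (phaseOf g t ξ) = hat (f t) ξ := by
    rw [corrOf, he, mul_assoc, ← Complex.exp_add, add_neg_cancel, Complex.exp_zero, mul_one]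
  have e1 : ‖pconf t (f t) ξ - hat (f t) ξ‖ ≤ 2 * (t ^ (-1 / 4 : ℝ) * t ^ δ) := by
    refine ((f t).nice.norm_pconf_sub_le ht0 ξ).trans ?_
    rw [mul_assoc]
    have := (f t).wtNorm_le.trans (h.growth_f t ht)
    gcongr
  have e2 := hW.rate t ht ξ
  have e3 := (norm_exp_neg_half_I_sub_le (phaseOf g t ξ) θ).trans (hΓ t ht ξ)
  have e4 := hW.norm_le ξ
  have e5 : pconf t (f t) ξ - W ξ * e θ = (pconf t (f t) ξ - hat (f t) ξ)
      + (corrOf f g t ξ - W ξ) * e (phaseOf g t ξ) + W ξ * (e (phaseOf g t ξ) - e θ) := by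
    rw [← hcorr]; ring
  set q := t ^ (-1 / 4 + 3 * δ) with hq
  have e6 : t ^ (-1 / 4 : ℝ) * t ^ δ ≤ q := by
    rw [← Real.rpow_add ht0]
    exact Real.rpow_le_rpow_of_exponent_le ht (by linarith)
  have hq0 : 0 ≤ q := by positivity
  have e7 : ‖pconf t (f t) ξ - W ξ * e θ‖ ≤ (2 + rateConst k δ + phaseConst k δ) * q := by
    rw [e5]
    refine norm_add₃_le.trans ?_
    rw [norm_mul, norm_mul, hen, mul_one]
    have e8 : ‖W ξ‖ * ‖e (phaseOf g t ξ) - e θ‖ ≤ 1 * (phaseConst k δ * q) := by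
      gcongr
    linarith
  rw [← mul_sub, norm_mul, norm_mul, hEn, mul_one, norm_kern ht0]
  have e9 : (Real.sqrt (2 * t))⁻¹ ≤ t ^ (-1 / 2 : ℝ) := by
    rw [neg_div, Real.rpow_neg ht0.le, ← Real.sqrt_eq_rpow]
    exact inv_anti₀ (by positivity) (Real.sqrt_le_sqrt (by linarith))
  calc _ ≤ t ^ (-1 / 2 : ℝ) * ((2 + rateConst k δ + phaseConst k δ) * q) := by gcongr
    _ ≤ t ^ (-1 / 2 : ℝ) * (C * q) := by gcongr
    _ = C * t ^ (-1 / 2 + (-1 / 4 + 3 * δ)) := by rw [Real.rpow_add ht0]; ring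
    _ ≤ C * t ^ (-3 / 4 + ν) := by
      refine mul_le_mul_of_nonneg_left (Real.rpow_le_rpow_of_exponent_le ht (by linarith))
        (by linarith)

theorem phaseExpansion_evol {k : ℕ} {δ ν C : ℝ} {f : ℝ → Prof k} {W : ℝ → ℂ} {Γ : ℝ → ℝ}
    (hν : 0 ≤ ν) (hν' : ν < 1 / 4) (hδ : δ = ν / 4)
    (hΓ : ∀ t, 1 ≤ t → ∀ ξ, ‖phaseOf f t ξ - (‖W ξ‖ ^ 2 * Real.log t + Γ ξ)‖
      ≤ phaseConst k δ * t ^ (-1 / 4 + 3 * δ)) (hC : phaseConst k δ ≤ C) :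
    PhaseExpansion ν C (evol f) W Γ := by
  rw [PhaseExpansion, phase_evol]
  refine (supBound_of_norm_le (C := phaseConst k δ) (r := -1 / 4 + 3 * δ) fun t ht ξ => ?_).mono
    (phaseConst_nonneg k (by linarith)) hC (by linarith)
  rw [Complex.norm_real]
  exact hΓ t ht ξ

/-- Small data launch a unique solution, and its profiles satisfy the a priori bounds. -/
theorem exists_small_solution (k : ℕ) {δ : ℝ} (hδ0 : 0 < δ) (hδ : δ ≤ 1 / 16) :
    ∃ ε : ℝ, 0 < ε ∧ ∀ u₁ v₁ : ℝ → ℂ,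
      sobolevNorm (k + 1) u₁ + weightNorm 1 u₁ + sobolevNorm (k + 1) v₁ + weightNorm 1 v₁
        ≤ ENNReal.ofReal ε →
      ∃ f g : ℝ → Prof k, SmallProfile k δ f g ∧ SmallProfile k δ g f ∧
        IsSolution (k + 1) u₁ v₁ (evol f) (evol g) ∧
        ∀ u v : ℝ → ℝ → ℂ, IsSolution (k + 1) u₁ v₁ u v →
          ∀ t : ℝ, 1 ≤ t → u t =ᵐ[volume] evol f t ∧ v t =ᵐ[volume] evol g t := by
  obtain ⟨ε, M, hε, -, hM1, hflow⟩ := exists_smallFlow k hδ0 hδ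
  refine ⟨ε / 6, by positivity, fun u₁ v₁ hsmall => ?_⟩
  rw [add_assoc] at hsmall
  have hex : ∀ φ : ℝ → ℂ, dataNorm (k + 1) φ ≤ ENNReal.ofReal (ε / 6) →
      ∃ p : Prof k, (Prof.group 1 p : ℝ → ℂ) =ᵐ[volume] φ ∧ ‖p‖ ≤ ε := by
    intro φ hφ
    obtain ⟨F, hF, hFn⟩ := Prof.exists_of_dataNorm (hφ.trans_lt ENNReal.ofReal_lt_top)
    have h1 : ‖F‖ ≤ ε / 6 :=
      hFn.trans (ENNReal.toReal_le_of_le_ofReal (by positivity) hφ)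
    refine ⟨Prof.group (-1) F, ?_, ?_⟩
    · have := Prof.group_neg_group (-1) F
      rw [neg_neg] at this
      rwa [this]
    · refine (Prof.norm_group_le (-1) F).trans ?_
      rw [abs_neg, abs_one]
      linarith
  obtain ⟨p, hp, hpn⟩ := hex u₁ (le_self_add.trans hsmall)
  obtain ⟨q, hq, hqn⟩ := hex v₁ (le_add_self.trans hsmall)
  obtain ⟨α, hα, hα1⟩ := hflow (p, q) (norm_prod_le_iff.2 ⟨hpn, hqn⟩)
  obtain ⟨h1, h2⟩ := hα.smallProfile hM1
  have hu : (Prof.group 1 (α 1).1 : ℝ → ℂ) =ᵐ[volume] u₁ := by rw [hα1]; exact hp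
  have hv : (Prof.group 1 (α 1).2 : ℝ → ℂ) =ᵐ[volume] v₁ := by rw [hα1]; exact hq
  exact ⟨_, _, h1, h2, ⟨continuousInSpace_evol h1.cont_f, continuousInSpace_evol h1.cont_g,
    solvesEquation_evol h1.deriv, solvesEquation_evol h2.deriv, hu, hv⟩,
    fun u v h => h.eq_evol hα.deriv hu hv⟩

end CoupledNLS

end

theorem theorem1 (n : ℕ) (ν : ℝ) (hν : 0 < ν) (hν' : ν < 1 / 4) :
    ∃ ε : ℝ, 0 < ε ∧ ∃ C : ℝ, 0 < C ∧ ∀ u₁ v₁ : ℝ → ℂ,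
      sobolevNorm (2 * n + 1) u₁ + weightNorm 1 u₁
          + sobolevNorm (2 * n + 1) v₁ + weightNorm 1 v₁ ≤ ENNReal.ofReal ε →
      ∃ u v : ℝ → ℝ → ℂ,
        -- existence and uniqueness of the global solution
        IsSolution (2 * n + 1) u₁ v₁ u v ∧
        (∀ u' v' : ℝ → ℝ → ℂ, IsSolution (2 * n + 1) u₁ v₁ u' v' →
          ∀ t : ℝ, 1 ≤ t → u' t =ᵐ[volume] u t ∧ v' t =ᵐ[volume] v t) ∧
        -- decay
        SupBound C 1 (-1 / 2) u ∧ SupBound C 1 (-1 / 2) v ∧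
        -- modified scattering, with uniqueness of the limits
        ∃ Wf Wg : ℝ → ℂ,
          MemLimitSpace n Wf ∧ MemLimitSpace n Wg ∧
          ScattersTo n ν C u v Wf ∧ ScattersTo n ν C v u Wg ∧
          (∀ Wf' Wg' : ℝ → ℂ, MemLimitSpace n Wf' → MemLimitSpace n Wg' →
            (∃ C' : ℝ, ScattersTo n ν C' u v Wf' ∧ ScattersTo n ν C' v u Wg') →
            Wf' =ᵐ[volume] Wf ∧ Wg' =ᵐ[volume] Wg) ∧
          -- expansion of the phases, with uniqueness, and the asymptotic formula
          ∃ Γf Γg : ℝ → ℝ,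
            MemLp Γf ⊤ volume ∧ MemLp Γg ⊤ volume ∧
            PhaseExpansion ν C u Wf Γf ∧ PhaseExpansion ν C v Wg Γg ∧
            AsymptoticFormula ν C 1 u Wf Wg Γg ∧ AsymptoticFormula ν C 1 v Wg Wf Γf ∧
            (∀ Γf' Γg' : ℝ → ℝ, MemLp Γf' ⊤ volume → MemLp Γg' ⊤ volume →
              (∃ C' : ℝ, PhaseExpansion ν C' u Wf Γf' ∧ PhaseExpansion ν C' v Wg Γg') →
              Γf' =ᵐ[volume] Γf ∧ Γg' =ᵐ[volume] Γg) ∧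
            -- what the asymptotic formula alone determines
            (∀ Γf' Γg' : ℝ → ℝ, MemLp Γf' ⊤ volume → MemLp Γg' ⊤ volume →
              (∃ C' T : ℝ, AsymptoticFormula ν C' T u Wf Wg Γg' ∧
                AsymptoticFormula ν C' T v Wg Wf Γf') →
              (∀ᵐ ξ : ℝ, Wf ξ ≠ 0 → ∃ k : ℤ, Γg' ξ = Γg ξ + 4 * Real.pi * k) ∧
              (∀ᵐ ξ : ℝ, Wg ξ ≠ 0 → ∃ k : ℤ, Γf' ξ = Γf ξ + 4 * Real.pi * k)) := by
  -- the rates come out as `t^(-1/4+3δ)` and `t^(-1/8+2δ)`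
  set δ := ν / 4 with hδ
  have hδ0 : 0 < δ := by positivity
  have hδ1 : δ < 1 / 16 := by linarith
  obtain ⟨ε, hε, hdata⟩ := exists_small_solution (2 * n) hδ0 hδ1.le
  have hK := rateConst_nonneg (2 * n) hδ1.le
  have hK₂ := rateConst₂_nonneg (2 * n) hδ1
  have hP := phaseConst_nonneg (2 * n) hδ1.le
  set C : ℝ := 3 + rateConst (2 * n) δ + (n + 1) * rateConst₂ (2 * n) δ + phaseConst (2 * n) δ
    with hC
  have hK₂' : 0 ≤ (n + 1) * rateConst₂ (2 * n) δ := by positivity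
  refine ⟨ε, hε, C, by positivity, fun u₁ v₁ hsmall => ?_⟩
  obtain ⟨f, g, hf, hg, hsol, huniq⟩ := hdata u₁ v₁ hsmall
  obtain ⟨Wf, hWf⟩ := hf.exists_isLimitProfile hδ1.le
  obtain ⟨Wg, hWg⟩ := hg.exists_isLimitProfile hδ1.le
  obtain ⟨Γf, hΓfc, hΓfb, hΓf⟩ := hf.exists_phase hδ1.le hWf
  obtain ⟨Γg, hΓgc, hΓgb, hΓg⟩ := hg.exists_phase hδ1.le hWg
  have sf := hf.scattersTo (C := C) le_rfl hν.le hν' hδ hWf (by linarith) (by linarith)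
  have sg := hg.scattersTo (C := C) le_rfl hν.le hν' hδ hWg (by linarith) (by linarith)
  have pf : PhaseExpansion ν C (evol f) Wf Γf :=
    phaseExpansion_evol hν.le hν' hδ hΓf (by linarith)
  have pg : PhaseExpansion ν C (evol g) Wg Γg :=
    phaseExpansion_evol hν.le hν' hδ hΓg (by linarith)
  have af := hf.asymptoticFormula (C := C) hν.le hν' hδ hWf hΓg (by linarith)
  have ag := hg.asymptoticFormula (C := C) hν.le hν' hδ hWg hΓf (by linarith)
  refine ⟨evol f, evol g, hsol, huniq,
    (hf.supBound_evol hδ1.le).mono (by norm_num) (by linarith) le_rfl,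
    (hg.supBound_evol hδ1.le).mono (by norm_num) (by linarith) le_rfl, Wf, Wg,
    hf.memLimitSpace hδ1 le_rfl hWf, hg.memLimitSpace hδ1 le_rfl hWg, sf, sg, ?_, Γf, Γg,
    memLp_top_of_continuous hΓfc hΓfb, memLp_top_of_continuous hΓgc hΓgb, pf, pg, af, ag, ?_, ?_⟩
  · rintro Wf' Wg' - - ⟨C', hf', hg'⟩
    exact ⟨sf.ae_eq hν' hf', sg.ae_eq hν' hg'⟩
  · rintro Γf' Γg' - - ⟨C', hf', hg'⟩
    exact ⟨pf.ae_eq hν' hf', pg.ae_eq hν' hg'⟩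
  · rintro Γf' Γg' - - ⟨C', T, hf', hg'⟩
    exact ⟨af.ae_eq_add hν' hf', ag.ae_eq_add hν' hg'⟩
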